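/- **Notation.** Fix $d\ge 1$, $T>0$, a compact metric space $U$; $B(0,R)\subset\mathbb R^d$ is the closed ball, $\mathcal P(K)$ the Borel probability measures supported in $K$, $\mathcal P_c(\mathbb R^d)$ the compactly supported ones, $W_p$ the Wasserstein distances, and $\Gamma_o(\mu,\nu)$ the set of $W_2$-optimal plans. "AC" means absolutely continuous for $W_1$, i.e. $W_1(\rho(\tau),\rho(t))\le\int_\tau^t m(s)\,\mathrm ds$ for $0\le\tau\le t\le T$ with some $m\in L^1([0,T],\mathbb R_+)$. An AC curve $\rho$ solves $\partial_t\rho(t)+\mathrm{div}(w(t)\rho(t))=0$ if for every $\psi\in C^\infty_c$ one has $\frac{\mathrm d}{\mathrm dt}\int\psi\,\mathrm d\rho(t)=\int\langle\nabla\psi,w(t)\rangle\,\mathrm d\rho(t)$ for a.e. $t\in[0,T]$. A functional $\phi:\mathcal P_c(\mathbb R^d)\to\mathbb R$ is *locally differentiable* at $\mu$ with Wasserstein gradient $\nabla\phi(\mu)$ if $\nabla\phi(\mu)$ lies in the $L^2(\mu)$-closure of $\{\nabla\xi:\xi\in C_c^\infty(\mathbb R^d)\}$ and, for every $R>0$ and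 every probability measure $\nu$ supported in the closed $R$-neighbourhood of $\mathrm{supp}(\mu)$, $$\inf_{\gamma\in\Gamma_o(\mu,\nu)}\int\langle\nabla\phi(\mu)(x),y-x\rangle\,\mathrm d\gamma(x,y)-o_R(W_2(\mu,\nu))\le\phi(\nu)-\phi(\mu)\le\sup_{\gamma\in\Gamma_o(\mu,\nu)}\int\langle\nabla\phi(\mu)(x),y-x\rangle\,\mathrm d\gamma(x,y)+o_R(W_2(\mu,\nu)).$$ For vector-valued maps, $\mathrm D\phi(\mu)(x)$ is the matrix whose rows are the gradients of the components. **Hypotheses.** Let $v:[0,T]\times\mathcal P_c(\mathbb R^d)\times U\times\mathbb R^d\to\mathbb R^d$ and $\varphi:\mathcal P_c(\mathbb R^d)\to\mathbb R$ be such that, for all $R>0$ and $K=B(0,R)$ (null sets of times and bounds being independent of $u\in U$): 1. $t\mapsto v(t,\mu,u,x)$ is measurable, and $|v(t,\mu,u,x)|\le m(t)\big(1+|x|+\int|y|\,\mathrm d\mu(y)\big)$ for a.e. $t$ and all $(\mu,u,x)$, for some $m\in L^1([0,T],\mathbb R_+)$; 2. there are $l_K,L_K\in L^1([0,T],\mathbb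 R_+)$ with $|v(t,\mu,u,x)-v(t,\mu,u,y)|\le l_K(t)|x-y|$ and $|v(t,\mu,u,x)-v(t,\nu,u,x)|\le L_K(t)W_1(\mu,\nu)$ for a.e. $t$, all $u\in U$, $\mu,\nu\in\mathcal P(K)$, $x,y\in K$; 3. for a.e. $t$ and every $u$, $v$ is Fréchet-differentiable in $x$, and $(\mu,x)\mapsto\mathrm D_xv(t,\mu,u,x)$ is continuous on $(\mathcal P(K),W_1)\times K$; 4. for a.e. $t$ and every $u$, $v$ is locally differentiable in $\mu$, and $(\mu,x,y)\mapsto\mathrm D_\mu v(t,\mu,u,x)(y)$ is continuous on $(\mathcal P(K),W_1)\times K\times K$; 5. for a.e. $t$ and all $(\mu,x)$, $u\mapsto v(t,\mu,u,x)$ is continuous; 6. $\varphi$ is $W_1$-Lipschitz on $\mathcal P(K)$ and locally differentiable, with $x\mapsto\nabla\varphi(\mu)(x)$ continuous for every $\mu\in\mathcal P_c(\mathbb R^d)$. Let $R'>0$ and $K'=B(0,R')$. Let $u^*:[0,T]\to U$ be measurable, let $\mu^*:[0,T]\to\mathcal P_c(\mathbb R^d)$, and let $\nu^*\in\mathrm{AC}([0,T],\mathcal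 P_1(K'\times K'))$ solve the forward-backward Hamiltonian continuity equation: $\pi^1_\#\nu^*(t)=\mu^*(t)$ for all $t\in[0,T]$, $\nu^*(T)=(\mathrm{Id},-\nabla\varphi(\mu^*(T)))_\#\mu^*(T)$, and $$\partial_t\nu^*(t)+\mathrm{div}_{(x,r)}\big(F(t,\cdot,\cdot)\,\nu^*(t)\big)=0,$$ $$F(t,x,r)=\Big(v(t,\mu^*(t),u^*(t),x)\,,\ -\mathrm D_xv(t,\mu^*(t),u^*(t),x)^\top r-\int\mathrm D_\mu v(t,\mu^*(t),u^*(t),y)(x)^\top p\,\mathrm d\nu^*(t)(y,p)\Big).$$ For $\tau,t\in[0,T]$ let $\Phi^*_{(\tau,t)}$ be the non-local flow along $(\mu^*,u^*)$: the unique solution $\Phi_{(\tau,t)}$, continuous in $(t,x)$, of $\Phi_{(\tau,t)}(x)=x+\int_\tau^tv\big(s,(\Phi_{(\tau,s)})_\#\mu^*(\tau),u^*(s),\Phi_{(\tau,s)}(x)\big)\,\mathrm ds$. Put $$\nu_T^*(t)=(\Phi^*_{(t,T)}\circ\pi^1,\pi^2)_\#\nu^*(t).$$ **Conclusion.** For each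 $t\in[0,T]$ one can choose a disintegration $\nu^*_T(t)=\int\sigma^*_x(t)\,\mathrm d\mu^*(T)(x)$ of $\nu_T^*(t)$ against its first marginal $\mu^*(T)$ (which is determined up to a $\mu^*(T)$-null set depending on $t$) in such a way that, for $\mu^*(T)$-a.e. $x$, the curve $\sigma_x^*$ belongs to $\mathrm{AC}([0,T],\mathcal P_1(K'))$ and solves the backward Cauchy problem $$\partial_t\sigma^*_x(t)+\mathrm{div}_r\big(\mathcal W_x(t,\sigma^*(t),\cdot)\,\sigma^*_x(t)\big)=0,\qquad\sigma_x^*(T)=\delta_{-\nabla\varphi(\mu^*(T))(x)},$$ where, for a family $\sigma=(\sigma_y)_y$ of measures, $$\mathcal W_x(t,\sigma,r)=-\mathrm D_xv\big(t,\mu^*(t),u^*(t),\Phi^*_{(T,t)}(x)\big)^\top r-\int\!\!\int\mathrm D_\mu v\big(t,\mu^*(t),u^*(t),\Phi^*_{(T,t)}(y)\big)\big(\Phi^*_{(T,t)}(x)\big)^\top p\,\mathrm d\sigma_y(p)\,\mathrm d\mu^*(T)(y).$$ The solution is unique in both of the following senses. * For $\mu^*(T)$-a.e. $x$, $\sigma^*_x$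 is the only AC curve $s:[0,T]\to\mathcal P_c(\mathbb R^d)$ with $s(T)=\delta_{-\nabla\varphi(\mu^*(T))(x)}$ solving $\partial_ts(t)+\mathrm{div}_r(\mathcal W_x(t,\sigma^*(t),\cdot)s(t))=0$. * If $(\sigma'_x(t))_{x}$, $t\in[0,T]$, are families depending in a Borel way on $x$ such that, for some $R$ and $\mu^*(T)$-a.e. $x$, the curve $\sigma'_x$ is AC with values in $\mathcal P(B(0,R))$ and solves $\partial_t\sigma'_x(t)+\mathrm{div}_r(\mathcal W_x(t,\sigma'(t),\cdot)\sigma_x'(t))=0$, $\sigma'_x(T)=\delta_{-\nabla\varphi(\mu^*(T))(x)}$, then for $\mu^*(T)$-a.e. $x$ one has $\sigma'_x(t)=\sigma_x^*(t)$ for all $t\in[0,T]$. Moreover, there is a map $m^\sigma\in L^1([0,T],\mathbb R_+)$, depending only on the data $(T,v,\varphi)$ and on $R'$ (not on $u^*,\mu^*,\nu^*$ or $x$), such that $$W_1(\sigma_x^*(t),\sigma_x^*(\tau))\le\int_\tau^tm^\sigma(s)\,\mathrm ds\qquad\text{for all }0\le\tau\le t\le T\text{ and }\mu^*(T)\text{-a.e.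 }x.$$ -/

import Mathlib

open MeasureTheory ProbabilityTheory Set Filter Topology
open scoped ENNReal ContDiff InnerProductSpace

noncomputable section

namespace MeanField

/-! ### Measures, transport plans, Wasserstein distances -/

section Transport

variable {X : Type*} [PseudoEMetricSpace X] [MeasurableSpace X]

/-- `ρ` is a Borel probability measure carried by the (closed) set `K`, i.e. `ρ ∈ P(K)`. -/
def ProbOn {X : Type*} [MeasurableSpace X] (K : Set X) (ρ : Measure X) : Prop :=
  IsProbabilityMeasure ρ ∧ ρ Kᶜ = 0

/-- `ρ ∈ P_c(X)`: a probability measure with compact support. -/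
def IsPc {X : Type*} [TopologicalSpace X] [MeasurableSpace X] (ρ : Measure X) : Prop :=
  IsProbabilityMeasure ρ ∧ IsCompact ρ.support

/-- The set `Γ(ρ₁, ρ₂)` of transport plans. -/
def transportPlans {X : Type*} [MeasurableSpace X] (ρ₁ ρ₂ : Measure X) : Set (Measure (X × X)) :=
  {γ | γ.map Prod.fst = ρ₁ ∧ γ.map Prod.snd = ρ₂}

/-- The transport cost `∫ d(x, y) ^ p dγ(x, y)`. -/
def transportCost (p : ℝ) (γ : Measure (X × X)) : ℝ≥0∞ :=
  ∫⁻ z, edist z.1 z.2 ^ p ∂γ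

/-- The Wasserstein distance `W_p`, with values in `[0, ∞]`. -/
def wasserstein (p : ℝ) (ρ₁ ρ₂ : Measure X) : ℝ≥0∞ :=
  (⨅ γ ∈ transportPlans ρ₁ ρ₂, transportCost p γ) ^ (1 / p)

/-- The set `Γ_o(ρ₁, ρ₂)` of plans which are optimal for the exponent `2`. -/
def optimalPlans (ρ₁ ρ₂ : Measure X) : Set (Measure (X × X)) :=
  {γ | γ ∈ transportPlans ρ₁ ρ₂ ∧
    ∀ γ' ∈ transportPlans ρ₁ ρ₂, transportCost 2 γ ≤ transportCost 2 γ'}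

/-- `m ∈ L¹([0, T], ℝ₊)`. -/
def IsL1Nonneg (T : ℝ) (m : ℝ → ℝ) : Prop :=
  IntegrableOn m (Icc 0 T) ∧ ∀ t, 0 ≤ m t

/-- `W₁(ρ(τ), ρ(t)) ≤ ∫_τ^t m(s) ds` for all `0 ≤ τ ≤ t ≤ T`. -/
def W1Bound (T : ℝ) (m : ℝ → ℝ) (ρ : ℝ → Measure X) : Prop :=
  ∀ τ t : ℝ, 0 ≤ τ → τ ≤ t → t ≤ T →
    wasserstein 1 (ρ τ) (ρ t) ≤ ENNReal.ofReal (∫ s in τ..t, m s)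

/-- Absolute continuity of the curve `t ∈ [0, T] ↦ ρ(t)` for the metric `W₁`.  (On a product
space the sup metric is used; it is equivalent to the Euclidean one, hence yields the same
absolutely continuous curves.) -/
def IsACCurve (T : ℝ) (ρ : ℝ → Measure X) : Prop :=
  ∃ m : ℝ → ℝ, IsL1Nonneg T m ∧ W1Bound T m ρ

end Transport

/-- The curve `ρ` satisfies `∂_t ρ(t) + div (w(t) ρ(t)) = 0` on `(0, T)` in the sense of
distributions: for every test function `ψ ∈ C_c^∞`,
`d/dt ∫ ψ dρ(t) = ∫ ⟨∇ψ, w(t)⟩ dρ(t)` for almost every `t ∈ [0, T]`.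
It is only used for `W₁`-absolutely continuous curves `ρ`. -/
def SolvesContinuityEq {X : Type*} [NormedAddCommGroup X] [NormedSpace ℝ X] [MeasurableSpace X]
    (T : ℝ) (w : ℝ → X → X) (ρ : ℝ → Measure X) : Prop :=
  ∀ ψ : X → ℝ, ContDiff ℝ ∞ ψ → HasCompactSupport ψ →
    ∀ᵐ t ∂(volume.restrict (Icc 0 T)),
      HasDerivAt (fun s => ∫ x, ψ x ∂(ρ s)) (∫ x, fderiv ℝ ψ x (w t x) ∂(ρ t)) t

/-! ### Localised subdifferential calculus over `P_c(ℝ^d)` -/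

section Calculus

variable {d : ℕ}

/-- The `R`-fattening `B_R(ρ)` of the support of `ρ`. -/
def fattening (R : ℝ) (ρ : Measure (EuclideanSpace ℝ (Fin d))) :
    Set (EuclideanSpace ℝ (Fin d)) :=
  ⋃ x ∈ ρ.support, Metric.closedBall x R

/-- `ξ` belongs to the localised Fréchet subdifferential of `φ` at `ρ`: for every `R > 0` and
every `ρ' ∈ P(B_R(ρ))`,
`φ(ρ') - φ(ρ) ≥ inf_{γ ∈ Γ_o(ρ, ρ')} ∫ ⟨ξ(x), y - x⟩ dγ(x, y) + o_R(W₂(ρ, ρ'))`. -/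
def InSubdiff (φ : Measure (EuclideanSpace ℝ (Fin d)) → ℝ)
    (ρ : Measure (EuclideanSpace ℝ (Fin d)))
    (ξ : EuclideanSpace ℝ (Fin d) → EuclideanSpace ℝ (Fin d)) : Prop :=
  MemLp ξ 2 ρ ∧
  ∀ R > 0, ∀ ε > 0, ∃ δ > 0, ∀ ρ' : Measure (EuclideanSpace ℝ (Fin d)),
    ProbOn (fattening R ρ) ρ' → (wasserstein 2 ρ ρ').toReal ≤ δ →
      ∃ γ ∈ optimalPlans ρ ρ',
        (∫ z, ⟪ξ z.1, z.2 - z.1⟫_ℝ ∂γ) - ε * (wasserstein 2 ρ ρ').toReal ≤ φ ρ' - φ ρ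

/-- `ξ` belongs to the localised Fréchet superdifferential of `φ` at `ρ`. -/
def InSuperdiff (φ : Measure (EuclideanSpace ℝ (Fin d)) → ℝ)
    (ρ : Measure (EuclideanSpace ℝ (Fin d)))
    (ξ : EuclideanSpace ℝ (Fin d) → EuclideanSpace ℝ (Fin d)) : Prop :=
  InSubdiff (fun ρ' => -φ ρ') ρ (fun x => -ξ x)

/-- `ξ ∈ Tan_ρ P₂(ℝ^d)`, the `L²(ρ)`-closure of the gradients of test functions. -/
def InTangent (ρ : Measure (EuclideanSpace ℝ (Fin d)))
    (ξ : EuclideanSpace ℝ (Fin d) → EuclideanSpace ℝ (Fin d)) : Prop :=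
  MemLp ξ 2 ρ ∧
  ∀ ε : ℝ≥0∞, 0 < ε → ∃ ψ : EuclideanSpace ℝ (Fin d) → ℝ,
    ContDiff ℝ ∞ ψ ∧ HasCompactSupport ψ ∧ eLpNorm (fun x => ξ x - gradient ψ x) 2 ρ ≤ ε

/-- `φ` is locally differentiable at `ρ` and `ξ` is (a representative of) its Wasserstein
gradient there: `ξ` is tangent, and both a localised sub- and supergradient.  There is at most
one such `ξ` up to `ρ`-null sets. -/
def IsWassersteinGradient (φ : Measure (EuclideanSpace ℝ (Fin d)) → ℝ)
    (ρ : Measure (EuclideanSpace ℝ (Fin d)))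
    (ξ : EuclideanSpace ℝ (Fin d) → EuclideanSpace ℝ (Fin d)) : Prop :=
  InTangent ρ ξ ∧ InSubdiff φ ρ ξ ∧ InSuperdiff φ ρ ξ

/-- `Φ` is locally differentiable at `ρ` with differential `D`: the `i`-th row `D(y)ᵀ e_i` of
the matrix `D(y)` is the Wasserstein gradient at `ρ` of the `i`-th component of `Φ`. -/
def IsWassersteinDifferential
    (Φ : Measure (EuclideanSpace ℝ (Fin d)) → EuclideanSpace ℝ (Fin d))
    (ρ : Measure (EuclideanSpace ℝ (Fin d)))
    (D : EuclideanSpace ℝ (Fin d) → EuclideanSpace ℝ (Fin d) →L[ℝ] EuclideanSpace ℝ (Fin d)) :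
    Prop :=
  ∀ i : Fin d, IsWassersteinGradient (fun ρ' => Φ ρ' i) ρ
    (fun y => ContinuousLinearMap.adjoint (D y) (EuclideanSpace.single i 1))

/-- Continuity of `(ρ, y) ↦ f(ρ, y)` on `P₁(K) × S`, where `P(K)` carries the metric `W₁`. -/
def ContinuousOnProb {Y F : Type*} [TopologicalSpace Y] [TopologicalSpace F]
    (K : Set (EuclideanSpace ℝ (Fin d))) (S : Set Y)
    (f : Measure (EuclideanSpace ℝ (Fin d)) → Y → F) : Prop :=
  ∀ (ρs : ℕ → Measure (EuclideanSpace ℝ (Fin d))) (ρ : Measure (EuclideanSpace ℝ (Fin d)))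
    (ys : ℕ → Y) (y : Y),
    (∀ n, ProbOn K (ρs n)) → ProbOn K ρ → (∀ n, ys n ∈ S) → y ∈ S →
    Tendsto (fun n => wasserstein 1 (ρs n) ρ) atTop (𝓝 0) → Tendsto ys atTop (𝓝 y) →
    Tendsto (fun n => f (ρs n) (ys n)) atTop (𝓝 (f ρ y))

end Calculus

/-! ### The optimal control problem -/

section Control

variable {d : ℕ} {U : Type*}

/-- Standing hypotheses on the data of the Mayer problem: the controlled non-local velocity field
`v(t, ρ, u, x)`, its differential `Dv(t, ρ, u, x)(y)` with respect to the measure variable, the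
final cost `φ` and its Wasserstein gradient `gradφ(ρ)(x)`. -/
structure HypOCP [TopologicalSpace U] (T : ℝ)
    (v : ℝ → Measure (EuclideanSpace ℝ (Fin d)) → U → EuclideanSpace ℝ (Fin d) →
      EuclideanSpace ℝ (Fin d))
    (Dv : ℝ → Measure (EuclideanSpace ℝ (Fin d)) → U → EuclideanSpace ℝ (Fin d) →
      EuclideanSpace ℝ (Fin d) → EuclideanSpace ℝ (Fin d) →L[ℝ] EuclideanSpace ℝ (Fin d))
    (φ : Measure (EuclideanSpace ℝ (Fin d)) → ℝ)
    (gradφ : Measure (EuclideanSpace ℝ (Fin d)) → EuclideanSpace ℝ (Fin d) →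
      EuclideanSpace ℝ (Fin d)) : Prop where
  measurable_time : ∀ ρ, IsPc ρ → ∀ u x,
    AEStronglyMeasurable (fun t => v t ρ u x) (volume.restrict (Icc 0 T))
  sublinear : ∃ m : ℝ → ℝ, IsL1Nonneg T m ∧
    ∀ᵐ t ∂(volume.restrict (Icc 0 T)), ∀ ρ, IsPc ρ → ∀ u x,
      ‖v t ρ u x‖ ≤ m t * (1 + ‖x‖ + ∫ y, ‖y‖ ∂ρ)
  lipschitz : ∀ R > 0, ∃ l L : ℝ → ℝ, IsL1Nonneg T l ∧ IsL1Nonneg T L ∧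
    ∀ᵐ t ∂(volume.restrict (Icc 0 T)), ∀ u,
      ∀ ρ₁ ρ₂ : Measure (EuclideanSpace ℝ (Fin d)),
        ProbOn (Metric.closedBall 0 R) ρ₁ → ProbOn (Metric.closedBall 0 R) ρ₂ →
        ∀ x ∈ Metric.closedBall (0 : EuclideanSpace ℝ (Fin d)) R,
        ∀ y ∈ Metric.closedBall (0 : EuclideanSpace ℝ (Fin d)) R,
          ‖v t ρ₁ u x - v t ρ₁ u y‖ ≤ l t * ‖x - y‖ ∧
          ‖v t ρ₁ u x - v t ρ₂ u x‖ ≤ L t * (wasserstein 1 ρ₁ ρ₂).toReal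
  differentiable_space : ∀ᵐ t ∂(volume.restrict (Icc 0 T)), ∀ u ρ, IsPc ρ →
    Differentiable ℝ (v t ρ u)
  continuous_space_deriv : ∀ R > 0, ∀ᵐ t ∂(volume.restrict (Icc 0 T)), ∀ u,
    ContinuousOnProb (Metric.closedBall 0 R) (Metric.closedBall 0 R)
      (fun ρ x => fderiv ℝ (v t ρ u) x)
  differentiable_measure : ∀ᵐ t ∂(volume.restrict (Icc 0 T)), ∀ u x ρ, IsPc ρ →
    IsWassersteinDifferential (fun ρ' => v t ρ' u x) ρ (Dv t ρ u x)
  continuous_measure_deriv : ∀ R > 0, ∀ᵐ t ∂(volume.restrict (Icc 0 T)), ∀ u,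
    ContinuousOnProb (Metric.closedBall 0 R)
      (Metric.closedBall (0 : EuclideanSpace ℝ (Fin d)) R ×ˢ
        Metric.closedBall (0 : EuclideanSpace ℝ (Fin d)) R)
      (fun ρ z => Dv t ρ u z.1 z.2)
  continuous_control : ∀ᵐ t ∂(volume.restrict (Icc 0 T)), ∀ ρ, IsPc ρ → ∀ x,
    Continuous (fun u => v t ρ u x)
  cost_lipschitz : ∀ R > 0, ∃ C : ℝ, ∀ ρ₁ ρ₂ : Measure (EuclideanSpace ℝ (Fin d)),
    ProbOn (Metric.closedBall 0 R) ρ₁ → ProbOn (Metric.closedBall 0 R) ρ₂ →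
      |φ ρ₁ - φ ρ₂| ≤ C * (wasserstein 1 ρ₁ ρ₂).toReal
  cost_differentiable : ∀ ρ, IsPc ρ → IsWassersteinGradient φ ρ (gradφ ρ)
  continuous_cost_gradient : ∀ ρ, IsPc ρ → Continuous (gradφ ρ)

/-- The Wasserstein gradient `∇_ν H(t, ν, u)(x, r)` of the Hamiltonian
`H(t, ν, u) = ∫ ⟨r, v(t, π¹_# ν, u, x)⟩ dν(x, r)`, in its explicit form. -/
def hamiltonianGradient
    (v : ℝ → Measure (EuclideanSpace ℝ (Fin d)) → U → EuclideanSpace ℝ (Fin d) →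
      EuclideanSpace ℝ (Fin d))
    (Dv : ℝ → Measure (EuclideanSpace ℝ (Fin d)) → U → EuclideanSpace ℝ (Fin d) →
      EuclideanSpace ℝ (Fin d) → EuclideanSpace ℝ (Fin d) →L[ℝ] EuclideanSpace ℝ (Fin d))
    (t : ℝ) (ν : Measure (EuclideanSpace ℝ (Fin d) × EuclideanSpace ℝ (Fin d))) (u : U)
    (z : EuclideanSpace ℝ (Fin d) × EuclideanSpace ℝ (Fin d)) :
    EuclideanSpace ℝ (Fin d) × EuclideanSpace ℝ (Fin d) :=
  (ContinuousLinearMap.adjoint (fderiv ℝ (v t (ν.map Prod.fst) u) z.1) z.2 +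
      ∫ w, ContinuousLinearMap.adjoint (Dv t (ν.map Prod.fst) u w.1 z.1) w.2 ∂ν,
    v t (ν.map Prod.fst) u z.1)

/-- The symplectic matrix `J (a, b) = (b, -a)`. -/
def symplectic (z : EuclideanSpace ℝ (Fin d) × EuclideanSpace ℝ (Fin d)) :
    EuclideanSpace ℝ (Fin d) × EuclideanSpace ℝ (Fin d) :=
  (z.2, -z.1)

/-- `ν ∈ AC([0, T], P₁(K' × K'))`, `K' = B(0, R')`, solves the forward-backward Hamiltonian
continuity equation associated with the state curve `μ` and the control `u`. -/
structure IsStateCostateCurve (T R' : ℝ)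
    (v : ℝ → Measure (EuclideanSpace ℝ (Fin d)) → U → EuclideanSpace ℝ (Fin d) →
      EuclideanSpace ℝ (Fin d))
    (Dv : ℝ → Measure (EuclideanSpace ℝ (Fin d)) → U → EuclideanSpace ℝ (Fin d) →
      EuclideanSpace ℝ (Fin d) → EuclideanSpace ℝ (Fin d) →L[ℝ] EuclideanSpace ℝ (Fin d))
    (gradφ : Measure (EuclideanSpace ℝ (Fin d)) → EuclideanSpace ℝ (Fin d) →
      EuclideanSpace ℝ (Fin d))
    (u : ℝ → U) (μ : ℝ → Measure (EuclideanSpace ℝ (Fin d)))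
    (ν : ℝ → Measure (EuclideanSpace ℝ (Fin d) × EuclideanSpace ℝ (Fin d))) : Prop where
  supported : ∀ t ∈ Icc 0 T, ProbOn
    (Metric.closedBall (0 : EuclideanSpace ℝ (Fin d)) R' ×ˢ
      Metric.closedBall (0 : EuclideanSpace ℝ (Fin d)) R') (ν t)
  absolutelyContinuous : IsACCurve T ν
  equation : SolvesContinuityEq T
    (fun t z => symplectic (hamiltonianGradient v Dv t (ν t) (u t) z)) ν
  marginal : ∀ t ∈ Icc 0 T, (ν t).map Prod.fst = μ t
  terminal : ν T = (μ T).map (fun x => (x, -gradφ (μ T) x))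

/-- `Ψ` solves the Cauchy problem
`Ψ(t, x) = x + ∫_τ^t w(s, Ψ(s, ·)_# ρ, Ψ(s, x)) ds`, `t ∈ [0, T]`. -/
structure IsNonlocalFlow (T : ℝ)
    (w : ℝ → Measure (EuclideanSpace ℝ (Fin d)) → EuclideanSpace ℝ (Fin d) →
      EuclideanSpace ℝ (Fin d))
    (τ : ℝ) (ρ : Measure (EuclideanSpace ℝ (Fin d)))
    (Ψ : ℝ → EuclideanSpace ℝ (Fin d) → EuclideanSpace ℝ (Fin d)) : Prop where
  continuousOn : ContinuousOn (fun q : ℝ × EuclideanSpace ℝ (Fin d) => Ψ q.1 q.2)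
    (Icc 0 T ×ˢ univ)
  integrable : ∀ x, IntegrableOn (fun s => w s (ρ.map (Ψ s)) (Ψ s x)) (Icc 0 T)
  equation : ∀ t ∈ Icc 0 T, ∀ x, Ψ t x = x + ∫ s in τ..t, w s (ρ.map (Ψ s)) (Ψ s x)

/-- The non-local flow `Φ_{(τ, t)}[ρ](x)` generated by `w`: the solution of the above Cauchy
problem (which is unique on `[0, T]` under the hypotheses at hand). -/
def nonlocalFlow (T : ℝ)
    (w : ℝ → Measure (EuclideanSpace ℝ (Fin d)) → EuclideanSpace ℝ (Fin d) →
      EuclideanSpace ℝ (Fin d))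
    (τ : ℝ) (ρ : Measure (EuclideanSpace ℝ (Fin d))) :
    ℝ → EuclideanSpace ℝ (Fin d) → EuclideanSpace ℝ (Fin d) :=
  Classical.epsilon (IsNonlocalFlow T w τ ρ)

/-- The flow `Φ*_{(τ, t)} = Φ^u_{(τ, t)}[μ(τ)]` along the state curve `μ` and the control `u`. -/
def stateFlow (T : ℝ)
    (v : ℝ → Measure (EuclideanSpace ℝ (Fin d)) → U → EuclideanSpace ℝ (Fin d) →
      EuclideanSpace ℝ (Fin d))
    (u : ℝ → U) (μ : ℝ → Measure (EuclideanSpace ℝ (Fin d))) (τ t : ℝ) :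
    EuclideanSpace ℝ (Fin d) → EuclideanSpace ℝ (Fin d) :=
  nonlocalFlow T (fun s ρ x => v s ρ (u s) x) τ (μ τ) t

/-- The transported curve `ν_T(t) = (Φ*_{(t, T)} ∘ π¹, π²)_# ν(t)`. -/
def transported (T : ℝ)
    (v : ℝ → Measure (EuclideanSpace ℝ (Fin d)) → U → EuclideanSpace ℝ (Fin d) →
      EuclideanSpace ℝ (Fin d))
    (u : ℝ → U) (μ : ℝ → Measure (EuclideanSpace ℝ (Fin d)))
    (ν : ℝ → Measure (EuclideanSpace ℝ (Fin d) × EuclideanSpace ℝ (Fin d))) (t : ℝ) :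
    Measure (EuclideanSpace ℝ (Fin d) × EuclideanSpace ℝ (Fin d)) :=
  (ν t).map (fun z => (stateFlow T v u μ t T z.1, z.2))

/-- The costate velocity field `W_x(t, σ, r)`, for a family `σ = (σ_y)_y` of measures:
`- D_x v(t, μ(t), u(t), Φ*_{(T,t)}(x))ᵀ r
  - ∫ ∫ D_μ v(t, μ(t), u(t), Φ*_{(T,t)}(y))(Φ*_{(T,t)}(x))ᵀ p dσ_y(p) dμ(T)(y)`. -/
def costateField (T : ℝ)
    (v : ℝ → Measure (EuclideanSpace ℝ (Fin d)) → U → EuclideanSpace ℝ (Fin d) →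
      EuclideanSpace ℝ (Fin d))
    (Dv : ℝ → Measure (EuclideanSpace ℝ (Fin d)) → U → EuclideanSpace ℝ (Fin d) →
      EuclideanSpace ℝ (Fin d) → EuclideanSpace ℝ (Fin d) →L[ℝ] EuclideanSpace ℝ (Fin d))
    (u : ℝ → U) (μ : ℝ → Measure (EuclideanSpace ℝ (Fin d)))
    (x : EuclideanSpace ℝ (Fin d)) (t : ℝ)
    (σ : EuclideanSpace ℝ (Fin d) → Measure (EuclideanSpace ℝ (Fin d)))
    (r : EuclideanSpace ℝ (Fin d)) : EuclideanSpace ℝ (Fin d) :=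
  -(ContinuousLinearMap.adjoint
      (fderiv ℝ (v t (μ t) (u t)) (stateFlow T v u μ T t x)) r) -
    ∫ y, ∫ p, ContinuousLinearMap.adjoint
      (Dv t (μ t) (u t) (stateFlow T v u μ T t y) (stateFlow T v u μ T t x)) p ∂(σ y) ∂(μ T)

end Control

end MeanField

end

/-! Freeze `μ` and `ν` in the non-local terms. The Hamiltonian continuity equation becomes a linear
continuity equation for `ν`, and on the product of balls its field is triangular, `(V(t, x), G(t, x,
r))`. The state part `V(t, x) = v(t, μ(t), u(t), x)` is Lipschitz in `x`. The costate part `G` is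
affine in `r` but merely continuous in `x`, since the derivatives of `v` are only assumed
continuous. Characteristics are nevertheless well defined: solve for the state, then solve an
equation for the costate that is Lipschitz in `r`.

The heart of the proof is that `ν(t)` is the image of `ν(T)` under these characteristics
(`eq_map_of_triangular`). It is a duality argument. Mollify `G` in `x` only, and test the equation
with a Lipschitz function composed with the regularised flow. Since `V` is not touched, the error is
the integral of the costate derivative of the transported test function against `G - G_k`.
Regularised characteristics with the same state component differ only in the costate, and there they
spread at a rate independent of `k`. That derivative is therefore bounded uniformly in `k`, although
the full Lipschitz constants are not controlled, and the error vanishes by dominated convergence.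

As `ν(T)` is a graph over `μ(T)`, `ν(t)` is the law under `μ(T)` of `(Φ_{(T,t)}(x), r_x(t))`, where
`r_x` is the costate trajectory (`exists_costate`). Transporting the state back to time `T` gives
the law of `(x, r_x(t))`, so the disintegration consists of the Dirac masses at `r_x(t)`. Their
equation is the chain rule, and their absolute continuity is the bound `(l + L) R'` on the costate
velocity.

For uniqueness, a continuity equation with an affine field and Dirac terminal datum has only Dirac
solutions (`eq_dirac_of_affine`): the mean solves the ODE, and the mean distance to it obeys a
homogeneous Gronwall inequality. The first uniqueness claim is then uniqueness for an ODE. In the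
second, the fibres are coupled only through an average, so Gronwall is applied to the averaged
distance (`eq_of_integral_eq_of_mean_bound`).

Two preparations are needed. Wasserstein gradients are given only up to null sets; to bound them
pointwise and to prove measurability in time, an atom of mass `m` is placed at `y` and moved, the
gradient at `y` is read off as a directional derivative (`tendsto_mixDirac`), and `m` is sent to
`0`. Moreover the flow in the statement is a choice among solutions, so it must be identified with
the flow of `V` (`stateFlow_eq_odeFlow`). -/

namespace MeanField

/-! ### Absolutely continuous functions -/

section AbsolutelyContinuous

variable {F : Type*} [NormedAddCommGroup F] {a b : ℝ} {g : ℝ → F} {k : ℝ → ℝ}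

theorem intervalIntegrable_sub {F : Type*} [NormedAddCommGroup F] {k : ℝ → F} {a b s t : ℝ}
    (hk : IntegrableOn k (Icc a b)) (hs : s ∈ Icc a b) (ht : t ∈ Icc a b) :
    IntervalIntegrable k volume s t := by
  rw [intervalIntegrable_iff]
  refine hk.mono_set ?_
  intro x hx
  have := uIoc_subset_uIcc hx
  exact (uIcc_subset_Icc hs ht) this

theorem absolutelyContinuousOnInterval_of_bound (hab : a ≤ b) (hk : IntegrableOn k (Icc a b))
    (h : ∀ s t, a ≤ s → s ≤ t → t ≤ b → ‖g t - g s‖ ≤ ∫ x in s..t, k x) :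
    AbsolutelyContinuousOnInterval g a b := by
  have hI : IntervalIntegrable k volume a b :=
    intervalIntegrable_sub hk (left_mem_Icc.2 hab) (right_mem_Icc.2 hab)
  have hac := hI.absolutelyContinuousOnInterval_intervalIntegral (c := a) (by simp)
  rw [absolutelyContinuousOnInterval_iff] at hac ⊢
  have key : ∀ s ∈ Icc a b, ∀ t ∈ Icc a b,
      dist (g s) (g t) ≤ dist (∫ x in a..s, k x) (∫ x in a..t, k x) := by
    intro s hs t ht
    wlog hst : s ≤ t generalizing s t
    · rw [dist_comm, dist_comm (∫ x in a..s, k x)]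
      exact this t ht s hs (le_of_not_ge hst)
    have h1 := h s t hs.1 hst ht.2
    have h2 : (∫ x in a..t, k x) - ∫ x in a..s, k x = ∫ x in s..t, k x :=
      intervalIntegral.integral_interval_sub_left
        (intervalIntegrable_sub hk (left_mem_Icc.2 hab) ht)
        (intervalIntegrable_sub hk (left_mem_Icc.2 hab) hs)
    rw [dist_comm, dist_eq_norm, dist_comm, dist_eq_norm, h2]
    exact h1.trans (le_abs_self _)
  intro ε hε
  obtain ⟨δ, hδ, H⟩ := hac ε hε
  refine ⟨δ, hδ, fun E hE hd => (Finset.sum_le_sum fun i hi => ?_).trans_lt (H E hE hd)⟩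
  have := hE.1 i (by simpa using hi)
  rw [uIcc_of_le hab] at this
  exact key _ this.1 _ this.2

variable [NormedSpace ℝ F] [CompleteSpace F]

/-- The right difference quotients of `g` are dominated by those of the primitive of `k`, which
converge to `k` almost everywhere. -/
theorem ae_norm_deriv_le (hk : IntegrableOn k (Icc a b))
    (h : ∀ s t, a ≤ s → s ≤ t → t ≤ b → ‖g t - g s‖ ≤ ∫ x in s..t, k x) {g' : ℝ → F}
    (hd : ∀ᵐ t ∂(volume.restrict (Icc a b)), HasDerivAt g (g' t) t) :
    ∀ᵐ t ∂(volume.restrict (Icc a b)), ‖g' t‖ ≤ k t := by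
  rcases le_or_gt a b with hab | hab
  swap
  · simp [Icc_eq_empty_of_lt hab]
  have hI : IntervalIntegrable k volume a b :=
    intervalIntegrable_sub hk (left_mem_Icc.2 hab) (right_mem_Icc.2 hab)
  have hb : ∀ᵐ t : ℝ, t ≠ b := by simp [ae_iff, measure_singleton]
  filter_upwards [hd, ae_restrict_of_ae hI.ae_hasDerivAt_integral, ae_restrict_of_ae hb,
    ae_restrict_mem measurableSet_Icc] with t h1 h2 h3 ht
  have h2' := h2 (by rwa [uIcc_of_le hab]) a (by simp)
  have e1 := (hasDerivWithinAt_iff_tendsto_slope.1 (h1.hasDerivWithinAt (s := Ioi t))).norm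
  have e2 := hasDerivWithinAt_iff_tendsto_slope.1 (h2'.hasDerivWithinAt (s := Ioi t))
  rw [sdiff_singleton_eq_self (by simp)] at e1 e2
  refine le_of_tendsto_of_tendsto e1 e2 ?_
  have htb : t < b := lt_of_le_of_ne ht.2 h3
  filter_upwards [Ioo_mem_nhdsGT htb] with s hs
  have h4 := h t s ht.1 hs.1.le hs.2.le
  have h5 : (∫ x in a..s, k x) - ∫ x in a..t, k x = ∫ x in t..s, k x :=
    intervalIntegral.integral_interval_sub_left
      (intervalIntegrable_sub hk (left_mem_Icc.2 hab) ⟨ht.1.trans hs.1.le, hs.2.le⟩)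
      (intervalIntegrable_sub hk (left_mem_Icc.2 hab) ht)
  simp only [slope, vsub_eq_sub, norm_smul, norm_inv, Real.norm_eq_abs, h5, smul_eq_mul]
  rw [abs_of_pos (sub_pos.2 hs.1)]
  have : 0 ≤ s - t := by linarith [hs.1]
  gcongr

/-- In a general Banach space absolute continuity does not produce a derivative, so its existence
almost everywhere is a hypothesis. Subtracting the primitive of `g'` leaves an absolutely continuous
function with vanishing derivative, hence a constant. -/
theorem integral_eq_sub_of_bound [SecondCountableTopology F] (hab : a ≤ b)
    (hk : IntegrableOn k (Icc a b))
    (h : ∀ s t, a ≤ s → s ≤ t → t ≤ b → ‖g t - g s‖ ≤ ∫ x in s..t, k x) {g' : ℝ → F}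
    (hd : ∀ᵐ t ∂(volume.restrict (Icc a b)), HasDerivAt g (g' t) t) :
    IntegrableOn g' (Icc a b) ∧ ∫ t in a..b, g' t = g b - g a := by
  have hm : AEStronglyMeasurable g' (volume.restrict (Icc a b)) := by
    borelize F
    refine ⟨deriv g, (measurable_deriv g).stronglyMeasurable, ?_⟩
    filter_upwards [hd] with t ht using ht.deriv.symm
  have hi : IntegrableOn g' (Icc a b) := Integrable.mono' hk hm (ae_norm_deriv_le hk h hd)
  refine ⟨hi, ?_⟩
  have hiI := intervalIntegrable_sub hi (left_mem_Icc.2 hab) (right_mem_Icc.2 hab)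
  let G (x : ℝ) := g x - ∫ t in a..x, g' t
  have hG : AbsolutelyContinuousOnInterval G a b := by
    refine absolutelyContinuousOnInterval_of_bound (k := fun x => k x + ‖g' x‖) hab
      (hk.add hi.norm) fun s t hs hst ht => ?_
    have hs' : s ∈ Icc a b := ⟨hs, hst.trans ht⟩
    have ht' : t ∈ Icc a b := ⟨hs.trans hst, ht⟩
    rw [intervalIntegral.integral_add (intervalIntegrable_sub hk hs' ht')
      (intervalIntegrable_sub hi.norm hs' ht')]
    have h5 : (∫ x in a..t, g' x) - ∫ x in a..s, g' x = ∫ x in s..t, g' x :=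
      intervalIntegral.integral_interval_sub_left
        (intervalIntegrable_sub hi (left_mem_Icc.2 hab) ht')
        (intervalIntegrable_sub hi (left_mem_Icc.2 hab) hs')
    calc ‖G t - G s‖ = ‖(g t - g s) - ∫ x in s..t, g' x‖ := by
          rw [← h5]; simp only [G]; congr 1; abel
      _ ≤ _ := (norm_sub_le _ _).trans (add_le_add (h s t hs hst ht)
          (intervalIntegral.norm_integral_le_integral_norm hst))
  have hG0 : ∀ᵐ x, x ∈ uIcc a b → HasDerivAt G 0 x := by
    rw [uIcc_of_le hab]
    have hd' := (ae_restrict_iff' measurableSet_Icc).1 hd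
    filter_upwards [hd', hiI.ae_hasDerivAt_integral] with x h1 h2 hx
    have := (h1 hx).sub (h2 (by rwa [uIcc_of_le hab]) a (by simp))
    rw [sub_self] at this
    exact this
  obtain ⟨C, hC⟩ := hG.const_of_ae_hasDerivAt_zero hG0
  have h1 := hC a (by simp)
  have h2 := hC b (by simp)
  simp only [G, intervalIntegral.integral_same, sub_zero] at h1 h2
  rw [h1, ← h2]; abel

end AbsolutelyContinuous

/-- A function whose increments are bounded by `∫ k + C (∫ K)²` has increments bounded by `∫ k`. -/
theorem abs_sub_le_of_quadratic_bound {a b : ℝ} {g k K : ℝ → ℝ} {C : ℝ}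
    (hab : a ≤ b) (hk : IntegrableOn k (Icc a b)) (hK : IntegrableOn K (Icc a b))
    (hK0 : ∀ t, 0 ≤ K t)
    (h : ∀ s t, a ≤ s → s ≤ t → t ≤ b →
      |g t - g s| ≤ (∫ x in s..t, k x) + C * (∫ x in s..t, K x) ^ 2) :
    |g b - g a| ≤ ∫ x in a..b, k x := by
  have hI {k : ℝ → ℝ} (hk : IntegrableOn k (Icc a b)) {s t : ℝ} (hs : s ∈ Icc a b)
      (ht : t ∈ Icc a b) : IntervalIntegrable k volume s t := intervalIntegrable_sub hk hs ht
  have ha : a ∈ Icc a b := left_mem_Icc.2 hab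
  have hb' : b ∈ Icc a b := right_mem_Icc.2 hab
  set A := ∫ x in a..b, K x
  have hA : ∀ s t, a ≤ s → s ≤ t → t ≤ b → ∫ x in s..t, K x ≤ A := fun s t h1 h2 h3 =>
    intervalIntegral.integral_mono_interval h1 h2 h3 (Eventually.of_forall fun x => hK0 x)
      (hI hK ha hb')
  have hKn : ∀ s t, s ≤ t → 0 ≤ ∫ x in s..t, K x := fun s t h2 =>
    intervalIntegral.integral_nonneg h2 fun x _ => hK0 x
  have hac : AbsolutelyContinuousOnInterval g a b := by
    refine absolutelyContinuousOnInterval_of_bound (k := fun x => k x + |C| * A * K x) hab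
      (hk.add (hK.const_mul _)) fun s t hs hst ht => ?_
    have hs' : s ∈ Icc a b := ⟨hs, hst.trans ht⟩
    have ht' : t ∈ Icc a b := ⟨hs.trans hst, ht⟩
    rw [intervalIntegral.integral_add (hI hk hs' ht') ((hI hK hs' ht').const_mul _),
      intervalIntegral.integral_const_mul]
    refine (h s t hs hst ht).trans ?_
    have h1 := hA s t hs hst ht
    have h2 := hKn s t hst
    have : C * (∫ x in s..t, K x) ^ 2 ≤ |C| * (A * ∫ x in s..t, K x) := by
      refine (mul_le_mul_of_nonneg_right (le_abs_self C) (sq_nonneg _)).trans ?_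
      rw [sq]
      gcongr
    linarith
  have hd : ∀ᵐ t ∂(volume.restrict (Icc a b)), HasDerivAt g (deriv g t) t := by
    rw [ae_restrict_iff' measurableSet_Icc]
    filter_upwards [hac.ae_differentiableAt] with t ht h
    exact (ht (by rwa [uIcc_of_le hab])).hasDerivAt
  have hb : ∀ᵐ t : ℝ, t ≠ b := by simp [ae_iff, measure_singleton]
  -- The square of `∫ K` vanishes to second order on the diagonal, so its contribution disappears
  -- from the derivative.
  have hle : ∀ᵐ t ∂(volume.restrict (Icc a b)), ‖deriv g t‖ ≤ k t := by
    filter_upwards [hd, ae_restrict_of_ae (hI hk ha hb').ae_hasDerivAt_integral,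
      ae_restrict_of_ae (hI hK ha hb').ae_hasDerivAt_integral, ae_restrict_of_ae hb,
      ae_restrict_mem measurableSet_Icc] with t h1 h2 h2K h3 ht
    rw [uIcc_of_le hab] at h2 h2K
    have h2' := h2 ht t ht
    have h2K' := h2K ht t ht
    have h4' := h2'.add ((h2K'.pow 2).const_mul C)
    have e1 := (hasDerivWithinAt_iff_tendsto_slope.1 (h1.hasDerivWithinAt (s := Ioi t))).norm
    have e2 := hasDerivWithinAt_iff_tendsto_slope.1 (h4'.hasDerivWithinAt (s := Ioi t))
    rw [sdiff_singleton_eq_self (by simp)] at e1 e2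
    simp only [Nat.cast_ofNat, Nat.add_one_sub_one, intervalIntegral.integral_same, pow_one,
      mul_zero, zero_mul, add_zero] at e2
    refine le_of_tendsto_of_tendsto e1 e2 ?_
    have htb : t < b := lt_of_le_of_ne ht.2 h3
    filter_upwards [Ioo_mem_nhdsGT htb] with s hs
    have h4 := h t s ht.1 hs.1.le hs.2.le
    simp only [slope, vsub_eq_sub, Real.norm_eq_abs, smul_eq_mul,
      Pi.add_apply, intervalIntegral.integral_same, Pi.pow_apply]
    rw [abs_mul, abs_inv, abs_of_pos (sub_pos.2 hs.1)]
    have : 0 ≤ s - t := by linarith [hs.1]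
    gcongr
    simpa using h4
  have e := hac.integral_deriv_eq_sub
  rw [← e, ← Real.norm_eq_abs]
  refine (intervalIntegral.norm_integral_le_integral_norm hab).trans ?_
  have hle' := (ae_restrict_iff' measurableSet_Icc).1 hle
  refine intervalIntegral.integral_mono_ae_restrict hab hac.intervalIntegrable_deriv.norm
    (hI hk ha hb') hle

/-! ### Gronwall's inequality with an integrable kernel -/

section Gronwall

variable {a b : ℝ} {l : ℝ → ℝ}

/-- Since `l` is only integrable, the primitive is differentiable almost everywhere only; the
increment bound needed by `integral_eq_sub_of_bound` comes from `1 + x ≤ exp x`. -/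
theorem integral_mul_exp (hab : a ≤ b) (hl : IntegrableOn l (Icc a b)) (hl0 : ∀ t, 0 ≤ l t) :
    IntegrableOn (fun t => l t * Real.exp (2 * ∫ x in a..t, l x)) (Icc a b) ∧
    ∫ t in a..b, l t * Real.exp (2 * ∫ x in a..t, l x) =
      (Real.exp (2 * ∫ x in a..b, l x) - 1) / 2 := by
  have ha : a ∈ Icc a b := left_mem_Icc.2 hab
  have hb : b ∈ Icc a b := right_mem_Icc.2 hab
  have hI := intervalIntegrable_sub hl ha hb
  have key := integral_eq_sub_of_bound (g := fun t => Real.exp (2 * ∫ x in a..t, l x) / 2)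
    (k := fun t => Real.exp (2 * ∫ x in a..b, l x) * l t)
    (g' := fun t => l t * Real.exp (2 * ∫ x in a..t, l x)) hab (hl.const_mul _) ?_ ?_
  · refine ⟨key.1, key.2.trans ?_⟩
    simp
    ring
  · intro s t hs hst ht
    have hs' : s ∈ Icc a b := ⟨hs, hst.trans ht⟩
    have ht' : t ∈ Icc a b := ⟨hs.trans hst, ht⟩
    have h5 : (∫ x in a..t, l x) - ∫ x in a..s, l x = ∫ x in s..t, l x :=
      intervalIntegral.integral_interval_sub_left
        (intervalIntegrable_sub hl ha ht') (intervalIntegrable_sub hl ha hs')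
    have h6 : 0 ≤ ∫ x in s..t, l x := intervalIntegral.integral_nonneg hst fun x _ => hl0 x
    have h7 : ∫ x in a..t, l x ≤ ∫ x in a..b, l x :=
      intervalIntegral.integral_mono_interval le_rfl ht'.1 ht (Eventually.of_forall hl0) hI
    set u := ∫ x in a..t, l x
    set w := ∫ x in a..s, l x
    rw [intervalIntegral.integral_const_mul, ← h5, Real.norm_eq_abs, abs_of_nonneg]
    · have h8 := Real.add_one_le_exp (2 * w - 2 * u)
      have h9 : Real.exp (2 * w) = Real.exp (2 * u) * Real.exp (2 * w - 2 * u) := by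
        rw [← Real.exp_add]; ring_nf
      have h10 : Real.exp (2 * u) ≤ Real.exp (2 * ∫ x in a..b, l x) := by gcongr
      have h11 : Real.exp (2 * u) * (1 - Real.exp (2 * w - 2 * u)) ≤
          Real.exp (2 * u) * (2 * (u - w)) := by
        gcongr; linarith
      have h12 : Real.exp (2 * u) * (u - w) ≤ Real.exp (2 * ∫ x in a..b, l x) * (u - w) := by
        gcongr; linarith
      rw [h9]
      linarith
    · have : Real.exp (2 * w) ≤ Real.exp (2 * u) := by gcongr; linarith
      linarith
  · filter_upwards [ae_restrict_of_ae hI.ae_hasDerivAt_integral,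
      ae_restrict_mem measurableSet_Icc] with t h2 ht
    have h2' := h2 (by rwa [uIcc_of_le hab]) a (by simp)
    have := ((h2'.const_mul 2).exp).div_const 2
    exact this.congr_deriv (by ring)

/-- Look at the maximum of `g` weighted by `exp (-2 ∫ l)`. With the factor `2` in the weight, the
integral term is at most half of the left side at the maximum point and can be absorbed. The
constant is not optimal, but it vanishes with `C`, which is what uniqueness needs. -/
theorem gronwall_forward (hab : a ≤ b) (hl : IntegrableOn l (Icc a b)) (hl0 : ∀ t, 0 ≤ l t)
    {g : ℝ → ℝ} (hg : ContinuousOn g (Icc a b)) {C : ℝ} (hC : 0 ≤ C)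
    (h : ∀ t ∈ Icc a b, g t ≤ C + ∫ s in a..t, l s * g s) :
    g b ≤ 2 * C * Real.exp (2 * ∫ s in a..b, l s) := by
  have ha : a ∈ Icc a b := left_mem_Icc.2 hab
  have hb : b ∈ Icc a b := right_mem_Icc.2 hab
  have hI := intervalIntegrable_sub hl ha hb
  have hLc : ContinuousOn (fun t => ∫ x in a..t, l x) (Icc a b) := by
    have := intervalIntegral.continuousOn_primitive_interval (f := l) (μ := volume) (a := a) (b := b)
      (by rwa [uIcc_of_le hab])
    rwa [uIcc_of_le hab] at this
  obtain ⟨T, hT, hmax⟩ := isCompact_Icc.exists_isMaxOn (nonempty_Icc.2 hab)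
    (hg.mul (((hLc.const_mul 2).neg).rexp))
  set M := g T * Real.exp (-(2 * ∫ x in a..T, l x)) with hM
  have hle : ∀ t ∈ Icc a b, g t ≤ M * Real.exp (2 * ∫ x in a..t, l x) := by
    intro t ht
    have h1 : g t * Real.exp (-(2 * ∫ x in a..t, l x)) ≤ M := hmax ht
    calc g t = g t * Real.exp (-(2 * ∫ x in a..t, l x)) * Real.exp (2 * ∫ x in a..t, l x) := by
          rw [mul_assoc, ← Real.exp_add]; simp
      _ ≤ _ := by gcongr
  have hM2 : M ≤ 2 * C := by
    rcases le_or_gt M 0 with h0 | h0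
    · linarith
    have hTsub : Icc a T ⊆ Icc a b := Icc_subset_Icc le_rfl hT.2
    have hlT := hl.mono_set hTsub
    obtain ⟨i1, i2⟩ := integral_mul_exp hT.1 hlT hl0
    have h1 := h T hT
    have h2 : ∫ s in a..T, l s * g s ≤ ∫ s in a..T, M * (l s * Real.exp (2 * ∫ x in a..s, l x)) := by
      refine intervalIntegral.integral_mono_on hT.1 ?_ ?_ ?_
      · exact (intervalIntegrable_sub hlT (left_mem_Icc.2 hT.1) (right_mem_Icc.2 hT.1)).mul_continuousOn
          (by rw [uIcc_of_le hT.1]; exact hg.mono hTsub)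
      · exact (intervalIntegrable_sub i1 (left_mem_Icc.2 hT.1) (right_mem_Icc.2 hT.1)).const_mul _
      · intro x hx
        have := hle x (hTsub hx)
        have := mul_le_mul_of_nonneg_left this (hl0 x)
        linarith
    rw [intervalIntegral.integral_const_mul, i2] at h2
    have h3 : g T = M * Real.exp (2 * ∫ x in a..T, l x) := by
      rw [hM, mul_assoc, ← Real.exp_add]; simp
    have h4 : 1 ≤ Real.exp (2 * ∫ x in a..T, l x) := by
      apply Real.one_le_exp
      have : 0 ≤ ∫ x in a..T, l x := intervalIntegral.integral_nonneg hT.1 fun x _ => hl0 x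
      linarith
    nlinarith
  exact (hle b hb).trans (by gcongr)

theorem gronwall_backward (hab : a ≤ b) (hl : IntegrableOn l (Icc a b)) (hl0 : ∀ t, 0 ≤ l t)
    {g : ℝ → ℝ} (hg : ContinuousOn g (Icc a b)) {C : ℝ} (hC : 0 ≤ C)
    (h : ∀ t ∈ Icc a b, g t ≤ C + ∫ s in t..b, l s * g s) :
    g a ≤ 2 * C * Real.exp (2 * ∫ s in a..b, l s) := by
  have hmap : MapsTo (fun x : ℝ => -x) (Icc (-b) (-a)) (Icc a b) := fun x hx =>
    ⟨by linarith [hx.2], by linarith [hx.1]⟩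
  have := gronwall_forward (a := -b) (b := -a) (l := fun s => l (-s)) (g := fun s => g (-s)) (C := C)
    (by linarith) ?_ (fun t => hl0 _) (hg.comp continuous_neg.continuousOn hmap) hC ?_
  · simpa [intervalIntegral.integral_comp_neg (f := l)] using this
  · have h1 := (Measure.measurePreserving_neg (volume : Measure ℝ)).integrableOn_comp_preimage
      (Homeomorph.neg ℝ).measurableEmbedding (f := l) (s := Icc a b)
    have h2 := h1.2 hl
    simpa [Function.comp_def] using h2
  · intro t ht
    have := h (-t) (hmap ht)
    rw [intervalIntegral.integral_comp_neg (f := fun s => l s * g s)]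
    simpa using this

theorem gronwall_uIcc {τ t : ℝ} (hl : IntegrableOn l (uIcc τ t)) (hl0 : ∀ t, 0 ≤ l t)
    {g : ℝ → ℝ} (hg : ContinuousOn g (uIcc τ t)) (hg0 : ∀ s ∈ uIcc τ t, 0 ≤ g s)
    {C : ℝ} (hC : 0 ≤ C)
    (h : ∀ s ∈ uIcc τ t, g s ≤ C + |∫ r in τ..s, l r * g r|) :
    g t ≤ 2 * C * Real.exp (2 * |∫ s in τ..t, l s|) := by
  rcases le_total τ t with hτ | hτ
  · rw [uIcc_of_le hτ] at *
    rw [abs_of_nonneg (intervalIntegral.integral_nonneg hτ fun x _ => hl0 x)]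
    refine gronwall_forward hτ hl hl0 hg hC fun s hs => ?_
    have h1 := h s hs
    rwa [abs_of_nonneg (intervalIntegral.integral_nonneg hs.1 fun x hx =>
      mul_nonneg (hl0 x) (hg0 x ⟨hx.1, hx.2.trans hs.2⟩))] at h1
  · rw [uIcc_of_ge hτ] at *
    rw [intervalIntegral.integral_symm, abs_neg,
      abs_of_nonneg (intervalIntegral.integral_nonneg hτ fun x _ => hl0 x)]
    refine gronwall_backward hτ hl hl0 hg hC fun s hs => ?_
    have h1 := h s hs
    rwa [intervalIntegral.integral_symm, abs_neg,
      abs_of_nonneg (intervalIntegral.integral_nonneg hs.2 fun x hx =>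
      mul_nonneg (hl0 x) (hg0 x ⟨hs.1.trans hx.1, hx.2⟩))] at h1

end Gronwall


/-! ### Transport plans and the distance `W₁` -/

section Wasserstein

section Basic

variable {X : Type*} [PseudoEMetricSpace X] [MeasurableSpace X]

theorem wasserstein_one_le {ρ₁ ρ₂ : Measure X} {γ : Measure (X × X)}
    (hγ : γ ∈ transportPlans ρ₁ ρ₂) : wasserstein 1 ρ₁ ρ₂ ≤ ∫⁻ z, edist z.1 z.2 ∂γ := by
  simp only [wasserstein, transportCost, div_one, ENNReal.rpow_one]
  exact iInf₂_le γ hγ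

theorem exists_plan_lt {ρ₁ ρ₂ : Measure X} {c : ℝ≥0∞} (h : wasserstein 1 ρ₁ ρ₂ < c) :
    ∃ γ ∈ transportPlans ρ₁ ρ₂, ∫⁻ z, edist z.1 z.2 ∂γ < c := by
  simp only [wasserstein, transportCost, div_one, ENNReal.rpow_one, iInf_lt_iff] at h
  obtain ⟨γ, hγ, h⟩ := h
  exact ⟨γ, hγ, h⟩

theorem mem_transportPlans_map {X : Type*} [MeasurableSpace X] {Y : Type*} [MeasurableSpace Y] {ρ : Measure Y} {f g : Y → X}
    (hf : AEMeasurable f ρ) (hg : AEMeasurable g ρ) :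
    ρ.map (fun y => (f y, g y)) ∈ transportPlans (ρ.map f) (ρ.map g) := by
  constructor
  · rw [AEMeasurable.map_map_of_aemeasurable measurable_fst.aemeasurable (hf.prodMk hg)]
    rfl
  · rw [AEMeasurable.map_map_of_aemeasurable measurable_snd.aemeasurable (hf.prodMk hg)]
    rfl

theorem wasserstein_one_map_le {Y : Type*} [MeasurableSpace Y] {ρ : Measure Y} {f g : Y → X}
    (hf : AEMeasurable f ρ) (hg : AEMeasurable g ρ) :
    wasserstein 1 (ρ.map f) (ρ.map g) ≤ ∫⁻ y, edist (f y) (g y) ∂ρ :=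
  (wasserstein_one_le (mem_transportPlans_map hf hg)).trans (lintegral_map_le _ _)

theorem wasserstein_one_dirac_le (x y : X) :
    wasserstein 1 (Measure.dirac x) (Measure.dirac y) ≤ edist x y := by
  have h := wasserstein_one_map_le (ρ := Measure.dirac ()) (f := fun _ => x) (g := fun _ => y)
    aemeasurable_const aemeasurable_const
  simpa using h

theorem wasserstein_one_map_map_le {Y : Type*} [PseudoEMetricSpace Y] [MeasurableSpace Y]
    {ρ₁ ρ₂ : Measure X} {f : X → Y} (hf : Measurable f)
    (hL : ∀ x y, edist (f x) (f y) ≤ edist x y) :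
    wasserstein 1 (ρ₁.map f) (ρ₂.map f) ≤ wasserstein 1 ρ₁ ρ₂ := by
  refine le_of_forall_gt fun c hc => ?_
  obtain ⟨γ, hγ, h⟩ := exists_plan_lt hc
  rw [← hγ.1, ← hγ.2, Measure.map_map hf measurable_fst, Measure.map_map hf measurable_snd]
  refine lt_of_le_of_lt (wasserstein_one_map_le (hf.comp measurable_fst).aemeasurable
    (hf.comp measurable_snd).aemeasurable) (lt_of_le_of_lt ?_ h)
  exact lintegral_mono fun z => hL _ _

theorem wasserstein_one_comm (ρ₁ ρ₂ : Measure X) : wasserstein 1 ρ₁ ρ₂ = wasserstein 1 ρ₂ ρ₁ := by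
  have key : ∀ ρ₁ ρ₂ : Measure X, wasserstein 1 ρ₂ ρ₁ ≤ wasserstein 1 ρ₁ ρ₂ := by
    intro ρ₁ ρ₂
    refine le_of_forall_gt fun c hc => ?_
    obtain ⟨γ, hγ, h⟩ := exists_plan_lt hc
    rw [← hγ.1, ← hγ.2]
    refine lt_of_le_of_lt (wasserstein_one_map_le measurable_snd.aemeasurable
      measurable_fst.aemeasurable) ?_
    simpa [edist_comm] using h
  exact le_antisymm (key _ _) (key _ _)

end Basic

section ProbOn

variable {X : Type*} [MeasurableSpace X] {K : Set X} {ρ : Measure X}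

theorem ProbOn.ae_mem (h : ProbOn K ρ) : ∀ᵐ x ∂ρ, x ∈ K := h.2

theorem ProbOn.mono {K' : Set X} (h : ProbOn K ρ) (hK : K ⊆ K') : ProbOn K' ρ :=
  ⟨h.1, measure_mono_null (compl_subset_compl.2 hK) h.2⟩

theorem ProbOn.map {Y : Type*} [MeasurableSpace Y] {K' : Set Y} {f : X → Y} (h : ProbOn K ρ)
    (hf : AEMeasurable f ρ) (hK' : MeasurableSet K') (hm : ∀ᵐ x ∂ρ, f x ∈ K') :
    ProbOn K' (ρ.map f) := by
  have := h.1
  refine ⟨Measure.isProbabilityMeasure_map hf, ?_⟩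
  rw [Measure.map_apply_of_aemeasurable hf hK'.compl]
  exact hm

theorem ProbOn.restrict_eq (h : ProbOn K ρ) : ρ.restrict K = ρ :=
  Measure.restrict_eq_self_of_ae_mem h.ae_mem

theorem probOn_dirac {x : X} (hK : MeasurableSet K) (hx : x ∈ K) : ProbOn K (Measure.dirac x) :=
  ⟨inferInstance, by rw [Measure.dirac_apply' _ hK.compl]; simp [hx]⟩

theorem ProbOn.aestronglyMeasurable [TopologicalSpace X] [OpensMeasurableSpace X]
    {Y : Type*} [TopologicalSpace Y] [TopologicalSpace.PseudoMetrizableSpace Y]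
    [SecondCountableTopology X]
    (h : ProbOn K ρ) (hK : MeasurableSet K) {f : X → Y} (hf : ContinuousOn f K) :
    AEStronglyMeasurable f ρ := by
  rw [← h.restrict_eq]
  exact hf.aestronglyMeasurable hK

theorem ProbOn.integrable_of_bound {Y : Type*} [NormedAddCommGroup Y] (h : ProbOn K ρ)
    {f : X → Y} (hf : AEStronglyMeasurable f ρ) {c : ℝ} (hc : ∀ x ∈ K, ‖f x‖ ≤ c) :
    Integrable f ρ := by
  have := h.1
  exact Integrable.of_bound hf c (h.ae_mem.mono hc)

theorem ProbOn.norm_integral_le {Y : Type*} [NormedAddCommGroup Y] [NormedSpace ℝ Y]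
    (h : ProbOn K ρ) {f : X → Y} {c : ℝ} (hc : ∀ x ∈ K, ‖f x‖ ≤ c) : ‖∫ x, f x ∂ρ‖ ≤ c := by
  have := h.1
  refine (norm_integral_le_of_norm_le_const (h.ae_mem.mono hc)).trans ?_
  simp

theorem ProbOn.isPc [TopologicalSpace X] [R1Space X] (h : ProbOn K ρ) (hK : IsCompact K)
    (hc : IsClosed K) : IsPc ρ := by
  refine ⟨h.1, hK.of_isClosed_subset Measure.isClosed_support ?_⟩
  exact Measure.support_subset_of_isClosed hc h.ae_mem

theorem ProbOn.nonempty (h : ProbOn K ρ) : K.Nonempty := by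
  have := h.1
  exact h.ae_mem.exists.imp fun _ hx => hx

end ProbOn

section Metric

variable {X : Type*} [PseudoMetricSpace X] [MeasurableSpace X] [BorelSpace X]
  [SecondCountableTopology X]

/-- The additive slack `a` is there so that merely uniformly continuous functions are covered as
well as Lipschitz ones. -/
theorem abs_integral_sub_le_of_plan {ρ₁ ρ₂ : Measure X} [IsProbabilityMeasure ρ₁] {K : Set X}
    (h₁ : ρ₁ Kᶜ = 0) (h₂ : ρ₂ Kᶜ = 0) {f : X → ℝ} (i₁ : Integrable f ρ₁) (i₂ : Integrable f ρ₂)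
    {a c : ℝ} (hf : ∀ x ∈ K, ∀ y ∈ K, |f x - f y| ≤ a + c * dist x y) {γ : Measure (X × X)}
    (hγ : γ ∈ transportPlans ρ₁ ρ₂) (hfin : ∫⁻ z, edist z.1 z.2 ∂γ ≠ ⊤) :
    |∫ x, f x ∂ρ₁ - ∫ x, f x ∂ρ₂| ≤ a + c * (∫⁻ z, edist z.1 z.2 ∂γ).toReal := by
  have hp : IsProbabilityMeasure γ := by
    constructor
    have := measure_univ (μ := ρ₁)
    rwa [← hγ.1, Measure.map_apply measurable_fst .univ] at this
  have hi : Integrable (fun z : X × X => dist z.1 z.2) γ := by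
    refine ⟨(measurable_fst.dist measurable_snd).aestronglyMeasurable, ?_⟩
    rw [hasFiniteIntegral_iff_norm]
    refine lt_of_le_of_ne le_top (by simpa [edist_dist] using hfin)
  have e0 : ∫ z, dist z.1 z.2 ∂γ = (∫⁻ z, edist z.1 z.2 ∂γ).toReal := by
    rw [integral_eq_lintegral_of_nonneg_ae (Eventually.of_forall fun _ => dist_nonneg)
      hi.aestronglyMeasurable]
    simp [edist_dist]
  have j₁ : Integrable (fun z : X × X => f z.1) γ := by
    rw [← hγ.1] at i₁; exact i₁.comp_measurable measurable_fst
  have j₂ : Integrable (fun z : X × X => f z.2) γ := by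
    rw [← hγ.2] at i₂; exact i₂.comp_measurable measurable_snd
  have e1 : ∫ x, f x ∂ρ₁ = ∫ z, f z.1 ∂γ := by
    rw [← hγ.1] at i₁ ⊢
    exact integral_map measurable_fst.aemeasurable i₁.aestronglyMeasurable
  have e2 : ∫ x, f x ∂ρ₂ = ∫ z, f z.2 ∂γ := by
    rw [← hγ.2] at i₂ ⊢
    exact integral_map measurable_snd.aemeasurable i₂.aestronglyMeasurable
  have m1 : ∀ᵐ z ∂γ, z.1 ∈ K := by
    rw [← hγ.1] at h₁
    exact ae_of_ae_map measurable_fst.aemeasurable h₁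
  have m2 : ∀ᵐ z ∂γ, z.2 ∈ K := by
    rw [← hγ.2] at h₂
    exact ae_of_ae_map measurable_snd.aemeasurable h₂
  rw [e1, e2, ← integral_sub j₁ j₂, ← Real.norm_eq_abs]
  calc ‖∫ z, (f z.1 - f z.2) ∂γ‖ ≤ ∫ z, (a + c * dist z.1 z.2) ∂γ := by
        refine norm_integral_le_of_norm_le ((integrable_const a).add (hi.const_mul c)) ?_
        filter_upwards [m1, m2] with z hz1 hz2 using hf _ hz1 _ hz2
    _ = _ := by
        rw [integral_add (integrable_const a) (hi.const_mul c), integral_const_mul, e0]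
        simp

theorem abs_integral_sub_le {ρ₁ ρ₂ : Measure X} [IsProbabilityMeasure ρ₁] {K : Set X}
    (h₁ : ρ₁ Kᶜ = 0) (h₂ : ρ₂ Kᶜ = 0) {f : X → ℝ} (i₁ : Integrable f ρ₁) (i₂ : Integrable f ρ₂)
    {a c : ℝ} (hc : 0 ≤ c) (hf : ∀ x ∈ K, ∀ y ∈ K, |f x - f y| ≤ a + c * dist x y)
    {w : ℝ} (hw0 : 0 ≤ w) (hw : wasserstein 1 ρ₁ ρ₂ ≤ ENNReal.ofReal w) :
    |∫ x, f x ∂ρ₁ - ∫ x, f x ∂ρ₂| ≤ a + c * w := by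
  refine le_of_forall_pos_le_add fun ε hε => ?_
  have hlt : wasserstein 1 ρ₁ ρ₂ < ENNReal.ofReal (w + ε / (c + 1)) :=
    hw.trans_lt ((ENNReal.ofReal_lt_ofReal_iff (by positivity)).2 (by
      have : 0 < ε / (c + 1) := by positivity
      linarith))
  obtain ⟨γ, hγ, h⟩ := exists_plan_lt hlt
  have := abs_integral_sub_le_of_plan h₁ h₂ i₁ i₂ hf hγ (ne_top_of_lt h)
  have h3 : (∫⁻ z, edist z.1 z.2 ∂γ).toReal ≤ w + ε / (c + 1) :=
    ENNReal.toReal_le_of_le_ofReal (by positivity) h.le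
  have h4 : c * (ε / (c + 1)) ≤ ε := by
    rw [mul_div_assoc', div_le_iff₀ (by positivity)]
    nlinarith
  have := mul_le_mul_of_nonneg_left h3 hc
  linarith

/-- `W₁`-convergence implies convergence of the integrals of functions continuous on a compact
carrier. -/
theorem tendsto_integral_of_wasserstein {ι : Type*}
    {L : Filter ι} {ρs : ι → Measure X} {ρ : Measure X} {K : Set X} (hK : IsCompact K)
    (hKm : MeasurableSet K)
    (hs : ∀ n, ProbOn K (ρs n)) (h : ProbOn K ρ)
    (hlim : Tendsto (fun n => wasserstein 1 (ρs n) ρ) L (𝓝 0)) {f : X → ℝ}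
    (hf : ContinuousOn f K) :
    Tendsto (fun n => ∫ x, f x ∂(ρs n)) L (𝓝 (∫ x, f x ∂ρ)) := by
  obtain ⟨B, hB⟩ := hK.exists_bound_of_continuousOn hf
  obtain ⟨x0, hx0⟩ := h.nonempty
  have hB0 : 0 ≤ B := (norm_nonneg _).trans (hB x0 hx0)
  rw [Metric.tendsto_nhds]
  intro ε hε
  have huc := hK.uniformContinuousOn_of_continuous hf
  rw [Metric.uniformContinuousOn_iff] at huc
  obtain ⟨δ, hδ, hδ'⟩ := huc (ε / 2) (by positivity)
  -- A bounded, uniformly continuous function is Lipschitz up to an error `ε / 2`: beyond distance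
  -- `δ` the oscillation `2 B` is paid for by the linear term.
  have hmod : ∀ x ∈ K, ∀ y ∈ K, |f x - f y| ≤ ε / 2 + (2 * B / δ) * dist x y := by
    intro x hx y hy
    rcases lt_or_ge (dist x y) δ with h1 | h1
    · have := hδ' x hx y hy h1
      rw [Real.dist_eq] at this
      have : 0 ≤ (2 * B / δ) * dist x y := by positivity
      linarith
    · have h2 : |f x - f y| ≤ 2 * B := by
        have := hB x hx
        have := hB y hy
        rw [Real.norm_eq_abs] at *
        linarith [abs_sub (f x) (f y)]
      have h3 : 2 * B ≤ (2 * B / δ) * dist x y := by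
        rw [div_mul_eq_mul_div, le_div_iff₀ hδ]
        gcongr
      linarith
  have hη : 0 < ε / (4 * (2 * B / δ + 1)) := by positivity
  have hev : ∀ᶠ n in L, wasserstein 1 (ρs n) ρ < ENNReal.ofReal (ε / (4 * (2 * B / δ + 1))) :=
    hlim.eventually (gt_mem_nhds (ENNReal.ofReal_pos.2 hη))
  filter_upwards [hev] with n hn
  have := (hs n).1
  have i1 := (hs n).integrable_of_bound ((hs n).aestronglyMeasurable hKm hf) hB
  have i2 := h.integrable_of_bound (h.aestronglyMeasurable hKm hf) hB
  have h5 := abs_integral_sub_le (hs n).2 h.2 i1 i2 (by positivity) hmod hη.le hn.le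
  rw [Real.dist_eq]
  refine h5.trans_lt ?_
  have : (2 * B / δ) * (ε / (4 * (2 * B / δ + 1))) ≤ ε / 4 := by
    have hD : 0 ≤ 2 * B / δ := by positivity
    rw [mul_div_assoc', div_le_iff₀ (by positivity)]
    nlinarith
  linarith

end Metric

/-! ### Mixtures with a Dirac mass -/

section Mixture

variable {X : Type*} [MeasurableSpace X]

/-- The mixture `(1 - m) ρ + m δ_y`. -/
noncomputable def mixDirac (m : ℝ) (ρ : Measure X) (y : X) : Measure X :=
  ENNReal.ofReal (1 - m) • ρ + ENNReal.ofReal m • Measure.dirac y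

theorem ProbOn.mixDirac {K : Set X} {ρ : Measure X} (h : ProbOn K ρ) (hK : MeasurableSet K)
    {m : ℝ} (h0 : 0 ≤ m) (h1 : m ≤ 1) {y : X} (hy : y ∈ K) : ProbOn K (mixDirac m ρ y) := by
  have := h.1
  refine ⟨⟨?_⟩, ?_⟩
  · simp only [MeanField.mixDirac, Measure.add_apply, Measure.smul_apply, measure_univ, smul_eq_mul, mul_one]
    rw [← ENNReal.ofReal_add (by linarith) h0]
    simp
  · have h2 := h.2
    simp [MeanField.mixDirac, Measure.dirac_apply' _ hK.compl, hy, h2]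

theorem mixDirac_mem_transportPlans {m : ℝ} {ρ ρ' : Measure X} {γ : Measure (X × X)}
    (hγ : γ ∈ transportPlans ρ ρ') (y y' : X) :
    mixDirac m γ (y, y') ∈ transportPlans (mixDirac m ρ y) (mixDirac m ρ' y') := by
  constructor
  · simp only [mixDirac]
    rw [Measure.map_add _ _ measurable_fst, Measure.map_smul, Measure.map_smul, hγ.1,
      Measure.map_dirac' measurable_fst]
  · simp only [mixDirac]
    rw [Measure.map_add _ _ measurable_snd, Measure.map_smul, Measure.map_smul, hγ.2,
      Measure.map_dirac' measurable_snd]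

theorem diag_mem_transportPlans (ρ : Measure X) :
    ρ.map (fun x => (x, x)) ∈ transportPlans ρ ρ := by
  have := mem_transportPlans_map (ρ := ρ) (f := fun x : X => x) (g := fun x : X => x)
    aemeasurable_id' aemeasurable_id'
  simpa using this

variable [PseudoMetricSpace X] [BorelSpace X] [SecondCountableTopology X]

theorem wasserstein_one_mixDirac_mixDirac_le {m : ℝ} (h0 : 0 ≤ m) (ρ ρ' : Measure X) (y : X) :
    wasserstein 1 (mixDirac m ρ y) (mixDirac m ρ' y) ≤ wasserstein 1 ρ ρ' := by
  refine le_of_forall_gt fun c hc => ?_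
  obtain ⟨γ, hγ, h⟩ := exists_plan_lt hc
  refine lt_of_le_of_lt (wasserstein_one_le (mixDirac_mem_transportPlans (m := m) hγ y y)) ?_
  refine lt_of_le_of_lt ?_ h
  rw [mixDirac, lintegral_add_measure, lintegral_smul_measure, lintegral_smul_measure,
    lintegral_dirac' _ (measurable_fst.edist measurable_snd)]
  simp only [edist_self, smul_eq_mul, mul_zero, add_zero]
  calc _ ≤ 1 * ∫⁻ z, edist z.1 z.2 ∂γ := by
        gcongr
        simpa using h0
    _ = _ := one_mul _

/-- Only the atom is moved. The factor `m` cancels the `m⁻¹` of the difference quotients below, so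
that bounds on the measure derivative do not depend on the mass of the atom. -/
theorem wasserstein_one_mixDirac_le {m : ℝ} (h0 : 0 ≤ m) (ρ : Measure X) (y y' : X) :
    wasserstein 1 (mixDirac m ρ y) (mixDirac m ρ y') ≤ ENNReal.ofReal (m * dist y y') := by
  refine (wasserstein_one_le (mixDirac_mem_transportPlans (m := m)
    (diag_mem_transportPlans ρ) y y')).trans ?_
  rw [mixDirac, lintegral_add_measure, lintegral_smul_measure, lintegral_smul_measure,
    lintegral_dirac' _ (measurable_fst.edist measurable_snd),
    lintegral_map (measurable_fst.edist measurable_snd) (by fun_prop)]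
  simp [ENNReal.ofReal_mul h0, edist_dist]

/-- The same competitor plan for the quadratic cost; every optimal plan is at most this expensive.
-/
theorem transportCost_two_mixDirac {m : ℝ} (h0 : 0 ≤ m) (ρ : Measure X) (y y' : X) :
    ∃ γ ∈ transportPlans (mixDirac m ρ y) (mixDirac m ρ y'),
      transportCost 2 γ = ENNReal.ofReal (m * dist y y' ^ 2) := by
  refine ⟨_, mixDirac_mem_transportPlans (m := m) (diag_mem_transportPlans ρ) y y', ?_⟩
  have hm : Measurable fun z : X × X => edist z.1 z.2 ^ (2 : ℝ) :=
    (measurable_fst.edist measurable_snd).pow_const _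
  rw [transportCost, mixDirac, lintegral_add_measure, lintegral_smul_measure,
    lintegral_smul_measure, lintegral_dirac' _ hm, lintegral_map hm (by fun_prop)]
  simp [ENNReal.ofReal_mul h0, edist_dist, ENNReal.ofReal_pow]

theorem wasserstein_one_mixDirac_self_le {m : ℝ} (h0 : 0 ≤ m) (h1 : m ≤ 1) {K : Set X}
    {ρ : Measure X} (h : ProbOn K ρ) {y : X} (hy : y ∈ K) {c : ℝ}
    (hc : ∀ x ∈ K, ∀ y ∈ K, dist x y ≤ c) :
    wasserstein 1 (mixDirac m ρ y) ρ ≤ ENNReal.ofReal (m * c) := by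
  have := h.1
  -- The part `(1 - m) ρ` stays in place and the atom is spread over `ρ` by a product plan.
  have hmem : ENNReal.ofReal (1 - m) • ρ.map (fun x => (x, x)) +
      ENNReal.ofReal m • (Measure.dirac y).prod ρ ∈ transportPlans (mixDirac m ρ y) ρ := by
    obtain ⟨d1, d2⟩ := diag_mem_transportPlans ρ
    constructor
    · rw [Measure.map_add _ _ measurable_fst, Measure.map_smul, Measure.map_smul, d1,
        Measure.map_fst_prod]
      simp [mixDirac]
    · rw [Measure.map_add _ _ measurable_snd, Measure.map_smul, Measure.map_smul, d2,
        Measure.map_snd_prod]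
      simp only [measure_univ, one_smul]
      rw [← add_smul, ← ENNReal.ofReal_add (by linarith) h0]
      simp
  refine (wasserstein_one_le hmem).trans ?_
  rw [lintegral_add_measure, lintegral_smul_measure, lintegral_smul_measure,
    lintegral_map (measurable_fst.edist measurable_snd) (by fun_prop)]
  simp only [edist_self, lintegral_zero, smul_eq_mul, mul_zero, zero_add]
  rw [lintegral_prod _ (measurable_fst.edist measurable_snd).aemeasurable,
    lintegral_dirac' _ (by fun_prop), ENNReal.ofReal_mul h0]
  gcongr
  have : ∀ᵐ x ∂ρ, edist y x ≤ ENNReal.ofReal c := by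
    filter_upwards [h.ae_mem] with x hx
    rw [edist_dist]
    exact ENNReal.ofReal_le_ofReal (hc y hy x hx)
  refine (lintegral_mono_ae this).trans ?_
  simp

end Mixture

end Wasserstein


/-! ### Carathéodory functions -/

section Caratheodory

/-- `f(t, x)` is measurable in `t` for every `x` and continuous in `x` for almost every `t`. -/
structure IsCaratheodory {α X Y : Type*} [MeasurableSpace α] [TopologicalSpace X]
    [TopologicalSpace Y] (P : Measure α) (f : α → X → Y) : Prop where
  meas : ∀ x, AEStronglyMeasurable (fun t => f t x) P
  cont : ∀ᵐ t ∂P, Continuous (f t)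

variable {α X Y : Type*} [MeasurableSpace α] [TopologicalSpace X]
  [TopologicalSpace.MetrizableSpace X] [SecondCountableTopology X] [MeasurableSpace X]
  [BorelSpace X] [NormedAddCommGroup Y] {P : Measure α} {f : α → X → Y}

/-- A function continuous in `x` is determined by its values on a dense sequence, for which
countably many measurable representatives are available. Setting the function to `0` on one null set
of times makes both properties hold everywhere, and joint measurability follows. -/
theorem IsCaratheodory.exists_modification (hf : IsCaratheodory P f) :
    ∃ g : α → X → Y, StronglyMeasurable (Function.uncurry g) ∧ ∀ᵐ t ∂P, g t = f t := by
  classical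
  rcases isEmpty_or_nonempty X with hX | hX
  · refine ⟨f, ?_, Eventually.of_forall fun t => rfl⟩
    have : Function.uncurry f = fun _ => 0 := by
      ext p; exact (hX.false p.2).elim
    rw [this]
    exact stronglyMeasurable_const
  set d := TopologicalSpace.denseSeq X
  have hgood : ∀ᵐ t ∂P, Continuous (f t) ∧ ∀ n, f t (d n) = (hf.meas (d n)).mk _ t := by
    filter_upwards [hf.cont, ae_all_iff.2 fun n => (hf.meas (d n)).ae_eq_mk] with t h1 h2
      using ⟨h1, h2⟩
  set N := toMeasurable P {t | ¬ (Continuous (f t) ∧ ∀ n, f t (d n) = (hf.meas (d n)).mk _ t)}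
  have hN : MeasurableSet N := measurableSet_toMeasurable _ _
  have hN0 : P N = 0 := (measure_toMeasurable _).trans hgood
  have hNc : ∀ t ∉ N, Continuous (f t) ∧ ∀ n, f t (d n) = (hf.meas (d n)).mk _ t := by
    intro t ht
    by_contra h
    exact ht (subset_toMeasurable _ _ h)
  set g : α → X → Y := fun t x => if t ∈ N then 0 else f t x with hg
  have hgc : ∀ t, Continuous (g t) := by
    intro t
    by_cases ht : t ∈ N
    · simp only [hg, ht, if_true]; exact continuous_const
    · simp only [hg, ht, if_false]; exact (hNc t ht).1
  have hgd : ∀ n, StronglyMeasurable fun t => g t (d n) := by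
    intro n
    have : (fun t => g t (d n)) = fun t => if t ∈ N then 0 else (hf.meas (d n)).mk _ t := by
      ext t
      by_cases ht : t ∈ N
      · simp [hg, ht]
      · simp only [hg, ht, if_false]; exact (hNc t ht).2 n
    rw [this]
    exact StronglyMeasurable.ite hN stronglyMeasurable_const (hf.meas (d n)).stronglyMeasurable_mk
  have hgx : ∀ x, StronglyMeasurable fun t => g t x := by
    intro x
    obtain ⟨u, hu, hux⟩ := mem_closure_iff_seq_limit.1
      ((TopologicalSpace.denseRange_denseSeq X) x)
    choose n hn using hu
    refine stronglyMeasurable_of_tendsto atTop (f := fun k t => g t (d (n k)))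
      (fun k => hgd (n k)) ?_
    rw [tendsto_pi_nhds]
    intro t
    have := ((hgc t).tendsto x).comp hux
    refine this.congr fun k => ?_
    simp only [Function.comp, d, hn]
  refine ⟨g, ?_, ?_⟩
  · exact (stronglyMeasurable_uncurry_of_continuous_of_stronglyMeasurable
      (u := fun x t => g t x) hgc hgx).comp_measurable measurable_swap
  · have : ∀ᵐ t ∂P, t ∉ N := measure_eq_zero_iff_ae_notMem.1 hN0
    filter_upwards [this] with t ht
    ext x
    simp [hg, ht]

theorem IsCaratheodory.comp (hf : IsCaratheodory P f) {z : α → X} (hz : AEMeasurable z P) :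
    AEStronglyMeasurable (fun t => f t (z t)) P := by
  obtain ⟨g, hg, hgf⟩ := hf.exists_modification
  refine ⟨fun t => g t (hz.mk z t), hg.comp_measurable (measurable_id.prodMk hz.measurable_mk), ?_⟩
  filter_upwards [hgf, hz.ae_eq_mk] with t h1 h2
  rw [h1, h2]

theorem IsCaratheodory.integral_kernel [NormedSpace ℝ Y] (hf : IsCaratheodory P f)
    (κ : Kernel α X) [IsSFiniteKernel κ] :
    AEStronglyMeasurable (fun t => ∫ x, f t x ∂(κ t)) P := by
  obtain ⟨g, hg, hgf⟩ := hf.exists_modification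
  refine ⟨fun t => ∫ x, g t x ∂(κ t), hg.integral_kernel_prod_right, ?_⟩
  filter_upwards [hgf] with t h1
  rw [h1]

theorem IsCaratheodory.integral [NormedSpace ℝ Y] (hf : IsCaratheodory P f)
    (ρ : Measure X) [IsFiniteMeasure ρ] : AEStronglyMeasurable (fun t => ∫ x, f t x ∂ρ) P := by
  have := hf.integral_kernel (Kernel.const α ρ)
  simpa using this

theorem IsCaratheodory.uncurry {Y : Type*} [NormedAddCommGroup Y] {f : α → X → Y} [SFinite P]
    (hf : IsCaratheodory P f) (ρ : Measure X) [SFinite ρ] :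
    AEStronglyMeasurable (Function.uncurry f) (P.prod ρ) := by
  obtain ⟨g, hg, hgf⟩ := hf.exists_modification
  refine ⟨Function.uncurry g, hg, ?_⟩
  have := Measure.quasiMeasurePreserving_fst (μ := P) (ν := ρ) |>.ae hgf
  filter_upwards [this] with p hp
  simp only [Function.uncurry, hp]

end Caratheodory

section Approximation

variable {α Y : Type*} [MeasurableSpace α] [TopologicalSpace Y]
  [TopologicalSpace.PseudoMetrizableSpace Y] {P : Measure α}

/-- For piecewise constant approximations of the control and of the curve of measures: measurability
in time is assumed only when these arguments are frozen. -/
theorem aestronglyMeasurable_comp_countable {ι : Type*} [Countable ι] {i : α → ι}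
    (hi : ∀ j, MeasurableSet (i ⁻¹' {j})) {g : ι → α → Y}
    (hg : ∀ j, AEStronglyMeasurable (g j) P) : AEStronglyMeasurable (fun a => g (i a) a) P := by
  have hU : ⋃ j, i ⁻¹' {j} = univ := by ext a; simp
  rw [← Measure.restrict_univ (μ := P), ← hU, aestronglyMeasurable_iUnion_iff]
  intro j
  refine (hg j).restrict.congr ?_
  filter_upwards [ae_restrict_mem (hi j)] with a ha
  rw [show i a = j from ha]

end Approximation

/-! ### Curves of measures which are absolutely continuous for `W₁` -/

section Curves

/-- The retraction of `ℝ` onto `[0, T]`. -/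
def clampTime (T t : ℝ) : ℝ := max 0 (min t T)

theorem clampTime_mem {T : ℝ} (hT : 0 ≤ T) (t : ℝ) : clampTime T t ∈ Icc 0 T :=
  ⟨le_max_left _ _, max_le hT (min_le_right _ _)⟩

theorem clampTime_of_mem {T t : ℝ} (h : t ∈ Icc 0 T) : clampTime T t = t := by
  simp [clampTime, h.1, h.2]

theorem continuous_clampTime (T : ℝ) : Continuous (clampTime T) := by
  unfold clampTime; fun_prop

theorem tendsto_abs_integral_clampTime {T : ℝ} (hT : 0 ≤ T) {m : ℝ → ℝ}
    (hm : IntegrableOn m (Icc 0 T)) (t : ℝ) :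
    Tendsto (fun s => |∫ r in clampTime T t..clampTime T s, m r|) (𝓝 t) (𝓝 0) := by
  have hc : ContinuousOn (fun s => ∫ r in clampTime T t..s, m r) (Icc 0 T) := by
    have := intervalIntegral.continuousOn_primitive_interval' (μ := volume) (f := m)
      (b₁ := 0) (b₂ := T) (a := clampTime T t)
      (intervalIntegrable_sub hm (left_mem_Icc.2 hT) (right_mem_Icc.2 hT))
      (by rw [uIcc_of_le hT]; exact clampTime_mem hT t)
    rwa [uIcc_of_le hT] at this
  have h2 : Continuous (fun s => ∫ r in clampTime T t..clampTime T s, m r) :=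
    hc.comp_continuous (continuous_clampTime T) (clampTime_mem hT)
  have := (h2.tendsto t).abs
  simpa using this

variable {X : Type*} [PseudoMetricSpace X] [MeasurableSpace X]

theorem W1Bound.wasserstein_le {T : ℝ} {m : ℝ → ℝ} {ρ : ℝ → Measure X}
    (h : W1Bound T m ρ) {s t : ℝ} (hs : s ∈ Icc 0 T) (ht : t ∈ Icc 0 T) :
    wasserstein 1 (ρ s) (ρ t) ≤ ENNReal.ofReal |∫ r in t..s, m r| := by
  rcases le_total s t with hst | hst
  · refine (h s t hs.1 hst ht.2).trans (ENNReal.ofReal_le_ofReal ?_)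
    rw [intervalIntegral.integral_symm]
    exact neg_le_abs _
  · rw [wasserstein_one_comm]
    exact (h t s ht.1 hst hs.2).trans (ENNReal.ofReal_le_ofReal (le_abs_self _))

theorem W1Bound.tendsto_clampTime {T : ℝ} (hT : 0 ≤ T) {m : ℝ → ℝ} (hm : IsL1Nonneg T m)
    {ρ : ℝ → Measure X} (h : W1Bound T m ρ) (t : ℝ) :
    Tendsto (fun s => wasserstein 1 (ρ (clampTime T s)) (ρ (clampTime T t))) (𝓝 t) (𝓝 0) := by
  have h1 := (ENNReal.tendsto_ofReal (tendsto_abs_integral_clampTime hT hm.1 t))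
  rw [ENNReal.ofReal_zero] at h1
  exact tendsto_of_tendsto_of_tendsto_of_le_of_le tendsto_const_nhds h1 (fun _ => zero_le)
    fun s => h.wasserstein_le (clampTime_mem hT s) (clampTime_mem hT t)

variable [BorelSpace X] [SecondCountableTopology X]

theorem continuous_integral_clampTime {T : ℝ} (hT : 0 ≤ T) {m : ℝ → ℝ} (hm : IsL1Nonneg T m)
    {ρ : ℝ → Measure X} (h : W1Bound T m ρ) {K : Set X} (hK : IsCompact K)
    (hKm : MeasurableSet K) (hρ : ∀ t ∈ Icc 0 T, ProbOn K (ρ t)) {g : X → ℝ}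
    (hg : ContinuousOn g K) : Continuous fun t => ∫ x, g x ∂(ρ (clampTime T t)) := by
  rw [continuous_iff_continuousAt]
  intro t
  exact tendsto_integral_of_wasserstein hK hKm (fun s => hρ _ (clampTime_mem hT s))
    (hρ _ (clampTime_mem hT t)) (h.tendsto_clampTime hT hm t) hg

/-- The closed sets form a generating π-system, and the mass of a closed set is the limit of
integrals of thickened indicators, each of which is continuous in time. -/
theorem measurable_clampTime_curve {T : ℝ} (hT : 0 ≤ T) {m : ℝ → ℝ} (hm : IsL1Nonneg T m)
    {ρ : ℝ → Measure X} (h : W1Bound T m ρ) {K : Set X} (hK : IsCompact K)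
    (hKm : MeasurableSet K) (hρ : ∀ t ∈ Icc 0 T, ProbOn K (ρ t)) :
    Measurable fun t => ρ (clampTime T t) := by
  have hp : ∀ t, IsProbabilityMeasure (ρ (clampTime T t)) := fun t => (hρ _ (clampTime_mem hT t)).1
  refine Measurable.measure_of_isPiSystem_of_isProbabilityMeasure
    (S := {F : Set X | IsClosed F}) ?_ isPiSystem_isClosed ?_
  · rw [BorelSpace.measurable_eq (α := X), borel_eq_generateFrom_isClosed]
  · intro F hF
    have hlim : ∀ t, Tendsto (fun n : ℕ => ∫ x, (thickenedIndicator
        (Nat.one_div_pos_of_nat (α := ℝ) (n := n)) F x : ℝ) ∂(ρ (clampTime T t))) atTop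
        (𝓝 ((ρ (clampTime T t)).real F)) := fun t =>
      tendsto_integral_thickenedIndicator_of_isClosed _ hF
        (fun n => Nat.one_div_pos_of_nat (α := ℝ) (n := n)) tendsto_one_div_add_atTop_nhds_zero_nat
    have hmeas : Measurable fun t => (ρ (clampTime T t)).real F := by
      refine measurable_of_tendsto_metrizable (f := fun (n : ℕ) t => ∫ x, (thickenedIndicator
        (Nat.one_div_pos_of_nat (α := ℝ) (n := n)) F x : ℝ) ∂(ρ (clampTime T t))) (fun n => ?_)
        (tendsto_pi_nhds.2 hlim)
      refine (continuous_integral_clampTime hT hm h hK hKm hρ ?_).measurable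
      exact (NNReal.continuous_coe.comp (thickenedIndicator _ F).continuous).continuousOn
    have : (fun t => ρ (clampTime T t) F) = fun t => ENNReal.ofReal ((ρ (clampTime T t)).real F) := by
      ext t
      simp
    rw [this]
    exact hmeas.ennreal_ofReal

/-- A `W₁`-continuous curve on `[0, T]` is the restriction of a Markov kernel. -/
theorem exists_kernel_of_curve {T : ℝ} (hT : 0 ≤ T) {m : ℝ → ℝ} (hm : IsL1Nonneg T m)
    {ρ : ℝ → Measure X} (h : W1Bound T m ρ) {K : Set X} (hK : IsCompact K)
    (hKm : MeasurableSet K) (hρ : ∀ t ∈ Icc 0 T, ProbOn K (ρ t)) :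
    ∃ κ : Kernel ℝ X, IsMarkovKernel κ ∧ ∀ t ∈ Icc 0 T, κ t = ρ t := by
  refine ⟨⟨fun t => ρ (clampTime T t), measurable_clampTime_curve hT hm h hK hKm hρ⟩, ⟨fun t => ?_⟩,
    fun t ht => ?_⟩
  · exact (hρ _ (clampTime_mem hT t)).1
  · simp [clampTime_of_mem ht]

end Curves


/-! ### Ordinary differential equations with Carathéodory right-hand side -/

section ODE

theorem intervalIntegral_norm_le_abs {F : Type*} [NormedAddCommGroup F] [NormedSpace ℝ F]
    {p : ℝ → F} {g : ℝ → ℝ} {τ t : ℝ} (hg : IntervalIntegrable g volume τ t)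
    (h : ∀ᵐ s ∂(volume.restrict (uIcc τ t)), ‖p s‖ ≤ g s) :
    ‖∫ s in τ..t, p s‖ ≤ |∫ s in τ..t, g s| := by
  refine intervalIntegral.norm_integral_le_abs_of_norm_le ?_ hg
  exact ae_restrict_of_ae_restrict_of_subset uIoc_subset_uIcc h

theorem abs_integral_mul_exp_le {l : ℝ → ℝ} {τ t : ℝ} (hl : IntegrableOn l (uIcc τ t))
    (hl0 : ∀ t, 0 ≤ l t) :
    |∫ s in τ..t, l s * Real.exp (2 * |∫ r in τ..s, l r|)| ≤
      (Real.exp (2 * |∫ s in τ..t, l s|) - 1) / 2 := by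
  have key : ∀ {l : ℝ → ℝ} {τ t : ℝ}, IntegrableOn l (uIcc τ t) → (∀ t, 0 ≤ l t) → τ ≤ t →
      |∫ s in τ..t, l s * Real.exp (2 * |∫ r in τ..s, l r|)| ≤
      (Real.exp (2 * |∫ s in τ..t, l s|) - 1) / 2 := by
    intro l τ t hl hl0 hτ
    rw [uIcc_of_le hτ] at hl
    have hn : ∀ s, τ ≤ s → |∫ r in τ..s, l r| = ∫ r in τ..s, l r := fun s hs =>
      abs_of_nonneg (intervalIntegral.integral_nonneg hs fun x _ => hl0 x)
    have e : ∫ s in τ..t, l s * Real.exp (2 * |∫ r in τ..s, l r|) =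
        ∫ s in τ..t, l s * Real.exp (2 * ∫ r in τ..s, l r) := by
      refine intervalIntegral.integral_congr fun s hs => ?_
      rw [uIcc_of_le hτ] at hs
      simp only [hn s hs.1]
    rw [e, hn t hτ, (integral_mul_exp hτ hl hl0).2, abs_of_nonneg]
    have : 0 ≤ ∫ r in τ..t, l r := intervalIntegral.integral_nonneg hτ fun x _ => hl0 x
    have := Real.one_le_exp (x := 2 * ∫ r in τ..t, l r) (by linarith)
    linarith
  rcases le_total τ t with hτ | hτ
  · exact key hl hl0 hτ
  · have h1 := (Measure.measurePreserving_neg (volume : Measure ℝ)).integrableOn_comp_preimage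
      (Homeomorph.neg ℝ).measurableEmbedding (f := l) (s := uIcc τ t)
    have h2 := key (l := fun s => l (-s)) (τ := -τ) (t := -t) (by
      have := h1.2 hl
      simpa [Function.comp_def, uIcc_of_ge hτ, uIcc_of_le (neg_le_neg hτ)] using this)
      (fun _ => hl0 _) (by linarith)
    have h3 : ∀ s, |∫ r in -τ..s, l (-r)| = |∫ r in τ..(-s), l r| := by
      intro s
      rw [intervalIntegral.integral_comp_neg (f := l), neg_neg, intervalIntegral.integral_symm, abs_neg]
    simp only [h3] at h2
    rw [intervalIntegral.integral_comp_neg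
      (f := fun s => l s * Real.exp (2 * |∫ r in τ..s, l r|)), neg_neg, neg_neg,
      intervalIntegral.integral_symm, abs_neg] at h2
    exact h2

variable {E : Type*} [NormedAddCommGroup E] [NormedSpace ℝ E]

theorem continuousOn_of_integral_eq {T τ : ℝ} (hτ : τ ∈ Icc 0 T) {x : E} {p X : ℝ → E}
    (hp : IntegrableOn p (Icc 0 T)) (h : ∀ t ∈ Icc 0 T, X t = x + ∫ s in τ..t, p s) :
    ContinuousOn X (Icc 0 T) := by
  have hT : 0 ≤ T := hτ.1.trans hτ.2
  have := intervalIntegral.continuousOn_primitive_interval' (μ := volume) (f := p)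
      (b₁ := 0) (b₂ := T) (a := τ)
      (intervalIntegrable_sub hp (left_mem_Icc.2 hT) (right_mem_Icc.2 hT))
      (by rwa [uIcc_of_le hT])
  rw [uIcc_of_le hT] at this
  exact (continuousOn_const.add this).congr h

/-- Gronwall estimate for the difference of two integral curves. -/
theorem norm_sub_le_of_integral_eq {T τ t : ℝ} (hτ : τ ∈ Icc 0 T) (ht : t ∈ Icc 0 T) {x y : E}
    {p q X Y : ℝ → E} (hp : IntegrableOn p (Icc 0 T)) (hq : IntegrableOn q (Icc 0 T))
    (hX : ∀ t ∈ Icc 0 T, X t = x + ∫ s in τ..t, p s)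
    (hY : ∀ t ∈ Icc 0 T, Y t = y + ∫ s in τ..t, q s) {l e : ℝ → ℝ}
    (hl : IsL1Nonneg T l) (he : IsL1Nonneg T e)
    (h : ∀ᵐ s ∂(volume.restrict (Icc 0 T)), ‖p s - q s‖ ≤ l s * ‖X s - Y s‖ + e s) :
    ‖X t - Y t‖ ≤ 2 * (‖x - y‖ + |∫ s in τ..t, e s|) * Real.exp (2 * |∫ s in τ..t, l s|) := by
  have hsub : uIcc τ t ⊆ Icc 0 T := uIcc_subset_Icc hτ ht
  have hXc := (continuousOn_of_integral_eq hτ hp hX).mono hsub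
  have hYc := (continuousOn_of_integral_eq hτ hq hY).mono hsub
  refine gronwall_uIcc (g := fun s => ‖X s - Y s‖) (hl.1.mono_set hsub) hl.2 (hXc.sub hYc).norm
    (fun _ _ => norm_nonneg _) (by positivity) fun s hs => ?_
  have hs' := hsub hs
  have hsub2 : uIcc τ s ⊆ uIcc τ t := uIcc_subset_uIcc left_mem_uIcc hs
  have ip := intervalIntegrable_sub hp hτ hs'
  have iq := intervalIntegrable_sub hq hτ hs'
  have il := intervalIntegrable_sub hl.1 hτ hs'
  have ie := intervalIntegrable_sub he.1 hτ hs'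
  have ilg : IntervalIntegrable (fun r => l r * ‖X r - Y r‖) volume τ s :=
    il.mul_continuousOn ((hXc.sub hYc).norm.mono hsub2)
  have e1 : X s - Y s = (x - y) + ∫ r in τ..s, (p r - q r) := by
    rw [hX s hs', hY s hs', intervalIntegral.integral_sub ip iq]
    abel
  have e2 : ‖∫ r in τ..s, (p r - q r)‖ ≤ |∫ r in τ..s, (l r * ‖X r - Y r‖ + e r)| :=
    intervalIntegral_norm_le_abs (ilg.add ie)
      (ae_restrict_of_ae_restrict_of_subset (hsub2.trans hsub) h)
  rw [intervalIntegral.integral_add ilg ie] at e2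
  have e3 : |∫ r in τ..s, e r| ≤ |∫ r in τ..t, e r| :=
    intervalIntegral.abs_integral_mono_interval (uIoc_subset_uIoc_of_uIcc_subset_uIcc hsub2)
      (Eventually.of_forall he.2) (intervalIntegrable_sub he.1 hτ ht)
  calc ‖X s - Y s‖ ≤ ‖x - y‖ + ‖∫ r in τ..s, (p r - q r)‖ := by rw [e1]; exact norm_add_le _ _
    _ ≤ _ := by
      have := abs_add_le (∫ r in τ..s, l r * ‖X r - Y r‖) (∫ r in τ..s, e r)
      linarith

/-- `X` is an integral curve of `f` on `[0, T]` with `X(τ) = x`. -/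
structure SolvesODE (T : ℝ) (f : ℝ → E → E) (τ : ℝ) (x : E) (X : ℝ → E) : Prop where
  integrable : IntegrableOn (fun s => f s (X s)) (Icc 0 T)
  eq : ∀ t ∈ Icc 0 T, X t = x + ∫ s in τ..t, f s (X s)

theorem SolvesODE.continuousOn {T : ℝ} {f : ℝ → E → E} {τ : ℝ} {x : E} {X : ℝ → E}
    (h : SolvesODE T f τ x X) (hτ : τ ∈ Icc 0 T) : ContinuousOn X (Icc 0 T) :=
  continuousOn_of_integral_eq hτ h.integrable h.eq

theorem SolvesODE.initial {T : ℝ} {f : ℝ → E → E} {τ : ℝ} {x : E} {X : ℝ → E}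
    (h : SolvesODE T f τ x X) (hτ : τ ∈ Icc 0 T) : X τ = x := by
  rw [h.eq τ hτ]; simp

theorem SolvesODE.restart {T : ℝ} {f : ℝ → E → E} {τ : ℝ} {x : E} {X : ℝ → E}
    (h : SolvesODE T f τ x X) (hτ : τ ∈ Icc 0 T) {τ' : ℝ} (hτ' : τ' ∈ Icc 0 T) :
    SolvesODE T f τ' (X τ') X := by
  refine ⟨h.integrable, fun t ht => ?_⟩
  rw [h.eq t ht, h.eq τ' hτ', add_assoc, intervalIntegral.integral_add_adjacent_intervals
    (intervalIntegrable_sub h.integrable hτ hτ') (intervalIntegrable_sub h.integrable hτ' ht)]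

theorem SolvesODE.norm_sub_le {T : ℝ} {f : ℝ → E → E} {τ t : ℝ} {x y : E} {X Y : ℝ → E}
    (hX : SolvesODE T f τ x X) (hY : SolvesODE T f τ y Y) (hτ : τ ∈ Icc 0 T) (ht : t ∈ Icc 0 T)
    {l : ℝ → ℝ} (hl : IsL1Nonneg T l) {K : Set E} (hXK : ∀ t ∈ Icc 0 T, X t ∈ K)
    (hYK : ∀ t ∈ Icc 0 T, Y t ∈ K)
    (hlip : ∀ᵐ s ∂(volume.restrict (Icc 0 T)), ∀ x ∈ K, ∀ y ∈ K,
      ‖f s x - f s y‖ ≤ l s * ‖x - y‖) :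
    ‖X t - Y t‖ ≤ 2 * Real.exp (2 * ∫ s in 0..T, l s) * ‖x - y‖ := by
  have hT : 0 ≤ T := hτ.1.trans hτ.2
  have := norm_sub_le_of_integral_eq hτ ht hX.integrable hY.integrable hX.eq hY.eq hl
    (e := fun _ => 0) ⟨by simp, fun _ => le_rfl⟩ (by
      filter_upwards [hlip, ae_restrict_mem measurableSet_Icc] with s h1 h2
      simpa using h1 _ (hXK s h2) _ (hYK s h2))
  simp only [intervalIntegral.integral_zero, abs_zero, add_zero] at this
  have h2 : |∫ s in τ..t, l s| ≤ ∫ s in 0..T, l s := by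
    rw [← abs_of_nonneg (intervalIntegral.integral_nonneg hT fun x _ => hl.2 x)]
    refine intervalIntegral.abs_integral_mono_interval ?_ (Eventually.of_forall hl.2)
      (intervalIntegrable_sub hl.1 (left_mem_Icc.2 hT) (right_mem_Icc.2 hT))
    apply uIoc_subset_uIoc_of_uIcc_subset_uIcc
    rw [uIcc_of_le hT]
    exact uIcc_subset_Icc hτ ht
  refine this.trans ?_
  rw [mul_right_comm]
  gcongr

theorem SolvesODE.unique {T : ℝ} {f : ℝ → E → E} {τ t : ℝ} {x : E} {X Y : ℝ → E}
    (hX : SolvesODE T f τ x X) (hY : SolvesODE T f τ x Y) (hτ : τ ∈ Icc 0 T) (ht : t ∈ Icc 0 T)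
    {l : ℝ → ℝ} (hl : IsL1Nonneg T l) {K : Set E} (hXK : ∀ t ∈ Icc 0 T, X t ∈ K)
    (hYK : ∀ t ∈ Icc 0 T, Y t ∈ K)
    (hlip : ∀ᵐ s ∂(volume.restrict (Icc 0 T)), ∀ x ∈ K, ∀ y ∈ K,
      ‖f s x - f s y‖ ≤ l s * ‖x - y‖) : X t = Y t := by
  have := hX.norm_sub_le hY hτ ht hl hXK hYK hlip
  simp only [sub_self, norm_zero, mul_zero] at this
  exact sub_eq_zero.1 (norm_le_zero_iff.1 this)

variable [CompleteSpace E] [SecondCountableTopology E] [MeasurableSpace E] [BorelSpace E]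

theorem IsCaratheodory.integrableOn_comp {T : ℝ} {f : ℝ → E → E} {m : ℝ → ℝ}
    (hf : IsCaratheodory (volume.restrict (Icc 0 T)) f) (hm : IsL1Nonneg T m)
    (hb : ∀ᵐ t ∂(volume.restrict (Icc 0 T)), ∀ x, ‖f t x‖ ≤ m t) {X : ℝ → E}
    (hX : ContinuousOn X (Icc 0 T)) : IntegrableOn (fun s => f s (X s)) (Icc 0 T) := by
  refine Integrable.mono' hm.1 (hf.comp (hX.aemeasurable measurableSet_Icc)) ?_
  filter_upwards [hb] with t ht using ht _

/-- Picard iteration on the whole interval at once: in the sup norm weighted by `exp (2 |∫ l|)` the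
integral operator contracts by `1 / 2`, however large `∫ l` is. -/
theorem exists_solvesODE {T : ℝ} {f : ℝ → E → E} {l m : ℝ → ℝ}
    (hf : IsCaratheodory (volume.restrict (Icc 0 T)) f) (hl : IsL1Nonneg T l)
    (hm : IsL1Nonneg T m)
    (hlip : ∀ᵐ t ∂(volume.restrict (Icc 0 T)), ∀ x y, ‖f t x - f t y‖ ≤ l t * ‖x - y‖)
    (hb : ∀ᵐ t ∂(volume.restrict (Icc 0 T)), ∀ x, ‖f t x‖ ≤ m t) {τ : ℝ} (hτ : τ ∈ Icc 0 T)
    (x : E) : ∃ X, SolvesODE T f τ x X := by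
  have hT : 0 ≤ T := hτ.1.trans hτ.2
  set L : ℝ → ℝ := fun t => ∫ r in τ..t, l r with hL
  have hLc : ContinuousOn L (Icc 0 T) :=
    continuousOn_of_integral_eq (x := 0) hτ hl.1 (fun t _ => (zero_add _).symm)
  set w : ℝ → ℝ := fun t => Real.exp (2 * |L t|) with hw
  have hwc : ContinuousOn w (Icc 0 T) := (hLc.abs.const_mul 2).rexp
  have hw0 : ∀ t, 0 < w t := fun t => Real.exp_pos _
  -- The unknown `h` is the solution divided by the weight, so that the plain sup norm of `h` is the
  -- weighted norm of `Y h`.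
  let Y (h : C(Icc 0 T, E)) (s : ℝ) : E := w s • h (projIcc 0 T hT s)
  have hYc : ∀ h, ContinuousOn (Y h) (Icc 0 T) := fun h =>
    hwc.smul (h.continuous.comp continuous_projIcc).continuousOn
  have hint : ∀ h, IntegrableOn (fun s => f s (Y h s)) (Icc 0 T) := fun h =>
    hf.integrableOn_comp hm hb (hYc h)
  have hSc : ∀ h, ContinuousOn (fun t => (w t)⁻¹ • (x + ∫ s in τ..t, f s (Y h s))) (Icc 0 T) :=
    fun h => (hwc.inv₀ fun t _ => (hw0 t).ne').smul
      (continuousOn_of_integral_eq hτ (hint h) fun t _ => rfl)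
  let S (h : C(Icc 0 T, E)) : C(Icc 0 T, E) :=
    ⟨fun t => (w t)⁻¹ • (x + ∫ s in τ..(t : ℝ), f s (Y h s)),
      (hSc h).comp_continuous continuous_subtype_val fun t => t.2⟩
  have hS : ContractingWith (1 / 2) S := by
    refine ⟨by norm_num, LipschitzWith.of_dist_le_mul fun g h => ?_⟩
    rw [ContinuousMap.dist_le (by positivity)]
    intro t
    have hsub : uIcc τ (t : ℝ) ⊆ Icc 0 T := uIcc_subset_Icc hτ t.2
    have ig := intervalIntegrable_sub (hint g) hτ t.2
    have ih := intervalIntegrable_sub (hint h) hτ t.2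
    have il := intervalIntegrable_sub hl.1 hτ t.2
    have ilw : IntervalIntegrable (fun s => l s * w s) volume τ t :=
      il.mul_continuousOn (hwc.mono hsub)
    have e1 : dist (S g t) (S h t) = (w t)⁻¹ * ‖∫ s in τ..(t : ℝ), (f s (Y g s) - f s (Y h s))‖ := by
      rw [intervalIntegral.integral_sub ig ih, dist_eq_norm]
      have : S g t - S h t = (w t)⁻¹ • ((∫ s in τ..(t : ℝ), f s (Y g s)) -
          ∫ s in τ..(t : ℝ), f s (Y h s)) := by
        change (w t)⁻¹ • (x + _) - (w t)⁻¹ • (x + _) = _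
        rw [← smul_sub, add_sub_add_left_eq_sub]
      rw [this, norm_smul, norm_inv, Real.norm_of_nonneg (hw0 _).le]
    have e2 : ‖∫ s in τ..(t : ℝ), (f s (Y g s) - f s (Y h s))‖ ≤
        |∫ s in τ..(t : ℝ), (l s * w s) * dist g h| := by
      refine intervalIntegral_norm_le_abs (ilw.mul_const _)
        (ae_restrict_of_ae_restrict_of_subset hsub ?_)
      filter_upwards [hlip] with s hs
      refine (hs _ _).trans ?_
      rw [mul_assoc]
      refine mul_le_mul_of_nonneg_left ?_ (hl.2 s)
      simp only [Y]
      rw [← smul_sub, norm_smul, Real.norm_of_nonneg (hw0 _).le, ← dist_eq_norm]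
      exact mul_le_mul_of_nonneg_left (ContinuousMap.dist_apply_le_dist _) (hw0 _).le
    rw [intervalIntegral.integral_mul_const, abs_mul, abs_of_nonneg (dist_nonneg (x := g))] at e2
    have e3 := abs_integral_mul_exp_le (hl.1.mono_set hsub) hl.2
    have e4 : |∫ s in τ..(t : ℝ), l s * w s| ≤ w t / 2 := by
      refine e3.trans ?_
      simp only [hw, hL]
      linarith
    rw [e1]
    calc (w t)⁻¹ * ‖∫ s in τ..(t : ℝ), (f s (Y g s) - f s (Y h s))‖
        ≤ (w t)⁻¹ * (w t / 2 * dist g h) := by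
          refine mul_le_mul_of_nonneg_left (e2.trans ?_) (inv_nonneg.2 (hw0 _).le)
          exact mul_le_mul_of_nonneg_right e4 dist_nonneg
      _ = _ := by
          have := (hw0 (t : ℝ)).ne'
          field_simp
          simp
          ring
  have hne : Nonempty C(Icc 0 T, E) := ⟨0⟩
  set h := ContractingWith.fixedPoint S hS
  have hfix : S h = h := hS.fixedPoint_isFixedPt
  refine ⟨Y h, hint h, fun t ht => ?_⟩
  have h1 : h ⟨t, ht⟩ = (w t)⁻¹ • (x + ∫ s in τ..t, f s (Y h s)) := by
    conv_lhs => rw [← hfix]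
    rfl
  have h2 : Y h t = w t • h ⟨t, ht⟩ := by simp only [Y, projIcc_of_mem hT ht]
  rw [h2, h1, smul_inv_smul₀ (hw0 t).ne']

end ODE

section ODE

variable {E : Type*} [NormedAddCommGroup E] [NormedSpace ℝ E]

/-- A choice of the flow of `f`: `odeFlow T f τ x` is an integral curve of `f` through `(τ, x)`. -/
noncomputable def odeFlow (T : ℝ) (f : ℝ → E → E) (τ : ℝ) (x : E) : ℝ → E :=
  Classical.epsilon (SolvesODE T f τ x)

/-- The radial retraction onto the closed ball of radius `R`. -/
noncomputable def ballRetract (R : ℝ) (x : E) : E := (R / max R ‖x‖) • x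

end ODE

section Retract

variable {E : Type*} [NormedAddCommGroup E] [NormedSpace ℝ E] {R : ℝ}

theorem ballRetract_of_mem (hR : 0 < R) {x : E} (hx : x ∈ Metric.closedBall 0 R) :
    ballRetract R x = x := by
  rw [mem_closedBall_zero_iff] at hx
  simp [ballRetract, max_eq_left hx, hR.ne']

theorem norm_ballRetract_le_norm (hR : 0 < R) (x : E) : ‖ballRetract R x‖ ≤ ‖x‖ := by
  have h : 0 < max R ‖x‖ := lt_max_of_lt_left hR
  rw [ballRetract, norm_smul, Real.norm_of_nonneg (by positivity)]
  refine mul_le_of_le_one_left (norm_nonneg _) ?_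
  rw [div_le_one h]
  exact le_max_left _ _

theorem ballRetract_mem (hR : 0 < R) (x : E) : ballRetract R x ∈ Metric.closedBall 0 R := by
  have h : 0 < max R ‖x‖ := lt_max_of_lt_left hR
  rw [mem_closedBall_zero_iff, ballRetract, norm_smul, Real.norm_of_nonneg (by positivity),
    div_mul_eq_mul_div, div_le_iff₀ h]
  exact mul_le_mul_of_nonneg_left (le_max_right _ _) hR.le

theorem continuous_ballRetract (hR : 0 < R) : Continuous (ballRetract R : E → E) := by
  unfold ballRetract
  refine Continuous.smul (continuous_const.div (by fun_prop) fun x => ?_) continuous_id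
  exact (lt_max_of_lt_left hR).ne'

/-- One `‖x - y‖` pays for the shared scaling factor, the other for the change of that factor; this
uses no inner product. -/
theorem norm_ballRetract_sub_le (hR : 0 < R) (x y : E) :
    ‖ballRetract R x - ballRetract R y‖ ≤ 2 * ‖x - y‖ := by
  have hx : 0 < max R ‖x‖ := lt_max_of_lt_left hR
  have hy : 0 < max R ‖y‖ := lt_max_of_lt_left hR
  have e : ballRetract R x - ballRetract R y =
      (R / max R ‖x‖) • (x - y) + (R / max R ‖x‖ - R / max R ‖y‖) • y := by
    simp only [ballRetract, smul_sub, sub_smul]; abel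
  have h1 : ‖(R / max R ‖x‖) • (x - y)‖ ≤ ‖x - y‖ := by
    rw [norm_smul, Real.norm_of_nonneg (by positivity)]
    refine mul_le_of_le_one_left (norm_nonneg _) ?_
    rw [div_le_one hx]
    exact le_max_left _ _
  have h2 : ‖(R / max R ‖x‖ - R / max R ‖y‖) • y‖ ≤ ‖x - y‖ := by
    have e2 : R / max R ‖x‖ - R / max R ‖y‖ =
        (R / max R ‖x‖) * ((max R ‖y‖ - max R ‖x‖) / max R ‖y‖) := by
      field_simp
    have h3 : |max R ‖y‖ - max R ‖x‖| ≤ ‖x - y‖ := by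
      have := abs_max_sub_max_le_max R ‖y‖ R ‖x‖
      refine this.trans ?_
      simp only [sub_self, abs_zero]
      refine max_le (norm_nonneg _) ?_
      rw [norm_sub_rev]
      exact abs_norm_sub_norm_le _ _
    rw [norm_smul, e2, norm_mul, norm_div, norm_div, Real.norm_of_nonneg hR.le,
      Real.norm_of_nonneg hx.le, Real.norm_of_nonneg hy.le, Real.norm_eq_abs, mul_assoc]
    have h4 : R / max R ‖x‖ ≤ 1 := by
      rw [div_le_one hx]
      exact le_max_left _ _
    have h5 : |max R ‖y‖ - max R ‖x‖| / max R ‖y‖ * ‖y‖ ≤ ‖x - y‖ := by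
      rw [div_mul_eq_mul_div, div_le_iff₀ hy]
      exact mul_le_mul h3 (le_max_right _ _) (norm_nonneg _) (norm_nonneg _)
    calc _ ≤ 1 * (|max R ‖y‖ - max R ‖x‖| / max R ‖y‖ * ‖y‖) :=
          mul_le_mul_of_nonneg_right h4 (by positivity)
      _ ≤ _ := by rwa [one_mul]
  rw [e]
  linarith [norm_add_le ((R / max R ‖x‖) • (x - y)) ((R / max R ‖x‖ - R / max R ‖y‖) • y)]

end Retract

/-! ### Flows of locally Lipschitz fields with sublinear growth -/

section Flow

variable {E : Type*} [NormedAddCommGroup E] [NormedSpace ℝ E]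

theorem continuous_of_lip {E F : Type*} [NormedAddCommGroup E] [NormedAddCommGroup F]
    {f : E → F} {l : ℝ} (h : ∀ x y, ‖f x - f y‖ ≤ l * ‖x - y‖) : Continuous f := by
  refine (LipschitzWith.of_dist_le_mul (K := l.toNNReal) fun x y => ?_).continuous
  rw [dist_eq_norm, dist_eq_norm]
  exact (h x y).trans (mul_le_mul_of_nonneg_right (Real.le_coe_toNNReal l) (norm_nonneg _))

theorem odeFlow_spec {T : ℝ} {f : ℝ → E → E} {τ : ℝ} {x : E} (h : ∃ X, SolvesODE T f τ x X) :
    SolvesODE T f τ x (odeFlow T f τ x) := Classical.epsilon_spec h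

theorem IsL1Nonneg.const_mul {T : ℝ} {m : ℝ → ℝ} (hm : IsL1Nonneg T m) {c : ℝ} (hc : 0 ≤ c) :
    IsL1Nonneg T fun t => c * m t := ⟨hm.1.const_mul c, fun t => mul_nonneg hc (hm.2 t)⟩

theorem IsL1Nonneg.add {T : ℝ} {m n : ℝ → ℝ} (hm : IsL1Nonneg T m) (hn : IsL1Nonneg T n) :
    IsL1Nonneg T fun t => m t + n t := ⟨hm.1.add hn.1, fun t => add_nonneg (hm.2 t) (hn.2 t)⟩

theorem isL1Nonneg_zero {T : ℝ} : IsL1Nonneg T fun _ => 0 := ⟨by simp, fun _ => le_rfl⟩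

theorem IsL1Nonneg.abs_integral_le {T : ℝ} {l : ℝ → ℝ} (hl : IsL1Nonneg T l) {τ t : ℝ}
    (hτ : τ ∈ Icc 0 T) (ht : t ∈ Icc 0 T) : |∫ s in τ..t, l s| ≤ ∫ s in 0..T, l s := by
  have hT : 0 ≤ T := hτ.1.trans hτ.2
  rw [← abs_of_nonneg (intervalIntegral.integral_nonneg hT fun x _ => hl.2 x)]
  refine intervalIntegral.abs_integral_mono_interval ?_ (Eventually.of_forall hl.2)
    (intervalIntegrable_sub hl.1 (left_mem_Icc.2 hT) (right_mem_Icc.2 hT))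
  apply uIoc_subset_uIoc_of_uIcc_subset_uIcc
  rw [uIcc_of_le hT]
  exact uIcc_subset_Icc hτ ht

/-- Growth bound for integral curves of fields with sublinear growth. -/
theorem SolvesODE.norm_le {T : ℝ} {f : ℝ → E → E} {τ t : ℝ} {x : E} {X : ℝ → E}
    (hX : SolvesODE T f τ x X) (hτ : τ ∈ Icc 0 T) (ht : t ∈ Icc 0 T) {m : ℝ → ℝ}
    (hm : IsL1Nonneg T m)
    (hg : ∀ᵐ s ∂(volume.restrict (Icc 0 T)), ∀ x, ‖f s x‖ ≤ m s * (1 + ‖x‖)) :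
    ‖X t‖ ≤ 2 * (‖x‖ + ∫ s in 0..T, m s) * Real.exp (2 * ∫ s in 0..T, m s) := by
  have := norm_sub_le_of_integral_eq (Y := fun _ => 0) (q := fun _ => 0) (y := 0) hτ ht
    hX.integrable (by simp) hX.eq (by simp) hm hm (by
      filter_upwards [hg] with s h1
      have := h1 (X s)
      simp only [sub_zero]
      linarith)
  simp only [sub_zero] at this
  have h2 := hm.abs_integral_le hτ ht
  refine this.trans ?_
  have : 0 ≤ ∫ s in 0..T, m s := (abs_nonneg _).trans h2
  gcongr

variable [CompleteSpace E] [SecondCountableTopology E] [MeasurableSpace E] [BorelSpace E]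

/-- Fields which are measurable in time, locally Lipschitz and of sublinear growth in space. -/
structure IsLocLipField (T : ℝ) (f : ℝ → E → E) : Prop where
  meas : ∀ x, AEStronglyMeasurable (fun t => f t x) (volume.restrict (Icc 0 T))
  lip : ∀ R > 0, ∃ l : ℝ → ℝ, IsL1Nonneg T l ∧ ∀ᵐ t ∂(volume.restrict (Icc 0 T)),
    ∀ x ∈ Metric.closedBall (0 : E) R, ∀ y ∈ Metric.closedBall (0 : E) R,
      ‖f t x - f t y‖ ≤ l t * ‖x - y‖
  growth : ∃ m : ℝ → ℝ, IsL1Nonneg T m ∧ ∀ᵐ t ∂(volume.restrict (Icc 0 T)),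
    ∀ x, ‖f t x‖ ≤ m t * (1 + ‖x‖)

/-- Composing the field with the retraction onto a ball makes it globally Lipschitz and bounded. As
the retraction decreases norms, the growth bound survives with the same `m`, and the a priori
estimate keeps the solution in the ball, where nothing was changed. -/
theorem IsLocLipField.exists_bounded_solution {T : ℝ} {f : ℝ → E → E} (hf : IsLocLipField T f) :
    ∃ B : ℝ → ℝ, Monotone B ∧ (∀ r, 0 < B r) ∧ ∀ τ ∈ Icc 0 T, ∀ x,
      (∃ X, SolvesODE T f τ x X) ∧ ∀ X, SolvesODE T f τ x X →
        ∀ t ∈ Icc 0 T, X t ∈ Metric.closedBall 0 (B ‖x‖) := by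
  obtain ⟨m, hm, hg⟩ := hf.growth
  rcases lt_or_ge T 0 with hT | hT
  · exact ⟨fun _ => 1, monotone_const, fun _ => one_pos, fun τ hτ =>
      absurd (hτ.1.trans hτ.2) (not_le.2 hT)⟩
  have hM : 0 ≤ ∫ s in 0..T, m s := intervalIntegral.integral_nonneg hT fun x _ => hm.2 x
  set M := ∫ s in 0..T, m s
  -- The maximum with `0` and the added `1` make `B` monotone and positive for every real argument;
  -- the value at `‖x‖` exceeds the Gronwall bound.
  set B : ℝ → ℝ := fun r => 2 * (max r 0 + M) * Real.exp (2 * M) + 1 with hB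
  have hBmono : Monotone B := by
    intro r s hrs
    simp only [hB]
    gcongr
  have hB0 : ∀ r, 0 < B r := fun r => by
    have : 0 ≤ max r 0 := le_max_right _ _
    simp only [hB]; positivity
  have hBle : ∀ x : E, 2 * (‖x‖ + M) * Real.exp (2 * M) ≤ B ‖x‖ := fun x => by
    simp only [hB, max_eq_left (norm_nonneg x)]; linarith
  refine ⟨B, hBmono, hB0, fun τ hτ x => ⟨?_, fun X hX t ht => ?_⟩⟩
  swap
  · rw [mem_closedBall_zero_iff]
    exact (hX.norm_le hτ ht hm hg).trans (hBle x)
  set R := B ‖x‖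
  have hR : 0 < R := hB0 _
  obtain ⟨l, hl, hlip⟩ := hf.lip R hR
  have hlip' : ∀ᵐ t ∂(volume.restrict (Icc 0 T)), ∀ x y,
      ‖f t (ballRetract R x) - f t (ballRetract R y)‖ ≤ 2 * l t * ‖x - y‖ := by
    filter_upwards [hlip] with t ht x y
    refine (ht _ (ballRetract_mem hR _) _ (ballRetract_mem hR _)).trans ?_
    rw [mul_comm 2, mul_assoc]
    exact mul_le_mul_of_nonneg_left (norm_ballRetract_sub_le hR x y) (hl.2 t)
  have hcar : IsCaratheodory (volume.restrict (Icc 0 T)) fun t x => f t (ballRetract R x) := by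
    refine ⟨fun x => hf.meas _, ?_⟩
    filter_upwards [hlip'] with t ht using continuous_of_lip ht
  have hb : ∀ᵐ t ∂(volume.restrict (Icc 0 T)), ∀ x, ‖f t (ballRetract R x)‖ ≤ (1 + R) * m t := by
    filter_upwards [hg] with t ht x
    refine (ht _).trans ?_
    rw [mul_comm]
    have := mem_closedBall_zero_iff.1 (ballRetract_mem hR x)
    have := hm.2 t
    gcongr
  obtain ⟨X, hX⟩ := exists_solvesODE hcar (hl.const_mul zero_le_two) (hm.const_mul (by positivity))
    hlip' hb hτ x
  have hXB : ∀ t ∈ Icc 0 T, ballRetract R (X t) = X t := by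
    intro t ht
    refine ballRetract_of_mem hR (mem_closedBall_zero_iff.2 ?_)
    refine (hX.norm_le hτ ht hm ?_).trans (hBle x)
    filter_upwards [hg] with s hs y
    refine (hs _).trans ?_
    have := norm_ballRetract_le_norm hR y
    have := hm.2 s
    gcongr
  refine ⟨X, hX.integrable.congr_fun (fun s hs => by simp only [hXB s hs]) measurableSet_Icc,
    fun t ht => (hX.eq t ht).trans ?_⟩
  congr 1
  refine intervalIntegral.integral_congr fun s hs => ?_
  simp only [hXB s (uIcc_subset_Icc hτ ht hs)]

theorem IsLocLipField.odeFlow_spec {T : ℝ} {f : ℝ → E → E} (hf : IsLocLipField T f) {τ : ℝ}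
    (hτ : τ ∈ Icc 0 T) (x : E) : SolvesODE T f τ x (odeFlow T f τ x) := by
  obtain ⟨B, -, -, hB⟩ := hf.exists_bounded_solution
  exact MeanField.odeFlow_spec (hB τ hτ x).1

theorem IsLocLipField.unique {T : ℝ} {f : ℝ → E → E} (hf : IsLocLipField T f) {τ : ℝ}
    (hτ : τ ∈ Icc 0 T) {x : E} {X : ℝ → E} (hX : SolvesODE T f τ x X) {t : ℝ} (ht : t ∈ Icc 0 T) :
    X t = odeFlow T f τ x t := by
  obtain ⟨B, -, hB0, hB⟩ := hf.exists_bounded_solution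
  obtain ⟨l, hl, hlip⟩ := hf.lip _ (hB0 ‖x‖)
  exact hX.unique (hf.odeFlow_spec hτ x) hτ ht hl ((hB τ hτ x).2 X hX)
    ((hB τ hτ x).2 _ (hf.odeFlow_spec hτ x)) hlip

theorem IsLocLipField.odeFlow_odeFlow {T : ℝ} {f : ℝ → E → E} (hf : IsLocLipField T f)
    {τ s t : ℝ} (hτ : τ ∈ Icc 0 T) (hs : s ∈ Icc 0 T) (ht : t ∈ Icc 0 T) (x : E) :
    odeFlow T f s (odeFlow T f τ x s) t = odeFlow T f τ x t :=
  (hf.unique hs ((hf.odeFlow_spec hτ x).restart hτ hs) ht).symm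

theorem IsLocLipField.odeFlow_self {T : ℝ} {f : ℝ → E → E} (hf : IsLocLipField T f)
    {τ : ℝ} (hτ : τ ∈ Icc 0 T) (x : E) : odeFlow T f τ x τ = x :=
  (hf.odeFlow_spec hτ x).initial hτ

/-- Near a given `x₀` all trajectories stay in one ball, so the flow is Lipschitz in `x` uniformly
in time there; continuity in time is that of a primitive. -/
theorem IsLocLipField.continuousOn_odeFlow {T : ℝ} {f : ℝ → E → E} (hf : IsLocLipField T f)
    {τ : ℝ} (hτ : τ ∈ Icc 0 T) :
    ContinuousOn (fun q : ℝ × E => odeFlow T f τ q.2 q.1) (Icc 0 T ×ˢ univ) := by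
  obtain ⟨B, hBm, hB0, hB⟩ := hf.exists_bounded_solution
  rintro ⟨t0, x0⟩ ⟨ht0, -⟩
  obtain ⟨l, hl, hlip⟩ := hf.lip _ (hB0 (‖x0‖ + 1))
  have hstay : ∀ x ∈ Metric.ball x0 1, ∀ t ∈ Icc 0 T,
      odeFlow T f τ x t ∈ Metric.closedBall 0 (B (‖x0‖ + 1)) := by
    intro x hx t ht
    refine Metric.closedBall_subset_closedBall (hBm ?_) ((hB τ hτ x).2 _ (hf.odeFlow_spec hτ x) t ht)
    rw [mem_ball_iff_norm] at hx
    have := norm_sub_norm_le x x0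
    linarith
  have hc : ContinuousOn (fun q : ℝ × E => odeFlow T f τ q.2 q.1) (Icc 0 T ×ˢ Metric.ball x0 1) := by
    refine continuousOn_prod_of_continuousOn_lipschitzOnWith' _
      (2 * Real.exp (2 * ∫ s in 0..T, l s)).toNNReal (fun t ht => ?_) (fun x hx => ?_)
    · refine LipschitzOnWith.of_dist_le_mul fun x hx y hy => ?_
      rw [dist_eq_norm, dist_eq_norm, Real.coe_toNNReal _ (by positivity)]
      exact (hf.odeFlow_spec hτ x).norm_sub_le (hf.odeFlow_spec hτ y) hτ ht hl (hstay x hx)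
        (hstay y hy) hlip
    · exact (hf.odeFlow_spec hτ x).continuousOn hτ
  have := hc (t0, x0) ⟨ht0, Metric.mem_ball_self one_pos⟩
  refine this.mono_of_mem_nhdsWithin ?_
  have h1 : (univ : Set ℝ) ×ˢ Metric.ball x0 1 ∈ 𝓝[Icc 0 T ×ˢ univ] (t0, x0) :=
    mem_nhdsWithin_of_mem_nhds (prod_mem_nhds univ_mem (Metric.ball_mem_nhds _ one_pos))
  filter_upwards [h1, self_mem_nhdsWithin] with q hq hq' using ⟨hq'.1, hq.2⟩

theorem IsLocLipField.continuous_odeFlow {T : ℝ} {f : ℝ → E → E} (hf : IsLocLipField T f)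
    {τ : ℝ} (hτ : τ ∈ Icc 0 T) {t : ℝ} (ht : t ∈ Icc 0 T) :
    Continuous fun x => odeFlow T f τ x t := by
  have := (hf.continuousOn_odeFlow hτ).comp_continuous (f := fun x : E => (t, x)) (by fun_prop)
    (fun x => ⟨ht, mem_univ _⟩)
  exact this

end Flow


/-! ### Mollification -/

section Mollification

open scoped Convolution

variable {X : Type*} [NormedAddCommGroup X] [NormedSpace ℝ X] [FiniteDimensional ℝ X]
  [MeasurableSpace X] [BorelSpace X] {Y : Type*} [NormedAddCommGroup Y] [NormedSpace ℝ Y]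

/-- The convolution of `g` with a normed bump function. -/
noncomputable def mollify (b : ContDiffBump (0 : X)) (g : X → Y) (x : X) : Y :=
  ∫ y, b.normed Measure.addHaar y • g (x - y) ∂Measure.addHaar

theorem integrable_bump_smul (b : ContDiffBump (0 : X)) {g : X → Y} (hg : Continuous g) :
    Integrable (fun y => b.normed Measure.addHaar y • g y) Measure.addHaar :=
  (b.continuous_normed.smul hg).integrable_of_hasCompactSupport
    b.hasCompactSupport_normed.smul_right

theorem norm_integral_bump_smul_sub_le [CompleteSpace Y] (b : ContDiffBump (0 : X)) {g h : X → Y}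
    (hg : Continuous g) (hh : Continuous h) {δ : ℝ}
    (H : ∀ y ∈ Metric.closedBall (0 : X) b.rOut, ‖g y - h y‖ ≤ δ) :
    ‖∫ y, b.normed Measure.addHaar y • g y ∂Measure.addHaar -
      ∫ y, b.normed Measure.addHaar y • h y ∂Measure.addHaar‖ ≤ δ := by
  rw [← integral_sub (integrable_bump_smul b hg) (integrable_bump_smul b hh)]
  calc _ ≤ ∫ y, b.normed Measure.addHaar y * δ ∂Measure.addHaar := by
        refine norm_integral_le_of_norm_le
          ((b.continuous_normed.integrable_of_hasCompactSupport b.hasCompactSupport_normed).mul_const _)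
          (Eventually.of_forall fun y => ?_)
        rw [← smul_sub, norm_smul, Real.norm_of_nonneg (b.nonneg_normed y)]
        by_cases hy : y ∈ Metric.closedBall (0 : X) b.rOut
        · exact mul_le_mul_of_nonneg_left (H y hy) (b.nonneg_normed y)
        · have : b.normed Measure.addHaar y = 0 := by
            rw [← Function.notMem_support, b.support_normed_eq]
            exact fun h => hy (Metric.ball_subset_closedBall h)
          simp [this]
    _ = δ := by rw [integral_mul_const, b.integral_normed, one_mul]

theorem integral_bump_smul_const [CompleteSpace Y] (b : ContDiffBump (0 : X)) (c : Y) :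
    ∫ y, b.normed Measure.addHaar y • c ∂Measure.addHaar = c := by
  rw [integral_smul_const, b.integral_normed, one_smul]

theorem norm_mollify_sub_self_le [CompleteSpace Y] (b : ContDiffBump (0 : X)) {g : X → Y}
    (hg : Continuous g) {x : X} {δ : ℝ}
    (H : ∀ y ∈ Metric.closedBall (0 : X) b.rOut, ‖g (x - y) - g x‖ ≤ δ) :
    ‖mollify b g x - g x‖ ≤ δ := by
  have := norm_integral_bump_smul_sub_le b (g := fun y => g (x - y)) (h := fun _ => g x)
    (by fun_prop) continuous_const H
  rwa [integral_bump_smul_const] at this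

/-- Different functions and different base points are allowed, because a function composed with the
flow has to be compared with the original function at a displaced point. -/
theorem norm_mollify_sub_le [CompleteSpace Y] (b : ContDiffBump (0 : X)) {g h : X → Y}
    (hg : Continuous g) (hh : Continuous h) {x z : X} {δ : ℝ}
    (H : ∀ y ∈ Metric.closedBall (0 : X) b.rOut, ‖g (x - y) - h (z - y)‖ ≤ δ) :
    ‖mollify b g x - mollify b h z‖ ≤ δ :=
  norm_integral_bump_smul_sub_le b (g := fun y => g (x - y)) (h := fun y => h (z - y))
    (by fun_prop) (by fun_prop) H

theorem norm_mollify_le [CompleteSpace Y] (b : ContDiffBump (0 : X)) {g : X → Y}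
    (hg : Continuous g) {x : X} {δ : ℝ} (H : ∀ y, ‖g y‖ ≤ δ) : ‖mollify b g x‖ ≤ δ := by
  have := norm_mollify_sub_le b (h := fun _ => (0 : Y)) (x := x) (z := x) (δ := δ) hg
    continuous_const fun y _ => by simpa using H _
  simpa [mollify] using this

theorem mollify_eq_convolution (b : ContDiffBump (0 : X)) (g : X → Y) :
    mollify b g = (b.normed Measure.addHaar ⋆[ContinuousLinearMap.lsmul ℝ ℝ, Measure.addHaar] g) := by
  ext x
  simp [mollify, convolution]

theorem contDiff_mollify [CompleteSpace Y] (b : ContDiffBump (0 : X)) {g : X → Y}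
    (hg : Continuous g) : ContDiff ℝ ∞ (mollify b g) := by
  rw [mollify_eq_convolution]
  exact b.hasCompactSupport_normed.contDiff_convolution_left _ b.contDiff_normed
    hg.locallyIntegrable

theorem fderiv_mollify [CompleteSpace Y] (b : ContDiffBump (0 : X)) {g : X → Y}
    (hg : Continuous g) (x : X) :
    fderiv ℝ (mollify b g) x = ∫ y, (ContinuousLinearMap.lsmul ℝ ℝ : ℝ →L[ℝ] Y →L[ℝ] Y).precompL X
      (fderiv ℝ (b.normed Measure.addHaar) y) (g (x - y)) ∂Measure.addHaar := by
  rw [mollify_eq_convolution]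
  exact (b.hasCompactSupport_normed.hasFDerivAt_convolution_left _ b.contDiff_normed
    hg.locallyIntegrable x).fderiv

/-- The derivative falls on the bump, so closeness of the values gives closeness of the derivatives,
with a constant depending on the bump only. -/
theorem exists_fderiv_mollify_sub_le (Y : Type*) [NormedAddCommGroup Y] [NormedSpace ℝ Y]
    [CompleteSpace Y] (b : ContDiffBump (0 : X)) :
    ∃ C, 0 ≤ C ∧ ∀ g h : X → Y, Continuous g → Continuous h → ∀ x z δ,
      (∀ y, ‖g (x - y) - h (z - y)‖ ≤ δ) →
      ‖fderiv ℝ (mollify b g) x - fderiv ℝ (mollify b h) z‖ ≤ C * δ := by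
  set L := (ContinuousLinearMap.lsmul ℝ ℝ : ℝ →L[ℝ] Y →L[ℝ] Y).precompL X with hL
  have hLn : ∀ u v, ‖L u v‖ ≤ ‖u‖ * ‖v‖ := by
    intro u v
    refine ContinuousLinearMap.opNorm_le_bound _ (by positivity) fun x => ?_
    simp only [hL, ContinuousLinearMap.precompL_apply, ContinuousLinearMap.lsmul_apply, norm_smul]
    have := u.le_opNorm x
    calc ‖u x‖ * ‖v‖ ≤ (‖u‖ * ‖x‖) * ‖v‖ := by gcongr
      _ = _ := by ring
  set k := fderiv ℝ (b.normed (Measure.addHaar : Measure X)) with hk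
  have hkc : Continuous k := b.contDiff_normed.continuous_fderiv (by simp : (∞ : WithTop ℕ∞) ≠ 0)
  have hks : HasCompactSupport k := b.hasCompactSupport_normed.fderiv (𝕜 := ℝ)
  have hki : Integrable k Measure.addHaar := hkc.integrable_of_hasCompactSupport hks
  refine ⟨∫ y, ‖k y‖ ∂Measure.addHaar, integral_nonneg fun _ => norm_nonneg _, fun g h hg hh x z δ H => ?_⟩
  have hi : ∀ (g : X → Y) (x : X), Continuous g →
      Integrable (fun y => L (k y) (g (x - y))) Measure.addHaar := by
    intro g x hg
    refine Continuous.integrable_of_hasCompactSupport ?_ ?_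
    · have hg' : Continuous fun y => g (x - y) := by fun_prop
      exact (L.continuous.comp hkc).clm_apply hg'
    · refine hks.mono' fun y hy => subset_tsupport _ ?_
      intro h0
      apply hy
      simp [show k y = 0 from h0]
  rw [fderiv_mollify b hg, fderiv_mollify b hh, ← hL, ← hk, ← integral_sub (hi g x hg) (hi h z hh)]
  calc _ ≤ ∫ y, ‖k y‖ * δ ∂Measure.addHaar := by
        refine norm_integral_le_of_norm_le (hki.norm.mul_const _)
          (Eventually.of_forall fun y => ?_)
        rw [← map_sub]
        refine (hLn _ _).trans ?_
        exact mul_le_mul_of_nonneg_left (H y) (norm_nonneg _)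
    _ = _ := by rw [integral_mul_const]

theorem exists_mollify_lipschitz_of_bounded (Y : Type*) [NormedAddCommGroup Y] [NormedSpace ℝ Y]
    [CompleteSpace Y] (b : ContDiffBump (0 : X)) :
    ∃ C, 0 ≤ C ∧ ∀ g : X → Y, Continuous g → ∀ M, (∀ y, ‖g y‖ ≤ M) → ∀ x z,
      ‖mollify b g x - mollify b g z‖ ≤ C * M * ‖x - z‖ := by
  obtain ⟨C, hC, H⟩ := exists_fderiv_mollify_sub_le Y b
  refine ⟨C, hC, fun g hg M hM x z => ?_⟩
  refine Convex.norm_image_sub_le_of_norm_fderiv_le (𝕜 := ℝ) (s := univ) (fun y _ => ?_) (fun y _ => ?_)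
    convex_univ (mem_univ z) (mem_univ x)
  · exact (contDiff_mollify b hg).differentiable (by simp) y
  · have := H g (fun _ => 0) hg continuous_const y y M (fun y => by simpa using hM _)
    have h0 : mollify b (fun _ : X => (0 : Y)) = fun _ => 0 := by ext; simp [mollify]
    simpa [h0] using this

/-- Mollifications of Lipschitz functions have Lipschitz derivatives, with a quantitative Taylor
estimate. -/
theorem exists_mollify_taylor (b : ContDiffBump (0 : X)) :
    ∃ C, 0 ≤ C ∧ ∀ q : X → ℝ, ∀ Λ, 0 ≤ Λ → (∀ x y, |q x - q y| ≤ Λ * ‖x - y‖) →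
      (∀ x z, ‖fderiv ℝ (mollify b q) x - fderiv ℝ (mollify b q) z‖ ≤ C * Λ * ‖x - z‖) ∧
      ∀ x a, |mollify b q (x + a) - mollify b q x - fderiv ℝ (mollify b q) x a| ≤
        C * Λ * ‖a‖ ^ 2 := by
  obtain ⟨C, hC, H⟩ := exists_fderiv_mollify_sub_le ℝ b
  refine ⟨C, hC, fun q Λ hΛ hq => ?_⟩
  have hqc : Continuous q := continuous_of_lip (l := Λ) fun x y => hq x y
  have h1 : ∀ x z, ‖fderiv ℝ (mollify b q) x - fderiv ℝ (mollify b q) z‖ ≤ C * Λ * ‖x - z‖ := by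
    intro x z
    rw [mul_assoc]
    refine H q q hqc hqc x z _ fun y => ?_
    refine (hq _ _).trans ?_
    simp
  refine ⟨h1, fun x a => ?_⟩
  have := Convex.norm_image_sub_le_of_norm_fderiv_le' (𝕜 := ℝ) (f := mollify b q)
    (s := Metric.closedBall x ‖a‖) (x := x) (y := x + a) (φ := fderiv ℝ (mollify b q) x)
    (C := C * Λ * ‖a‖) (fun y _ => (contDiff_mollify b hqc).differentiable (by simp) y)
    (fun y hy => (h1 y x).trans ?_) (convex_closedBall _ _) (by simp) (by simp)
  · rw [Real.norm_eq_abs] at this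
    simp only [add_sub_cancel_left] at this
    linarith
  · rw [mem_closedBall_iff_norm] at hy
    gcongr

theorem norm_fderiv_mollify_le (b : ContDiffBump (0 : X)) {q : X → ℝ} {Λ : ℝ} (hΛ : 0 ≤ Λ)
    (hq : ∀ x y, |q x - q y| ≤ Λ * ‖x - y‖) (x : X) : ‖fderiv ℝ (mollify b q) x‖ ≤ Λ := by
  have hqc : Continuous q := continuous_of_lip (l := Λ) fun x y => hq x y
  have hL : LipschitzWith Λ.toNNReal (mollify b q) := by
    refine LipschitzWith.of_dist_le_mul fun x z => ?_
    rw [dist_eq_norm, dist_eq_norm, Real.coe_toNNReal _ hΛ]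
    refine norm_mollify_sub_le b hqc hqc fun y _ => ?_
    refine (hq _ _).trans ?_
    simp
  have := norm_fderiv_le_of_lipschitz ℝ hL (x₀ := x)
  rwa [Real.coe_toNNReal _ hΛ] at this

end Mollification


/-! ### The continuity equation tested with smooth functions and with transported functions -/

section Transport

variable {X : Type*} [NormedAddCommGroup X] [NormedSpace ℝ X] [FiniteDimensional ℝ X]
  [MeasurableSpace X] [BorelSpace X]

/-- A cutoff equal to `1` near the common carrier `K` turns any smooth function into an admissible
test function with the same values and derivatives on `K`. Its Lipschitz constant turns the `W₁`
bound into absolute continuity of the integrals. -/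
theorem SolvesContinuityEq.integral_eq {T : ℝ} {F : ℝ → X → X} {ν : ℝ → Measure X} {m : ℝ → ℝ}
    (hν : SolvesContinuityEq T F ν) (hm : IsL1Nonneg T m) (hW : W1Bound T m ν) {K : Set X}
    (hK : IsCompact K) (hνK : ∀ t ∈ Icc 0 T, ProbOn K (ν t)) {θ : X → ℝ} (hθ : ContDiff ℝ ∞ θ)
    {s t : ℝ} (hs : 0 ≤ s) (hst : s ≤ t) (ht : t ≤ T) :
    IntegrableOn (fun τ => ∫ x, fderiv ℝ θ x (F τ x) ∂(ν τ)) (Icc s t) ∧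
      ∫ τ in s..t, ∫ x, fderiv ℝ θ x (F τ x) ∂(ν τ) = ∫ x, θ x ∂(ν t) - ∫ x, θ x ∂(ν s) := by
  obtain ⟨R, hR0, hR⟩ := hK.isBounded.subset_ball_lt 0 0
  let χ : ContDiffBump (0 : X) := ⟨R, R + 1, hR0, by linarith⟩
  set ψ : X → ℝ := fun x => χ x * θ x with hψ
  have hψs : ContDiff ℝ ∞ ψ := χ.contDiff.mul hθ
  have hψc : HasCompactSupport ψ := χ.hasCompactSupport.mul_right
  have hψe : ∀ x ∈ K, ψ =ᶠ[𝓝 x] θ := by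
    intro x hx
    filter_upwards [Metric.isOpen_ball.mem_nhds (hR hx)] with y hy
    simp only [hψ]
    rw [χ.one_of_mem_closedBall (Metric.ball_subset_closedBall hy), one_mul]
  obtain ⟨L, hL⟩ := (hψs.of_le (by simp)).lipschitzWith_of_hasCompactSupport hψc
    one_ne_zero
  have hsub : Icc s t ⊆ Icc 0 T := Icc_subset_Icc hs ht
  have hi : ∀ τ ∈ Icc 0 T, ∫ x, ψ x ∂(ν τ) = ∫ x, θ x ∂(ν τ) := by
    intro τ hτ
    refine integral_congr_ae ?_
    filter_upwards [(hνK τ hτ).ae_mem] with x hx using (hψe x hx).eq_of_nhds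
  have hint : ∀ τ ∈ Icc 0 T, Integrable ψ (ν τ) := by
    intro τ hτ
    have := (hνK τ hτ).1
    exact (hψs.continuous).integrable_of_hasCompactSupport hψc
  have key := integral_eq_sub_of_bound (g := fun τ => ∫ x, ψ x ∂(ν τ)) (k := fun τ => (L : ℝ) * m τ)
    (g' := fun τ => ∫ x, fderiv ℝ θ x (F τ x) ∂(ν τ)) hst
    ((hm.1.mono_set hsub).const_mul _) ?_ ?_
  · refine ⟨key.1, key.2.trans ?_⟩
    simp only [hi t (hsub (right_mem_Icc.2 hst)), hi s (hsub (left_mem_Icc.2 hst))]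
  · intro a b ha hab hb
    have ha' : a ∈ Icc 0 T := hsub ⟨ha, hab.trans hb⟩
    have hb' : b ∈ Icc 0 T := hsub ⟨ha.trans hab, hb⟩
    have := (hνK a ha').1
    rw [norm_sub_rev, Real.norm_eq_abs, intervalIntegral.integral_const_mul]
    have := abs_integral_sub_le (hνK a ha').2 (hνK b hb').2 (hint a ha') (hint b hb') (a := 0)
      L.2 (fun x _ y _ => by simpa [Real.dist_eq] using hL.dist_le_mul x y)
      (intervalIntegral.integral_nonneg hab fun x _ => hm.2 x) (hW a b ha'.1 hab hb'.2)
    simpa using this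
  · have h1 := ae_restrict_of_ae_restrict_of_subset hsub (hν ψ hψs hψc)
    filter_upwards [h1, ae_restrict_mem measurableSet_Icc] with τ h1 hτ
    have e : ∫ x, fderiv ℝ θ x (F τ x) ∂(ν τ) = ∫ x, fderiv ℝ ψ x (F τ x) ∂(ν τ) := by
      refine integral_congr_ae ?_
      filter_upwards [(hνK τ (hsub hτ)).ae_mem] with x hx
      simp only [(hψe x hx).fderiv_eq]
    rw [e]
    exact h1

/-- Lipschitz and bounded Carathéodory fields. -/
structure IsLipField {X : Type*} [NormedAddCommGroup X] (T : ℝ) (w : ℝ → X → X) (l m : ℝ → ℝ) :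
    Prop where
  meas : ∀ x, AEStronglyMeasurable (fun t => w t x) (volume.restrict (Icc 0 T))
  l_nonneg : IsL1Nonneg T l
  m_nonneg : IsL1Nonneg T m
  lip : ∀ᵐ t ∂(volume.restrict (Icc 0 T)), ∀ x y, ‖w t x - w t y‖ ≤ l t * ‖x - y‖
  bound : ∀ᵐ t ∂(volume.restrict (Icc 0 T)), ∀ x, ‖w t x‖ ≤ m t

variable {T : ℝ} {w : ℝ → X → X} {l m : ℝ → ℝ}

theorem IsLipField.isCaratheodory (hw : IsLipField T w l m) :
    IsCaratheodory (volume.restrict (Icc 0 T)) w :=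
  ⟨hw.meas, hw.lip.mono fun _ h => continuous_of_lip h⟩

theorem IsLipField.isLocLipField (hw : IsLipField T w l m) : IsLocLipField T w := by
  refine ⟨hw.meas, fun R _ => ⟨l, hw.l_nonneg, hw.lip.mono fun t h x _ y _ => h x y⟩,
    ⟨m, hw.m_nonneg, hw.bound.mono fun t h x => (h x).trans ?_⟩⟩
  have := hw.m_nonneg.2 t
  nlinarith [norm_nonneg x]

theorem IsLipField.norm_odeFlow_sub_le (hw : IsLipField T w l m) {s t : ℝ} (hs : 0 ≤ s)
    (hst : s ≤ t) (ht : t ≤ T) (z : X) : ‖odeFlow T w s z t - z‖ ≤ ∫ τ in s..t, m τ := by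
  have hs' : s ∈ Icc 0 T := ⟨hs, hst.trans ht⟩
  have ht' : t ∈ Icc 0 T := ⟨hs.trans hst, ht⟩
  have h := hw.isLocLipField.odeFlow_spec hs' z
  rw [h.eq t ht', add_sub_cancel_left]
  have h2 := intervalIntegral_norm_le_abs (p := fun τ => w τ (odeFlow T w s z τ)) (g := m)
    (intervalIntegrable_sub hw.m_nonneg.1 hs' ht')
    (ae_restrict_of_ae_restrict_of_subset (uIcc_subset_Icc hs' ht')
      (hw.bound.mono fun τ hτ => hτ _))
  rwa [abs_of_nonneg (intervalIntegral.integral_nonneg hst fun x _ => hw.m_nonneg.2 x)] at h2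

/-- Comparison of the flow with the shifted average of the field. -/
theorem IsLipField.norm_odeFlow_sub_add_le (hw : IsLipField T w l m) {s t : ℝ} (hs : 0 ≤ s)
    (hst : s ≤ t) (ht : t ≤ T) (z y : X) :
    ‖odeFlow T w s (z - y) t - (z + (∫ τ in s..t, w τ z) - y)‖ ≤
      (∫ τ in s..t, l τ) * (‖y‖ + ∫ τ in s..t, m τ) := by
  have hs' : s ∈ Icc 0 T := ⟨hs, hst.trans ht⟩
  have ht' : t ∈ Icc 0 T := ⟨hs.trans hst, ht⟩
  have hsub := uIcc_subset_Icc hs' ht'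
  have h := hw.isLocLipField.odeFlow_spec hs' (z - y)
  have iz : IntegrableOn (fun τ => w τ z) (Icc 0 T) :=
    Integrable.mono' hw.m_nonneg.1 (hw.meas z) (hw.bound.mono fun t h => h z)
  have e : odeFlow T w s (z - y) t - (z + (∫ τ in s..t, w τ z) - y) =
      ∫ τ in s..t, (w τ (odeFlow T w s (z - y) τ) - w τ z) := by
    rw [h.eq t ht', intervalIntegral.integral_sub (intervalIntegrable_sub h.integrable hs' ht')
      (intervalIntegrable_sub iz hs' ht')]
    abel
  rw [e]
  have h2 := intervalIntegral_norm_le_abs (p := fun τ => w τ (odeFlow T w s (z - y) τ) - w τ z)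
    (g := fun τ => l τ * (‖y‖ + ∫ r in s..t, m r))
    ((intervalIntegrable_sub hw.l_nonneg.1 hs' ht').mul_const _) (by
      filter_upwards [ae_restrict_of_ae_restrict_of_subset hsub hw.lip,
        ae_restrict_mem measurableSet_uIcc] with τ h1 hτ
      refine (h1 _ _).trans (mul_le_mul_of_nonneg_left ?_ (hw.l_nonneg.2 τ))
      rw [uIcc_of_le hst] at hτ
      have h3 := hw.norm_odeFlow_sub_le hs hτ.1 (hτ.2.trans ht) (z - y)
      have h4 : ∫ r in s..τ, m r ≤ ∫ r in s..t, m r :=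
        intervalIntegral.integral_mono_interval le_rfl hτ.1 hτ.2
          (Eventually.of_forall hw.m_nonneg.2) (intervalIntegrable_sub hw.m_nonneg.1 hs' ht')
      have e5 : odeFlow T w s (z - y) τ - z = (odeFlow T w s (z - y) τ - (z - y)) + (-y) := by abel
      rw [e5]
      refine (norm_add_le _ _).trans ?_
      rw [norm_neg]
      linarith)
  rwa [intervalIntegral.integral_mul_const, abs_of_nonneg] at h2
  refine mul_nonneg (intervalIntegral.integral_nonneg hst fun x _ => hw.l_nonneg.2 x)
    (add_nonneg (norm_nonneg _) (intervalIntegral.integral_nonneg hst fun x _ => hw.m_nonneg.2 x))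

/-- Fubini for a Carathéodory integrand: the average displacement at first order equals the time
integral of the weak form of the transport term, with the measure frozen. -/
theorem IsLipField.integral_fderiv_swap (hw : IsLipField T w l m) {s t : ℝ} (hs : 0 ≤ s)
    (hst : s ≤ t) (ht : t ≤ T) (ρ : Measure X) [IsProbabilityMeasure ρ] {D : X → X →L[ℝ] ℝ}
    (hD : Continuous D) {Λ : ℝ} (hΛ : 0 ≤ Λ) (hDb : ∀ x, ‖D x‖ ≤ Λ) :
    ∫ z, D z (∫ τ in s..t, w τ z) ∂ρ = ∫ τ in s..t, ∫ z, D z (w τ z) ∂ρ ∧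
      IntegrableOn (fun τ => ∫ z, D z (w τ z) ∂ρ) (Icc 0 T) ∧
      Integrable (fun z => D z (∫ τ in s..t, w τ z)) ρ := by
  have hs' : s ∈ Icc 0 T := ⟨hs, hst.trans ht⟩
  have ht' : t ∈ Icc 0 T := ⟨hs.trans hst, ht⟩
  have iz : ∀ z, IntegrableOn (fun τ => w τ z) (Icc 0 T) := fun z =>
    Integrable.mono' hw.m_nonneg.1 (hw.meas z) (hw.bound.mono fun t h => h z)
  have hcar : IsCaratheodory (volume.restrict (Icc 0 T)) fun τ z => D z (w τ z) := by
    refine ⟨fun x => (D x).continuous.comp_aestronglyMeasurable (hw.meas x), ?_⟩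
    filter_upwards [hw.isCaratheodory.cont] with τ hτ using hD.clm_apply hτ
  have hbd : ∀ᵐ τ ∂(volume.restrict (Icc 0 T)), ∀ z, ‖D z (w τ z)‖ ≤ Λ * m τ := by
    filter_upwards [hw.bound] with τ hτ z
    refine ((D z).le_opNorm _).trans ?_
    exact mul_le_mul (hDb z) (hτ z) (norm_nonneg _) hΛ
  have hprod : Integrable (Function.uncurry fun τ z => D z (w τ z))
      ((volume.restrict (Icc 0 T)).prod ρ) := by
    refine Integrable.mono' (g := fun p => Λ * m p.1) ?_ (hcar.uncurry ρ) ?_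
    · exact (hw.m_nonneg.1.const_mul Λ).comp_fst ρ
    · have := Measure.quasiMeasurePreserving_fst (μ := volume.restrict (Icc 0 T)) (ν := ρ) |>.ae hbd
      filter_upwards [this] with p hp using hp _
  have hprod' : Integrable (Function.uncurry fun τ z => D z (w τ z))
      ((volume.restrict (Ioc s t)).prod ρ) := by
    refine hprod.mono_measure ?_
    exact Measure.prod_mono (Measure.restrict_mono
      (Ioc_subset_Icc_self.trans (Icc_subset_Icc hs ht)) le_rfl) le_rfl
  have e : ∀ z, D z (∫ τ in s..t, w τ z) = ∫ τ in Ioc s t, D z (w τ z) := by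
    intro z
    rw [← intervalIntegral.integral_of_le hst]
    exact ((D z).intervalIntegral_comp_comm (intervalIntegrable_sub (iz z) hs' ht')).symm
  refine ⟨?_, ?_, ?_⟩
  · rw [intervalIntegral.integral_of_le hst]
    simp_rw [e]
    exact integral_integral_swap (f := fun z τ => D z (w τ z)) hprod'.swap
  · exact hprod.integral_prod_left
  · simp_rw [e]
    exact hprod'.integral_prod_right

/-- One time step of the duality argument. -/
theorem SolvesContinuityEq.mollified_step {F : ℝ → X → X} {ν : ℝ → Measure X} {m₀ : ℝ → ℝ}
    (hν : SolvesContinuityEq T F ν) (hm₀ : IsL1Nonneg T m₀) (hW : W1Bound T m₀ ν) {K : Set X}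
    (hK : IsCompact K) (hνK : ∀ t ∈ Icc 0 T, ProbOn K (ν t))
    (hF : ∀ᵐ t ∂(volume.restrict (Icc 0 T)), AEStronglyMeasurable (F t) (ν t) ∧
      ∃ c, ∀ x ∈ K, ‖F t x‖ ≤ c)
    (hw : IsLipField T w l m) (b : ContDiffBump (0 : X)) {Λ : ℝ} (hΛ : 0 ≤ Λ) {C : ℝ} (hC : 0 ≤ C)
    {s t : ℝ} (hs : 0 ≤ s) (hst : s ≤ t) (ht : t ≤ T) {q : X → ℝ}
    (hq : ∀ x y, |q x - q y| ≤ Λ * ‖x - y‖)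
    (hC1 : ∀ x z, ‖fderiv ℝ (mollify b q) x - fderiv ℝ (mollify b q) z‖ ≤ C * Λ * ‖x - z‖)
    (hC2 : ∀ x a, |mollify b q (x + a) - mollify b q x - fderiv ℝ (mollify b q) x a| ≤
        C * Λ * ‖a‖ ^ 2) {e : ℝ → ℝ} (he : IsL1Nonneg T e)
    (hE : ∀ᵐ τ ∂(volume.restrict (Icc 0 T)),
      |∫ z, fderiv ℝ (mollify b q) z (F τ z - w τ z) ∂(ν τ)| ≤ e τ) :
    |∫ z, mollify b q z ∂(ν t) - ∫ z, mollify b (fun x => q (odeFlow T w s x t)) z ∂(ν s)| ≤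
      (∫ τ in s..t, (e τ + Λ * b.rOut * l τ)) +
        (2 * (C + 1) * Λ) * (∫ τ in s..t, (m₀ τ + (l τ + m τ))) ^ 2 := by
  have hs' : s ∈ Icc 0 T := ⟨hs, hst.trans ht⟩
  have ht' : t ∈ Icc 0 T := ⟨hs.trans hst, ht⟩
  have hsub : Icc s t ⊆ Icc 0 T := Icc_subset_Icc hs ht
  have := (hνK s hs').1
  have hl := hw.l_nonneg
  have hm := hw.m_nonneg
  have hqc : Continuous q := continuous_of_lip (l := Λ) fun x y => hq x y
  set θ := mollify b q with hθ
  have hθs : ContDiff ℝ ∞ θ := contDiff_mollify b hqc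
  have hDc : Continuous (fderiv ℝ θ) := hθs.continuous_fderiv (by simp)
  have hDb : ∀ x, ‖fderiv ℝ θ x‖ ≤ Λ := norm_fderiv_mollify_le b hΛ hq
  set D := fderiv ℝ θ with hD
  set δ := ∫ τ in s..t, m τ with hδ
  set lam := ∫ τ in s..t, l τ with hlam
  set δ₀ := ∫ τ in s..t, m₀ τ with hδ₀
  have hδn : 0 ≤ δ := intervalIntegral.integral_nonneg hst fun x _ => hm.2 x
  have hlamn : 0 ≤ lam := intervalIntegral.integral_nonneg hst fun x _ => hl.2 x
  have hδ₀n : 0 ≤ δ₀ := intervalIntegral.integral_nonneg hst fun x _ => hm₀.2 x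
  have hflow : Continuous fun x => odeFlow T w s x t := hw.isLocLipField.continuous_odeFlow hs' ht'
  set qs : X → ℝ := fun x => q (odeFlow T w s x t) with hqs
  have hqsc : Continuous qs := hqc.comp hflow
  set a : X → X := fun z => ∫ τ in s..t, w τ z with ha
  have ha_le : ∀ z, ‖a z‖ ≤ δ := by
    intro z
    have h2 := intervalIntegral_norm_le_abs (p := fun τ => w τ z) (g := m)
      (intervalIntegrable_sub hm.1 hs' ht')
      (ae_restrict_of_ae_restrict_of_subset (uIcc_subset_Icc hs' ht')
        (hw.bound.mono fun τ hτ => hτ _))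
    rwa [abs_of_nonneg hδn] at h2
  -- comparison of the mollified transported function with the Taylor expansion
  have hpt : ∀ z, |mollify b qs z - θ z - D z (a z)| ≤
      Λ * (lam * (b.rOut + δ)) + C * Λ * δ ^ 2 := by
    intro z
    -- Mollification does not commute with the flow. The commutator costs `Λ * lam * b.rOut`, which
    -- is of first order in the time step and becomes small only with the radius of the bump; the
    -- remaining part is of second order.
    have h1 : ‖mollify b qs z - θ (z + a z)‖ ≤ Λ * (lam * (b.rOut + δ)) := by
      refine norm_mollify_sub_le b hqsc hqc fun y hy => ?_
      refine (hq _ _).trans (mul_le_mul_of_nonneg_left ?_ hΛ)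
      refine (hw.norm_odeFlow_sub_add_le hs hst ht z y).trans ?_
      rw [mem_closedBall_zero_iff] at hy
      gcongr
    have h2 := hC2 z (a z)
    have h3 : C * Λ * ‖a z‖ ^ 2 ≤ C * Λ * δ ^ 2 := by
      have := ha_le z
      gcongr
    rw [Real.norm_eq_abs] at h1
    have e1 : mollify b qs z - θ z - D z (a z) =
        (mollify b qs z - θ (z + a z)) + (θ (z + a z) - θ z - D z (a z)) := by ring
    rw [e1]
    exact (abs_add_le _ _).trans (add_le_add h1 (h2.trans h3))
  obtain ⟨hsw, hswi, hai⟩ := hw.integral_fderiv_swap hs hst ht (ν s) hDc hΛ hDb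
  obtain ⟨hci, hce⟩ := hν.integral_eq hm₀ hW hK hνK hθs hs hst ht
  have hint : ∀ g : X → ℝ, Continuous g → ∀ τ ∈ Icc 0 T, Integrable g (ν τ) := by
    intro g hg τ hτ
    obtain ⟨B, hB⟩ := hK.exists_bound_of_continuousOn hg.continuousOn
    exact (hνK τ hτ).integrable_of_bound
      ((hνK τ hτ).aestronglyMeasurable hK.measurableSet hg.continuousOn) hB
  have hqsm : Continuous (mollify b qs) := (contDiff_mollify b hqsc).continuous
  have hB : |∫ z, mollify b qs z ∂(ν s) - ∫ z, θ z ∂(ν s) - ∫ τ in s..t, ∫ z, D z (w τ z) ∂(ν s)| ≤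
      Λ * (lam * (b.rOut + δ)) + C * Λ * δ ^ 2 := by
    have i0 : Integrable (fun z => mollify b qs z - θ z) (ν s) :=
      (hint _ hqsm s hs').sub (hint _ hθs.continuous s hs')
    rw [← hsw, ← integral_sub (hint _ hqsm s hs') (hint _ hθs.continuous s hs'),
      ← integral_sub i0 hai, ← Real.norm_eq_abs]
    exact (hνK s hs').norm_integral_le fun z _ => hpt z
  -- Replacing `ν τ` by `ν s` costs the Lipschitz constant of `z ↦ D z (w τ z)` times their `W₁`
  -- distance, hence at most `δ₀`; after integration in `τ` this is of second order.
  have hstep : ∀ᵐ τ ∂(volume.restrict (Icc s t)),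
      ‖(∫ x, D x (F τ x) ∂(ν τ)) - ∫ z, D z (w τ z) ∂(ν s)‖ ≤
        e τ + (C * Λ * m τ + Λ * l τ) * δ₀ := by
    filter_upwards [ae_restrict_of_ae_restrict_of_subset hsub hE,
      ae_restrict_of_ae_restrict_of_subset hsub hF, ae_restrict_of_ae_restrict_of_subset hsub hw.lip,
      ae_restrict_of_ae_restrict_of_subset hsub hw.bound,
      ae_restrict_mem measurableSet_Icc] with τ h1 h2 h3 h4 hτ
    have hτ' := hsub hτ
    have hwc : Continuous (w τ) := continuous_of_lip h3
    have hDw : Continuous fun z => D z (w τ z) := hDc.clm_apply hwc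
    obtain ⟨hFm, c, hc⟩ := h2
    have hc0 : 0 ≤ c := by
      obtain ⟨x, hx⟩ := (hνK τ hτ').nonempty
      exact (norm_nonneg _).trans (hc x hx)
    have iF : Integrable (fun z => D z (F τ z)) (ν τ) := by
      refine (hνK τ hτ').integrable_of_bound (c := Λ * c) ?_ fun x hx => ?_
      · exact isBoundedBilinearMap_apply.continuous.comp_aestronglyMeasurable
          (hDc.aestronglyMeasurable.prodMk hFm)
      · refine ((D x).le_opNorm _).trans ?_
        exact mul_le_mul (hDb x) (hc x hx) (norm_nonneg _) hΛ
    have e1 : ∫ z, D z (F τ z - w τ z) ∂(ν τ) = (∫ z, D z (F τ z) ∂(ν τ)) - ∫ z, D z (w τ z) ∂(ν τ) := by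
      rw [← integral_sub iF (hint _ hDw τ hτ')]
      simp only [map_sub]
    have hp := (hνK τ hτ').1
    have e2 : |∫ z, D z (w τ z) ∂(ν s) - ∫ z, D z (w τ z) ∂(ν τ)| ≤
        0 + (C * Λ * m τ + Λ * l τ) * ∫ r in s..τ, m₀ r := by
      have hmτ := hm.2 τ
      have hlτ := hl.2 τ
      refine abs_integral_sub_le (hνK s hs').2 (hνK τ hτ').2 (hint _ hDw s hs') (hint _ hDw τ hτ')
        (by positivity) (fun x _ y _ => ?_)
        (intervalIntegral.integral_nonneg hτ.1 fun x _ => hm₀.2 x) (hW s τ hs hτ.1 hτ'.2)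
      have e3 : D x (w τ x) - D y (w τ y) = (D x - D y) (w τ x) + D y (w τ x - w τ y) := by
        simp
      rw [e3, zero_add, dist_eq_norm]
      have i1 : |(D x - D y) (w τ x)| ≤ (C * Λ * ‖x - y‖) * m τ := by
        rw [← Real.norm_eq_abs]
        refine ((D x - D y).le_opNorm _).trans ?_
        exact mul_le_mul (hC1 x y) (h4 x) (norm_nonneg _) (by positivity)
      have i2 : |D y (w τ x - w τ y)| ≤ Λ * (l τ * ‖x - y‖) := by
        rw [← Real.norm_eq_abs]
        refine ((D y).le_opNorm _).trans ?_
        exact mul_le_mul (hDb y) (h3 x y) (norm_nonneg _) hΛ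
      refine (abs_add_le _ _).trans ?_
      linarith
    have e4 : ∫ r in s..τ, m₀ r ≤ δ₀ :=
      intervalIntegral.integral_mono_interval le_rfl hτ.1 hτ.2
        (Eventually.of_forall hm₀.2) (intervalIntegrable_sub hm₀.1 hs' ht')
    have e5 : (C * Λ * m τ + Λ * l τ) * ∫ r in s..τ, m₀ r ≤ (C * Λ * m τ + Λ * l τ) * δ₀ := by
      have hmτ := hm.2 τ
      have hlτ := hl.2 τ
      gcongr
    rw [e1] at h1
    rw [Real.norm_eq_abs]
    have := abs_sub_le (∫ x, D x (F τ x) ∂(ν τ)) (∫ z, D z (w τ z) ∂(ν τ)) (∫ z, D z (w τ z) ∂(ν s))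
    rw [abs_sub_comm (∫ z, D z (w τ z) ∂(ν τ)) (∫ z, D z (w τ z) ∂(ν s))] at this
    linarith
  have hA : |(∫ τ in s..t, ∫ x, D x (F τ x) ∂(ν τ)) - ∫ τ in s..t, ∫ z, D z (w τ z) ∂(ν s)| ≤
      (∫ τ in s..t, e τ) + (C * Λ * δ + Λ * lam) * δ₀ := by
    rw [← intervalIntegral.integral_sub
      (intervalIntegrable_sub hci (left_mem_Icc.2 hst) (right_mem_Icc.2 hst))
      (intervalIntegrable_sub hswi hs' ht'), ← Real.norm_eq_abs]
    have ie := intervalIntegrable_sub he.1 hs' ht'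
    have il := intervalIntegrable_sub hl.1 hs' ht'
    have im := intervalIntegrable_sub hm.1 hs' ht'
    have i3 : IntervalIntegrable (fun τ => (C * Λ * m τ + Λ * l τ) * δ₀) volume s t :=
      ((im.const_mul _).add (il.const_mul _)).mul_const _
    have := intervalIntegral_norm_le_abs (g := fun τ => e τ + (C * Λ * m τ + Λ * l τ) * δ₀)
      (ie.add i3) (by rwa [uIcc_of_le hst])
    refine this.trans_eq ?_
    rw [intervalIntegral.integral_add ie i3, intervalIntegral.integral_mul_const,
      intervalIntegral.integral_add (im.const_mul _) (il.const_mul _),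
      intervalIntegral.integral_const_mul, intervalIntegral.integral_const_mul, abs_of_nonneg]
    have := intervalIntegral.integral_nonneg (μ := volume) hst fun x _ => he.2 x
    positivity
  have hsum : ∫ τ in s..t, (m₀ τ + (l τ + m τ)) = δ₀ + (lam + δ) := by
    rw [intervalIntegral.integral_add (intervalIntegrable_sub hm₀.1 hs' ht')
      (intervalIntegrable_sub (hl.add hm).1 hs' ht'),
      intervalIntegral.integral_add (intervalIntegrable_sub hl.1 hs' ht')
      (intervalIntegrable_sub hm.1 hs' ht')]
  have hsum2 : ∫ τ in s..t, (e τ + Λ * b.rOut * l τ) = (∫ τ in s..t, e τ) + Λ * b.rOut * lam := by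
    rw [intervalIntegral.integral_add (intervalIntegrable_sub he.1 hs' ht')
      ((intervalIntegrable_sub hl.1 hs' ht').const_mul _), intervalIntegral.integral_const_mul]
  rw [hsum, hsum2]
  have hfin : ∫ z, θ z ∂(ν t) - ∫ z, mollify b qs z ∂(ν s) =
      ((∫ τ in s..t, ∫ x, D x (F τ x) ∂(ν τ)) - ∫ τ in s..t, ∫ z, D z (w τ z) ∂(ν s)) -
      (∫ z, mollify b qs z ∂(ν s) - ∫ z, θ z ∂(ν s) - ∫ τ in s..t, ∫ z, D z (w τ z) ∂(ν s)) := by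
    rw [hce]; ring
  rw [hfin]
  -- Apart from the integral of `e` and the commutator term, only products of two of the integrals
  -- of `m₀`, `l`, `m` remain, and they are absorbed by the square of the sum.
  refine (abs_sub _ _).trans ((add_le_add hA hB).trans ?_)
  have hb0 := b.rOut_pos
  have p1 : 0 ≤ Λ * (lam * δ₀) := by positivity
  have p2 : 0 ≤ Λ * (δ * δ₀) := by positivity
  have p3 : 0 ≤ Λ * (δ * lam) := by positivity
  have p4 : 0 ≤ C * Λ * (δ * δ₀) := by positivity
  have p5 : 0 ≤ C * Λ * (lam * δ₀) := by positivity
  have p6 : 0 ≤ C * Λ * (lam * δ) := by positivity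
  have p7 : 0 ≤ (C + 1) * Λ * (δ ^ 2) := by positivity
  have p8 : 0 ≤ (C + 1) * Λ * (δ₀ ^ 2) := by positivity
  have p9 : 0 ≤ (C + 1) * Λ * (lam ^ 2) := by positivity
  have p10 : 0 ≤ Λ * δ ^ 2 := by positivity
  nlinarith

end Transport


/-! ### Duality with transported test functions -/

section Ext

/-- Bounded Lipschitz functions detect weak convergence; apply this to a constant sequence and use
uniqueness of limits. -/
theorem ext_of_forall_lipschitz {Ω : Type*} [MeasurableSpace Ω] [PseudoMetricSpace Ω]
    [BorelSpace Ω] {ρ₁ ρ₂ : Measure Ω} [h₁ : IsProbabilityMeasure ρ₁]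
    [h₂ : IsProbabilityMeasure ρ₂]
    (h : ∀ f : Ω → ℝ, (∃ C, ∀ x, |f x| ≤ C) → (∃ L, LipschitzWith L f) →
      ∫ x, f x ∂ρ₁ = ∫ x, f x ∂ρ₂) : ρ₁ = ρ₂ := by
  let P₁ : ProbabilityMeasure Ω := ⟨ρ₁, h₁⟩
  let P₂ : ProbabilityMeasure Ω := ⟨ρ₂, h₂⟩
  have : Tendsto (fun _ : ℕ => P₁) atTop (𝓝 P₂) := by
    rw [tendsto_iff_forall_lipschitz_integral_tendsto]
    rintro f ⟨C, hC⟩ hL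
    have hΩ : Nonempty Ω := nonempty_of_isProbabilityMeasure ρ₁
    obtain ⟨x₀⟩ := hΩ
    have := h f ⟨C + |f x₀|, fun x => ?_⟩ hL
    · change Tendsto (fun _ : ℕ => ∫ x, f x ∂ρ₁) atTop (𝓝 (∫ x, f x ∂ρ₂))
      rw [this]
      exact tendsto_const_nhds
    · have h3 := hC x x₀
      rw [Real.dist_eq] at h3
      have := abs_sub_abs_le_abs_sub (f x) (f x₀)
      linarith
  have h4 := tendsto_nhds_unique this tendsto_const_nhds
  exact (congrArg Subtype.val h4).symm

end Ext

section Transport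

variable {X : Type*} [NormedAddCommGroup X] [NormedSpace ℝ X] [FiniteDimensional ℝ X]
  [MeasurableSpace X] [BorelSpace X]

/-- Convolution preserves Lipschitz bounds direction by direction. This keeps the good bound in the
costate direction apart from the bad one in the state direction. -/
theorem abs_fderiv_mollify_le_of_line (b : ContDiffBump (0 : X)) {q : X → ℝ} (hq : Continuous q)
    {a : X} {c : ℝ} (hc : 0 ≤ c) (h : ∀ z (s : ℝ), |q (z + s • a) - q z| ≤ c * |s|) (z : X) :
    |fderiv ℝ (mollify b q) z a| ≤ c := by
  have hd : DifferentiableAt ℝ (mollify b q) z :=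
    (contDiff_mollify b hq).differentiable (by simp) z
  have hline : HasDerivAt (fun s : ℝ => mollify b q (z + s • a)) (fderiv ℝ (mollify b q) z a) 0 := by
    have h1 : HasDerivAt (fun s : ℝ => z + s • a) a 0 := by
      simpa using ((hasDerivAt_id (0 : ℝ)).smul_const a).const_add z
    have h2 : HasFDerivAt (mollify b q) (fderiv ℝ (mollify b q) z) (z + (0 : ℝ) • a) := by
      simpa using hd.hasFDerivAt
    exact h2.comp_hasDerivAt (0 : ℝ) h1
  refine hline.le_of_lip' hc (Eventually.of_forall fun s => ?_)
  simp only [zero_smul, add_zero, sub_zero, Real.norm_eq_abs s]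
  refine norm_mollify_sub_le b hq hq fun y _ => ?_
  have := h (z - y) s
  rwa [show z - y + s • a = z + s • a - y by abel] at this

/-- If `w` were the true field, `∫ q_t dν(t)` would be constant for `q_t` equal to `ψ` composed with
the flow from `t` to `t₀`. In general its variation is driven by the difference of the fields,
tested with the derivative of `q_t`. As `q_t` is only Lipschitz, everything is done for
mollifications, at an error vanishing with their radius. -/
theorem SolvesContinuityEq.abs_integral_flow_sub_le {T : ℝ} {w F : ℝ → X → X} {l m : ℝ → ℝ}
    {ν : ℝ → Measure X} {m₀ : ℝ → ℝ}
    (hν : SolvesContinuityEq T F ν) (hm₀ : IsL1Nonneg T m₀) (hW : W1Bound T m₀ ν) {K : Set X}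
    (hK : IsCompact K) (hνK : ∀ t ∈ Icc 0 T, ProbOn K (ν t))
    (hF : ∀ᵐ t ∂(volume.restrict (Icc 0 T)), AEStronglyMeasurable (F t) (ν t) ∧
      ∃ c, ∀ x ∈ K, ‖F t x‖ ≤ c)
    (hw : IsLipField T w l m) {ψ : X → ℝ} {L : ℝ} (hL : 0 ≤ L)
    (hψ : ∀ x y, |ψ x - ψ y| ≤ L * ‖x - y‖) {t₀ : ℝ} (ht₀ : t₀ ∈ Icc 0 T) {e : ℝ → ℝ}
    (he : IsL1Nonneg T e)
    (hE : ∀ b : ContDiffBump (0 : X), ∀ t ∈ Icc t₀ T, ∀ᵐ τ ∂(volume.restrict (Icc 0 T)),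
      |∫ z, fderiv ℝ (mollify b fun x => ψ (odeFlow T w t x t₀)) z (F τ z - w τ z) ∂(ν τ)| ≤ e τ) :
    |∫ z, ψ (odeFlow T w T z t₀) ∂(ν T) - ∫ z, ψ z ∂(ν t₀)| ≤ ∫ τ in t₀..T, e τ := by
  have hT : 0 ≤ T := ht₀.1.trans ht₀.2
  have hT' : T ∈ Icc 0 T := right_mem_Icc.2 hT
  have hl := hw.l_nonneg
  set Λ := L * (2 * Real.exp (2 * ∫ s in 0..T, l s)) with hΛ
  have hΛ0 : 0 ≤ Λ := by positivity
  set q : ℝ → X → ℝ := fun t x => ψ (odeFlow T w t x t₀) with hq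
  have hqL : ∀ t ∈ Icc 0 T, ∀ x y, |q t x - q t y| ≤ Λ * ‖x - y‖ := by
    intro t ht x y
    refine (hψ _ _).trans ?_
    rw [hΛ, mul_assoc]
    refine mul_le_mul_of_nonneg_left ?_ hL
    exact (hw.isLocLipField.odeFlow_spec ht x).norm_sub_le (hw.isLocLipField.odeFlow_spec ht y) ht
      ht₀ hl (K := univ) (fun _ _ => mem_univ _) (fun _ _ => mem_univ _)
      (hw.lip.mono fun s h x _ y _ => h x y)
  have hqc : ∀ t ∈ Icc 0 T, Continuous (q t) := fun t ht =>
    continuous_of_lip (l := Λ) fun x y => hqL t ht x y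
  have hint : ∀ g : X → ℝ, Continuous g → ∀ τ ∈ Icc 0 T, Integrable g (ν τ) := by
    intro g hg τ hτ
    obtain ⟨B, hB⟩ := hK.exists_bound_of_continuousOn hg.continuousOn
    exact (hνK τ hτ).integrable_of_bound
      ((hνK τ hτ).aestronglyMeasurable hK.measurableSet hg.continuousOn) hB
  have hq0 : ∫ z, q t₀ z ∂(ν t₀) = ∫ z, ψ z ∂(ν t₀) := by
    simp only [hq, hw.isLocLipField.odeFlow_self ht₀]
  have hsub : Icc t₀ T ⊆ Icc 0 T := Icc_subset_Icc ht₀.1 le_rfl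
  have hll : 0 ≤ ∫ τ in t₀..T, l τ := intervalIntegral.integral_nonneg ht₀.2 fun x _ => hl.2 x
  refine le_of_forall_pos_le_add fun ε hε => ?_
  -- Both endpoint errors are at most `Λ * δ` and the commutators add up to `Λ * δ * ∫ l`; this
  -- radius makes their total at most `ε`.
  set δ := ε / (Λ * ((∫ τ in t₀..T, l τ) + 2) + 1) with hδ
  have hδ0 : 0 < δ := by positivity
  let b : ContDiffBump (0 : X) := ⟨δ / 2, δ, by positivity, by linarith⟩
  obtain ⟨C, hC, hCb⟩ := exists_mollify_taylor b
  have key := abs_sub_le_of_quadratic_bound (a := t₀) (b := T)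
    (g := fun t => ∫ z, mollify b (q t) z ∂(ν t)) (k := fun τ => e τ + Λ * b.rOut * l τ)
    (K := fun τ => m₀ τ + (l τ + m τ)) (C := 2 * (C + 1) * Λ) ht₀.2
    (((he.1.add (hl.1.const_mul _))).mono_set hsub)
    ((hm₀.1.add (hl.1.add hw.m_nonneg.1)).mono_set hsub)
    (fun t => add_nonneg (hm₀.2 t) (add_nonneg (hl.2 t) (hw.m_nonneg.2 t))) (by
      intro s t hs hst ht
      have hs' : s ∈ Icc 0 T := ⟨ht₀.1.trans hs, hst.trans ht⟩
      have ht' : t ∈ Icc 0 T := ⟨hs'.1.trans hst, ht⟩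
      have := hν.mollified_step hm₀ hW hK hνK hF hw b hΛ0 hC hs'.1 hst ht (hqL t ht')
        (hCb _ _ hΛ0 (hqL t ht')).1 (hCb _ _ hΛ0 (hqL t ht')).2 he (hE b t ⟨hs.trans hst, ht⟩)
      -- By the semigroup property, transporting `q t` back to time `s` gives `q s`, so one-step
      -- estimates are increments of a single function of time.
      have e1 : (fun x => q t (odeFlow T w s x t)) = q s := by
        ext x
        simp only [hq, hw.isLocLipField.odeFlow_odeFlow hs' ht' ht₀]
      rwa [e1] at this)
  have hclose : ∀ t ∈ Icc 0 T, |∫ z, mollify b (q t) z ∂(ν t) - ∫ z, q t z ∂(ν t)| ≤ Λ * δ := by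
    intro t ht
    rw [← integral_sub (hint _ (contDiff_mollify b (hqc t ht)).continuous t ht)
      (hint _ (hqc t ht) t ht), ← Real.norm_eq_abs]
    refine (hνK t ht).norm_integral_le fun z _ => norm_mollify_sub_self_le b (hqc t ht) fun y hy => ?_
    refine (hqL t ht _ _).trans ?_
    rw [mem_closedBall_zero_iff] at hy
    rw [sub_sub_cancel_left, norm_neg]
    exact mul_le_mul_of_nonneg_left hy hΛ0
  have h1 := hclose T hT'
  have h2 := hclose t₀ ht₀
  rw [hq0] at h2
  rw [intervalIntegral.integral_add (intervalIntegrable_sub he.1 ht₀ hT')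
    ((intervalIntegrable_sub hl.1 ht₀ hT').const_mul _), intervalIntegral.integral_const_mul] at key
  have h3 : Λ * δ * ((∫ τ in t₀..T, l τ) + 2) ≤ ε := by
    rw [hδ]
    rw [show Λ * (ε / (Λ * ((∫ τ in t₀..T, l τ) + 2) + 1)) * ((∫ τ in t₀..T, l τ) + 2) =
      ε * (Λ * ((∫ τ in t₀..T, l τ) + 2) / (Λ * ((∫ τ in t₀..T, l τ) + 2) + 1)) by ring]
    refine mul_le_of_le_one_right hε.le ?_
    rw [div_le_one (by positivity)]
    linarith
  have hb : b.rOut = δ := rfl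
  rw [hb] at key
  rw [abs_le] at *
  constructor <;> nlinarith [key.1, key.2, h1.1, h1.2, h2.1, h2.2]

end Transport


/-! ### Triangular fields, merely continuous in the state in the costate component -/

section Triangular

variable {E : Type*} [NormedAddCommGroup E] [NormedSpace ℝ E] [FiniteDimensional ℝ E]
  [MeasurableSpace E] [BorelSpace E]

/-- Mollification in the first variable. -/
noncomputable def mollifyFst (b : ContDiffBump (0 : E)) (g : E × E → E) (z : E × E) : E :=
  mollify b (fun x => g (x, z.2)) z.1

theorem norm_mollifyFst_le (b : ContDiffBump (0 : E)) {g : E × E → E} (hg : Continuous g) {M : ℝ}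
    (hM : ∀ z, ‖g z‖ ≤ M) (z : E × E) : ‖mollifyFst b g z‖ ≤ M :=
  norm_mollify_le b (by fun_prop) fun _ => hM _

theorem norm_mollifyFst_sub_le_snd (b : ContDiffBump (0 : E)) {g : E × E → E} (hg : Continuous g)
    {κ : ℝ} (hκ : ∀ x r r', ‖g (x, r) - g (x, r')‖ ≤ κ * ‖r - r'‖) (x r r' : E) :
    ‖mollifyFst b g (x, r) - mollifyFst b g (x, r')‖ ≤ κ * ‖r - r'‖ :=
  norm_mollify_sub_le b (by fun_prop) (by fun_prop) fun _ _ => hκ _ _ _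

/-- Smoothing in the first variable yields a Lipschitz constant depending on the bump in that
variable, and leaves the constant `κ` of the second variable unchanged. -/
theorem exists_mollifyFst_lipschitz (b : ContDiffBump (0 : E)) :
    ∃ C, 0 ≤ C ∧ ∀ (g : E × E → E) (M κ : ℝ), Continuous g → (∀ z, ‖g z‖ ≤ M) → 0 ≤ M → 0 ≤ κ →
      (∀ x r r', ‖g (x, r) - g (x, r')‖ ≤ κ * ‖r - r'‖) →
      ∀ z z', ‖mollifyFst b g z - mollifyFst b g z'‖ ≤ (C * M + κ) * ‖z - z'‖ := by
  obtain ⟨C, hC, h⟩ := exists_mollify_lipschitz_of_bounded E b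
  refine ⟨C, hC, fun g M κ hg hM hM0 hκ0 hκ z z' => ?_⟩
  have h1 : ‖mollifyFst b g (z.1, z.2) - mollifyFst b g (z'.1, z.2)‖ ≤ C * M * ‖z.1 - z'.1‖ :=
    h (fun x => g (x, z.2)) (by fun_prop) M (fun _ => hM _) _ _
  have h2 := norm_mollifyFst_sub_le_snd b hg hκ z'.1 z.2 z'.2
  have h3 : ‖z.1 - z'.1‖ ≤ ‖z - z'‖ := norm_fst_le (z - z')
  have h4 : ‖z.2 - z'.2‖ ≤ ‖z - z'‖ := norm_snd_le (z - z')
  have h5 := norm_sub_le_norm_sub_add_norm_sub (mollifyFst b g z) (mollifyFst b g (z'.1, z.2))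
    (mollifyFst b g z')
  have h6 := mul_le_mul_of_nonneg_left h3 (mul_nonneg hC hM0)
  have h7 := mul_le_mul_of_nonneg_left h4 hκ0
  calc _ ≤ _ := h5
    _ ≤ C * M * ‖z.1 - z'.1‖ + κ * ‖z.2 - z'.2‖ := add_le_add h1 h2
    _ ≤ (C * M + κ) * ‖z - z'‖ := by linarith

theorem IsCaratheodory.mollifyFst {α : Type*} [MeasurableSpace α] {P : Measure α}
    {G : α → E × E → E} (hG : IsCaratheodory P G) (b : ContDiffBump (0 : E)) {M κ : α → ℝ}
    (hM : ∀ᵐ t ∂P, ∀ z, ‖G t z‖ ≤ M t) (hM0 : ∀ t, 0 ≤ M t) (hκ0 : ∀ t, 0 ≤ κ t)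
    (hκ : ∀ᵐ t ∂P, ∀ x r r', ‖G t (x, r) - G t (x, r')‖ ≤ κ t * ‖r - r'‖) :
    IsCaratheodory P fun t => mollifyFst b (G t) := by
  refine ⟨fun z => ?_, ?_⟩
  · have h1 : IsCaratheodory P fun t y => b.normed Measure.addHaar y • G t (z.1 - y, z.2) := by
      refine ⟨fun y => (hG.meas _).const_smul _, ?_⟩
      filter_upwards [hG.cont] with t ht
      exact b.continuous_normed.smul (by fun_prop)
    -- Haar measure need not be finite, but the bump vanishes outside its ball, so it may be
    -- restricted to that ball.
    have : IsFiniteMeasure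
        ((Measure.addHaar : Measure E).restrict (Metric.closedBall (0 : E) b.rOut)) :=
      ⟨by rw [Measure.restrict_apply_univ]; exact (isCompact_closedBall _ _).measure_lt_top⟩
    have h2 := h1.integral (Measure.addHaar.restrict (Metric.closedBall (0 : E) b.rOut))
    refine h2.congr (Eventually.of_forall fun t => ?_)
    refine setIntegral_eq_integral_of_forall_compl_eq_zero fun y hy => ?_
    have : b.normed Measure.addHaar y = 0 := by
      rw [← Function.notMem_support, b.support_normed_eq]
      exact fun h => hy (Metric.ball_subset_closedBall h)
    rw [this, zero_smul]
  · obtain ⟨C, hC, h⟩ := exists_mollifyFst_lipschitz b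
    filter_upwards [hG.cont, hM, hκ] with t h1 h2 h3
    exact continuous_of_lip (h (G t) (M t) (κ t) h1 h2 (hM0 t) (hκ0 t) h3)

theorem tendsto_mollifyFst {b : ℕ → ContDiffBump (0 : E)}
    (hb : Tendsto (fun k => (b k).rOut) atTop (𝓝 0)) {g : E × E → E} (hg : Continuous g)
    (z : E × E) : Tendsto (fun k => mollifyFst (b k) g z) atTop (𝓝 (g z)) := by
  rw [Metric.tendsto_nhds]
  intro ε hε
  have hc : Continuous fun y : E => g (z.1 - y, z.2) := by fun_prop
  have h0 : Tendsto (fun y : E => g (z.1 - y, z.2)) (𝓝 0) (𝓝 (g z)) := by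
    simpa using hc.tendsto (0 : E)
  obtain ⟨δ, hδ, hball⟩ := Metric.tendsto_nhds_nhds.1 h0 (ε / 2) (by positivity)
  filter_upwards [hb.eventually (gt_mem_nhds hδ)] with k hk
  rw [dist_eq_norm]
  refine lt_of_le_of_lt ?_ (half_lt_self hε)
  refine norm_mollify_sub_self_le (b k) (g := fun x => g (x, z.2)) (by fun_prop) fun y hy => ?_
  have := hball (x := y) (lt_of_le_of_lt (Metric.mem_closedBall.1 hy) hk)
  rw [dist_eq_norm] at this
  exact this.le

variable {T : ℝ} {V : ℝ → E → E} {H H' : ℝ → E × E → E} {τ t : ℝ} {x r r' : E} {Z Z' : ℝ → E × E}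

theorem SolvesODE.fst (hZ : SolvesODE T (fun t z => (V t z.1, H t z)) τ (x, r) Z)
    (hτ : τ ∈ Icc 0 T) : SolvesODE T V τ x (fun t => (Z t).1) := by
  refine ⟨(ContinuousLinearMap.fst ℝ E E).integrable_comp hZ.integrable, fun t ht => ?_⟩
  have := congrArg Prod.fst (hZ.eq t ht)
  rw [this, Prod.fst_add]
  congr 1
  exact ((ContinuousLinearMap.fst ℝ E E).intervalIntegral_comp_comm
    (intervalIntegrable_sub hZ.integrable hτ ht)).symm

theorem SolvesODE.snd_eq (hZ : SolvesODE T (fun t z => (V t z.1, H t z)) τ (x, r) Z)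
    (hτ : τ ∈ Icc 0 T) : IntegrableOn (fun s => H s (Z s)) (Icc 0 T) ∧
      ∀ t ∈ Icc 0 T, (Z t).2 = r + ∫ s in τ..t, H s (Z s) := by
  refine ⟨(ContinuousLinearMap.snd ℝ E E).integrable_comp hZ.integrable, fun t ht => ?_⟩
  have := congrArg Prod.snd (hZ.eq t ht)
  rw [this, Prod.snd_add]
  congr 1
  exact ((ContinuousLinearMap.snd ℝ E E).intervalIntegral_comp_comm
    (intervalIntegrable_sub hZ.integrable hτ ht)).symm

theorem SolvesODE.norm_snd_sub_le (hZ : SolvesODE T (fun t z => (V t z.1, H t z)) τ (x, r) Z)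
    (hZ' : SolvesODE T (fun t z => (V t z.1, H' t z)) τ (x, r') Z') (hτ : τ ∈ Icc 0 T)
    (ht : t ∈ Icc 0 T) {κ e : ℝ → ℝ} (hκ : IsL1Nonneg T κ) (he : IsL1Nonneg T e)
    (h : ∀ᵐ s ∂(volume.restrict (Icc 0 T)),
      ‖H s (Z s) - H' s (Z' s)‖ ≤ κ s * ‖(Z s).2 - (Z' s).2‖ + e s) :
    ‖(Z t).2 - (Z' t).2‖ ≤
      2 * (‖r - r'‖ + |∫ s in τ..t, e s|) * Real.exp (2 * |∫ s in τ..t, κ s|) :=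
  norm_sub_le_of_integral_eq hτ ht (hZ.snd_eq hτ).1 (hZ'.snd_eq hτ).1 (hZ.snd_eq hτ).2
    (hZ'.snd_eq hτ).2 hκ he h

/-- With the same initial state, uniqueness for `V` makes the first components coincide. So the
second components need to be compared only at equal states, where no regularity in `x` is required.
-/
theorem SolvesODE.norm_sub_le_of_triangular
    (hZ : SolvesODE T (fun t z => (V t z.1, H t z)) τ (x, r) Z)
    (hZ' : SolvesODE T (fun t z => (V t z.1, H' t z)) τ (x, r') Z') (hV : IsLocLipField T V)
    (hτ : τ ∈ Icc 0 T) (ht : t ∈ Icc 0 T) {κ e : ℝ → ℝ} (hκ : IsL1Nonneg T κ)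
    (he : IsL1Nonneg T e)
    (h : ∀ᵐ s ∂(volume.restrict (Icc 0 T)), (Z s).1 = (Z' s).1 →
      ‖H s (Z s) - H' s (Z' s)‖ ≤ κ s * ‖(Z s).2 - (Z' s).2‖ + e s) :
    ‖Z t - Z' t‖ ≤
      2 * (‖r - r'‖ + |∫ s in τ..t, e s|) * Real.exp (2 * |∫ s in τ..t, κ s|) := by
  have h1 : ∀ s ∈ Icc 0 T, (Z s).1 = (Z' s).1 := fun s hs =>
    (hV.unique hτ (hZ.fst hτ) hs).trans (hV.unique hτ (hZ'.fst hτ) hs).symm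
  have h2 := hZ.norm_snd_sub_le hZ' hτ ht hκ he (by
    filter_upwards [h, ae_restrict_mem measurableSet_Icc] with s h hs using h (h1 s hs))
  rw [Prod.norm_def, Prod.fst_sub, Prod.snd_sub, h1 t ht, sub_self, norm_zero]
  exact max_le ((norm_nonneg _).trans h2) h2

theorem norm_sub_le_of_fst_eq {g : E × E → E} {κ : ℝ}
    (h : ∀ x r r', ‖g (x, r) - g (x, r')‖ ≤ κ * ‖r - r'‖) {z z' : E × E} (e : z.1 = z'.1) :
    ‖g z - g z'‖ ≤ κ * ‖z.2 - z'.2‖ := by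
  obtain ⟨x, r⟩ := z
  obtain ⟨x', r'⟩ := z'
  obtain rfl : x = x' := e
  exact h _ _ _

/-- A triangular field which is merely continuous in the first variable in its second component
transports the solutions of its continuity equation along its characteristics. -/
theorem SolvesContinuityEq.eq_map_of_triangular {lV mV g κ m₀ : ℝ → ℝ} (hV : IsLipField T V lV mV)
    {G : ℝ → E × E → E} (hG : IsCaratheodory (volume.restrict (Icc 0 T)) G)
    (hg : IsL1Nonneg T g) (hκ : IsL1Nonneg T κ)
    (hGb : ∀ᵐ t ∂(volume.restrict (Icc 0 T)), ∀ z, ‖G t z‖ ≤ g t)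
    (hGl : ∀ᵐ t ∂(volume.restrict (Icc 0 T)), ∀ x r r',
      ‖G t (x, r) - G t (x, r')‖ ≤ κ t * ‖r - r'‖)
    {F : ℝ → E × E → E × E} {ν : ℝ → Measure (E × E)}
    (hν : SolvesContinuityEq T F ν) (hm₀ : IsL1Nonneg T m₀) (hW : W1Bound T m₀ ν)
    {K : Set (E × E)} (hK : IsCompact K) (hνK : ∀ t ∈ Icc 0 T, ProbOn K (ν t))
    (hF : ∀ᵐ t ∂(volume.restrict (Icc 0 T)), ∀ z ∈ K, F t z = (V t z.1, G t z))
    {Z : E × E → ℝ → E × E} (hZ : ∀ z, SolvesODE T (fun t z => (V t z.1, G t z)) T z (Z z))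
    (ht : t ∈ Icc 0 T) :
    Measurable (fun z => Z z t) ∧ ν t = (ν T).map (fun z => Z z t) := by
  have hT : 0 ≤ T := ht.1.trans ht.2
  have hT' : T ∈ Icc 0 T := right_mem_Icc.2 hT
  obtain ⟨P, hP, hPν⟩ := exists_kernel_of_curve hT hm₀ hW hK hK.measurableSet hνK
  let b : ℕ → ContDiffBump (0 : E) := fun k =>
    ⟨1 / ((k : ℝ) + 1) / 2, 1 / ((k : ℝ) + 1), by positivity, half_lt_self (by positivity)⟩
  have hb : Tendsto (fun k => (b k).rOut) atTop (𝓝 0) := tendsto_one_div_add_atTop_nhds_zero_nat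
  set Gk : ℕ → ℝ → E × E → E := fun k t => mollifyFst (b k) (G t) with hGk
  have hGkc : ∀ k, IsCaratheodory (volume.restrict (Icc 0 T)) (Gk k) := fun k =>
    hG.mollifyFst (b k) hGb hg.2 hκ.2 hGl
  have hGkb : ∀ᵐ t ∂(volume.restrict (Icc 0 T)), ∀ k z, ‖Gk k t z‖ ≤ g t := by
    filter_upwards [hG.cont, hGb] with t h1 h2 k z using norm_mollifyFst_le _ h1 h2 z
  have hGkl : ∀ᵐ t ∂(volume.restrict (Icc 0 T)), ∀ k x r r',
      ‖Gk k t (x, r) - Gk k t (x, r')‖ ≤ κ t * ‖r - r'‖ := by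
    filter_upwards [hG.cont, hGl] with t h1 h2 k using norm_mollifyFst_sub_le_snd _ h1 h2
  have hdb : ∀ᵐ t ∂(volume.restrict (Icc 0 T)), ∀ k z, ‖G t z - Gk k t z‖ ≤ 2 * g t := by
    filter_upwards [hGb, hGkb] with t h1 h2 k z
    refine (norm_sub_le _ _).trans ?_
    linarith [h1 z, h2 k z]
  have hdc : ∀ k, IsCaratheodory (volume.restrict (Icc 0 T)) fun t z => ‖G t z - Gk k t z‖ :=
    fun k => ⟨fun z => ((hG.meas z).sub ((hGkc k).meas z)).norm, by
      filter_upwards [hG.cont, (hGkc k).cont] with t h1 h2 using (h1.sub h2).norm⟩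
  have hdlim : ∀ᵐ t ∂(volume.restrict (Icc 0 T)), ∀ z,
      Tendsto (fun k => ‖G t z - Gk k t z‖) atTop (𝓝 0) := by
    filter_upwards [hG.cont] with t h1 z
    have := (tendsto_mollifyFst hb h1 z).const_sub (G t z)
    simpa using this.norm
  -- The state component is not regularised: regularised and original characteristics keep the same
  -- state, and the defect of the field points in the costate direction.
  set W : ℕ → ℝ → E × E → E × E := fun k t z => (V t z.1, Gk k t z) with hWdef
  have hWlip : ∀ k, ∃ l, IsLipField T (W k) l (fun t => mV t + g t) := by
    intro k
    obtain ⟨C, hC, h⟩ := exists_mollifyFst_lipschitz (b k)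
    refine ⟨fun t => lV t + (C * g t + κ t), fun z => ?_,
      hV.l_nonneg.add ((hg.const_mul hC).add hκ), hV.m_nonneg.add hg, ?_, ?_⟩
    · exact (hV.meas z.1).prodMk ((hGkc k).meas z)
    · filter_upwards [hV.lip, hG.cont, hGb, hGl] with t h1 h2 h3 h4 z z'
      have h5 := h (G t) (g t) (κ t) h2 h3 (hg.2 t) (hκ.2 t) h4 z z'
      have h6 := h1 z.1 z'.1
      have h7 : ‖z.1 - z'.1‖ ≤ ‖z - z'‖ := norm_fst_le (z - z')
      have h8 := mul_le_mul_of_nonneg_left h7 (hV.l_nonneg.2 t)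
      have h9 : 0 ≤ (C * g t + κ t) * ‖z - z'‖ := (norm_nonneg _).trans h5
      have h10 : 0 ≤ lV t * ‖z - z'‖ := mul_nonneg (hV.l_nonneg.2 t) (norm_nonneg _)
      refine max_le ?_ ?_
      · change ‖V t z.1 - V t z'.1‖ ≤ _
        linarith
      · change ‖mollifyFst (b k) (G t) z - mollifyFst (b k) (G t) z'‖ ≤ _
        linarith
    · filter_upwards [hV.bound, hGkb] with t h1 h2 z
      refine max_le ((h1 _).trans ?_) ((h2 k _).trans ?_)
      · linarith [hg.2 t]
      · linarith [hV.m_nonneg.2 t]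
  choose l hWl using hWlip
  have hVloc := hV.isLocLipField
  set c := 2 * Real.exp (2 * ∫ s in 0..T, κ s) with hc
  have hc0 : 0 ≤ c := by positivity
  have hexp : ∀ s ∈ Icc 0 T, ∀ t ∈ Icc 0 T, 2 * Real.exp (2 * |∫ r in s..t, κ r|) ≤ c := by
    intro s hs t ht
    have := hκ.abs_integral_le hs ht
    rw [hc]
    gcongr
  -- Lipschitz dependence of the regularised flow on the second variable
  have hflow_snd : ∀ k, ∀ s ∈ Icc 0 T, ∀ x r r',
      ‖odeFlow T (W k) s (x, r) t - odeFlow T (W k) s (x, r') t‖ ≤ c * ‖r - r'‖ := by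
    intro k s hs x r r'
    have h1 := SolvesODE.norm_sub_le_of_triangular ((hWl k).isLocLipField.odeFlow_spec hs (x, r))
      ((hWl k).isLocLipField.odeFlow_spec hs (x, r')) hVloc hs ht hκ isL1Nonneg_zero (by
        filter_upwards [hGkl] with s h1 h2
        rw [add_zero]
        exact norm_sub_le_of_fst_eq (h1 k) h2)
    simp only [intervalIntegral.integral_zero, abs_zero, add_zero] at h1
    refine h1.trans ?_
    have := mul_le_mul_of_nonneg_right (hexp s hs t ht) (norm_nonneg (r - r'))
    linarith
  -- The mean defect of the regularisation under `ν s`. It is written with the kernel `P` to be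
  -- measurable in `s`, and tends to `0` pointwise since `G s` is continuous.
  set err : ℕ → ℝ → ℝ := fun k s => ∫ z, ‖G s z - Gk k s z‖ ∂(P s) with herr
  have herr0 : ∀ k s, 0 ≤ err k s := fun k s => integral_nonneg fun _ => norm_nonneg _
  have herrm : ∀ k, AEStronglyMeasurable (err k) (volume.restrict (Icc 0 T)) := fun k =>
    (hdc k).integral_kernel P
  have herrb : ∀ᵐ s ∂(volume.restrict (Icc 0 T)), ∀ k, ‖err k s‖ ≤ 2 * g s := by
    filter_upwards [hdb] with s h1 k
    have h2 := norm_integral_le_of_norm_le_const (μ := P s) (C := 2 * g s)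
      (f := fun z => ‖G s z - Gk k s z‖) (Eventually.of_forall fun z => by simpa using h1 k z)
    simpa using h2
  have hg2 : IntegrableOn (fun s => 2 * g s) (Icc 0 T) := hg.1.const_mul 2
  have herrL : ∀ k, IsL1Nonneg T (err k) := fun k =>
    ⟨Integrable.mono' hg2 (herrm k) (herrb.mono fun s h => h k), herr0 k⟩
  have hsubI : uIoc t T ⊆ Icc 0 T := uIoc_subset_uIcc.trans (uIcc_subset_Icc ht hT')
  have hdcont : ∀ᵐ s ∂(volume.restrict (Icc 0 T)), ∀ k, Continuous fun z => ‖G s z - Gk k s z‖ :=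
    ae_all_iff.2 fun k => (hdc k).cont
  have herr_lim : Tendsto (fun k => ∫ s in t..T, err k s) atTop (𝓝 0) := by
    rw [← intervalIntegral.integral_zero (a := t) (b := T) (μ := volume)]
    refine intervalIntegral.tendsto_integral_filter_of_dominated_convergence (fun s => 2 * g s)
      (Eventually.of_forall fun k => (herrm k).mono_measure (Measure.restrict_mono hsubI le_rfl))
      (Eventually.of_forall fun k => ?_) (intervalIntegrable_sub hg2 ht hT') ?_
    · exact (ae_restrict_iff' measurableSet_uIoc).1
        (ae_restrict_of_ae_restrict_of_subset hsubI (herrb.mono fun s h => h k))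
    · refine (ae_restrict_iff' measurableSet_uIoc).1
        (ae_restrict_of_ae_restrict_of_subset hsubI ?_)
      filter_upwards [hdcont, hdb, hdlim] with s h1 h2 h3
      have := tendsto_integral_of_dominated_convergence (μ := P s) (fun _ => 2 * g s)
        (F := fun k z => ‖G s z - Gk k s z‖) (f := fun _ => 0)
        (fun k => (h1 k).aestronglyMeasurable) (integrable_const _)
        (fun k => Eventually.of_forall fun z => by simpa using h2 k z)
        (Eventually.of_forall h3)
      simpa using this
  -- convergence of the regularised characteristics
  have hlim : ∀ z, Tendsto (fun k => odeFlow T (W k) T z t) atTop (𝓝 (Z z t)) := by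
    intro z
    have hZc : ContinuousOn (Z z) (Icc 0 T) := (hZ z).continuousOn hT'
    set e : ℕ → ℝ → ℝ := fun k s => ‖G s (Z z s) - Gk k s (Z z s)‖ with he
    have hem : ∀ k, AEStronglyMeasurable (e k) (volume.restrict (Icc 0 T)) := fun k =>
      (hdc k).comp (hZc.aemeasurable measurableSet_Icc)
    have heb : ∀ᵐ s ∂(volume.restrict (Icc 0 T)), ∀ k, ‖e k s‖ ≤ 2 * g s := by
      filter_upwards [hdb] with s h1 k
      simpa [he] using h1 k (Z z s)
    have heL : ∀ k, IsL1Nonneg T (e k) := fun k =>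
      ⟨Integrable.mono' hg2 (hem k) (heb.mono fun s h => h k), fun _ => norm_nonneg _⟩
    have he_lim : Tendsto (fun k => ∫ s in T..t, e k s) atTop (𝓝 0) := by
      rw [← intervalIntegral.integral_zero (a := T) (b := t) (μ := volume)]
      have hsubI' : uIoc T t ⊆ Icc 0 T := by rwa [uIoc_comm]
      refine intervalIntegral.tendsto_integral_filter_of_dominated_convergence (fun s => 2 * g s)
        (Eventually.of_forall fun k => (hem k).mono_measure (Measure.restrict_mono hsubI' le_rfl))
        (Eventually.of_forall fun k => ?_) (intervalIntegrable_sub hg2 hT' ht) ?_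
      · exact (ae_restrict_iff' measurableSet_uIoc).1
          (ae_restrict_of_ae_restrict_of_subset hsubI' (heb.mono fun s h => h k))
      · refine (ae_restrict_iff' measurableSet_uIoc).1
          (ae_restrict_of_ae_restrict_of_subset hsubI' ?_)
        filter_upwards [hdlim] with s h3 using h3 _
    have hbound : ∀ k, ‖odeFlow T (W k) T z t - Z z t‖ ≤ c * |∫ s in T..t, e k s| := by
      intro k
      have h1 := SolvesODE.norm_sub_le_of_triangular (x := z.1) (r := z.2) (r' := z.2)
        ((hWl k).isLocLipField.odeFlow_spec hT' z) (hZ z) hVloc hT' ht hκ (heL k) (by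
          filter_upwards [hGkl] with s h1 h2
          have h3 := norm_sub_le_of_fst_eq (h1 k) h2
          have h4 := norm_sub_le_norm_sub_add_norm_sub (Gk k s (odeFlow T (W k) T z s))
            (Gk k s (Z z s)) (G s (Z z s))
          have h5 : ‖Gk k s (Z z s) - G s (Z z s)‖ = e k s := norm_sub_rev _ _
          rw [h5] at h4
          exact h4.trans (add_le_add h3 le_rfl))
      rw [sub_self, norm_zero, zero_add] at h1
      have := mul_le_mul_of_nonneg_right (hexp T hT' t ht) (abs_nonneg (∫ s in T..t, e k s))
      linarith
    rw [tendsto_iff_norm_sub_tendsto_zero]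
    refine squeeze_zero (fun _ => norm_nonneg _) hbound ?_
    simpa using he_lim.abs.const_mul c
  -- The curves `Z z` are chosen separately for each `z`, so measurability in `z` is not automatic;
  -- it is inherited from the continuous regularised flows.
  have hmeas : Measurable fun z => Z z t :=
    measurable_of_tendsto_metrizable
      (fun k => ((hWl k).isLocLipField.continuous_odeFlow hT' ht).measurable)
      (tendsto_pi_nhds.2 hlim)
  refine ⟨hmeas, ?_⟩
  have := (hνK t ht).1
  have := (hνK T hT').1
  have : IsProbabilityMeasure ((ν T).map fun z => Z z t) :=
    Measure.isProbabilityMeasure_map hmeas.aemeasurable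
  have hF' : ∀ᵐ t ∂(volume.restrict (Icc 0 T)), AEStronglyMeasurable (F t) (ν t) ∧
      ∃ c, ∀ x ∈ K, ‖F t x‖ ≤ c := by
    filter_upwards [hF, hV.lip, hG.cont, hV.bound, hGb, ae_restrict_mem measurableSet_Icc] with
      s h1 h2 h3 h4 h5 hs
    have hVc : Continuous (V s) := continuous_of_lip h2
    constructor
    · refine AEStronglyMeasurable.congr (f := fun z : E × E => (V s z.1, G s z))
        ((hVc.comp continuous_fst).prodMk h3).aestronglyMeasurable ?_
      filter_upwards [(hνK s hs).ae_mem] with z hz using (h1 z hz).symm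
    · refine ⟨max (mV s) (g s), fun z hz => ?_⟩
      rw [h1 z hz]
      exact max_le_max (h4 _) (h5 _)
  refine ext_of_forall_lipschitz fun ψ ⟨Cψ, hCψ⟩ ⟨L, hL⟩ => ?_
  have hLn : ∀ x y, |ψ x - ψ y| ≤ L * ‖x - y‖ := fun x y => by
    simpa [Real.dist_eq, dist_eq_norm] using hL.dist_le_mul x y
  have hstep : ∀ k, |∫ z, ψ (odeFlow T (W k) T z t) ∂(ν T) - ∫ z, ψ z ∂(ν t)| ≤
      L * c * ∫ s in t..T, err k s := by
    intro k
    have hLc : 0 ≤ (L : ℝ) * c := mul_nonneg L.2 hc0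
    rw [← intervalIntegral.integral_const_mul]
    refine hν.abs_integral_flow_sub_le hm₀ hW hK hνK hF' (hWl k) L.2 hLn ht
      ((herrL k).const_mul hLc) fun b' s hs => ?_
    have hs' : s ∈ Icc 0 T := ⟨ht.1.trans hs.1, hs.2⟩
    filter_upwards [hF, hdb, hdcont, ae_restrict_mem measurableSet_Icc] with τ h1 h2 h3 hτ
    set q : E × E → ℝ := fun x => ψ (odeFlow T (W k) s x t) with hq
    have hqc : Continuous q :=
      hL.continuous.comp ((hWl k).isLocLipField.continuous_odeFlow hs' ht)
    -- In the costate direction the transported test function has Lipschitz constant `L * c` for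
    -- every `k`; the Lipschitz constants of `W k`, which depend on `k`, do not enter.
    have hpt : ∀ z a, |fderiv ℝ (mollify b' q) z (0, a)| ≤ L * c * ‖a‖ := by
      intro z a
      refine abs_fderiv_mollify_le_of_line b' hqc (mul_nonneg hLc (norm_nonneg _)) (fun z s' => ?_) z
      refine (hLn _ _).trans ?_
      rw [mul_assoc, mul_assoc]
      refine mul_le_mul_of_nonneg_left ?_ L.2
      have h5 := hflow_snd k s hs' z.1 (z.2 + s' • a) z.2
      have h6 : z + s' • ((0 : E), a) = (z.1, z.2 + s' • a) := by
        ext <;> simp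
      rw [h6]
      refine h5.trans_eq ?_
      rw [add_sub_cancel_left, norm_smul, Real.norm_eq_abs, mul_comm |s'|]
    have hprob := (hνK τ hτ).1
    rw [← Real.norm_eq_abs]
    have hdom : Integrable (fun z => L * c * ‖G τ z - Gk k τ z‖) (ν τ) :=
      ((hνK τ hτ).integrable_of_bound (h3 k).aestronglyMeasurable
        (c := 2 * g τ) fun z _ => by simpa using h2 k z).const_mul _
    refine (norm_integral_le_of_norm_le hdom ?_).trans_eq ?_
    · filter_upwards [(hνK τ hτ).ae_mem] with z hz
      rw [h1 z hz, Real.norm_eq_abs]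
      have h7 : (V τ z.1, G τ z) - W k τ z = ((0 : E), G τ z - Gk k τ z) := by
        simp [hWdef]
      rw [h7]
      exact hpt z _
    · simp only [integral_const_mul, herr, hPν τ hτ]
  rw [integral_map hmeas.aemeasurable hL.continuous.aestronglyMeasurable]
  have l1 : Tendsto (fun k => ∫ z, ψ (odeFlow T (W k) T z t) ∂(ν T)) atTop
      (𝓝 (∫ z, ψ (Z z t) ∂(ν T))) :=
    tendsto_integral_of_dominated_convergence (fun _ => Cψ)
      (fun k => (hL.continuous.comp
        ((hWl k).isLocLipField.continuous_odeFlow hT' ht)).aestronglyMeasurable)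
      (integrable_const _) (fun k => Eventually.of_forall fun z => hCψ _)
      (Eventually.of_forall fun z => (hL.continuous.tendsto _).comp (hlim z))
  have l2 : Tendsto (fun k => ∫ z, ψ (odeFlow T (W k) T z t) ∂(ν T)) atTop
      (𝓝 (∫ z, ψ z ∂(ν t))) := by
    rw [tendsto_iff_norm_sub_tendsto_zero]
    refine squeeze_zero (fun _ => norm_nonneg _) hstep ?_
    simpa using herr_lim.const_mul (L * c : ℝ)
  exact tendsto_nhds_unique l2 l1

end Triangular


/-! ### Continuity equations with an affine field and Dirac terminal datum -/

section Affine

variable {E : Type*} [NormedAddCommGroup E] [NormedSpace ℝ E] [FiniteDimensional ℝ E]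
  [MeasurableSpace E] [BorelSpace E] {T : ℝ} {s : ℝ → Measure E} {m : ℝ → ℝ}

theorem IsPc.exists_probOn_closedBall {ρ : Measure E} (h : IsPc ρ) :
    ∃ R > 0, ProbOn (Metric.closedBall 0 R) ρ := by
  obtain ⟨R, hR0, hR⟩ := h.2.isBounded.subset_closedBall_lt 0 0
  exact ⟨R, hR0, h.1, measure_mono_null (compl_subset_compl.2 hR) Measure.measure_compl_support⟩

theorem IsPc.integrable {ρ : Measure E} (h : IsPc ρ) {F : Type*} [NormedAddCommGroup F]
    {f : E → F} (hf : Continuous f) : Integrable f ρ := by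
  obtain ⟨R, -, hR⟩ := h.exists_probOn_closedBall
  obtain ⟨B, hB⟩ := (isCompact_closedBall (0 : E) R).exists_bound_of_continuousOn hf.continuousOn
  exact hR.integrable_of_bound
    (hR.aestronglyMeasurable Metric.isClosed_closedBall.measurableSet hf.continuousOn) hB

theorem W1Bound.abs_integral_sub_le (hW : W1Bound T m s) (hm : IsL1Nonneg T m)
    (hs : ∀ t ∈ Icc 0 T, IsPc (s t)) {f : E → ℝ} {L : ℝ} (hL : 0 ≤ L)
    (hf : ∀ x y, |f x - f y| ≤ L * ‖x - y‖) {a b : ℝ} (ha : 0 ≤ a) (hab : a ≤ b) (hb : b ≤ T) :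
    |∫ x, f x ∂(s b) - ∫ x, f x ∂(s a)| ≤ L * ∫ t in a..b, m t := by
  have ha' : a ∈ Icc 0 T := ⟨ha, hab.trans hb⟩
  have hb' : b ∈ Icc 0 T := ⟨ha.trans hab, hb⟩
  have hfc : Continuous f := continuous_of_lip (l := L) fun x y => hf x y
  have := (hs a ha').1
  rw [abs_sub_comm]
  have := MeanField.abs_integral_sub_le (K := univ) (by simp) (by simp) ((hs a ha').integrable hfc)
    ((hs b hb').integrable hfc) (a := 0) hL
    (fun x _ y _ => by simpa [dist_eq_norm] using hf x y)
    (intervalIntegral.integral_nonneg hab fun x _ => hm.2 x) (hW a b ha hab hb)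
  simpa using this

/-- Each `s t` has compact support, but no common ball is assumed, so one cutoff does not suffice.
Cutoffs at growing scales are used: for each `t` the integrals are eventually exact, and uniform
Lipschitz bounds make `L' * m` a dominating function. -/
theorem SolvesContinuityEq.integral_eq_of_lipschitz {w : ℝ → E → E}
    (hce : SolvesContinuityEq T w s) (hm : IsL1Nonneg T m) (hW : W1Bound T m s)
    (hs : ∀ t ∈ Icc 0 T, IsPc (s t)) {f : E → ℝ} (hf : ContDiff ℝ ∞ f) {L : ℝ} (hL : 0 ≤ L)
    (hfL : ∀ x y, |f x - f y| ≤ L * ‖x - y‖) {a b : ℝ} (ha : 0 ≤ a) (hab : a ≤ b) (hb : b ≤ T) :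
    IntegrableOn (fun τ => ∫ x, fderiv ℝ f x (w τ x) ∂(s τ)) (Icc a b) ∧
      ∫ τ in a..b, ∫ x, fderiv ℝ f x (w τ x) ∂(s τ) = ∫ x, f x ∂(s b) - ∫ x, f x ∂(s a) := by
  have ha' : a ∈ Icc 0 T := ⟨ha, hab.trans hb⟩
  have hb' : b ∈ Icc 0 T := ⟨ha.trans hab, hb⟩
  have hsub : Icc a b ⊆ Icc 0 T := Icc_subset_Icc ha hb
  let χ : ContDiffBump (0 : E) := ⟨1, 2, one_pos, one_lt_two⟩
  obtain ⟨Lχ, hLχ⟩ := ((χ.contDiff (n := 1))).lipschitzWith_of_hasCompactSupport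
    χ.hasCompactSupport one_ne_zero
  set N : ℕ → ℝ := fun n => (n : ℝ) + 1 with hN
  have hN0 : ∀ n, 0 < N n := fun n => by positivity
  set fN : ℕ → E → ℝ := fun n x => χ ((N n)⁻¹ • x) * (f x - f 0) with hfN
  have hsm : ∀ n, ContDiff ℝ ∞ (fN n) := fun n =>
    (χ.contDiff.comp (contDiff_const_smul _)).mul (hf.sub contDiff_const)
  have hχ0 : ∀ n x, 2 * N n < ‖x‖ → χ ((N n)⁻¹ • x) = 0 := by
    intro n x hx
    refine χ.zero_of_le_dist ?_
    rw [dist_zero_right, norm_smul, norm_inv, Real.norm_of_nonneg (hN0 n).le, ← div_eq_inv_mul]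
    exact (le_div_iff₀ (hN0 n)).2 hx.le
  have hcs : ∀ n, HasCompactSupport (fN n) := by
    intro n
    refine HasCompactSupport.intro (isCompact_closedBall (0 : E) (2 * N n)) fun x hx => ?_
    rw [mem_closedBall_zero_iff, not_le] at hx
    simp only [hfN, hχ0 n x hx, zero_mul]
  -- Where the cutoff varies, `f - f 0` is of size `2 * L * N` and the cutoff is Lipschitz with
  -- constant `Lχ / N`, so the scale `N` cancels.
  set L' := L + 2 * Lχ * L with hL'
  have hL'0 : 0 ≤ L' := by positivity
  have hlip0 : ∀ n x y, ‖y‖ ≤ 2 * N n → |fN n x - fN n y| ≤ L' * ‖x - y‖ := by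
    intro n x y hy
    have e : fN n x - fN n y = χ ((N n)⁻¹ • x) * (f x - f y) +
        (χ ((N n)⁻¹ • x) - χ ((N n)⁻¹ • y)) * (f y - f 0) := by simp only [hfN]; ring
    have h1 : |χ ((N n)⁻¹ • x) * (f x - f y)| ≤ L * ‖x - y‖ := by
      rw [abs_mul, abs_of_nonneg χ.nonneg]
      exact (mul_le_of_le_one_left (abs_nonneg _) χ.le_one).trans (hfL _ _)
    have h2 : |χ ((N n)⁻¹ • x) - χ ((N n)⁻¹ • y)| ≤ Lχ * ((N n)⁻¹ * ‖x - y‖) := by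
      have := hLχ.dist_le_mul ((N n)⁻¹ • x) ((N n)⁻¹ • y)
      rwa [Real.dist_eq, dist_eq_norm, ← smul_sub, norm_smul, norm_inv,
        Real.norm_of_nonneg (hN0 n).le] at this
    have h3 : |f y - f 0| ≤ L * (2 * N n) := by
      refine (hfL _ _).trans ?_
      rw [sub_zero]
      exact mul_le_mul_of_nonneg_left hy hL
    have h4 : |(χ ((N n)⁻¹ • x) - χ ((N n)⁻¹ • y)) * (f y - f 0)| ≤ 2 * Lχ * L * ‖x - y‖ := by
      rw [abs_mul]
      refine (mul_le_mul h2 h3 (abs_nonneg _) (by have := hN0 n; positivity)).trans_eq ?_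
      have := (hN0 n).ne'
      field_simp
    rw [e]
    refine (abs_add_le _ _).trans ?_
    linarith
  have hlip : ∀ n x y, |fN n x - fN n y| ≤ L' * ‖x - y‖ := by
    intro n x y
    rcases le_or_gt ‖y‖ (2 * N n) with hy | hy
    · exact hlip0 n x y hy
    rcases le_or_gt ‖x‖ (2 * N n) with hx | hx
    · rw [abs_sub_comm, norm_sub_rev]
      exact hlip0 n y x hx
    · simp only [hfN, hχ0 n x hx, hχ0 n y hy, zero_mul, sub_self, abs_zero]
      positivity
  have hev : ∀ (R : ℝ), ∀ᶠ n in atTop, ∀ x ∈ Metric.closedBall (0 : E) R,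
      fN n =ᶠ[𝓝 x] fun y => f y - f 0 := by
    intro R
    filter_upwards [eventually_gt_atTop ⌈R⌉₊] with n hn x hx
    have hR : R < N n := (Nat.le_ceil R).trans_lt (by simp only [hN]; exact_mod_cast hn.trans (Nat.lt_succ_self n))
    rw [mem_closedBall_zero_iff] at hx
    filter_upwards [Metric.isOpen_ball.mem_nhds
      (show x ∈ Metric.ball (0 : E) (N n) by simpa using hx.trans_lt hR)] with y hy
    simp only [hfN]
    rw [χ.one_of_mem_closedBall, one_mul]
    rw [mem_closedBall_zero_iff, norm_smul, norm_inv, Real.norm_of_nonneg (hN0 n).le,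
      ← div_eq_inv_mul]
    refine (div_le_one (hN0 n)).2 ?_
    simpa using (mem_ball_zero_iff.1 hy).le
  have hend : ∀ t ∈ Icc 0 T, ∀ᶠ n in atTop, ∫ x, fN n x ∂(s t) = (∫ x, f x ∂(s t)) - f 0 := by
    intro t ht
    obtain ⟨R, -, hR⟩ := (hs t ht).exists_probOn_closedBall
    have := (hs t ht).1
    filter_upwards [hev R] with n hn
    have e : ∫ x, fN n x ∂(s t) = ∫ x, (f x - f 0) ∂(s t) := by
      refine integral_congr_ae ?_
      filter_upwards [hR.ae_mem] with x hx using (hn x hx).eq_of_nhds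
    rw [e, integral_sub ((hs t ht).integrable hf.continuous) (integrable_const _)]
    simp
  have hmid : ∀ t ∈ Icc 0 T, ∀ᶠ n in atTop,
      ∫ x, fderiv ℝ (fN n) x (w t x) ∂(s t) = ∫ x, fderiv ℝ f x (w t x) ∂(s t) := by
    intro t ht
    obtain ⟨R, -, hR⟩ := (hs t ht).exists_probOn_closedBall
    filter_upwards [hev R] with n hn
    refine integral_congr_ae ?_
    filter_upwards [hR.ae_mem] with x hx
    simp only [(hn x hx).fderiv_eq, fderiv_sub_const]
  have hbd : ∀ n, ∀ c e, a ≤ c → c ≤ e → e ≤ b →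
      ‖∫ x, fN n x ∂(s e) - ∫ x, fN n x ∂(s c)‖ ≤ ∫ t in c..e, L' * m t := by
    intro n c e hc hce' he
    rw [Real.norm_eq_abs, intervalIntegral.integral_const_mul]
    exact hW.abs_integral_sub_le hm hs hL'0 (hlip n) (ha.trans hc) hce' (he.trans hb)
  have hder : ∀ n, ∀ᵐ t ∂(volume.restrict (Icc a b)), HasDerivAt (fun t => ∫ x, fN n x ∂(s t))
      (∫ x, fderiv ℝ (fN n) x (w t x) ∂(s t)) t := fun n =>
    ae_restrict_of_ae_restrict_of_subset hsub (hce (fN n) (hsm n) (hcs n))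
  have hmab : IntegrableOn (fun t => L' * m t) (Icc a b) := (hm.1.mono_set hsub).const_mul _
  have hN1 := fun n => integral_eq_sub_of_bound hab hmab (hbd n) (hder n)
  have hbN : ∀ n, ∀ᵐ t ∂(volume.restrict (Icc a b)),
      ‖∫ x, fderiv ℝ (fN n) x (w t x) ∂(s t)‖ ≤ L' * m t := fun n =>
    ae_norm_deriv_le hmab (hbd n) (hder n)
  have hlimae : ∀ᵐ t ∂(volume.restrict (Icc a b)),
      Tendsto (fun n => ∫ x, fderiv ℝ (fN n) x (w t x) ∂(s t)) atTop
        (𝓝 (∫ x, fderiv ℝ f x (w t x) ∂(s t))) := by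
    filter_upwards [ae_restrict_mem measurableSet_Icc] with t ht
    exact tendsto_nhds_of_eventually_eq (hmid t (hsub ht))
  have hGm : AEStronglyMeasurable (fun t => ∫ x, fderiv ℝ f x (w t x) ∂(s t))
      (volume.restrict (Icc a b)) :=
    aestronglyMeasurable_of_tendsto_ae atTop (fun n => (hN1 n).1.aestronglyMeasurable) hlimae
  have hGb : ∀ᵐ t ∂(volume.restrict (Icc a b)),
      ‖∫ x, fderiv ℝ f x (w t x) ∂(s t)‖ ≤ L' * m t := by
    filter_upwards [hlimae, ae_all_iff.2 hbN] with t h1 h2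
    exact le_of_tendsto h1.norm (Eventually.of_forall h2)
  refine ⟨Integrable.mono' hmab hGm hGb, ?_⟩
  have t1 : Tendsto (fun n => ∫ t in a..b, ∫ x, fderiv ℝ (fN n) x (w t x) ∂(s t)) atTop
      (𝓝 (∫ t in a..b, ∫ x, fderiv ℝ f x (w t x) ∂(s t))) := by
    have hIoc : Ioc a b ⊆ Icc a b := Ioc_subset_Icc_self
    simp only [intervalIntegral.integral_of_le hab]
    exact tendsto_integral_of_dominated_convergence (fun t => L' * m t)
      (fun n => ((hN1 n).1.mono_set hIoc).aestronglyMeasurable) (hmab.mono_set hIoc)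
      (fun n => ae_restrict_of_ae_restrict_of_subset hIoc (hbN n))
      (ae_restrict_of_ae_restrict_of_subset hIoc hlimae)
  have t2 : Tendsto (fun n => ∫ t in a..b, ∫ x, fderiv ℝ (fN n) x (w t x) ∂(s t)) atTop
      (𝓝 (∫ x, f x ∂(s b) - ∫ x, f x ∂(s a))) := by
    refine tendsto_nhds_of_eventually_eq ?_
    filter_upwards [hend a ha', hend b hb'] with n h1 h2
    rw [(hN1 n).2, h1, h2]
    ring
  exact tendsto_nhds_unique t1 t2

end Affine


section Affine

variable {E : Type*} [NormedAddCommGroup E] [NormedSpace ℝ E] [FiniteDimensional ℝ E]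

theorem integrable_of_forall_dual {α : Type*} [MeasurableSpace α] {P : Measure α} {f : α → E}
    (h : ∀ ℓ : E →L[ℝ] ℝ, Integrable (fun t => ℓ (f t)) P) : Integrable f P := by
  let b := Module.finBasis ℝ E
  have e : f = fun t => ∑ i, (LinearMap.toContinuousLinearMap (b.coord i)) (f t) • b i := by
    ext t
    simp
  rw [e]
  exact integrable_finsetSum _ fun i _ => (h _).smul_const _

variable [MeasurableSpace E] [BorelSpace E] {T : ℝ} {s : ℝ → Measure E} {m κ : ℝ → ℝ}
  {M : ℝ → E →L[ℝ] E} {c : ℝ → E}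

theorem W1Bound.abs_integral_sub_le_abs (hW : W1Bound T m s) (hm : IsL1Nonneg T m)
    (hs : ∀ t ∈ Icc 0 T, IsPc (s t)) {f : E → ℝ} {L : ℝ} (hL : 0 ≤ L)
    (hf : ∀ x y, |f x - f y| ≤ L * ‖x - y‖) {a b : ℝ} (ha : a ∈ Icc 0 T) (hb : b ∈ Icc 0 T) :
    |∫ x, f x ∂(s b) - ∫ x, f x ∂(s a)| ≤ L * |∫ t in a..b, m t| := by
  rcases le_total a b with hab | hab
  · exact (hW.abs_integral_sub_le hm hs hL hf ha.1 hab hb.2).trans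
      (mul_le_mul_of_nonneg_left (le_abs_self _) hL)
  · rw [abs_sub_comm, intervalIntegral.integral_symm, abs_neg]
    exact (hW.abs_integral_sub_le hm hs hL hf hb.1 hab ha.2).trans
      (mul_le_mul_of_nonneg_left (le_abs_self _) hL)

/-- Test with linear functionals: an affine field commutes with taking means, so the equation for
the mean is closed. -/
theorem SolvesContinuityEq.mean_of_affine (hT : 0 ≤ T)
    (hce : SolvesContinuityEq T (fun t r => M t r + c t) s) (hm : IsL1Nonneg T m)
    (hW : W1Bound T m s) (hs : ∀ t ∈ Icc 0 T, IsPc (s t)) :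
    SolvesODE T (fun t r => M t r + c t) T (∫ r, r ∂(s T)) fun t => ∫ r, r ∂(s t) := by
  have key : ∀ (ℓ : E →L[ℝ] ℝ) (a b : ℝ), 0 ≤ a → a ≤ b → b ≤ T →
      IntegrableOn (fun t => ℓ (M t (∫ r, r ∂(s t)) + c t)) (Icc a b) ∧
      ∫ t in a..b, ℓ (M t (∫ r, r ∂(s t)) + c t) = ℓ (∫ r, r ∂(s b)) - ℓ (∫ r, r ∂(s a)) := by
    intro ℓ a b ha hab hb
    have hsub : Icc a b ⊆ Icc 0 T := Icc_subset_Icc ha hb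
    obtain ⟨h1, h2⟩ := hce.integral_eq_of_lipschitz hm hW hs ℓ.contDiff (norm_nonneg ℓ)
      (fun x y => by rw [← map_sub]; exact ℓ.le_opNorm _) ha hab hb
    have e : ∀ t ∈ Icc 0 T, ∫ r, ℓ r ∂(s t) = ℓ (∫ r, r ∂(s t)) := fun t ht =>
      ℓ.integral_comp_comm ((hs t ht).integrable continuous_id)
    have e2 : ∀ t ∈ Icc a b, ∫ r, fderiv ℝ ℓ r (M t r + c t) ∂(s t) =
        ℓ (M t (∫ r, r ∂(s t)) + c t) := by
      intro t ht
      have ht' := hsub ht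
      have := (hs t ht').1
      simp only [ContinuousLinearMap.fderiv]
      rw [ℓ.integral_comp_comm ((hs t ht').integrable (by fun_prop)),
        integral_add ((hs t ht').integrable (M t).continuous) (integrable_const _),
        (M t).integral_comp_comm (φ := fun r => r) ((hs t ht').integrable continuous_id)]
      simp
    have e3 : (fun t => ∫ r, fderiv ℝ ℓ r (M t r + c t) ∂(s t)) =ᵐ[volume.restrict (Icc a b)]
        fun t => ℓ (M t (∫ r, r ∂(s t)) + c t) := by
      filter_upwards [ae_restrict_mem measurableSet_Icc] with t ht using e2 t ht
    refine ⟨h1.congr e3, ?_⟩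
    rw [← e b ⟨ha.trans hab, hb⟩, ← e a ⟨ha, hab.trans hb⟩, ← h2]
    refine intervalIntegral.integral_congr fun t ht => (e2 t ?_).symm
    rwa [uIcc_of_le hab] at ht
  have hint : IntegrableOn (fun t => M t (∫ r, r ∂(s t)) + c t) (Icc 0 T) :=
    integrable_of_forall_dual fun ℓ => (key ℓ 0 T le_rfl hT le_rfl).1
  refine ⟨hint, fun t ht => ?_⟩
  rw [SeparatingDual.eq_iff_forall_dual_eq (R := ℝ)]
  intro ℓ
  have h1 := (key ℓ t T ht.1 ht.2 le_rfl).2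
  have h2 := ℓ.intervalIntegral_comp_comm (intervalIntegrable_sub hint ht (right_mem_Icc.2 hT))
  rw [intervalIntegral.integral_symm, map_add, map_neg, ← h2, h1]
  ring

theorem eq_dirac_of_integral_norm_sub_eq_zero {ρ : Measure E} (h : IsPc ρ) {y : E}
    (h0 : ∫ r, ‖r - y‖ ∂ρ ≤ 0) : ρ = Measure.dirac y := by
  have := h.1
  have h1 : ∫ r, ‖r - y‖ ∂ρ = 0 := le_antisymm h0 (integral_nonneg fun _ => norm_nonneg _)
  rw [integral_eq_zero_iff_of_nonneg (fun _ => norm_nonneg _) (h.integrable (by fun_prop))] at h1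
  have h2 : (id : E → E) =ᵐ[ρ] fun _ => y := by
    filter_upwards [h1] with r hr
    exact sub_eq_zero.1 (norm_eq_zero.1 hr)
  have h3 : ρ.map id = ρ.map fun _ => y := Measure.map_congr h2
  rwa [Measure.map_id, Measure.map_const, measure_univ, one_smul] at h3

/-- A continuity equation with an affine field, started at a Dirac mass, is solved by Dirac masses
only. -/
theorem SolvesContinuityEq.eq_dirac_of_affine (hT : 0 ≤ T) (hκ : IsL1Nonneg T κ)
    (hM : ∀ᵐ t ∂(volume.restrict (Icc 0 T)), ‖M t‖ ≤ κ t)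
    (hc : ∀ᵐ t ∂(volume.restrict (Icc 0 T)), ‖c t‖ ≤ κ t)
    (hce : SolvesContinuityEq T (fun t r => M t r + c t) s) (hm : IsL1Nonneg T m)
    (hW : W1Bound T m s) (hs : ∀ t ∈ Icc 0 T, IsPc (s t)) {p : E} (hp : s T = Measure.dirac p) :
    ∃ y, SolvesODE T (fun t r => M t r + c t) T p y ∧ ∀ t ∈ Icc 0 T, s t = Measure.dirac (y t) := by
  have hT' : T ∈ Icc 0 T := right_mem_Icc.2 hT
  have hy := hce.mean_of_affine hT hm hW hs
  set y : ℝ → E := fun t => ∫ r, r ∂(s t) with hydef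
  have hyT : ∫ r, r ∂(s T) = p := by rw [hp, integral_dirac]
  rw [hyT] at hy
  refine ⟨y, hy, fun t ht => eq_dirac_of_integral_norm_sub_eq_zero (hs t ht) ?_⟩
  have hyc : ContinuousOn y (Icc 0 T) := hy.continuousOn hT'
  obtain ⟨Y, hY⟩ := isCompact_Icc.exists_bound_of_continuousOn hyc
  have hY0 : 0 ≤ Y := (norm_nonneg _).trans (hY T hT')
  -- The first moment is used rather than the variance, because `W₁` controls only integrals of
  -- Lipschitz functions when the supports have no common bound.
  set D : ℝ → ℝ := fun τ => ∫ r, ‖r - y τ‖ ∂(s τ) with hD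
  have hD0 : ∀ τ, 0 ≤ D τ := fun τ => integral_nonneg fun _ => norm_nonneg _
  have hDle : ∀ a ∈ Icc 0 T, ∀ b ∈ Icc 0 T, |D b - D a| ≤ |∫ t in a..b, m t| + ‖y b - y a‖ := by
    intro a ha b hb
    have hpa := (hs a ha).1
    have h1 := hW.abs_integral_sub_le_abs hm hs zero_le_one
      (f := fun r => ‖r - y b‖) (fun x z => by
        rw [one_mul]
        exact (abs_norm_sub_norm_le _ _).trans_eq (by rw [sub_sub_sub_cancel_right])) ha hb
    have h2 : |∫ r, ‖r - y b‖ ∂(s a) - D a| ≤ ‖y b - y a‖ := by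
      rw [hD, ← integral_sub ((hs a ha).integrable (by fun_prop))
        ((hs a ha).integrable (by fun_prop)), ← Real.norm_eq_abs]
      refine (norm_integral_le_of_norm_le_const (C := ‖y b - y a‖)
        (Eventually.of_forall fun r => ?_)).trans_eq (by simp)
      refine (abs_norm_sub_norm_le _ _).trans_eq ?_
      rw [sub_sub_sub_cancel_left, norm_sub_rev]
    rw [one_mul] at h1
    exact (abs_sub_le _ _ _).trans (add_le_add h1 h2)
  have hDc : ContinuousOn D (Icc 0 T) := by
    intro a ha
    have h1 : ContinuousOn (fun b => ∫ t in a..b, m t) (Icc 0 T) := by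
      have := intervalIntegral.continuousOn_primitive_interval' (μ := volume) (f := m)
        (b₁ := 0) (b₂ := T) (a := a)
        (intervalIntegrable_sub hm.1 (left_mem_Icc.2 hT) (right_mem_Icc.2 hT))
        (by rwa [uIcc_of_le hT])
      rwa [uIcc_of_le hT] at this
    have h2 : ContinuousOn (fun b => |∫ t in a..b, m t| + ‖y b - y a‖) (Icc 0 T) :=
      h1.abs.add (hyc.sub continuousOn_const).norm
    have h3 := h2 a ha
    simp only [ContinuousWithinAt, intervalIntegral.integral_same, sub_self, norm_zero, abs_zero,
      add_zero] at h3
    rw [ContinuousWithinAt, tendsto_iff_norm_sub_tendsto_zero]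
    refine squeeze_zero' (Eventually.of_forall fun _ => norm_nonneg _) ?_ h3
    filter_upwards [self_mem_nhdsWithin] with b hb using hDle a ha b hb
  have hκD : IntegrableOn (fun τ => κ τ * D τ) (Icc 0 T) := by
    obtain ⟨B, hB⟩ := isCompact_Icc.exists_bound_of_continuousOn hDc
    exact hκ.1.mul_bdd (c := B) (hDc.aestronglyMeasurable measurableSet_Icc)
      (by filter_upwards [ae_restrict_mem measurableSet_Icc] with t ht using hB t ht)
  set k : ℝ → ℝ := fun τ => κ τ * Y + κ τ with hk
  have hkL : IsL1Nonneg T k :=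
    ⟨(hκ.1.mul_const _).add hκ.1, fun t => add_nonneg (mul_nonneg (hκ.2 t) hY0) (hκ.2 t)⟩
  have hvb : ∀ᵐ τ ∂(volume.restrict (Icc 0 T)), ‖M τ (y τ) + c τ‖ ≤ k τ := by
    filter_upwards [hM, hc, ae_restrict_mem measurableSet_Icc] with τ h1 h2 h3
    refine (norm_add_le _ _).trans (add_le_add (((M τ).le_opNorm _).trans ?_) h2)
    exact mul_le_mul h1 (hY τ h3) (norm_nonneg _) (hκ.2 τ)
  have hmain : ∀ t₀ ∈ Icc 0 T, D t₀ ≤ 0 + ∫ τ in t₀..T, κ τ * D τ := by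
    intro t₀ ht₀
    rw [zero_add]
    refine le_of_forall_pos_le_add fun ε hε => ?_
    -- The norm is mollified in order to be an admissible test function; radius `ε / 2` costs `ε /
    -- 2` at each end of the time interval.
    let b : ContDiffBump (0 : E) := ⟨ε / 4, ε / 2, by positivity, by linarith⟩
    have hn : ∀ x y : E, |‖x‖ - ‖y‖| ≤ 1 * ‖x - y‖ := fun x y => by
      rw [one_mul]; exact abs_norm_sub_norm_le x y
    obtain ⟨C, hC, hCb⟩ := exists_mollify_taylor b
    obtain ⟨hC1, hC2⟩ := hCb (fun x => ‖x‖) 1 zero_le_one hn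
    have hDb := norm_fderiv_mollify_le b zero_le_one hn
    have hsm := contDiff_mollify b (continuous_norm (E := E))
    have hcl : ∀ x : E, |mollify b (fun x => ‖x‖) x - ‖x‖| ≤ ε / 2 := fun x => by
      refine norm_mollify_sub_self_le b continuous_norm fun y hy => ?_
      refine (hn _ _).trans ?_
      rw [mem_closedBall_zero_iff] at hy
      simpa using hy
    set h : E → ℝ := mollify b fun x => ‖x‖ with hh
    have hDcont : Continuous (fderiv ℝ h) := hsm.continuous_fderiv (by simp)
    have hhL : ∀ x y, |h x - h y| ≤ 1 * ‖x - y‖ := fun x y => by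
      refine norm_mollify_sub_le b continuous_norm continuous_norm fun z _ => ?_
      refine (hn _ _).trans_eq ?_
      rw [sub_sub_sub_cancel_right]
    have key := abs_sub_le_of_quadratic_bound (a := t₀) (b := T)
      (g := fun t => ∫ r, h (r - y t) ∂(s t)) (k := fun τ => κ τ * D τ)
      (K := fun τ => m τ + k τ) (C := C) ht₀.2
      (hκD.mono_set (Icc_subset_Icc ht₀.1 le_rfl))
      ((hm.add hkL).1.mono_set (Icc_subset_Icc ht₀.1 le_rfl)) (hm.add hkL).2 (by
        intro a t ha hat htT
        have ha0 := ht₀.1.trans ha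
        have ha' : a ∈ Icc 0 T := ⟨ha0, hat.trans htT⟩
        have ht' : t ∈ Icc 0 T := ⟨ha0.trans hat, htT⟩
        have hpa := (hs a ha').1
        have hsub : Icc a t ⊆ Icc 0 T := Icc_subset_Icc ha0 htT
        have hsmt : ContDiff ℝ ∞ fun r => h (r - y t) := hsm.comp (contDiff_id.sub contDiff_const)
        obtain ⟨hI, hIe⟩ := hce.integral_eq_of_lipschitz hm hW hs hsmt zero_le_one
          (fun x z => (hhL _ _).trans_eq (by rw [sub_sub_sub_cancel_right])) ha0 hat htT
        simp only [sub_eq_add_neg, fderiv_comp_add_right] at hI hIe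
        simp only [← sub_eq_add_neg] at hI hIe
        set I : ℝ → ℝ := fun τ => ∫ r, fderiv ℝ h (r - y t) (M τ r + c τ) ∂(s τ) with hIdef
        set v : ℝ → E := fun τ => M τ (y τ) + c τ with hv
        have hvi : IntegrableOn v (Icc 0 T) := hy.integrable
        set A := ∫ τ in a..t, v τ with hA
        have hyA : y t - y a = A := by
          have := (hy.restart hT' ha').eq t ht'
          rw [this, add_sub_cancel_left]
        have hDi : Integrable (fun r => fderiv ℝ h (r - y t)) (s a) :=
          (hs a ha').integrable (by fun_prop)
        set ℓ : E →L[ℝ] ℝ := ∫ r, fderiv ℝ h (r - y t) ∂(s a) with hℓ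
        have hℓv : ∀ w, ℓ w = ∫ r, fderiv ℝ h (r - y t) w ∂(s a) := fun w =>
          ContinuousLinearMap.integral_apply hDi w
        have hℓA : ℓ A = ∫ τ in a..t, ℓ (v τ) :=
          (ℓ.intervalIntegral_comp_comm (intervalIntegrable_sub hvi ha' ht')).symm
        have iℓ : IntervalIntegrable (fun τ => ℓ (v τ)) volume a t :=
          intervalIntegrable_sub (ℓ.integrable_comp hvi) ha' ht'
        have iI : IntervalIntegrable I volume a t :=
          intervalIntegrable_sub hI (left_mem_Icc.2 hat) (right_mem_Icc.2 hat)
        have i1 : Integrable (fun r => h (r - y t)) (s a) := (hs a ha').integrable (by fun_prop)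
        have i2 : Integrable (fun r => h (r - y a)) (s a) := (hs a ha').integrable (by fun_prop)
        have i3 : Integrable (fun r => fderiv ℝ h (r - y t) A) (s a) :=
          (hs a ha').integrable (by fun_prop)
        -- The increment comes from the change of the measure and from the motion of the centre `y`.
        -- Both are linearised at `r - y t`; the last integral is the Taylor remainder of the motion
        -- of the centre, of second order.
        have hsplit : (∫ r, h (r - y t) ∂(s t)) - ∫ r, h (r - y a) ∂(s a) =
            (∫ τ in a..t, (I τ - ℓ (v τ))) -
              ∫ r, (h (r - y a) - h (r - y t) - fderiv ℝ h (r - y t) A) ∂(s a) := by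
          rw [intervalIntegral.integral_sub iI iℓ, ← hℓA, hℓv, hIe,
            integral_sub (f := fun r => h (r - y a) - h (r - y t)) (i2.sub i1) i3,
            integral_sub i2 i1]
          ring
        have hδk : 0 ≤ ∫ τ in a..t, k τ := intervalIntegral.integral_nonneg hat fun x _ => hkL.2 x
        have hδm : 0 ≤ ∫ τ in a..t, m τ := intervalIntegral.integral_nonneg hat fun x _ => hm.2 x
        have hAk : ‖A‖ ≤ ∫ τ in a..t, k τ := by
          have := intervalIntegral_norm_le_abs (intervalIntegrable_sub hkL.1 ha' ht')
            (ae_restrict_of_ae_restrict_of_subset (uIcc_subset_Icc ha' ht') hvb)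
          rwa [abs_of_nonneg hδk] at this
        have hrem : |∫ r, (h (r - y a) - h (r - y t) - fderiv ℝ h (r - y t) A) ∂(s a)| ≤
            C * (∫ τ in a..t, k τ) ^ 2 := by
          rw [← Real.norm_eq_abs]
          refine (norm_integral_le_of_norm_le_const (C := C * (∫ τ in a..t, k τ) ^ 2)
            (Eventually.of_forall fun r => ?_)).trans_eq (by simp)
          have h3 := hC2 (r - y t) A
          rw [show r - y t + A = r - y a by rw [← hyA]; abel, mul_one] at h3
          refine h3.trans ?_
          gcongr
        have hstep : ∀ᵐ τ ∂(volume.restrict (Icc a t)),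
            ‖I τ - ℓ (v τ)‖ ≤ κ τ * D τ + C * k τ * ∫ r in a..t, m r := by
          filter_upwards [ae_restrict_of_ae_restrict_of_subset hsub hM,
            ae_restrict_of_ae_restrict_of_subset hsub hvb,
            ae_restrict_mem measurableSet_Icc] with τ h1 h2 h3
          have hτ := hsub h3
          have hpτ := (hs τ hτ).1
          have j1 : Integrable (fun r => fderiv ℝ h (r - y t) (M τ (r - y τ))) (s τ) :=
            (hs τ hτ).integrable (by fun_prop)
          have j2 : Integrable (fun r => fderiv ℝ h (r - y t) (v τ)) (s τ) :=
            (hs τ hτ).integrable (by fun_prop)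
          -- Split `M r + c` as `M (r - y) + v`. The velocity `v`, common to all points, is
          -- cancelled by the motion of the centre, up to replacing `s τ` by `s a`; the part left
          -- over is bounded by `κ * D`.
          have e1 : I τ = (∫ r, fderiv ℝ h (r - y t) (M τ (r - y τ)) ∂(s τ)) +
              ∫ r, fderiv ℝ h (r - y t) (v τ) ∂(s τ) := by
            rw [← integral_add j1 j2]
            refine integral_congr_ae (Eventually.of_forall fun r => ?_)
            simp only [← map_add, hv]
            congr 1
            rw [map_sub]; abel
          have b1 : |∫ r, fderiv ℝ h (r - y t) (M τ (r - y τ)) ∂(s τ)| ≤ κ τ * D τ := by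
            rw [hD, ← integral_const_mul, ← Real.norm_eq_abs]
            refine norm_integral_le_of_norm_le
              (((hs τ hτ).integrable (by fun_prop)).const_mul _) (Eventually.of_forall fun r => ?_)
            refine ((fderiv ℝ h (r - y t)).le_opNorm _).trans ?_
            refine (mul_le_of_le_one_left (norm_nonneg _) (hDb _)).trans ?_
            refine ((M τ).le_opNorm _).trans ?_
            exact mul_le_mul_of_nonneg_right h1 (norm_nonneg _)
          have b2 : |(∫ r, fderiv ℝ h (r - y t) (v τ) ∂(s τ)) - ℓ (v τ)| ≤
              C * k τ * ∫ r in a..t, m r := by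
            rw [hℓv]
            have hk0 := hkL.2 τ
            refine (hW.abs_integral_sub_le hm hs (L := C * k τ) (mul_nonneg hC hk0)
              (f := fun r => fderiv ℝ h (r - y t) (v τ)) (fun x z => ?_) ha0 h3.1 hτ.2).trans ?_
            · have h4 : fderiv ℝ h (x - y t) (v τ) - fderiv ℝ h (z - y t) (v τ) =
                  (fderiv ℝ h (x - y t) - fderiv ℝ h (z - y t)) (v τ) := rfl
              rw [h4]
              rw [← Real.norm_eq_abs]
              refine (ContinuousLinearMap.le_opNorm _ _).trans ?_
              refine (mul_le_mul (hC1 _ _) h2 (norm_nonneg _) (by positivity)).trans_eq ?_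
              rw [sub_sub_sub_cancel_right]; ring
            · refine mul_le_mul_of_nonneg_left ?_ (mul_nonneg hC hk0)
              exact intervalIntegral.integral_mono_interval le_rfl h3.1 h3.2
                (Eventually.of_forall hm.2) (intervalIntegrable_sub hm.1 ha' ht')
          rw [e1, add_sub_assoc]
          exact (norm_add_le _ _).trans (add_le_add b1 b2)
        have iκD := intervalIntegrable_sub hκD ha' ht'
        have ik := intervalIntegrable_sub hkL.1 ha' ht'
        have im := intervalIntegrable_sub hm.1 ha' ht'
        have hκDn : 0 ≤ ∫ τ in a..t, κ τ * D τ :=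
          intervalIntegral.integral_nonneg hat fun x _ => mul_nonneg (hκ.2 x) (hD0 x)
        have hfirst : |∫ τ in a..t, (I τ - ℓ (v τ))| ≤
            (∫ τ in a..t, κ τ * D τ) + C * (∫ τ in a..t, k τ) * ∫ τ in a..t, m τ := by
          have h5 := intervalIntegral_norm_le_abs
            (iκD.add ((ik.const_mul C).mul_const (∫ r in a..t, m r)))
            (p := fun τ => I τ - ℓ (v τ)) (by rwa [uIcc_of_le hat])
          refine h5.trans_eq ?_
          rw [intervalIntegral.integral_add iκD ((ik.const_mul C).mul_const _),
            intervalIntegral.integral_mul_const, intervalIntegral.integral_const_mul,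
            abs_of_nonneg (by positivity)]
        rw [hsplit, intervalIntegral.integral_add im ik]
        refine (abs_sub _ _).trans ((add_le_add hfirst hrem).trans ?_)
        have q1 : 0 ≤ C * ((∫ τ in a..t, k τ) * ∫ τ in a..t, m τ) := by positivity
        have q2 : 0 ≤ C * (∫ τ in a..t, m τ) ^ 2 := by positivity
        nlinarith)
    have h1 : |∫ r, h (r - y T) ∂(s T)| ≤ ε / 2 := by
      have : y T = p := hyT
      rw [this, hp, integral_dirac, sub_self]
      simpa using hcl 0
    have h2 : |∫ r, h (r - y t₀) ∂(s t₀) - D t₀| ≤ ε / 2 := by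
      have := (hs t₀ ht₀).1
      rw [hD, ← integral_sub ((hs t₀ ht₀).integrable (by fun_prop))
        ((hs t₀ ht₀).integrable (by fun_prop)), ← Real.norm_eq_abs]
      refine (norm_integral_le_of_norm_le_const (Eventually.of_forall fun r => hcl _)).trans_eq ?_
      simp
    rw [abs_le] at *
    linarith [key.1, key.2, h1.1, h1.2, h2.1, h2.2]
  -- At time `T` the measure is the Dirac mass at the centre, so the Gronwall constant is `0` and
  -- `D` vanishes.
  have hl := gronwall_backward ht.2 (hκ.1.mono_set (Icc_subset_Icc ht.1 le_rfl)) hκ.2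
    (hDc.mono (Icc_subset_Icc ht.1 le_rfl)) le_rfl
    (fun t' ht' => hmain t' ⟨ht.1.trans ht'.1, ht'.2⟩)
  simpa using hl

end Affine


/-! ### Directional derivatives along moving atoms -/

section Gradient

/-- The Euclidean space of dimension `d`. -/
abbrev Euc (d : ℕ) := EuclideanSpace ℝ (Fin d)

variable {d : ℕ}

theorem inner_gradient_eq (ψ : Euc d → ℝ) (x e : Euc d) : ⟪gradient ψ x, e⟫_ℝ = fderiv ℝ ψ x e := by
  rw [gradient, InnerProductSpace.toDual_symm_apply]

theorem exists_taylor_of_hasCompactSupport {ψ : Euc d → ℝ} (hψ : ContDiff ℝ ∞ ψ)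
    (hc : HasCompactSupport ψ) :
    ∃ C, 0 ≤ C ∧ ∀ a b, |ψ b - ψ a - ⟪gradient ψ a, b - a⟫_ℝ| ≤ C * ‖b - a‖ ^ 2 := by
  have h1 : ContDiff ℝ 1 (fderiv ℝ ψ) := hψ.fderiv_right (by norm_cast)
  obtain ⟨L, hL⟩ := h1.lipschitzWith_of_hasCompactSupport (hc.fderiv ℝ) one_ne_zero
  refine ⟨L, L.2, fun a b => ?_⟩
  have := Convex.norm_image_sub_le_of_norm_fderiv_le' (𝕜 := ℝ) (f := ψ)
    (s := Metric.closedBall a ‖b - a‖) (x := a) (y := b) (φ := fderiv ℝ ψ a)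
    (C := L * ‖b - a‖) (fun y _ => hψ.differentiable (by simp) y)
    (fun y hy => ?_) (convex_closedBall _ _) (by simp) (by simp [dist_eq_norm])
  · rw [Real.norm_eq_abs] at this
    rw [inner_gradient_eq]
    linarith
  · have h2 := hL.dist_le_mul y a
    rw [dist_eq_norm, dist_eq_norm] at h2
    rw [mem_closedBall_iff_norm] at hy
    exact h2.trans (mul_le_mul_of_nonneg_left hy L.2)

variable {κ : Measure (Euc d)} {R m : ℝ} {y y' : Euc d}

theorem integral_mixDirac (h0 : 0 ≤ m) (h1 : m ≤ 1) {f : Euc d → ℝ}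
    (hf : Integrable f (mixDirac m κ y)) :
    ∫ x, f x ∂(mixDirac m κ y) = (1 - m) * ∫ x, f x ∂κ + m * f y := by
  rw [mixDirac] at hf ⊢
  rw [integral_add_measure hf.left_of_add_measure hf.right_of_add_measure, integral_smul_measure,
    integral_smul_measure, integral_dirac, ENNReal.toReal_ofReal (by linarith),
    ENNReal.toReal_ofReal h0]
  rfl

/-- Little is known about the optimal plan except its marginals and a bound on its cost. Tangency
helps: for `ξ = ∇ψ` the integral is a difference of integrals of `ψ`, thus a function of the
marginals, up to the cost. The passage from `ξ` to `∇ψ` is Young's inequality with a free parameter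
`lam`. -/
theorem abs_integral_inner_sub_le (hκ : ProbOn (Metric.closedBall 0 R) κ) (h0 : 0 < m)
    (h1 : m ≤ 1) (hy : y ∈ Metric.closedBall 0 R) (hy' : y' ∈ Metric.closedBall 0 R) {ξ : Euc d → Euc d}
    (hξ : MemLp ξ 2 (mixDirac m κ y)) {ψ : Euc d → ℝ} (hψ : ContDiff ℝ ∞ ψ)
    (hψc : HasCompactSupport ψ) {C : ℝ} (hC : 0 ≤ C)
    (hT : ∀ a b, |ψ b - ψ a - ⟪gradient ψ a, b - a⟫_ℝ| ≤ C * ‖b - a‖ ^ 2)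
    {γ : Measure (Euc d × Euc d)} (hγ : γ ∈ optimalPlans (mixDirac m κ y) (mixDirac m κ y'))
    {lam : ℝ} (hlam : 0 < lam) :
    |∫ z, ⟪ξ z.1, z.2 - z.1⟫_ℝ ∂γ - m * (ψ y' - ψ y)| ≤
      lam / 2 * ∫ x, ‖ξ x - gradient ψ x‖ ^ 2 ∂(mixDirac m κ y) +
        (1 / (2 * lam) + C) * (m * dist y y' ^ 2) := by
  have hBm : MeasurableSet (Metric.closedBall (0 : Euc d) R) := Metric.isClosed_closedBall.measurableSet
  have hρ := hκ.mixDirac hBm h0.le h1 hy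
  have hρ' := hκ.mixDirac hBm h0.le h1 hy'
  obtain ⟨⟨hγ1, hγ2⟩, hopt⟩ := hγ
  have hpρ := hρ.1
  have hγp : IsProbabilityMeasure γ := by
    constructor
    rw [← hpρ.measure_univ, ← hγ1, Measure.map_apply measurable_fst MeasurableSet.univ, preimage_univ]
  have hz1 : ∀ᵐ z ∂γ, z.1 ∈ Metric.closedBall (0 : Euc d) R :=
    ae_of_ae_map measurable_fst.aemeasurable (by rw [hγ1]; exact hρ.ae_mem)
  have hz2 : ∀ᵐ z ∂γ, z.2 ∈ Metric.closedBall (0 : Euc d) R :=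
    ae_of_ae_map measurable_snd.aemeasurable (by rw [hγ2]; exact hρ'.ae_mem)
  have hdb : ∀ᵐ z ∂γ, ‖z.2 - z.1‖ ≤ R + R := by
    filter_upwards [hz1, hz2] with z h1 h2
    rw [mem_closedBall_zero_iff] at h1 h2
    exact (norm_sub_le _ _).trans (add_le_add h2 h1)
  have hdL : MemLp (fun z : Euc d × Euc d => z.2 - z.1) 2 γ :=
    MemLp.of_bound (by fun_prop) (R + R) hdb
  have hgc : Continuous (gradient ψ) := by
    have : Continuous (fderiv ℝ ψ) := hψ.continuous_fderiv (by simp)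
    exact (InnerProductSpace.toDual ℝ (Euc d)).symm.continuous.comp this
  have hgcs : HasCompactSupport (gradient ψ) :=
    (hψc.fderiv ℝ).comp_left (g := (InnerProductSpace.toDual ℝ (Euc d)).symm) (map_zero _)
  have hgρ : MemLp (gradient ψ) 2 (mixDirac m κ y) := hgc.memLp_of_hasCompactSupport hgcs
  have hdiff : MemLp (fun x => ξ x - gradient ψ x) 2 (mixDirac m κ y) := hξ.sub hgρ
  have hmp : MeasurePreserving (Prod.fst : Euc d × Euc d → Euc d) γ (mixDirac m κ y) := ⟨measurable_fst, hγ1⟩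
  have hξγ : MemLp (fun z : Euc d × Euc d => ξ z.1) 2 γ := hξ.comp_measurePreserving hmp
  have hgγ : MemLp (fun z : Euc d × Euc d => gradient ψ z.1) 2 γ := hgρ.comp_measurePreserving hmp
  have hdγ : MemLp (fun z : Euc d × Euc d => ξ z.1 - gradient ψ z.1) 2 γ :=
    hdiff.comp_measurePreserving hmp
  have hinner : ∀ f : Euc d × Euc d → Euc d, MemLp f 2 γ →
      Integrable (fun z => ⟪f z, z.2 - z.1⟫_ℝ) γ := fun f hf =>
    ((hf.integrable one_le_two).norm.mul_const (R + R)).mono'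
      (hf.1.inner hdL.1) (by
        filter_upwards [hdb] with z hz
        exact (norm_inner_le_norm _ _).trans (mul_le_mul_of_nonneg_left hz (norm_nonneg _)))
  have i1 : Integrable (fun z : Euc d × Euc d => ⟪ξ z.1, z.2 - z.1⟫_ℝ) γ := hinner _ hξγ
  have i2 : Integrable (fun z : Euc d × Euc d => ⟪gradient ψ z.1, z.2 - z.1⟫_ℝ) γ :=
    hinner _ hgγ
  have i3 : Integrable (fun z : Euc d × Euc d => ‖ξ z.1 - gradient ψ z.1‖ ^ 2) γ := hdγ.integrable_norm_pow (by simp)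
  have i4 : Integrable (fun z : Euc d × Euc d => ‖z.2 - z.1‖ ^ 2) γ := hdL.integrable_norm_pow (by simp)
  have hψi : ∀ P : Measure (Euc d), IsProbabilityMeasure P → Integrable ψ P := fun P _ =>
    hψ.continuous.integrable_of_hasCompactSupport hψc
  have i5 : Integrable (fun z : Euc d × Euc d => ψ z.1) γ :=
    hmp.integrable_comp_of_integrable (hψi _ hρ.1)
  have i6 : Integrable (fun z : Euc d × Euc d => ψ z.2) γ :=
    MeasurePreserving.integrable_comp_of_integrable ⟨measurable_snd, hγ2⟩ (hψi _ hρ'.1)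
  have hcost : ∫ z, ‖z.2 - z.1‖ ^ 2 ∂γ ≤ m * dist y y' ^ 2 := by
    obtain ⟨γ', hγ', hc⟩ := transportCost_two_mixDirac h0.le κ y y'
    have h3 := hopt γ' hγ'
    rw [hc, transportCost] at h3
    have h4 : ∫⁻ z, edist z.1 z.2 ^ (2 : ℝ) ∂γ = ∫⁻ z, ENNReal.ofReal (‖z.2 - z.1‖ ^ 2) ∂γ := by
      refine lintegral_congr fun z => ?_
      rw [edist_comm, edist_dist, dist_eq_norm, ENNReal.ofReal_pow (norm_nonneg _)]
      norm_cast
    rw [h4, ← ofReal_integral_eq_lintegral_ofReal i4 (Eventually.of_forall fun _ => by positivity)]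
      at h3
    exact (ENNReal.ofReal_le_ofReal_iff (by positivity)).1 h3
  have hA : ∫ z, ‖ξ z.1 - gradient ψ z.1‖ ^ 2 ∂γ =
      ∫ x, ‖ξ x - gradient ψ x‖ ^ 2 ∂(mixDirac m κ y) := by
    rw [← hγ1, integral_map measurable_fst.aemeasurable]
    rw [hγ1]
    exact (hdiff.1.norm.pow 2)
  have hiii : ∫ z, (ψ z.2 - ψ z.1) ∂γ = m * (ψ y' - ψ y) := by
    have e1 : ∫ z, ψ z.1 ∂γ = ∫ x, ψ x ∂(mixDirac m κ y) := by
      rw [← hγ1, integral_map measurable_fst.aemeasurable hψ.continuous.aestronglyMeasurable]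
    have e2 : ∫ z, ψ z.2 ∂γ = ∫ x, ψ x ∂(mixDirac m κ y') := by
      rw [← hγ2, integral_map measurable_snd.aemeasurable hψ.continuous.aestronglyMeasurable]
    rw [integral_sub i6 i5, e1, e2, integral_mixDirac h0.le h1 (hψi _ hρ.1),
      integral_mixDirac h0.le h1 (hψi _ hρ'.1)]
    ring
  have b1 : |∫ z, ⟪ξ z.1, z.2 - z.1⟫_ℝ ∂γ - ∫ z, ⟪gradient ψ z.1, z.2 - z.1⟫_ℝ ∂γ| ≤
      lam / 2 * ∫ z, ‖ξ z.1 - gradient ψ z.1‖ ^ 2 ∂γ + 1 / (2 * lam) * ∫ z, ‖z.2 - z.1‖ ^ 2 ∂γ := by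
    rw [← integral_sub i1 i2, ← integral_const_mul, ← integral_const_mul,
      ← integral_add (i3.const_mul _) (i4.const_mul _), ← Real.norm_eq_abs]
    refine norm_integral_le_of_norm_le ((i3.const_mul _).add (i4.const_mul _))
      (Eventually.of_forall fun z => ?_)
    rw [← inner_sub_left]
    refine (norm_inner_le_norm _ _).trans ?_
    set a := ‖ξ z.1 - gradient ψ z.1‖
    set b := ‖z.2 - z.1‖
    have : lam / 2 * a ^ 2 + 1 / (2 * lam) * b ^ 2 - a * b = (lam * a - b) ^ 2 / (2 * lam) := by
      field_simp; ring
    have h5 : 0 ≤ (lam * a - b) ^ 2 / (2 * lam) := by positivity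
    linarith
  have b2 : |∫ z, (ψ z.2 - ψ z.1) ∂γ - ∫ z, ⟪gradient ψ z.1, z.2 - z.1⟫_ℝ ∂γ| ≤
      C * ∫ z, ‖z.2 - z.1‖ ^ 2 ∂γ := by
    have i7 : Integrable (fun z : Euc d × Euc d => ψ z.2 - ψ z.1) γ := i6.sub i5
    rw [← integral_sub i7 i2, ← integral_const_mul, ← Real.norm_eq_abs]
    exact norm_integral_le_of_norm_le (i4.const_mul _) (Eventually.of_forall fun z => hT _ _)
  rw [hiii] at b2
  rw [hA] at b1
  have b3 : (1 / (2 * lam) + C) * ∫ z, ‖z.2 - z.1‖ ^ 2 ∂γ ≤ (1 / (2 * lam) + C) * (m * dist y y' ^ 2) :=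
    mul_le_mul_of_nonneg_left hcost (by positivity)
  rw [abs_sub_comm] at b2
  refine (abs_sub_le _ _ _).trans ((add_le_add b1 b2).trans ?_)
  linarith

theorem mem_support_mixDirac (h0 : 0 < m) : y ∈ (mixDirac m κ y).support := by
  rw [Measure.mem_support_iff_forall]
  intro W hW
  have h1 : ENNReal.ofReal m * Measure.dirac y W ≤ mixDirac m κ y W := by
    rw [mixDirac, Measure.add_apply, Measure.smul_apply, Measure.smul_apply, smul_eq_mul,
      smul_eq_mul]
    exact le_add_self
  refine lt_of_lt_of_le ?_ h1
  rw [Measure.dirac_apply_of_mem (mem_of_mem_nhds hW), mul_one]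
  exact ENNReal.ofReal_pos.2 h0

/-- The mass carried by `κ` stays in the support, and since `m > 0` the atom `y` belongs to the
support, within distance `1` of `y'`. -/
theorem probOn_fattening_mixDirac (hκ : IsProbabilityMeasure κ) (h0 : 0 < m) (h1 : m ≤ 1)
    (hyy' : dist y y' ≤ 1) : ProbOn (fattening 1 (mixDirac m κ y)) (mixDirac m κ y') := by
  have hp : ∀ z, ProbOn univ (mixDirac m κ z) := fun z =>
    ProbOn.mixDirac ⟨hκ, by simp⟩ MeasurableSet.univ h0.le h1 (mem_univ z)
  refine ⟨(hp y').1, ?_⟩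
  have hsub : (mixDirac m κ y).support ⊆ fattening 1 (mixDirac m κ y) := fun x hx =>
    mem_iUnion₂.2 ⟨x, hx, by simp⟩
  have hnull : mixDirac m κ y (fattening 1 (mixDirac m κ y))ᶜ = 0 :=
    measure_mono_null (compl_subset_compl.2 hsub) Measure.measure_compl_support
  have hmem : y' ∈ fattening 1 (mixDirac m κ y) :=
    mem_iUnion₂.2 ⟨y, mem_support_mixDirac h0, by rwa [Metric.mem_closedBall, dist_comm]⟩
  set S := (fattening 1 (mixDirac m κ y))ᶜ with hS
  rw [mixDirac, Measure.add_apply, add_eq_zero] at hnull ⊢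
  refine ⟨hnull.1, ?_⟩
  rw [Measure.smul_apply, Measure.dirac_apply, indicator_of_notMem (by simpa [hS] using hmem),
    smul_zero]

theorem wasserstein_two_mixDirac_le (h0 : 0 ≤ m) (h1 : m ≤ 1) :
    (wasserstein 2 (mixDirac m κ y) (mixDirac m κ y')).toReal ≤ dist y y' := by
  refine ENNReal.toReal_le_of_le_ofReal dist_nonneg ?_
  obtain ⟨γ, hγ, hc⟩ := transportCost_two_mixDirac h0 κ y y'
  have h2 : (⨅ γ ∈ transportPlans (mixDirac m κ y) (mixDirac m κ y'), transportCost 2 γ) ≤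
      ENNReal.ofReal (dist y y') ^ (2 : ℝ) := by
    refine (iInf₂_le γ hγ).trans ?_
    rw [hc, ENNReal.ofReal_rpow_of_nonneg dist_nonneg (by norm_num)]
    refine ENNReal.ofReal_le_ofReal ?_
    norm_cast
    exact mul_le_of_le_one_left (by positivity) h1
  rw [wasserstein]
  refine (ENNReal.rpow_le_rpow h2 (by norm_num)).trans_eq ?_
  rw [← ENNReal.rpow_mul]
  norm_num

/-- The Wasserstein gradient computes the derivative of a functional when an atom moves. -/
theorem IsWassersteinGradient.tendsto_mixDirac {φ : Measure (Euc d) → ℝ} {ξ : Euc d → Euc d}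
    (hκ : ProbOn (Metric.closedBall 0 R) κ) (h0 : 0 < m) (h1 : m ≤ 1)
    (hy : y ∈ Metric.closedBall 0 R) (h : IsWassersteinGradient φ (mixDirac m κ y) ξ) (e : Euc d) :
    Tendsto (fun s : ℝ => (m * s)⁻¹ * (φ (mixDirac m κ (y + s • e)) - φ (mixDirac m κ y)))
      (𝓝[>] 0) (𝓝 ⟪ξ y, e⟫_ℝ) := by
  obtain ⟨htan, ⟨hξ, hsub⟩, hsup⟩ := h
  have hsup := hsup.2
  have hκR : ProbOn (Metric.closedBall 0 (R + 1)) κ :=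
    hκ.mono (Metric.closedBall_subset_closedBall (by linarith))
  have hyR : y ∈ Metric.closedBall (0 : Euc d) (R + 1) :=
    Metric.closedBall_subset_closedBall (by linarith) hy
  have hρ := hκ.mixDirac Metric.isClosed_closedBall.measurableSet h0.le h1 hy
  have hpρ := hρ.1
  rw [Metric.tendsto_nhds]
  intro η hη
  -- `B` dominates the coefficients of all errors linear in `ε`, and `ε` is chosen so that `ε * B`
  -- is a quarter of `η * m`.
  set B : ℝ := 2 * ‖e‖ + 1 + ‖e‖ ^ 2 with hB
  have hB0 : 0 < B := by positivity
  set ε := η * m / (4 * B) with hε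
  have hε0 : 0 < ε := by positivity
  obtain ⟨ψ, hψ, hψc, hψε⟩ := htan.2 (ENNReal.ofReal ε) (ENNReal.ofReal_pos.2 hε0)
  obtain ⟨C, hC, hT⟩ := exists_taylor_of_hasCompactSupport hψ hψc
  have hgc : Continuous (gradient ψ) := by
    have : Continuous (fderiv ℝ ψ) := hψ.continuous_fderiv (by simp)
    exact (InnerProductSpace.toDual ℝ (Euc d)).symm.continuous.comp this
  have hgcs : HasCompactSupport (gradient ψ) :=
    (hψc.fderiv ℝ).comp_left (g := (InnerProductSpace.toDual ℝ (Euc d)).symm) (map_zero _)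
  have hdiff : MemLp (fun x => ξ x - gradient ψ x) 2 (mixDirac m κ y) :=
    hξ.sub (hgc.memLp_of_hasCompactSupport hgcs)
  have hdi : Integrable (fun x => ‖ξ x - gradient ψ x‖ ^ 2) (mixDirac m κ y) :=
    hdiff.integrable_norm_pow (by simp)
  have hA : ∫ x, ‖ξ x - gradient ψ x‖ ^ 2 ∂(mixDirac m κ y) ≤ ε ^ 2 := by
    rw [hdiff.eLpNorm_eq_integral_rpow_norm (by simp) (by simp),
      ENNReal.ofReal_le_ofReal_iff hε0.le] at hψε
    simp only [ENNReal.toReal_ofNat, Real.rpow_ofNat] at hψε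
    rwa [← one_div, ← Real.sqrt_eq_rpow, Real.sqrt_le_left hε0.le] at hψε
  -- An atom of mass `m` turns closeness in `L²` into closeness at the point `y`; this is why the
  -- mixture is used.
  have hatom : m * ‖ξ y - gradient ψ y‖ ^ 2 ≤ ε ^ 2 := by
    rw [integral_mixDirac h0.le h1 hdi] at hA
    have h5 : 0 ≤ (1 - m) * ∫ x, ‖ξ x - gradient ψ x‖ ^ 2 ∂κ :=
      mul_nonneg (by linarith) (integral_nonneg fun _ => by positivity)
    linarith
  have hatom' : m * ‖ξ y - gradient ψ y‖ ≤ ε := by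
    have h6 : (m * ‖ξ y - gradient ψ y‖) ^ 2 ≤ ε ^ 2 := by
      have := mul_le_mul_of_nonneg_left hatom h0.le
      nlinarith [sq_nonneg ε]
    exact (sq_le_sq₀ (by positivity) hε0.le).1 h6
  obtain ⟨δ₁, hδ₁, hsub⟩ := hsub 1 one_pos ε hε0
  obtain ⟨δ₂, hδ₂, hsup⟩ := hsup 1 one_pos ε hε0
  have hev : ∀ c : ℝ, 0 < c → ∀ᶠ s : ℝ in 𝓝[>] 0, s * (‖e‖ + 1) ≤ c := by
    intro c hc
    have : Tendsto (fun s : ℝ => s * (‖e‖ + 1)) (𝓝[>] 0) (𝓝 (0 * (‖e‖ + 1))) :=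
      (tendsto_id.mono_left nhdsWithin_le_nhds).mul_const _
    rw [zero_mul] at this
    exact (this.eventually (gt_mem_nhds hc)).mono fun _ h => le_of_lt h
  filter_upwards [self_mem_nhdsWithin, hev 1 one_pos, hev δ₁ hδ₁, hev δ₂ hδ₂,
    hev (η * m / (4 * (C + 1) * (‖e‖ + 1) ^ 2)) (by positivity)] with s hs hs1 hs2 hs3 hs4
  have hs0 : 0 < s := hs
  set y' := y + s • e with hy'
  have hdist : dist y y' = s * ‖e‖ := by
    rw [hy', dist_self_add_right, norm_smul, Real.norm_of_nonneg hs0.le]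
  have hle : s * ‖e‖ ≤ s * (‖e‖ + 1) := by nlinarith
  have hyR' : y' ∈ Metric.closedBall (0 : Euc d) (R + 1) := by
    rw [mem_closedBall_zero_iff] at hy ⊢
    refine (norm_add_le _ _).trans ?_
    rw [norm_smul, Real.norm_of_nonneg hs0.le]
    linarith
  have hfat := probOn_fattening_mixDirac (m := m) hκ.1 h0 h1
    (show dist y y' ≤ 1 by rw [hdist]; linarith)
  have hW := wasserstein_two_mixDirac_le (κ := κ) (y := y) (y' := y') h0.le h1
  rw [hdist] at hW
  -- The sub- and the superdifferential may provide different optimal plans; the estimate used for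
  -- them holds for every optimal plan.
  obtain ⟨γ₁, hγ₁, hg1⟩ := hsub _ hfat (by linarith)
  obtain ⟨γ₂, hγ₂, hg2⟩ := hsup _ hfat (by linarith)
  -- This value of the Young parameter balances the two terms: both become of order `s * ε`, small
  -- compared with `m * s * η`.
  have hlam : 0 < s / ε := by positivity
  have k1 := abs_integral_inner_sub_le hκR h0 h1 hyR hyR' hξ hψ hψc hC hT hγ₁ hlam
  have k2 := abs_integral_inner_sub_le hκR h0 h1 hyR hyR' hξ hψ hψc hC hT hγ₂ hlam
  simp only [inner_neg_left, integral_neg] at hg2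
  set Δ := φ (mixDirac m κ y') - φ (mixDirac m κ y) with hΔ
  set W := (wasserstein 2 (mixDirac m κ y) (mixDirac m κ y')).toReal with hWdef
  set Q := s / ε / 2 * ∫ x, ‖ξ x - gradient ψ x‖ ^ 2 ∂(mixDirac m κ y) +
        (1 / (2 * (s / ε)) + C) * (m * dist y y' ^ 2) with hQ
  have hQle : Q ≤ s * (ε / 2 + ε * ‖e‖ ^ 2 / 2 + C * s * ‖e‖ ^ 2) := by
    have q1 : s / ε / 2 * ∫ x, ‖ξ x - gradient ψ x‖ ^ 2 ∂(mixDirac m κ y) ≤ s / ε / 2 * ε ^ 2 :=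
      mul_le_mul_of_nonneg_left hA (by positivity)
    have q2 : (1 / (2 * (s / ε)) + C) * (m * dist y y' ^ 2) ≤
        (1 / (2 * (s / ε)) + C) * (s * ‖e‖) ^ 2 := by
      rw [hdist]
      exact mul_le_mul_of_nonneg_left (mul_le_of_le_one_left (by positivity) h1) (by positivity)
    refine (add_le_add q1 q2).trans_eq ?_
    field_simp
    ring
  have hεW : ε * W ≤ ε * (s * ‖e‖) := mul_le_mul_of_nonneg_left hW hε0.le
  have k3 : |Δ - m * (ψ y' - ψ y)| ≤ Q + ε * (s * ‖e‖) := by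
    rw [abs_le] at *
    constructor <;> linarith [k1.1, k1.2, k2.1, k2.2]
  have k4 : |m * (ψ y' - ψ y) - m * s * ⟪gradient ψ y, e⟫_ℝ| ≤ C * (s * ‖e‖) ^ 2 := by
    have h6 := hT y y'
    rw [hy', add_sub_cancel_left, inner_smul_right, norm_smul, Real.norm_of_nonneg hs0.le, ← hy'] at h6
    have e2 : m * (ψ y' - ψ y) - m * s * ⟪gradient ψ y, e⟫_ℝ =
        m * (ψ y' - ψ y - s * ⟪gradient ψ y, e⟫_ℝ) := by ring
    rw [e2, abs_mul, abs_of_pos h0]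
    exact (mul_le_of_le_one_left (abs_nonneg _) h1).trans h6
  have k5 : |m * s * ⟪gradient ψ y, e⟫_ℝ - m * s * ⟪ξ y, e⟫_ℝ| ≤ s * (ε * ‖e‖) := by
    rw [← mul_sub, ← inner_sub_left, abs_mul, abs_of_pos (by positivity)]
    have h6 := abs_real_inner_le_norm (gradient ψ y - ξ y) e
    rw [norm_sub_rev] at h6
    calc m * s * |⟪gradient ψ y - ξ y, e⟫_ℝ| ≤ m * s * (‖ξ y - gradient ψ y‖ * ‖e‖) :=
          mul_le_mul_of_nonneg_left h6 (by positivity)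
      _ = s * ((m * ‖ξ y - gradient ψ y‖) * ‖e‖) := by ring
      _ ≤ s * (ε * ‖e‖) := by gcongr
  have k6 : |Δ - m * s * ⟪ξ y, e⟫_ℝ| < m * s * η := by
    have hm4 : ε * B = η * m / 4 := by rw [hε]; field_simp
    have hε1 : ε * (1 / 2 + ‖e‖ ^ 2 / 2 + 2 * ‖e‖) ≤ η * m / 4 := by
      rw [← hm4, hB]
      refine mul_le_mul_of_nonneg_left ?_ hε0.le
      nlinarith [norm_nonneg e]
    have hs5 : C * s * ‖e‖ ^ 2 ≤ η * m / 4 := by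
      rw [le_div_iff₀ (by positivity)] at hs4
      have p1 : C * s * ‖e‖ ^ 2 ≤ (C + 1) * s * (‖e‖ + 1) ^ 2 := by
        have := norm_nonneg e
        gcongr <;> linarith
      have p2 : (C + 1) * s * (‖e‖ + 1) ^ 2 ≤ (C + 1) * s * (‖e‖ + 1) ^ 2 * (‖e‖ + 1) :=
        le_mul_of_one_le_right (by positivity) (by linarith [norm_nonneg e])
      linarith
    have h7 : |Δ - m * s * ⟪ξ y, e⟫_ℝ| ≤ (Q + ε * (s * ‖e‖)) + C * (s * ‖e‖) ^ 2 + s * (ε * ‖e‖) := by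
      rw [abs_le] at *
      constructor <;> linarith [k3.1, k3.2, k4.1, k4.2, k5.1, k5.2]
    have h8 : (Q + ε * (s * ‖e‖)) + C * (s * ‖e‖) ^ 2 + s * (ε * ‖e‖) ≤
        s * (ε * (1 / 2 + ‖e‖ ^ 2 / 2 + 2 * ‖e‖)) + s * (2 * (C * s * ‖e‖ ^ 2)) := by
      linarith
    have h9 := mul_le_mul_of_nonneg_left hε1 hs0.le
    have h10 := mul_le_mul_of_nonneg_left hs5 hs0.le
    have h11 : 0 < s * (η * m) := by positivity
    linarith
  rw [Real.dist_eq]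
  have hms : 0 < m * s := by positivity
  have e1 : (m * s)⁻¹ * Δ - ⟪ξ y, e⟫_ℝ = (m * s)⁻¹ * (Δ - m * s * ⟪ξ y, e⟫_ℝ) := by
    field_simp
  rw [e1, abs_mul, abs_of_pos (inv_pos.2 hms), inv_mul_lt_iff₀ hms]
  exact k6

end Gradient


/-! ### Consequences of the standing hypotheses -/

section Hyp

variable {d : ℕ} {U : Type*}

theorem adjoint_single_inner (D : Euc d →L[ℝ] Euc d) (i : Fin d) (e : Euc d) :
    ⟪ContinuousLinearMap.adjoint D (EuclideanSpace.single i 1), e⟫_ℝ = D e i := by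
  rw [ContinuousLinearMap.adjoint_inner_left, EuclideanSpace.inner_single_left]
  simp

theorem tendsto_euclidean {α : Type*} {l : Filter α} {f : α → Euc d} {a : Euc d}
    (h : ∀ i, Tendsto (fun s => f s i) l (𝓝 (a i))) : Tendsto f l (𝓝 a) := by
  rw [(EuclideanSpace.equiv (Fin d) ℝ).toHomeomorph.isInducing.tendsto_nhds_iff, tendsto_pi_nhds]
  exact h

theorem aestronglyMeasurable_euclidean {α : Type*} [MeasurableSpace α] {P : Measure α}
    {f : α → Euc d} (h : ∀ i, AEStronglyMeasurable (fun t => f t i) P) :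
    AEStronglyMeasurable f P := by
  have e : f = fun t => ∑ i, f t i • EuclideanSpace.single i (1 : ℝ) := by
    ext t j
    simp [Finset.sum_apply, Pi.single_apply]
  rw [e]
  exact Finset.aestronglyMeasurable_fun_sum _ fun i _ => (h i).smul_const _

theorem IsWassersteinDifferential.tendsto_mixDirac {Φ : Measure (Euc d) → Euc d}
    {D : Euc d → Euc d →L[ℝ] Euc d} {κ : Measure (Euc d)} {R m : ℝ} {y : Euc d}
    (hκ : ProbOn (Metric.closedBall 0 R) κ) (h0 : 0 < m) (h1 : m ≤ 1)
    (hy : y ∈ Metric.closedBall 0 R) (h : IsWassersteinDifferential Φ (mixDirac m κ y) D)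
    (e : Euc d) :
    Tendsto (fun s : ℝ => (m * s)⁻¹ • (Φ (mixDirac m κ (y + s • e)) - Φ (mixDirac m κ y)))
      (𝓝[>] 0) (𝓝 (D y e)) := by
  refine tendsto_euclidean fun i => ?_
  have := (h i).tendsto_mixDirac hκ h0 h1 hy e
  rw [adjoint_single_inner] at this
  exact this

theorem IsPc.mixDirac {κ : Measure (Euc d)} {R m : ℝ} {y : Euc d}
    (hκ : ProbOn (Metric.closedBall 0 R) κ) (h0 : 0 ≤ m) (h1 : m ≤ 1)
    (hy : y ∈ Metric.closedBall 0 R) : IsPc (mixDirac m κ y) :=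
  (hκ.mixDirac Metric.isClosed_closedBall.measurableSet h0 h1 hy).isPc (isCompact_closedBall _ _)
    Metric.isClosed_closedBall

theorem tendsto_wasserstein_mixDirac {κ : Measure (Euc d)} {R : ℝ} {y : Euc d}
    (hκ : ProbOn (Metric.closedBall 0 R) κ) (hy : y ∈ Metric.closedBall 0 R) :
    Tendsto (fun n : ℕ => wasserstein 1 (mixDirac (1 / ((n : ℝ) + 1)) κ y) κ) atTop (𝓝 0) := by
  have hR : 0 ≤ R := by
    rw [mem_closedBall_zero_iff] at hy
    exact (norm_nonneg y).trans hy
  have h1 : Tendsto (fun n : ℕ => ENNReal.ofReal (1 / ((n : ℝ) + 1) * (2 * R))) atTop (𝓝 0) := by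
    have := (tendsto_one_div_add_atTop_nhds_zero_nat (𝕜 := ℝ)).mul_const (2 * R)
    rw [zero_mul] at this
    simpa using ENNReal.tendsto_ofReal this
  refine tendsto_of_tendsto_of_tendsto_of_le_of_le tendsto_const_nhds h1 (fun _ => zero_le) fun n => ?_
  refine wasserstein_one_mixDirac_self_le (by positivity) ?_ hκ hy fun x hx z hz => ?_
  · rw [div_le_one (by positivity)]
    linarith [(Nat.cast_nonneg n : (0 : ℝ) ≤ n)]
  · rw [mem_closedBall_zero_iff] at hx hz
    rw [dist_eq_norm]
    linarith [norm_sub_le x z]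

variable {T : ℝ}
  {v : ℝ → Measure (Euc d) → U → Euc d → Euc d}
  {Dv : ℝ → Measure (Euc d) → U → Euc d → Euc d → Euc d →L[ℝ] Euc d}
  {φ : Measure (Euc d) → ℝ} {gradφ : Measure (Euc d) → Euc d → Euc d}

/-- The Lipschitz constants bound the derivatives. For the measure derivative at `y`, give the
measure an atom of mass `m` at `y`: moving it by `s • e` changes the measure by at most `m * s *
‖e‖` in `W₁`, so the difference quotients are bounded by `L` for every `m`. Continuity of the
derivative then allows `m → 0`. -/
theorem HypOCP.exists_bounds [TopologicalSpace U] (h : HypOCP T v Dv φ gradφ) {R : ℝ}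
    (hR : 0 < R) :
    ∃ l L : ℝ → ℝ, IsL1Nonneg T l ∧ IsL1Nonneg T L ∧
      ∀ᵐ t ∂(volume.restrict (Icc 0 T)), ∀ u,
        ∀ ρ, ProbOn (Metric.closedBall 0 R) ρ → ∀ x ∈ Metric.closedBall (0 : Euc d) R,
          (∀ y ∈ Metric.closedBall (0 : Euc d) R, ‖v t ρ u x - v t ρ u y‖ ≤ l t * ‖x - y‖) ∧
          (∀ ρ', ProbOn (Metric.closedBall 0 R) ρ' →
            ‖v t ρ u x - v t ρ' u x‖ ≤ L t * (wasserstein 1 ρ ρ').toReal) ∧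
          ‖fderiv ℝ (v t ρ u) x‖ ≤ l t ∧
          ∀ y ∈ Metric.closedBall (0 : Euc d) R, ‖Dv t ρ u x y‖ ≤ L t := by
  -- The extra unit of radius leaves room for the displaced points and atoms in the difference
  -- quotients.
  obtain ⟨l, L, hl, hL, hlL⟩ := h.lipschitz (R + 1) (by linarith)
  have hsubR : Metric.closedBall (0 : Euc d) R ⊆ Metric.closedBall 0 (R + 1) :=
    Metric.closedBall_subset_closedBall (by linarith)
  have hBm : MeasurableSet (Metric.closedBall (0 : Euc d) (R + 1)) :=
    Metric.isClosed_closedBall.measurableSet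
  refine ⟨l, L, hl, hL, ?_⟩
  filter_upwards [hlL, h.differentiable_measure, h.continuous_measure_deriv (R + 1) (by linarith)]
    with t h1 h2 h3 u ρ hρ x hx
  have hρ' := hρ.mono hsubR
  have hx' := hsubR hx
  refine ⟨fun y hy => (h1 u ρ ρ hρ' hρ' x hx' y (hsubR hy)).1,
    fun ρ' hρ2 => (h1 u ρ ρ' hρ' (hρ2.mono hsubR) x hx' x hx').2, ?_, fun y hy => ?_⟩
  · refine norm_fderiv_le_of_lip' ℝ (hl.2 t) ?_
    filter_upwards [Metric.ball_mem_nhds x one_pos] with z hz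
    refine (h1 u ρ ρ hρ' hρ' z ?_ x hx').1
    rw [mem_closedBall_zero_iff] at hx ⊢
    rw [mem_ball_iff_norm] at hz
    linarith [norm_le_norm_add_norm_sub' z x]
  · have hm1 : ∀ m : ℝ, 0 < m → m ≤ 1 → ‖Dv t (mixDirac m ρ y) u x y‖ ≤ L t := by
      intro m hm0 hm1
      refine ContinuousLinearMap.opNorm_le_bound _ (hL.2 t) fun e => ?_
      have hlim := (h2 u x _ (IsPc.mixDirac hρ hm0.le hm1 hy)).tendsto_mixDirac hρ hm0 hm1 hy e
      refine le_of_tendsto hlim.norm ?_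
      have hsm : ∀ᶠ s : ℝ in 𝓝[>] 0, s * ‖e‖ ≤ 1 := by
        have : Tendsto (fun s : ℝ => s * ‖e‖) (𝓝[>] 0) (𝓝 (0 * ‖e‖)) :=
          (tendsto_id.mono_left nhdsWithin_le_nhds).mul_const _
        rw [zero_mul] at this
        exact (this.eventually (gt_mem_nhds one_pos)).mono fun _ h => le_of_lt h
      filter_upwards [self_mem_nhdsWithin, hsm] with s hs hs1
      have hs0 : 0 < s := hs
      have hy' : y + s • e ∈ Metric.closedBall (0 : Euc d) (R + 1) := by
        rw [mem_closedBall_zero_iff] at hy ⊢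
        refine (norm_add_le _ _).trans ?_
        rw [norm_smul, Real.norm_of_nonneg hs0.le]
        linarith
      have h4 := (h1 u _ _ (hρ'.mixDirac hBm hm0.le hm1 hy')
        (hρ'.mixDirac hBm hm0.le hm1 (hsubR hy)) x hx' x hx').2
      have h5 := ENNReal.toReal_le_of_le_ofReal (by positivity)
        (wasserstein_one_mixDirac_le hm0.le ρ (y + s • e) y)
      rw [dist_eq_norm, add_sub_cancel_left, norm_smul, Real.norm_of_nonneg hs0.le] at h5
      rw [norm_smul, norm_inv, Real.norm_of_nonneg (by positivity), inv_mul_le_iff₀ (by positivity)]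
      refine h4.trans ((mul_le_mul_of_nonneg_left h5 (hL.2 t)).trans_eq (by ring))
    -- The atom is removed along masses `1 / (n + 1)`, with both points kept fixed.
    have hlim := h3 u (fun n => mixDirac (1 / ((n : ℝ) + 1)) ρ y) ρ (fun _ => (x, y)) (x, y)
      (fun n => hρ'.mixDirac hBm (by positivity) (by
        rw [div_le_one (by positivity)]
        linarith [(Nat.cast_nonneg n : (0 : ℝ) ≤ n)]) (hsubR hy)) hρ' (fun _ => ⟨hx', hsubR hy⟩)
      ⟨hx', hsubR hy⟩ (tendsto_wasserstein_mixDirac hρ hy) tendsto_const_nhds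
    refine le_of_tendsto hlim.norm (Eventually.of_forall fun n => hm1 _ (by positivity) ?_)
    rw [div_le_one (by positivity)]
    linarith [(Nat.cast_nonneg n : (0 : ℝ) ≤ n)]

/-- Measurability in time of the velocity along a curve of measures and a control. -/
theorem HypOCP.aestronglyMeasurable_velocity [MetricSpace U] (h : HypOCP T v Dv φ gradφ)
    (hT : 0 ≤ T) {u : ℝ → U} (hu : AEStronglyMeasurable u (volume.restrict (Icc 0 T)))
    {ρ : ℝ → Measure (Euc d)} {R : ℝ} (hR : 0 < R)
    (hρ : ∀ t ∈ Icc 0 T, ProbOn (Metric.closedBall 0 R) (ρ t)) {m : ℝ → ℝ}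
    (hm : IsL1Nonneg T m) (hW : W1Bound T m ρ) (x : Euc d) :
    AEStronglyMeasurable (fun t => v t (ρ t) (u t) x) (volume.restrict (Icc 0 T)) := by
  obtain ⟨u', hu', huu'⟩ := hu
  suffices hs : AEStronglyMeasurable (fun t => v t (ρ (clampTime T t)) (u' t) x)
      (volume.restrict (Icc 0 T)) by
    refine hs.congr ?_
    filter_upwards [huu', ae_restrict_mem measurableSet_Icc] with t h1 h2
    rw [h1, clampTime_of_mem h2]
  have hpc : ∀ t, IsPc (ρ (clampTime T t)) := fun t =>
    (hρ _ (clampTime_mem hT t)).isPc (isCompact_closedBall _ _) Metric.isClosed_closedBall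
  -- The curve of measures is sampled on a grid of mesh `1 / (n + 1)` and the control is replaced by
  -- simple functions; only countably many pairs of frozen arguments occur, while the explicit time
  -- in `v` remains `t`. Grid points may leave `[0, T]`, hence the clamping.
  set q : ℕ → ℝ → ℝ := fun n t => (⌊((n : ℝ) + 1) * t⌋ : ℝ) / ((n : ℝ) + 1) with hq
  have hqlim : ∀ t, Tendsto (fun n => q n t) atTop (𝓝 t) := by
    intro t
    rw [tendsto_iff_norm_sub_tendsto_zero]
    refine squeeze_zero (fun _ => norm_nonneg _) (fun n => ?_)
      (tendsto_one_div_add_atTop_nhds_zero_nat (𝕜 := ℝ))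
    have hn : (0 : ℝ) < (n : ℝ) + 1 := by positivity
    have e : q n t - t = ((⌊((n : ℝ) + 1) * t⌋ : ℝ) - ((n : ℝ) + 1) * t) / ((n : ℝ) + 1) := by
      simp only [hq]; field_simp
    rw [e, norm_div, Real.norm_of_nonneg hn.le, Real.norm_eq_abs]
    gcongr
    rw [abs_le]
    constructor
    · linarith [Int.lt_floor_add_one (((n : ℝ) + 1) * t)]
    · linarith [Int.floor_le (((n : ℝ) + 1) * t)]
  have happ : ∀ n, AEStronglyMeasurable
      (fun t => v t (ρ (clampTime T (q n t))) (hu'.approx n t) x) (volume.restrict (Icc 0 T)) := by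
    intro n
    let S := (hu'.approx n).range
    let i : ℝ → ℤ × S := fun t => (⌊((n : ℝ) + 1) * t⌋, ⟨hu'.approx n t, SimpleFunc.mem_range_self _ t⟩)
    refine aestronglyMeasurable_comp_countable (i := i)
      (g := fun j t => v t (ρ (clampTime T ((j.1 : ℝ) / ((n : ℝ) + 1)))) j.2 x) ?_ ?_
    · rintro ⟨k, w, hw⟩
      have e : i ⁻¹' {(k, ⟨w, hw⟩)} =
          (fun t : ℝ => ⌊((n : ℝ) + 1) * t⌋) ⁻¹' {k} ∩ (hu'.approx n) ⁻¹' {w} := by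
        ext t
        simp [i, Prod.ext_iff, Subtype.ext_iff]
      rw [e]
      refine MeasurableSet.inter ?_ ((hu'.approx n).measurableSet_fiber w)
      exact (Int.measurable_floor.comp (measurable_const.mul measurable_id)) (measurableSet_singleton k)
    · rintro ⟨k, w, hw⟩
      exact h.measurable_time _ (hpc _) w x
  obtain ⟨l, L, -, hL, hlL⟩ := h.exists_bounds (R := R + ‖x‖) (by positivity)
  have hsubR : Metric.closedBall (0 : Euc d) R ⊆ Metric.closedBall 0 (R + ‖x‖) :=
    Metric.closedBall_subset_closedBall (by linarith [norm_nonneg x])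
  have hxb : x ∈ Metric.closedBall (0 : Euc d) (R + ‖x‖) := by
    rw [mem_closedBall_zero_iff]; linarith
  have hρ' : ∀ t, ProbOn (Metric.closedBall (0 : Euc d) (R + ‖x‖)) (ρ (clampTime T t)) := fun t =>
    (hρ _ (clampTime_mem hT t)).mono hsubR
  refine aestronglyMeasurable_of_tendsto_ae atTop happ ?_
  filter_upwards [hlL, h.continuous_control] with t h1 h2
  have hw0 : Tendsto (fun n => wasserstein 1 (ρ (clampTime T (q n t))) (ρ (clampTime T t))) atTop
      (𝓝 0) := (hW.tendsto_clampTime hT hm t).comp (hqlim t)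
  have hw1 : Tendsto (fun n => L t * (wasserstein 1 (ρ (clampTime T (q n t)))
      (ρ (clampTime T t))).toReal) atTop (𝓝 0) := by
    have := ((ENNReal.tendsto_toReal ENNReal.zero_ne_top).comp hw0).const_mul (L t)
    simpa using this
  have hlim1 : Tendsto (fun n => v t (ρ (clampTime T (q n t))) (hu'.approx n t) x -
      v t (ρ (clampTime T t)) (hu'.approx n t) x) atTop (𝓝 0) :=
    squeeze_zero_norm (fun n => (h1 (hu'.approx n t) _ (hρ' _) x hxb).2.1 _ (hρ' _)) hw1
  have hlim2 : Tendsto (fun n => v t (ρ (clampTime T t)) (hu'.approx n t) x) atTop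
      (𝓝 (v t (ρ (clampTime T t)) (u' t) x)) :=
    ((h2 _ (hpc t) x).tendsto _).comp (hu'.tendsto_approx t)
  simpa using hlim1.add hlim2

end Hyp


section Hyp

variable {d : ℕ} {U : Type*} [MetricSpace U] {T : ℝ}
  {v : ℝ → Measure (Euc d) → U → Euc d → Euc d}
  {Dv : ℝ → Measure (Euc d) → U → Euc d → Euc d → Euc d →L[ℝ] Euc d}
  {φ : Measure (Euc d) → ℝ} {gradφ : Measure (Euc d) → Euc d → Euc d}

theorem aestronglyMeasurable_adjoint_apply {α : Type*} [MeasurableSpace α] {P : Measure α}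
    {D : α → Euc d →L[ℝ] Euc d} (h : ∀ e, AEStronglyMeasurable (fun t => D t e) P) (p : Euc d) :
    AEStronglyMeasurable (fun t => ContinuousLinearMap.adjoint (D t) p) P := by
  refine aestronglyMeasurable_euclidean fun i => ?_
  have e : (fun t => ContinuousLinearMap.adjoint (D t) p i) =
      fun t => ⟪D t (EuclideanSpace.single i 1), p⟫_ℝ := by
    ext t
    rw [← ContinuousLinearMap.adjoint_inner_right, EuclideanSpace.inner_single_left]
    simp
  rw [e]
  exact (h _).inner aestronglyMeasurable_const

theorem HypOCP.aestronglyMeasurable_fderiv (h : HypOCP T v Dv φ gradφ)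
    (hT : 0 ≤ T) {u : ℝ → U} (hu : AEStronglyMeasurable u (volume.restrict (Icc 0 T)))
    {ρ : ℝ → Measure (Euc d)} {R : ℝ} (hR : 0 < R)
    (hρ : ∀ t ∈ Icc 0 T, ProbOn (Metric.closedBall 0 R) (ρ t)) {m : ℝ → ℝ}
    (hm : IsL1Nonneg T m) (hW : W1Bound T m ρ) (x e : Euc d) :
    AEStronglyMeasurable (fun t => fderiv ℝ (v t (ρ t) (u t)) x e) (volume.restrict (Icc 0 T)) := by
  have hmeas := fun z => h.aestronglyMeasurable_velocity hT hu hR hρ hm hW z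
  refine aestronglyMeasurable_of_tendsto_ae atTop (f := fun (n : ℕ) t =>
    ((n : ℝ) + 1) • (v t (ρ t) (u t) (x + ((n : ℝ) + 1)⁻¹ • e) - v t (ρ t) (u t) x))
    (fun n => ((hmeas (x + ((n : ℝ) + 1)⁻¹ • e)).sub (hmeas x)).const_smul ((n : ℝ) + 1)) ?_
  filter_upwards [h.differentiable_space, ae_restrict_mem measurableSet_Icc] with t h1 ht
  have hd := h1 (u t) (ρ t)
    ((hρ t ht).isPc (isCompact_closedBall _ _) Metric.isClosed_closedBall) x
  have hc : Tendsto (fun n : ℕ => (n : ℝ) + 1) atTop atTop :=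
    tendsto_atTop_add_const_right _ _ tendsto_natCast_atTop_atTop
  exact (hd.hasFDerivAt.lim_real e).comp hc

/-- Two successive limits of measurable functions: difference quotients along a moving atom of fixed
mass, and then vanishing mass. Adding a fixed atom does not increase `W₁`, so the perturbed curves
obey the same bound as `ρ`. -/
theorem HypOCP.aestronglyMeasurable_measureDeriv (h : HypOCP T v Dv φ gradφ)
    (hT : 0 ≤ T) {u : ℝ → U} (hu : AEStronglyMeasurable u (volume.restrict (Icc 0 T)))
    {ρ : ℝ → Measure (Euc d)} {R : ℝ} (hR : 0 < R)
    (hρ : ∀ t ∈ Icc 0 T, ProbOn (Metric.closedBall 0 R) (ρ t)) {m : ℝ → ℝ}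
    (hm : IsL1Nonneg T m) (hW : W1Bound T m ρ) {x y : Euc d} (hx : x ∈ Metric.closedBall 0 R)
    (hy : y ∈ Metric.closedBall 0 R) (e : Euc d) :
    AEStronglyMeasurable (fun t => Dv t (ρ t) (u t) x y e) (volume.restrict (Icc 0 T)) := by
  have hBm : MeasurableSet (Metric.closedBall (0 : Euc d) R) := Metric.isClosed_closedBall.measurableSet
  have hmix : ∀ m₁ : ℝ, 0 < m₁ → m₁ ≤ 1 → ∀ z, AEStronglyMeasurable
      (fun t => v t (mixDirac m₁ (ρ t) z) (u t) x) (volume.restrict (Icc 0 T)) := by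
    intro m₁ h0 h1 z
    have hsub : Metric.closedBall (0 : Euc d) R ⊆ Metric.closedBall 0 (R + ‖z‖) :=
      Metric.closedBall_subset_closedBall (by linarith [norm_nonneg z])
    refine h.aestronglyMeasurable_velocity (R := R + ‖z‖) (ρ := fun t => mixDirac m₁ (ρ t) z)
      hT hu (by positivity) (fun t ht => ((hρ t ht).mono hsub).mixDirac
        Metric.isClosed_closedBall.measurableSet h0.le h1 ?_) hm (fun τ t h2 h3 h4 => ?_) x
    · rw [mem_closedBall_zero_iff]; linarith
    · exact (wasserstein_one_mixDirac_mixDirac_le h0.le _ _ z).trans (hW τ t h2 h3 h4)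
  have hm1 : ∀ n : ℕ, 0 < 1 / ((n : ℝ) + 1) ∧ 1 / ((n : ℝ) + 1) ≤ 1 := fun n => by
    refine ⟨by positivity, ?_⟩
    rw [div_le_one (by positivity)]
    linarith [(Nat.cast_nonneg n : (0 : ℝ) ≤ n)]
  have hn : ∀ m₁ : ℝ, 0 < m₁ → m₁ ≤ 1 → AEStronglyMeasurable
      (fun t => Dv t (mixDirac m₁ (ρ t) y) (u t) x y e) (volume.restrict (Icc 0 T)) := by
    intro m₁ h0 h1
    refine aestronglyMeasurable_of_tendsto_ae atTop (f := fun (k : ℕ) t =>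
      (m₁ * (1 / ((k : ℝ) + 1)))⁻¹ • (v t (mixDirac m₁ (ρ t) (y + (1 / ((k : ℝ) + 1)) • e)) (u t) x -
        v t (mixDirac m₁ (ρ t) y) (u t) x))
      (fun k => ((hmix m₁ h0 h1 (y + (1 / ((k : ℝ) + 1)) • e)).sub (hmix m₁ h0 h1 y)).const_smul
        ((m₁ * (1 / ((k : ℝ) + 1)))⁻¹)) ?_
    filter_upwards [h.differentiable_measure, ae_restrict_mem measurableSet_Icc] with t h2 ht
    have hlim := (h2 (u t) x _ (IsPc.mixDirac (hρ t ht) h0.le h1 hy)).tendsto_mixDirac (hρ t ht)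
      h0 h1 hy e
    refine hlim.comp (tendsto_nhdsWithin_iff.2 ⟨tendsto_one_div_add_atTop_nhds_zero_nat, ?_⟩)
    exact Eventually.of_forall fun k => (hm1 k).1
  refine aestronglyMeasurable_of_tendsto_ae atTop (fun n : ℕ => hn _ (hm1 n).1 (hm1 n).2) ?_
  filter_upwards [h.continuous_measure_deriv R hR, ae_restrict_mem measurableSet_Icc] with t h3 ht
  have hlim := h3 (u t) (fun n => mixDirac (1 / ((n : ℝ) + 1)) (ρ t) y) (ρ t) (fun _ => (x, y)) (x, y)
    (fun n => (hρ t ht).mixDirac hBm (hm1 n).1.le (hm1 n).2 hy) (hρ t ht) (fun _ => ⟨hx, hy⟩)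
    ⟨hx, hy⟩ (tendsto_wasserstein_mixDirac (hρ t ht) hy) tendsto_const_nhds
  exact ((ContinuousLinearMap.apply ℝ (Euc d) e).continuous.tendsto _).comp hlim

theorem ContinuousOnProb.continuousOn {Y F : Type*} [TopologicalSpace Y] [FirstCountableTopology Y]
    [TopologicalSpace F] {K : Set (Euc d)} {S : Set Y} {f : Measure (Euc d) → Y → F}
    (h : ContinuousOnProb K S f) {ρ : Measure (Euc d)} (hρ : ProbOn K ρ) : ContinuousOn (f ρ) S := by
  have hp := hρ.1
  have hself : wasserstein 1 ρ ρ = 0 := by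
    refine le_antisymm ((wasserstein_one_le (diag_mem_transportPlans ρ)).trans ?_) zero_le
    rw [lintegral_map (measurable_fst.edist measurable_snd) (by fun_prop)]
    simp
  rw [continuousOn_iff_continuous_domRestrict, continuous_iff_seqContinuous]
  intro ys y hy
  refine h (fun _ => ρ) ρ (fun n => ys n) y (fun _ => hρ) hρ (fun n => (ys n).2) y.2 ?_
    ((continuous_subtype_val.tendsto y).comp hy)
  simp [hself]

end Hyp


/-! ### State and costate fields along a state-costate curve -/

section Solutions

variable {E : Type*} [NormedAddCommGroup E] [NormedSpace ℝ E] [FiniteDimensional ℝ E]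
  [MeasurableSpace E] [BorelSpace E] {T : ℝ}

/-- `G` is not Lipschitz in the state, but once the state trajectory is known, the costate equation
is Lipschitz in its own unknown. -/
theorem exists_solvesODE_of_triangular {V : ℝ → E → E} {lV mV : ℝ → ℝ} (hV : IsLipField T V lV mV)
    {G : ℝ → E × E → E} (hG : IsCaratheodory (volume.restrict (Icc 0 T)) G) {g κ : ℝ → ℝ}
    (hg : IsL1Nonneg T g) (hκ : IsL1Nonneg T κ)
    (hGb : ∀ᵐ t ∂(volume.restrict (Icc 0 T)), ∀ z, ‖G t z‖ ≤ g t)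
    (hGl : ∀ᵐ t ∂(volume.restrict (Icc 0 T)), ∀ x r r',
      ‖G t (x, r) - G t (x, r')‖ ≤ κ t * ‖r - r'‖) {τ : ℝ} (hτ : τ ∈ Icc 0 T) (z : E × E) :
    ∃ Z, SolvesODE T (fun t z => (V t z.1, G t z)) τ z Z := by
  have hX := hV.isLocLipField.odeFlow_spec hτ z.1
  have hXc := hX.continuousOn hτ
  set X := odeFlow T V τ z.1 with hXdef
  have hr : IsLipField T (fun t r => G t (X t, r)) κ g := by
    refine ⟨fun r => ?_, hκ, hg, ?_, ?_⟩
    · exact hG.comp (z := fun t => (X t, r)) ((hXc.aemeasurable measurableSet_Icc).prodMk aemeasurable_const)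
    · filter_upwards [hGl] with t h r r' using h _ r r'
    · filter_upwards [hGb] with t h r using h _
  have hY := hr.isLocLipField.odeFlow_spec hτ z.2
  set Y := odeFlow T (fun t r => G t (X t, r)) τ z.2 with hYdef
  have hint : IntegrableOn (fun s => (V s (X s), G s (X s, Y s))) (Icc 0 T) :=
    hX.integrable.prodMk hY.integrable
  refine ⟨fun t => (X t, Y t), hint, fun t ht => ?_⟩
  have h1 := (ContinuousLinearMap.fst ℝ E E).intervalIntegral_comp_comm
    (intervalIntegrable_sub hint hτ ht)
  have h2 := (ContinuousLinearMap.snd ℝ E E).intervalIntegral_comp_comm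
    (intervalIntegrable_sub hint hτ ht)
  refine Prod.ext ?_ ?_
  · rw [Prod.fst_add]
    exact (hX.eq t ht).trans (congrArg (z.1 + ·) h1)
  · rw [Prod.snd_add]
    exact (hY.eq t ht).trans (congrArg (z.2 + ·) h2)

/-- The exceptional null set depends on the time; take the union over a countable dense set of times
and conclude by continuity of the trajectories. -/
theorem ae_forall_mem_of_forall_ae_mem {α F : Type*} [MeasurableSpace α] {P : Measure α}
    [TopologicalSpace F] {S : Set F} (hS : IsClosed S) {Z : α → ℝ → F} {I : Set ℝ}
    (hc : ∀ a, ContinuousOn (Z a) I) (h : ∀ t ∈ I, ∀ᵐ a ∂P, Z a t ∈ S) :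
    ∀ᵐ a ∂P, ∀ t ∈ I, Z a t ∈ S := by
  obtain ⟨D, hDc, hD⟩ := TopologicalSpace.exists_countable_dense I
  have h1 : ∀ᵐ a ∂P, ∀ t ∈ D, Z a t ∈ S := (ae_ball_iff hDc).2 fun t _ => h t t.2
  filter_upwards [h1] with a ha t ht
  have hcl : IsClosed {s : I | Z a s ∈ S} :=
    hS.preimage (continuousOn_iff_continuous_domRestrict.1 (hc a))
  have : (univ : Set I) ⊆ {s : I | Z a s ∈ S} := by
    rw [← hD.closure_eq]
    exact hcl.closure_subset_iff.2 fun s hs => ha s hs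
  exact this (mem_univ ⟨t, ht⟩)

end Solutions

section Hyp

variable {d : ℕ} {U : Type*} [MetricSpace U] {T : ℝ}
  {v : ℝ → Measure (Euc d) → U → Euc d → Euc d}
  {Dv : ℝ → Measure (Euc d) → U → Euc d → Euc d → Euc d →L[ℝ] Euc d}
  {φ : Measure (Euc d) → ℝ} {gradφ : Measure (Euc d) → Euc d → Euc d}
  {u : ℝ → U} {μ : ℝ → Measure (Euc d)} {R : ℝ} {m₀ : ℝ → ℝ}

theorem HypOCP.isLocLipField (h : HypOCP T v Dv φ gradφ) (hT : 0 ≤ T)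
    (hu : AEStronglyMeasurable u (volume.restrict (Icc 0 T))) (hR : 0 < R)
    (hμ : ∀ t ∈ Icc 0 T, ProbOn (Metric.closedBall 0 R) (μ t)) (hm₀ : IsL1Nonneg T m₀)
    (hW : W1Bound T m₀ μ) : IsLocLipField T fun t x => v t (μ t) (u t) x := by
  refine ⟨h.aestronglyMeasurable_velocity hT hu hR hμ hm₀ hW, fun R₁ hR₁ => ?_, ?_⟩
  · obtain ⟨l, L, hl, -, hlL⟩ := h.exists_bounds (R := R + R₁) (by positivity)
    refine ⟨l, hl, ?_⟩
    filter_upwards [hlL, ae_restrict_mem measurableSet_Icc] with t h1 ht x hx y hy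
    exact (h1 (u t) (μ t) ((hμ t ht).mono (Metric.closedBall_subset_closedBall (by linarith))) x
      (Metric.closedBall_subset_closedBall (by linarith) hx)).1 y
      (Metric.closedBall_subset_closedBall (by linarith) hy)
  · obtain ⟨m, hm, hmb⟩ := h.sublinear
    refine ⟨fun t => (1 + R) * m t, hm.const_mul (by positivity), ?_⟩
    filter_upwards [hmb, ae_restrict_mem measurableSet_Icc] with t h1 ht x
    have h2 : ∫ y, ‖y‖ ∂(μ t) ≤ R :=
      (le_abs_self _).trans ((hμ t ht).norm_integral_le (f := fun y => ‖y‖)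
        fun y hy => by simpa using hy)
    refine (h1 (μ t) ((hμ t ht).isPc (isCompact_closedBall _ _) Metric.isClosed_closedBall)
      (u t) x).trans ?_
    have h3 : 1 + ‖x‖ + ∫ y, ‖y‖ ∂(μ t) ≤ (1 + R) * (1 + ‖x‖) := by
      nlinarith [norm_nonneg x]
    calc _ ≤ m t * ((1 + R) * (1 + ‖x‖)) := mul_le_mul_of_nonneg_left h3 (hm.2 t)
      _ = _ := by ring

theorem HypOCP.isLipField_retract (h : HypOCP T v Dv φ gradφ) (hT : 0 ≤ T)
    (hu : AEStronglyMeasurable u (volume.restrict (Icc 0 T))) (hR : 0 < R)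
    (hμ : ∀ t ∈ Icc 0 T, ProbOn (Metric.closedBall 0 R) (μ t)) (hm₀ : IsL1Nonneg T m₀)
    (hW : W1Bound T m₀ μ) :
    ∃ l m, IsLipField T (fun t x => v t (μ t) (u t) (ballRetract R x)) l m := by
  have hloc := h.isLocLipField hT hu hR hμ hm₀ hW
  obtain ⟨l, hl, hlip⟩ := hloc.lip R hR
  obtain ⟨m, hm, hmb⟩ := hloc.growth
  refine ⟨fun t => 2 * l t, fun t => (1 + R) * m t, fun x => hloc.meas _,
    hl.const_mul zero_le_two, hm.const_mul (by positivity), ?_, ?_⟩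
  · filter_upwards [hlip] with t h1 x y
    refine (h1 _ (ballRetract_mem hR x) _ (ballRetract_mem hR y)).trans ?_
    have := mul_le_mul_of_nonneg_left (norm_ballRetract_sub_le hR x y) (hl.2 t)
    linarith
  · filter_upwards [hmb] with t h1 x
    refine (h1 _).trans ?_
    have h2 : ‖ballRetract R x‖ ≤ R := by simpa using ballRetract_mem hR x
    have := mul_le_mul_of_nonneg_left h2 (hm.2 t)
    linarith

/-- The retracted integrand of the non-local part of the costate field. -/
theorem HypOCP.isCaratheodory_adjoint_measureDeriv (h : HypOCP T v Dv φ gradφ) (hT : 0 ≤ T)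
    (hu : AEStronglyMeasurable u (volume.restrict (Icc 0 T))) (hR : 0 < R)
    (hμ : ∀ t ∈ Icc 0 T, ProbOn (Metric.closedBall 0 R) (μ t)) (hm₀ : IsL1Nonneg T m₀)
    (hW : W1Bound T m₀ μ) :
    IsCaratheodory (volume.restrict (Icc 0 T)) fun t (z : (Euc d × Euc d) × Euc d) =>
      ContinuousLinearMap.adjoint
        (Dv t (μ t) (u t) (ballRetract R z.1.1) (ballRetract R z.2)) (ballRetract R z.1.2) := by
  refine ⟨fun z => aestronglyMeasurable_adjoint_apply (fun e =>
    h.aestronglyMeasurable_measureDeriv hT hu hR hμ hm₀ hW (ballRetract_mem hR _)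
      (ballRetract_mem hR _) e) _, ?_⟩
  filter_upwards [h.continuous_measure_deriv R hR, ae_restrict_mem measurableSet_Icc] with t h1 ht
  have hP := continuous_ballRetract (E := Euc d) hR
  have h2 : Continuous fun z : (Euc d × Euc d) × Euc d =>
      Dv t (μ t) (u t) (ballRetract R z.1.1) (ballRetract R z.2) :=
    ((h1 (u t)).continuousOn (hμ t ht)).comp_continuous
      (f := fun z : (Euc d × Euc d) × Euc d => (ballRetract R z.1.1, ballRetract R z.2))
      (by fun_prop) fun z => ⟨ballRetract_mem hR _, ballRetract_mem hR _⟩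
  exact (ContinuousLinearMap.adjoint.continuous.comp h2).clm_apply (by fun_prop)

theorem HypOCP.isCaratheodory_adjoint_fderiv (h : HypOCP T v Dv φ gradφ) (hT : 0 ≤ T)
    (hu : AEStronglyMeasurable u (volume.restrict (Icc 0 T))) (hR : 0 < R)
    (hμ : ∀ t ∈ Icc 0 T, ProbOn (Metric.closedBall 0 R) (μ t)) (hm₀ : IsL1Nonneg T m₀)
    (hW : W1Bound T m₀ μ) :
    IsCaratheodory (volume.restrict (Icc 0 T)) fun t (z : Euc d × Euc d) =>
      ContinuousLinearMap.adjoint (fderiv ℝ (v t (μ t) (u t)) (ballRetract R z.1))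
        (ballRetract R z.2) := by
  refine ⟨fun z => aestronglyMeasurable_adjoint_apply (fun e =>
    h.aestronglyMeasurable_fderiv hT hu hR hμ hm₀ hW _ e) _, ?_⟩
  filter_upwards [h.continuous_space_deriv R hR, ae_restrict_mem measurableSet_Icc] with t h1 ht
  have hP := continuous_ballRetract (E := Euc d) hR
  have h2 : Continuous fun z : Euc d × Euc d => fderiv ℝ (v t (μ t) (u t)) (ballRetract R z.1) :=
    ((h1 (u t)).continuousOn (hμ t ht)).comp_continuous
      (f := fun z : Euc d × Euc d => ballRetract R z.1)
      (by fun_prop) fun z => ballRetract_mem hR _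
  exact (ContinuousLinearMap.adjoint.continuous.comp h2).clm_apply (by fun_prop)

/-- The costate field `-D_x v(x)ᵀ r - ∫ D_μ v(y)(x)ᵀ p dν(y, p)`, with all arguments retracted to
the ball of radius `R`. -/
noncomputable def retractedCostateField (R : ℝ)
    (v : ℝ → Measure (Euc d) → U → Euc d → Euc d)
    (Dv : ℝ → Measure (Euc d) → U → Euc d → Euc d → Euc d →L[ℝ] Euc d)
    (u : ℝ → U) (μ : ℝ → Measure (Euc d)) (ν : ℝ → Measure (Euc d × Euc d)) (t : ℝ)
    (z : Euc d × Euc d) : Euc d :=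
  -(ContinuousLinearMap.adjoint (fderiv ℝ (v t (μ t) (u t)) (ballRetract R z.1))
      (ballRetract R z.2)) -
    ∫ w, ContinuousLinearMap.adjoint
      (Dv t (μ t) (u t) (ballRetract R w.1) (ballRetract R z.1)) (ballRetract R w.2) ∂(ν t)

theorem norm_adjoint_apply_le (D : Euc d →L[ℝ] Euc d) {c b : ℝ} (hD : ‖D‖ ≤ c) {p : Euc d}
    (hp : ‖p‖ ≤ b) : ‖ContinuousLinearMap.adjoint D p‖ ≤ c * b := by
  refine (ContinuousLinearMap.le_opNorm _ _).trans ?_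
  rw [LinearIsometryEquiv.norm_map]
  exact mul_le_mul hD hp (norm_nonneg _) ((norm_nonneg _).trans hD)

theorem norm_adjoint_ballRetract_le (hR : 0 < R) {D : Euc d →L[ℝ] Euc d} {c : ℝ} (hD : ‖D‖ ≤ c)
    (r : Euc d) : ‖ContinuousLinearMap.adjoint D (ballRetract R r)‖ ≤ c * R :=
  norm_adjoint_apply_le D hD (mem_closedBall_zero_iff.1 (ballRetract_mem hR r))

/-- The retractions give global bounds without changing the field on the carrier of `ν`. Lipschitz
continuity is claimed in the costate only, where it comes from linearity; in the state only
continuity is available. -/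
theorem HypOCP.exists_retractedCostateField_bounds (h : HypOCP T v Dv φ gradφ) (hT : 0 ≤ T)
    (hu : AEStronglyMeasurable u (volume.restrict (Icc 0 T))) (hR : 0 < R)
    (hμ : ∀ t ∈ Icc 0 T, ProbOn (Metric.closedBall 0 R) (μ t)) (hm₀ : IsL1Nonneg T m₀)
    (hW : W1Bound T m₀ μ) {ν : ℝ → Measure (Euc d × Euc d)} {mν : ℝ → ℝ} (hmν : IsL1Nonneg T mν)
    (hWν : W1Bound T mν ν)
    (hν : ∀ t ∈ Icc 0 T, ProbOn (Metric.closedBall 0 R ×ˢ Metric.closedBall 0 R) (ν t)) :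
    IsCaratheodory (volume.restrict (Icc 0 T)) (retractedCostateField R v Dv u μ ν) ∧
    ∃ g κ, IsL1Nonneg T g ∧ IsL1Nonneg T κ ∧
      (∀ᵐ t ∂(volume.restrict (Icc 0 T)), ∀ z, ‖retractedCostateField R v Dv u μ ν t z‖ ≤ g t) ∧
      ∀ᵐ t ∂(volume.restrict (Icc 0 T)), ∀ x r r',
        ‖retractedCostateField R v Dv u μ ν t (x, r) -
          retractedCostateField R v Dv u μ ν t (x, r')‖ ≤ κ t * ‖r - r'‖ := by
  obtain ⟨l, L, hl, hL, hlL⟩ := h.exists_bounds hR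
  have hA := h.isCaratheodory_adjoint_fderiv hT hu hR hμ hm₀ hW
  have hB := h.isCaratheodory_adjoint_measureDeriv hT hu hR hμ hm₀ hW
  have hKc : IsCompact (Metric.closedBall (0 : Euc d) R ×ˢ Metric.closedBall (0 : Euc d) R) :=
    (isCompact_closedBall _ _).prod (isCompact_closedBall _ _)
  obtain ⟨P, hP, hPν⟩ := exists_kernel_of_curve hT hmν hWν hKc hKc.measurableSet hν
  have hDb : ∀ᵐ t ∂(volume.restrict (Icc 0 T)), ∀ z : (Euc d × Euc d) × Euc d,
      ‖ContinuousLinearMap.adjoint (Dv t (μ t) (u t) (ballRetract R z.1.1) (ballRetract R z.2))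
        (ballRetract R z.1.2)‖ ≤ L t * R := by
    filter_upwards [hlL, ae_restrict_mem measurableSet_Icc] with t h1 ht z
    exact norm_adjoint_ballRetract_le hR ((h1 (u t) (μ t) (hμ t ht) _ (ballRetract_mem hR _)).2.2.2 _
      (ballRetract_mem hR _)) _
  have hAb : ∀ᵐ t ∂(volume.restrict (Icc 0 T)), ∀ z : Euc d × Euc d,
      ‖ContinuousLinearMap.adjoint (fderiv ℝ (v t (μ t) (u t)) (ballRetract R z.1))
        (ballRetract R z.2)‖ ≤ l t * R := by
    filter_upwards [hlL, ae_restrict_mem measurableSet_Icc] with t h1 ht z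
    exact norm_adjoint_ballRetract_le hR
      (h1 (u t) (μ t) (hμ t ht) _ (ballRetract_mem hR _)).2.2.1 _
  refine ⟨⟨fun z => ?_, ?_⟩, fun t => l t * R + L t * R, fun t => l t * 2, ?_, ?_, ?_, ?_⟩
  · refine (hA.meas z).neg.sub ?_
    have h1 : IsCaratheodory (volume.restrict (Icc 0 T)) fun t (w : Euc d × Euc d) =>
        ContinuousLinearMap.adjoint (Dv t (μ t) (u t) (ballRetract R w.1) (ballRetract R z.1))
          (ballRetract R w.2) :=
      ⟨fun w => hB.meas (w, z.1), hB.cont.mono fun t ht =>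
        ht.comp (f := fun w : Euc d × Euc d => (w, z.1)) (by fun_prop)⟩
    refine (h1.integral_kernel P).congr ?_
    filter_upwards [ae_restrict_mem measurableSet_Icc] with t ht
    rw [hPν t ht]
  · filter_upwards [hA.cont, hB.cont, hDb, ae_restrict_mem measurableSet_Icc] with t h1 h2 h3 ht
    have := (hν t ht).1
    refine h1.neg.sub ?_
    refine continuous_of_dominated (bound := fun _ => L t * R)
      (fun z => Continuous.aestronglyMeasurable ?_) (fun z => Eventually.of_forall fun w => h3 (w, z.1))
      (integrable_const _) (Eventually.of_forall fun w => ?_)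
    · exact h2.comp (f := fun w : Euc d × Euc d => (w, z.1)) (by fun_prop)
    · exact h2.comp (f := fun z : Euc d × Euc d => (w, z.1)) (by fun_prop)
  · exact ⟨(hl.1.mul_const _).add (hL.1.mul_const _), fun t =>
      add_nonneg (mul_nonneg (hl.2 t) hR.le) (mul_nonneg (hL.2 t) hR.le)⟩
  · exact ⟨hl.1.mul_const _, fun t => mul_nonneg (hl.2 t) zero_le_two⟩
  · filter_upwards [hAb, hDb, ae_restrict_mem measurableSet_Icc] with t h1 h2 ht z
    refine (norm_sub_le _ _).trans (add_le_add ?_ ?_)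
    · rw [norm_neg]; exact h1 z
    · exact (hν t ht).norm_integral_le fun w _ => h2 (w, z.1)
  · filter_upwards [hlL, ae_restrict_mem measurableSet_Icc] with t h1 ht x r r'
    simp only [retractedCostateField, sub_sub_sub_cancel_right]
    rw [neg_sub_neg, ← map_sub]
    refine (ContinuousLinearMap.le_opNorm _ _).trans ?_
    rw [LinearIsometryEquiv.norm_map, mul_assoc]
    refine mul_le_mul (h1 (u t) (μ t) (hμ t ht) _ (ballRetract_mem hR _)).2.2.1 ?_ (norm_nonneg _)
      (hl.2 t)
    rw [norm_sub_rev r r']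
    exact norm_ballRetract_sub_le hR r' r

end Hyp


/-! ### Families of curves coupled through an average -/

section MeanFieldGronwall

variable {α E : Type*} [MeasurableSpace α] [NormedAddCommGroup E] [NormedSpace ℝ E]

/-- Uniqueness for families of integral curves which are coupled through their mean distance. -/
theorem eq_of_integral_eq_of_mean_bound {T τ : ℝ} (hτ : τ ∈ Icc 0 T) {P : Measure α}
    [IsProbabilityMeasure P] {S : Set α} (hS : ∀ᵐ a ∂P, a ∈ S) {x : α → E} {p q X Y : α → ℝ → E}
    (hm : ∀ t ∈ Icc 0 T, AEStronglyMeasurable (fun a => X a t - Y a t) P)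
    (hp : ∀ a ∈ S, IntegrableOn (p a) (Icc 0 T)) (hq : ∀ a ∈ S, IntegrableOn (q a) (Icc 0 T))
    (hX : ∀ a ∈ S, ∀ t ∈ Icc 0 T, X a t = x a + ∫ s in τ..t, p a s)
    (hY : ∀ a ∈ S, ∀ t ∈ Icc 0 T, Y a t = x a + ∫ s in τ..t, q a s) {B : ℝ}
    (hB : ∀ a ∈ S, ∀ t ∈ Icc 0 T, ‖X a t - Y a t‖ ≤ B) {l L : ℝ → ℝ}
    (hl : IsL1Nonneg T l) (hL : IsL1Nonneg T L)
    (h : ∀ a ∈ S, ∀ᵐ s ∂(volume.restrict (Icc 0 T)),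
      ‖p a s - q a s‖ ≤ l s * ‖X a s - Y a s‖ + L s * ∫ b, ‖X b s - Y b s‖ ∂P) :
    ∀ a ∈ S, ∀ t ∈ Icc 0 T, X a t = Y a t := by
  set D : ℝ → ℝ := fun s => ∫ b, ‖X b s - Y b s‖ ∂P with hD
  have hD0 : ∀ s, 0 ≤ D s := fun s => integral_nonneg fun _ => norm_nonneg _
  have hDc : ContinuousOn D (Icc 0 T) := by
    refine continuousOn_of_dominated (bound := fun _ => B) (fun t ht => (hm t ht).norm)
      (fun t ht => hS.mono fun a ha => by simpa using hB a ha t ht) (integrable_const _)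
      (hS.mono fun a ha => ?_)
    exact ((continuousOn_of_integral_eq hτ (hp a ha) (hX a ha)).sub
      (continuousOn_of_integral_eq hτ (hq a ha) (hY a ha))).norm
  have he : IsL1Nonneg T fun s => L s * D s :=
    ⟨hL.1.mul_continuousOn hDc isCompact_Icc, fun s => mul_nonneg (hL.2 s) (hD0 s)⟩
  set C : ℝ := 2 * Real.exp (2 * ∫ s in 0..T, l s) with hC
  -- With the averaged distance `D` regarded as a given forcing, each pair of curves separates by at
  -- most `C * |∫ L D|`. Averaging this over `P` gives a homogeneous Gronwall inequality for `D`,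
  -- hence `D = 0`, and the same bound then settles every index in `S`.
  have key : ∀ a ∈ S, ∀ t ∈ Icc 0 T, ‖X a t - Y a t‖ ≤ C * |∫ s in τ..t, L s * D s| := by
    intro a ha t ht
    have h1 := norm_sub_le_of_integral_eq hτ ht (hp a ha) (hq a ha) (hX a ha) (hY a ha) hl he
      (h a ha)
    rw [sub_self, norm_zero, zero_add] at h1
    refine h1.trans ?_
    have h2 : Real.exp (2 * |∫ s in τ..t, l s|) ≤ Real.exp (2 * ∫ s in 0..T, l s) :=
      Real.exp_le_exp.2 (mul_le_mul_of_nonneg_left (hl.abs_integral_le hτ ht) zero_le_two)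
    have h3 := mul_le_mul_of_nonneg_left h2 (abs_nonneg (∫ s in τ..t, L s * D s))
    rw [hC]
    linarith
  have hC0 : 0 ≤ C := by positivity
  have hDz : ∀ t ∈ Icc 0 T, D t = 0 := by
    intro t ht
    refine le_antisymm ?_ (hD0 t)
    have hsub := uIcc_subset_Icc hτ ht
    have := gronwall_uIcc (l := fun s => C * L s) (C := 0) ((hL.const_mul hC0).1.mono_set hsub)
      (hL.const_mul hC0).2 (hDc.mono hsub) (fun s _ => hD0 s) le_rfl fun s hs => by
        rw [zero_add]
        simp only [mul_assoc]
        rw [intervalIntegral.integral_const_mul, abs_mul, abs_of_nonneg hC0]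
        have h1 := norm_integral_le_of_norm_le_const (f := fun a => ‖X a s - Y a s‖)
          (hS.mono fun a ha => (norm_norm _).trans_le (key a ha s (hsub hs)))
        rw [probReal_univ, mul_one] at h1
        exact (le_abs_self _).trans h1
    simpa using this
  intro a ha t ht
  have h1 := key a ha t ht
  have h2 : ∫ s in τ..t, L s * D s = ∫ s in τ..t, 0 := intervalIntegral.integral_congr fun s hs => by
    simp [hDz s (uIcc_subset_Icc hτ ht hs)]
  rw [h2] at h1
  simpa [sub_eq_zero] using h1

end MeanFieldGronwall

/-! ### Lagrangian representation of state-costate curves -/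

section Representation

variable {d : ℕ} {U : Type*} {T R' : ℝ}
  {v : ℝ → Measure (Euc d) → U → Euc d → Euc d}
  {Dv : ℝ → Measure (Euc d) → U → Euc d → Euc d → Euc d →L[ℝ] Euc d}
  {φ : Measure (Euc d) → ℝ} {gradφ : Measure (Euc d) → Euc d → Euc d}
  {u : ℝ → U} {μ : ℝ → Measure (Euc d)} {ν : ℝ → Measure (Euc d × Euc d)}

theorem IsStateCostateCurve.probOn_state (hν : IsStateCostateCurve T R' v Dv gradφ u μ ν) {t : ℝ}
    (ht : t ∈ Icc 0 T) : ProbOn (Metric.closedBall 0 R') (μ t) := by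
  rw [← hν.marginal t ht]
  exact (hν.supported t ht).map measurable_fst.aemeasurable Metric.isClosed_closedBall.measurableSet
    ((hν.supported t ht).ae_mem.mono fun z hz => hz.1)

theorem IsStateCostateCurve.w1Bound_state (hν : IsStateCostateCurve T R' v Dv gradφ u μ ν)
    {m : ℝ → ℝ} (hm : W1Bound T m ν) : W1Bound T m μ := by
  intro τ t h0 hτt htT
  rw [← hν.marginal τ ⟨h0, hτt.trans htT⟩, ← hν.marginal t ⟨h0.trans hτt, htT⟩]
  exact (wasserstein_one_map_map_le measurable_fst fun x y => by
    rw [Prod.edist_eq]; exact le_max_left _ _).trans (hm τ t h0 hτt htT)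

/-- The affine velocity of the costate along the state trajectory starting from `x` at time `T`,
when the costate attached to `y` is `r y t`. -/
noncomputable def costateVelocity (T : ℝ) (v : ℝ → Measure (Euc d) → U → Euc d → Euc d)
    (Dv : ℝ → Measure (Euc d) → U → Euc d → Euc d → Euc d →L[ℝ] Euc d)
    (u : ℝ → U) (μ : ℝ → Measure (Euc d)) (r : Euc d → ℝ → Euc d) (x : Euc d) (t : ℝ)
    (q : Euc d) : Euc d :=
  -(ContinuousLinearMap.adjoint
      (fderiv ℝ (v t (μ t) (u t)) (odeFlow T (fun t => v t (μ t) (u t)) T x t)) q) -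
    ∫ y, ContinuousLinearMap.adjoint
      (Dv t (μ t) (u t) (odeFlow T (fun t => v t (μ t) (u t)) T y t)
        (odeFlow T (fun t => v t (μ t) (u t)) T x t)) (r y t) ∂(μ T)

variable [MetricSpace U]

/-- The terminal measure is a graph over `μ T`, and characteristics starting from a graph remain
parametrised by the base point. Almost all of them stay in the carrier of `ν`, where the retractions
act trivially, so they solve the original state and costate equations. -/
theorem IsStateCostateCurve.exists_costate (hν : IsStateCostateCurve T R' v Dv gradφ u μ ν)
    (h : HypOCP T v Dv φ gradφ) (hT : 0 ≤ T)
    (hu : AEStronglyMeasurable u (volume.restrict (Icc 0 T))) (hR : 0 < R') :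
    ∃ r : Euc d → ℝ → Euc d, (∀ t ∈ Icc 0 T, Measurable fun x => r x t) ∧
      (∀ t ∈ Icc 0 T,
        ν t = (μ T).map fun x => (odeFlow T (fun t => v t (μ t) (u t)) T x t, r x t)) ∧
      (∀ x, ContinuousOn (r x) (Icc 0 T)) ∧
      ∀ᵐ x ∂(μ T),
        (∀ t ∈ Icc 0 T, odeFlow T (fun t => v t (μ t) (u t)) T x t ∈ Metric.closedBall 0 R' ∧
          r x t ∈ Metric.closedBall 0 R') ∧
        SolvesODE T (costateVelocity T v Dv u μ r x) T (-gradφ (μ T) x) (r x) := by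
  have hT' : T ∈ Icc 0 T := right_mem_Icc.2 hT
  obtain ⟨m₀, hm₀, hWν⟩ := hν.absolutelyContinuous
  have hμ := fun t (ht : t ∈ Icc 0 T) => hν.probOn_state ht
  have hW := hν.w1Bound_state hWν
  have hK : IsCompact (Metric.closedBall (0 : Euc d) R' ×ˢ Metric.closedBall (0 : Euc d) R') :=
    (isCompact_closedBall _ _).prod (isCompact_closedBall _ _)
  have hloc := h.isLocLipField hT hu hR hμ hm₀ hW
  obtain ⟨lV, mV, hV⟩ := h.isLipField_retract hT hu hR hμ hm₀ hW
  obtain ⟨hG, g, κ, hg, hκ, hGb, hGl⟩ :=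
    h.exists_retractedCostateField_bounds hT hu hR hμ hm₀ hW hm₀ hWν hν.supported
  choose Z hZ using fun z => exists_solvesODE_of_triangular hV hG hg hκ hGb hGl hT' z
  have hF : ∀ᵐ t ∂(volume.restrict (Icc 0 T)),
      ∀ z ∈ Metric.closedBall (0 : Euc d) R' ×ˢ Metric.closedBall (0 : Euc d) R',
        symplectic (hamiltonianGradient v Dv t (ν t) (u t) z) =
          (v t (μ t) (u t) (ballRetract R' z.1), retractedCostateField R' v Dv u μ ν t z) := by
    filter_upwards [ae_restrict_mem measurableSet_Icc] with t ht z hz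
    rw [symplectic, hamiltonianGradient, retractedCostateField, hν.marginal t ht,
      ballRetract_of_mem hR hz.1, ballRetract_of_mem hR hz.2, neg_add']
    congr 2
    refine integral_congr_ae ?_
    filter_upwards [(hν.supported t ht).ae_mem] with w hw
    rw [ballRetract_of_mem hR hw.1, ballRetract_of_mem hR hw.2]
  have hrep := fun t (ht : t ∈ Icc 0 T) => hν.equation.eq_map_of_triangular hV hG hg hκ hGb hGl
    hm₀ hWν hK hν.supported hF hZ ht
  -- Since `ν t` is the image of `ν T` and is carried by the product of balls, almost every
  -- characteristic stays there for all times.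
  have hZK := ae_forall_mem_of_forall_ae_mem (P := ν T) hK.isClosed
    (fun z => (hZ z).continuousOn hT') fun t ht => by
      have := (hν.supported t ht).ae_mem
      rw [(hrep t ht).2] at this
      exact ae_of_ae_map (hrep t ht).1.aemeasurable this
  have hp : Measurable fun x => (x, -gradφ (μ T) x) := measurable_id.prodMk
    (h.continuous_cost_gradient _ ((hμ T hT').isPc (isCompact_closedBall _ _)
      Metric.isClosed_closedBall)).measurable.neg
  rw [hν.terminal] at hZK
  have hgood := ae_of_ae_map hp.aemeasurable hZK
  have hfst : ∀ᵐ x ∂(μ T), ∀ t ∈ Icc 0 T,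
      (Z (x, -gradφ (μ T) x) t).1 = odeFlow T (fun t => v t (μ t) (u t)) T x t := by
    filter_upwards [hgood] with x hx t ht
    have h1 := SolvesODE.fst (V := fun t x => v t (μ t) (u t) (ballRetract R' x))
      (hZ (x, -gradφ (μ T) x)) hT'
    have hEq : ∀ s ∈ Icc 0 T, v s (μ s) (u s) (ballRetract R' (Z (x, -gradφ (μ T) x) s).1) =
        v s (μ s) (u s) (Z (x, -gradφ (μ T) x) s).1 := fun s hs => by
      rw [ballRetract_of_mem hR (hx s hs).1]
    refine hloc.unique hT' (X := fun t => (Z (x, -gradφ (μ T) x) t).1) ⟨?_, fun s hs => ?_⟩ ht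
    · exact h1.integrable.congr_fun hEq measurableSet_Icc
    · rw [h1.eq s hs]
      congr 1
      exact intervalIntegral.integral_congr fun q hq => hEq q (uIcc_subset_Icc hT' hs hq)
  have hmap : ∀ t ∈ Icc 0 T, ν t = (μ T).map fun x =>
      (odeFlow T (fun t => v t (μ t) (u t)) T x t, (Z (x, -gradφ (μ T) x) t).2) := by
    intro t ht
    rw [(hrep t ht).2, hν.terminal, Measure.map_map (hrep t ht).1 hp]
    refine Measure.map_congr ?_
    filter_upwards [hfst] with x hx
    exact Prod.ext (hx t ht) rfl
  refine ⟨fun x t => (Z (x, -gradφ (μ T) x) t).2,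
    fun t ht => ((hrep t ht).1.comp hp).snd, hmap, fun x =>
      continuous_snd.comp_continuousOn ((hZ _).continuousOn hT'), ?_⟩
  filter_upwards [hgood, hfst] with x hx hx1
  have hx2 : ∀ t ∈ Icc 0 T,
      odeFlow T (fun t => v t (μ t) (u t)) T x t ∈ Metric.closedBall 0 R' :=
    fun t ht => hx1 t ht ▸ (hx t ht).1
  refine ⟨fun t ht => ⟨hx2 t ht, (hx t ht).2⟩, ?_⟩
  obtain ⟨h1, h2⟩ := SolvesODE.snd_eq
    (V := fun t x => v t (μ t) (u t) (ballRetract R' x))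
    (H := retractedCostateField R' v Dv u μ ν) (hZ (x, -gradφ (μ T) x)) hT'
  have hEq : ∀ᵐ s ∂(volume.restrict (Icc 0 T)),
      retractedCostateField R' v Dv u μ ν s (Z (x, -gradφ (μ T) x) s) =
        costateVelocity T v Dv u μ (fun x t => (Z (x, -gradφ (μ T) x) t).2) x s
          (Z (x, -gradφ (μ T) x) s).2 := by
    filter_upwards [h.continuous_measure_deriv R' hR, ae_restrict_mem measurableSet_Icc]
      with s hs1 hs
    rw [retractedCostateField, costateVelocity, ballRetract_of_mem hR (hx s hs).1,
      ballRetract_of_mem hR (hx s hs).2, hx1 s hs]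
    congr 1
    -- Changing variables from `ν s` to `μ T` requires measurability of the unretracted integrand
    -- for `ν s`, which holds because it is continuous on the carrier.
    have hc : ContinuousOn (fun w : Euc d × Euc d => ContinuousLinearMap.adjoint
        (Dv s (μ s) (u s) w.1 (odeFlow T (fun t => v t (μ t) (u t)) T x s)) w.2)
        (Metric.closedBall 0 R' ×ˢ Metric.closedBall 0 R') := by
      refine ContinuousOn.clm_apply (ContinuousLinearMap.adjoint.continuous.comp_continuousOn
        (((hs1 (u s)).continuousOn (hμ s hs)).comp
        (f := fun w : Euc d × Euc d => (w.1, odeFlow T (fun t => v t (μ t) (u t)) T x s))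
        (by fun_prop) fun w hw => ⟨hw.1, hx2 s hs⟩)) continuousOn_snd
    have hm := (hν.supported s hs).aestronglyMeasurable hK.measurableSet hc
    have hcong : ∫ w, ContinuousLinearMap.adjoint (Dv s (μ s) (u s) (ballRetract R' w.1)
          (odeFlow T (fun t => v t (μ t) (u t)) T x s)) (ballRetract R' w.2) ∂(ν s) =
        ∫ w, ContinuousLinearMap.adjoint (Dv s (μ s) (u s) w.1
          (odeFlow T (fun t => v t (μ t) (u t)) T x s)) w.2 ∂(ν s) := by
      refine integral_congr_ae ?_
      filter_upwards [(hν.supported s hs).ae_mem] with w hw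
      rw [ballRetract_of_mem hR hw.1, ballRetract_of_mem hR hw.2]
    rw [hcong]
    rw [hmap s hs] at hm ⊢
    exact integral_map (((hloc.continuous_odeFlow hT' hs).measurable.prodMk
      ((hrep s hs).1.comp hp).snd).aemeasurable) hm
  refine ⟨Integrable.congr h1 hEq, fun t ht => ?_⟩
  rw [h2 t ht]
  congr 1
  have hsub : uIoc T t ⊆ Icc 0 T := uIoc_subset_uIcc.trans (uIcc_subset_Icc hT' ht)
  exact intervalIntegral.integral_congr_ae_restrict (ae_restrict_of_ae_restrict_of_subset hsub hEq)

theorem map_odeFlow_of_terminal {V : ℝ → Euc d → Euc d} (hV : IsLocLipField T V)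
    (hμ : ∀ t ∈ Icc 0 T, μ t = (μ T).map fun x => odeFlow T V T x t) {τ t : ℝ}
    (hτ : τ ∈ Icc 0 T) (ht : t ∈ Icc 0 T) : (μ τ).map (fun x => odeFlow T V τ x t) = μ t := by
  have hT' : T ∈ Icc 0 T := right_mem_Icc.2 (hτ.1.trans hτ.2)
  rw [hμ τ hτ, Measure.map_map (hV.continuous_odeFlow hτ ht).measurable
    (hV.continuous_odeFlow hT' hτ).measurable, hμ t ht]
  congr 1
  funext x
  exact hV.odeFlow_odeFlow hT' hτ ht x

/-- The flow of the field with `μ` frozen carries `μ τ` to `μ s`, so the frozen measure is the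
measure it generates. This also shows that a non-local flow exists. -/
theorem isNonlocalFlow_odeFlow (hV : IsLocLipField T fun t x => v t (μ t) (u t) x)
    (hμ : ∀ t ∈ Icc 0 T, μ t = (μ T).map fun x => odeFlow T (fun t => v t (μ t) (u t)) T x t) {τ : ℝ}
    (hτ : τ ∈ Icc 0 T) : IsNonlocalFlow T (fun s ρ x => v s ρ (u s) x) τ (μ τ)
      (fun t x => odeFlow T (fun t => v t (μ t) (u t)) τ x t) := by
  have hmap := fun s (hs : s ∈ Icc 0 T) => map_odeFlow_of_terminal hV hμ hτ hs
  refine ⟨hV.continuousOn_odeFlow hτ, fun x => ?_, fun t ht x => ?_⟩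
  · refine (hV.odeFlow_spec hτ x).integrable.congr_fun (fun s hs => ?_) measurableSet_Icc
    simp only [hmap s hs]
  · refine ((hV.odeFlow_spec hτ x).eq t ht).trans ?_
    congr 1
    refine intervalIntegral.integral_congr fun s hs => ?_
    simp only [hmap s (uIcc_subset_Icc hτ ht hs)]

/-- The measure generated by any other solution differs from `μ s` by at most the mean distance of
the two flows, so the coupled Gronwall argument applies. The comparison on the ball suffices, since
it carries `μ τ`. -/
theorem IsNonlocalFlow.eq_odeFlow {Ψ : ℝ → Euc d → Euc d} {τ : ℝ}
    (hΨ : IsNonlocalFlow T (fun s ρ x => v s ρ (u s) x) τ (μ τ) Ψ)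
    (h : HypOCP T v Dv φ gradφ) (hμK : ProbOn (Metric.closedBall 0 R') (μ τ))
    (hV : IsLocLipField T fun t x => v t (μ t) (u t) x)
    (hμ : ∀ t ∈ Icc 0 T, μ t = (μ T).map fun x => odeFlow T (fun t => v t (μ t) (u t)) T x t)
    (hτ : τ ∈ Icc 0 T) :
    ∀ x ∈ Metric.closedBall 0 R', ∀ t ∈ Icc 0 T,
      Ψ t x = odeFlow T (fun t => v t (μ t) (u t)) τ x t := by
  have := hμK.1
  have hmap := fun s (hs : s ∈ Icc 0 T) => map_odeFlow_of_terminal hV hμ hτ hs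
  have hKc : IsCompact (Icc (0 : ℝ) T ×ˢ Metric.closedBall (0 : Euc d) R') :=
    isCompact_Icc.prod (isCompact_closedBall _ _)
  have hsub : Icc (0 : ℝ) T ×ˢ Metric.closedBall (0 : Euc d) R' ⊆ Icc 0 T ×ˢ univ :=
    prod_mono subset_rfl (subset_univ _)
  obtain ⟨B₁, hB₁⟩ := hKc.exists_bound_of_continuousOn (hΨ.continuousOn.mono hsub)
  obtain ⟨B₂, hB₂⟩ := hKc.exists_bound_of_continuousOn ((hV.continuousOn_odeFlow hτ).mono hsub)
  set Φ : ℝ → Euc d → Euc d := fun t x => odeFlow T (fun t => v t (μ t) (u t)) τ x t with hΦ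
  set B : ℝ := max 1 (max B₁ B₂) with hBdef
  have hB0 : 0 < B := lt_of_lt_of_le one_pos (le_max_left _ _)
  have hΨB : ∀ s ∈ Icc 0 T, ∀ x ∈ Metric.closedBall (0 : Euc d) R', Ψ s x ∈ Metric.closedBall 0 B :=
    fun s hs x hx => mem_closedBall_zero_iff.2
      ((hB₁ (s, x) ⟨hs, hx⟩).trans ((le_max_left _ _).trans (le_max_right _ _)))
  have hΦB : ∀ s ∈ Icc 0 T, ∀ x ∈ Metric.closedBall (0 : Euc d) R', Φ s x ∈ Metric.closedBall 0 B :=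
    fun s hs x hx => mem_closedBall_zero_iff.2
      ((hB₂ (s, x) ⟨hs, hx⟩).trans ((le_max_right _ _).trans (le_max_right _ _)))
  have hΨc : ∀ s ∈ Icc 0 T, Continuous (Ψ s) := fun s hs =>
    hΨ.continuousOn.comp_continuous (f := fun x : Euc d => (s, x)) (by fun_prop)
      fun x => ⟨hs, mem_univ _⟩
  have hΦc : ∀ s ∈ Icc 0 T, Continuous (Φ s) := fun s hs => hV.continuous_odeFlow hτ hs
  obtain ⟨l, L, hl, hL, hlL⟩ := h.lipschitz B hB0
  refine eq_of_integral_eq_of_mean_bound hτ (P := μ τ) (X := fun x t => Ψ t x)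
    (Y := fun x t => Φ t x) (x := fun x => x) (B := B + B)
    (p := fun x s => v s ((μ τ).map (Ψ s)) (u s) (Ψ s x))
    (q := fun x s => v s (μ s) (u s) (Φ s x)) hμK.ae_mem
    (fun t ht => ((hΨc t ht).sub (hΦc t ht)).aestronglyMeasurable)
    (fun x _ => hΨ.integrable x) (fun x _ => (hV.odeFlow_spec hτ x).integrable)
    (fun x _ t ht => hΨ.equation t ht x) (fun x _ => (hV.odeFlow_spec hτ x).eq)
    (fun x hx t ht => (norm_sub_le _ _).trans (add_le_add
      (mem_closedBall_zero_iff.1 (hΨB t ht x hx)) (mem_closedBall_zero_iff.1 (hΦB t ht x hx))))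
    hl hL fun x hx => ?_
  filter_upwards [hlL, ae_restrict_mem measurableSet_Icc] with s h1 hs
  have hρ : ProbOn (Metric.closedBall 0 B) ((μ τ).map (Ψ s)) :=
    hμK.map (hΨc s hs).aemeasurable Metric.isClosed_closedBall.measurableSet
      (hμK.ae_mem.mono fun x hx => hΨB s hs x hx)
  have hμs : ProbOn (Metric.closedBall 0 B) ((μ τ).map (Φ s)) :=
    hμK.map (hΦc s hs).aemeasurable Metric.isClosed_closedBall.measurableSet
      (hμK.ae_mem.mono fun x hx => hΦB s hs x hx)
  -- Points with the same initial position are coupled.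
  have hWle : (wasserstein 1 ((μ τ).map (Ψ s)) ((μ τ).map (Φ s))).toReal ≤
      ∫ y, ‖Ψ s y - Φ s y‖ ∂(μ τ) := by
    refine ENNReal.toReal_le_of_le_ofReal (integral_nonneg fun _ => norm_nonneg _) ?_
    refine (wasserstein_one_map_le (hΨc s hs).aemeasurable (hΦc s hs).aemeasurable).trans_eq ?_
    rw [ofReal_integral_norm_eq_lintegral_enorm]
    · simp only [edist_eq_enorm_sub]
    · exact hμK.integrable_of_bound ((hΨc s hs).sub (hΦc s hs)).aestronglyMeasurable (c := B + B)
        fun x hx => (norm_sub_le _ _).trans (add_le_add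
          (mem_closedBall_zero_iff.1 (hΨB s hs x hx)) (mem_closedBall_zero_iff.1 (hΦB s hs x hx)))
  rw [hmap s hs] at hμs hWle
  have h2 := (h1 (u s) _ _ hρ hμs (Ψ s x) (hΨB s hs x hx) (Ψ s x) (hΨB s hs x hx)).2
  have h3 := (h1 (u s) _ _ hμs hμs (Ψ s x) (hΨB s hs x hx) (Φ s x) (hΦB s hs x hx)).1
  calc _ ≤ ‖v s (μ s) (u s) (Ψ s x) - v s (μ s) (u s) (Φ s x)‖ +
        ‖v s ((μ τ).map (Ψ s)) (u s) (Ψ s x) - v s (μ s) (u s) (Ψ s x)‖ := by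
        rw [add_comm]; exact norm_sub_le_norm_sub_add_norm_sub _ _ _
    _ ≤ _ := add_le_add h3 (h2.trans (mul_le_mul_of_nonneg_left hWle (hL.2 s)))

theorem stateFlow_eq_odeFlow (h : HypOCP T v Dv φ gradφ) {τ : ℝ}
    (hμK : ProbOn (Metric.closedBall 0 R') (μ τ))
    (hV : IsLocLipField T fun t x => v t (μ t) (u t) x)
    (hμ : ∀ t ∈ Icc 0 T, μ t = (μ T).map fun x => odeFlow T (fun t => v t (μ t) (u t)) T x t)
    (hτ : τ ∈ Icc 0 T) :
    ∀ x ∈ Metric.closedBall 0 R', ∀ t ∈ Icc 0 T,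
      stateFlow T v u μ τ t x = odeFlow T (fun t => v t (μ t) (u t)) τ x t :=
  IsNonlocalFlow.eq_odeFlow (Classical.epsilon_spec ⟨_, isNonlocalFlow_odeFlow hV hμ hτ⟩) h hμK hV
    hμ hτ

end Representation


/-! ### The costate equation along fibres -/

section Dirac

variable {E : Type*} [NormedAddCommGroup E] [NormedSpace ℝ E] [CompleteSpace E]
  [MeasurableSpace E] [BorelSpace E]

/-- The integral of `ψ` is `ψ (X t)`, so this is the chain rule at the times where the primitive is
differentiable. -/
theorem SolvesODE.solvesContinuityEq_dirac {T τ : ℝ} {f w : ℝ → E → E} {x : E} {X : ℝ → E}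
    (hX : SolvesODE T f τ x X) (hτ : τ ∈ Icc 0 T)
    {s : ℝ → Measure E} (hs : ∀ t ∈ Icc 0 T, s t = Measure.dirac (X t))
    (hw : ∀ᵐ t ∂(volume.restrict (Icc 0 T)), w t (X t) = f t (X t)) :
    SolvesContinuityEq T w s := by
  intro ψ hψ hψc
  have hT : 0 ≤ T := hτ.1.trans hτ.2
  have hint := intervalIntegrable_sub hX.integrable (left_mem_Icc.2 hT) (right_mem_Icc.2 hT)
  have hder := ae_restrict_of_ae (s := Icc 0 T) hint.ae_hasDerivAt_integral
  -- The derivative is two-sided while the curve is described on `[0, T]` only; the two endpoints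
  -- are negligible.
  rw [← restrict_Ioo_eq_restrict_Icc] at *
  filter_upwards [hw, hder, ae_restrict_mem measurableSet_Ioo] with t h1 h2 ht
  rw [uIcc_of_le hT] at h2
  have hIcc : Icc 0 T ∈ 𝓝 t := Icc_mem_nhds ht.1 ht.2
  have hXd : HasDerivAt X (f t (X t)) t :=
    ((h2 (Ioo_subset_Icc_self ht) τ hτ).const_add x).congr_of_eventuallyEq
      (by filter_upwards [hIcc] with q hq using hX.eq q hq)
  rw [hs t (Ioo_subset_Icc_self ht), integral_dirac, h1]
  refine ((hψ.differentiable (by simp) (X t)).hasFDerivAt.comp_hasDerivAt t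
    hXd).congr_of_eventuallyEq ?_
  filter_upwards [hIcc] with q hq
  rw [hs q hq, integral_dirac]
  rfl

end Dirac

section Fibres

variable {d : ℕ} {U : Type*} {T R : ℝ}
  {v : ℝ → Measure (Euc d) → U → Euc d → Euc d}
  {Dv : ℝ → Measure (Euc d) → U → Euc d → Euc d → Euc d →L[ℝ] Euc d}
  {u : ℝ → U} {μ : ℝ → Measure (Euc d)}

/-- Solutions of the costate equation along a fibre, for a given family of fibre measures, are
curves of Dirac masses. -/
theorem eq_dirac_of_costateField (hT : 0 ≤ T) {l L : ℝ → ℝ} (hl : IsL1Nonneg T l)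
    (hL : IsL1Nonneg T L)
    (hb : ∀ᵐ t ∂(volume.restrict (Icc 0 T)), ∀ x ∈ Metric.closedBall (0 : Euc d) R,
      ‖fderiv ℝ (v t (μ t) (u t)) x‖ ≤ l t ∧
      ∀ y ∈ Metric.closedBall (0 : Euc d) R, ‖Dv t (μ t) (u t) x y‖ ≤ L t)
    (hμ : IsProbabilityMeasure (μ T))
    (hS : ∀ᵐ y ∂(μ T), ∀ t ∈ Icc 0 T, stateFlow T v u μ T t y ∈ Metric.closedBall 0 R)
    {σ : ℝ → Euc d → Measure (Euc d)} {b : ℝ}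
    (hσ : ∀ t ∈ Icc 0 T, ∀ᵐ y ∂(μ T), ProbOn (Metric.closedBall 0 b) (σ t y)) {x : Euc d}
    (hx : ∀ t ∈ Icc 0 T, stateFlow T v u μ T t x ∈ Metric.closedBall 0 R)
    {s : ℝ → Measure (Euc d)} (hs : ∀ t ∈ Icc 0 T, IsPc (s t)) (hsac : IsACCurve T s)
    (hce : SolvesContinuityEq T (fun t => costateField T v Dv u μ x t (σ t)) s)
    {p : Euc d} (hp : s T = Measure.dirac p) :
    ∃ y, SolvesODE T (fun t => costateField T v Dv u μ x t (σ t)) T p y ∧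
      ∀ t ∈ Icc 0 T, s t = Measure.dirac (y t) := by
  obtain ⟨m, hm, hW⟩ := hsac
  have hfield : (fun t => costateField T v Dv u μ x t (σ t)) = fun t r =>
      (-ContinuousLinearMap.adjoint (fderiv ℝ (v t (μ t) (u t)) (stateFlow T v u μ T t x))) r +
      -∫ y, ∫ p, ContinuousLinearMap.adjoint (Dv t (μ t) (u t) (stateFlow T v u μ T t y)
        (stateFlow T v u μ T t x)) p ∂(σ t y) ∂(μ T) := by
    funext t r
    rw [costateField, sub_eq_add_neg]
    rfl
  rw [hfield] at hce ⊢
  have hbT : 0 ≤ b := by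
    obtain ⟨y, hy⟩ := (hσ T (right_mem_Icc.2 hT)).exists
    obtain ⟨q, hq⟩ := hy.nonempty
    exact (norm_nonneg q).trans (mem_closedBall_zero_iff.1 hq)
  refine SolvesContinuityEq.eq_dirac_of_affine hT (hl.add (hL.const_mul hbT)) ?_ ?_ hce hm hW hs hp
  · filter_upwards [hb, ae_restrict_mem measurableSet_Icc] with t h1 ht
    rw [norm_neg, LinearIsometryEquiv.norm_map]
    exact (h1 _ (hx t ht)).1.trans (le_add_of_nonneg_right (mul_nonneg hbT (hL.2 t)))
  · filter_upwards [hb, ae_restrict_mem measurableSet_Icc] with t h1 ht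
    rw [norm_neg]
    refine le_trans ?_ (le_add_of_nonneg_left (hl.2 t))
    have := norm_integral_le_of_norm_le_const (μ := μ T) (C := b * L t)
      (f := fun y => ∫ p, ContinuousLinearMap.adjoint (Dv t (μ t) (u t) (stateFlow T v u μ T t y)
        (stateFlow T v u μ T t x)) p ∂(σ t y)) ?_
    · rwa [probReal_univ, mul_one] at this
    · filter_upwards [hS, hσ t ht] with y hy hσy
      refine hσy.norm_integral_le fun q hq => ?_
      rw [mul_comm]
      exact norm_adjoint_apply_le _ ((h1 _ (hy t ht)).2 _ (hx t ht)) (mem_closedBall_zero_iff.1 hq)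

theorem costateField_eq_costateVelocity {t : ℝ} {σ : Euc d → Measure (Euc d)}
    {r : Euc d → ℝ → Euc d} (hσ : ∀ᵐ y ∂(μ T), σ y = Measure.dirac (r y t))
    (hflow : ∀ᵐ y ∂(μ T),
      stateFlow T v u μ T t y = odeFlow T (fun t => v t (μ t) (u t)) T y t) {x : Euc d}
    (hx : stateFlow T v u μ T t x = odeFlow T (fun t => v t (μ t) (u t)) T x t) :
    costateField T v Dv u μ x t σ = costateVelocity T v Dv u μ r x t := by
  funext q
  rw [costateField, costateVelocity, hx]
  congr 1
  refine integral_congr_ae ?_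
  filter_upwards [hσ, hflow] with y hy hf
  rw [hy, integral_dirac, hf]

theorem norm_costateVelocity_le {t : ℝ} {lt Lt b : ℝ}
    (hb : ∀ x ∈ Metric.closedBall (0 : Euc d) R, ‖fderiv ℝ (v t (μ t) (u t)) x‖ ≤ lt ∧
      ∀ y ∈ Metric.closedBall (0 : Euc d) R, ‖Dv t (μ t) (u t) x y‖ ≤ Lt)
    (hμ : IsProbabilityMeasure (μ T)) {r : Euc d → ℝ → Euc d}
    (hS : ∀ᵐ y ∂(μ T), odeFlow T (fun t => v t (μ t) (u t)) T y t ∈ Metric.closedBall 0 R ∧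
      r y t ∈ Metric.closedBall 0 b)
    {x : Euc d} (hx : odeFlow T (fun t => v t (μ t) (u t)) T x t ∈ Metric.closedBall 0 R)
    {q : Euc d} (hq : q ∈ Metric.closedBall 0 b) :
    ‖costateVelocity T v Dv u μ r x t q‖ ≤ (lt + Lt) * b := by
  rw [costateVelocity, add_mul]
  refine (norm_sub_le _ _).trans (add_le_add ?_ ?_)
  · rw [norm_neg]
    exact norm_adjoint_apply_le _ (hb _ hx).1 (mem_closedBall_zero_iff.1 hq)
  · have := norm_integral_le_of_norm_le_const (μ := μ T) (C := Lt * b)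
      (f := fun y => ContinuousLinearMap.adjoint
        (Dv t (μ t) (u t) (odeFlow T (fun t => v t (μ t) (u t)) T y t)
          (odeFlow T (fun t => v t (μ t) (u t)) T x t)) (r y t)) ?_
    · rwa [probReal_univ, mul_one] at this
    · filter_upwards [hS] with y hy
      exact norm_adjoint_apply_le _ ((hb _ hy.1).2 _ hx) (mem_closedBall_zero_iff.1 hy.2)

/-- The velocity is affine in `q` and depends linearly on the family `r` through an average. The
continuity of `Dv` and the measurability of the families are needed to split the integral of a
difference. -/
theorem norm_costateVelocity_sub_le {t : ℝ} {lt Lt b b' : ℝ}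
    (hb : ∀ x ∈ Metric.closedBall (0 : Euc d) R, ‖fderiv ℝ (v t (μ t) (u t)) x‖ ≤ lt ∧
      ∀ y ∈ Metric.closedBall (0 : Euc d) R, ‖Dv t (μ t) (u t) x y‖ ≤ Lt)
    (hc : ContinuousOn (fun z : Euc d × Euc d => Dv t (μ t) (u t) z.1 z.2)
      (Metric.closedBall 0 R ×ˢ Metric.closedBall 0 R))
    (hμ : IsProbabilityMeasure (μ T))
    (hΦ : Continuous fun y => odeFlow T (fun t => v t (μ t) (u t)) T y t)
    {r r' : Euc d → ℝ → Euc d} (hr : Measurable fun y => r y t) (hr' : Measurable fun y => r' y t)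
    (hS : ∀ᵐ y ∂(μ T), odeFlow T (fun t => v t (μ t) (u t)) T y t ∈ Metric.closedBall 0 R ∧
      r y t ∈ Metric.closedBall 0 b ∧ r' y t ∈ Metric.closedBall 0 b')
    {x : Euc d} (hx : odeFlow T (fun t => v t (μ t) (u t)) T x t ∈ Metric.closedBall 0 R)
    (q q' : Euc d) :
    ‖costateVelocity T v Dv u μ r x t q - costateVelocity T v Dv u μ r' x t q'‖ ≤
      lt * ‖q - q'‖ + Lt * ∫ y, ‖r y t - r' y t‖ ∂(μ T) := by
  set Φ : Euc d → Euc d := fun y => odeFlow T (fun t => v t (μ t) (u t)) T y t with hΦdef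
  have hA : AEStronglyMeasurable (fun y => ContinuousLinearMap.adjoint
      (Dv t (μ t) (u t) (Φ y) (Φ x))) (μ T) := by
    refine (ProbOn.aestronglyMeasurable (K := Φ ⁻¹' Metric.closedBall 0 R)
      ⟨hμ, hS.mono fun y hy => hy.1⟩ (hΦ.measurable Metric.isClosed_closedBall.measurableSet) ?_)
    exact ContinuousLinearMap.adjoint.continuous.comp_continuousOn
      (hc.comp (f := fun y => (Φ y, Φ x)) (by fun_prop) fun y hy => ⟨hy, hx⟩)
  have hev : Continuous fun z : (Euc d →L[ℝ] Euc d) × Euc d => z.1 z.2 := by fun_prop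
  have hint : ∀ {ρ : Euc d → ℝ → Euc d} {c : ℝ}, Measurable (fun y => ρ y t) →
      (∀ᵐ y ∂(μ T), Φ y ∈ Metric.closedBall 0 R ∧ ρ y t ∈ Metric.closedBall 0 c) →
      Integrable (fun y => ContinuousLinearMap.adjoint (Dv t (μ t) (u t) (Φ y) (Φ x)) (ρ y t))
        (μ T) := by
    intro ρ c hρ hρc
    refine Integrable.of_bound (hev.comp_aestronglyMeasurable
      (hA.prodMk hρ.aestronglyMeasurable)) (Lt * c) ?_
    filter_upwards [hρc] with y hy
    exact norm_adjoint_apply_le _ ((hb _ hy.1).2 _ hx) (mem_closedBall_zero_iff.1 hy.2)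
  have h1 := hint hr (hS.mono fun y hy => ⟨hy.1, hy.2.1⟩)
  have h2 := hint hr' (hS.mono fun y hy => ⟨hy.1, hy.2.2⟩)
  have hdiff : Integrable (fun y => ‖r y t - r' y t‖) (μ T) := by
    refine (Integrable.of_bound (hr.sub hr').aestronglyMeasurable (b + b') ?_).norm
    filter_upwards [hS] with y hy
    exact (norm_sub_le _ _).trans (add_le_add (mem_closedBall_zero_iff.1 hy.2.1)
      (mem_closedBall_zero_iff.1 hy.2.2))
  have hsplit : costateVelocity T v Dv u μ r x t q - costateVelocity T v Dv u μ r' x t q' =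
      -(ContinuousLinearMap.adjoint (fderiv ℝ (v t (μ t) (u t)) (Φ x)) (q - q')) -
        ∫ y, ContinuousLinearMap.adjoint (Dv t (μ t) (u t) (Φ y) (Φ x)) (r y t - r' y t) ∂(μ T) := by
    simp only [costateVelocity, map_sub]
    rw [integral_sub h1 h2]
    abel
  rw [hsplit]
  refine (norm_sub_le _ _).trans (add_le_add ?_ ?_)
  · rw [norm_neg]
    exact norm_adjoint_apply_le _ (hb _ hx).1 le_rfl
  · rw [← integral_const_mul]
    refine norm_integral_le_of_norm_le (hdiff.const_mul _) ?_
    filter_upwards [hS] with y hy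
    exact norm_adjoint_apply_le _ ((hb _ hy.1).2 _ hx) le_rfl

end Fibres


/-! ### Families of costates and the main theorem -/

section Main

variable {d : ℕ} {U : Type*} {T R : ℝ}
  {v : ℝ → Measure (Euc d) → U → Euc d → Euc d}
  {Dv : ℝ → Measure (Euc d) → U → Euc d → Euc d → Euc d →L[ℝ] Euc d}
  {φ : Measure (Euc d) → ℝ} {gradφ : Measure (Euc d) → Euc d → Euc d}
  {u : ℝ → U} {μ : ℝ → Measure (Euc d)} {ν : ℝ → Measure (Euc d × Euc d)}
  {l L : ℝ → ℝ} {p : Euc d → Euc d} {r : Euc d → ℝ → Euc d}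

/-- The curves `r x` are the costates along the state trajectories ending at `x`, with terminal
values `p x`; all of them stay in the ball of radius `R`, on which `l` and `L` bound the
differentials of the velocity field. -/
structure IsCostateFamily (T R : ℝ) (v : ℝ → Measure (Euc d) → U → Euc d → Euc d)
    (Dv : ℝ → Measure (Euc d) → U → Euc d → Euc d → Euc d →L[ℝ] Euc d)
    (u : ℝ → U) (μ : ℝ → Measure (Euc d)) (l L : ℝ → ℝ) (p : Euc d → Euc d)
    (r : Euc d → ℝ → Euc d) : Prop where
  time_nonneg : 0 ≤ T
  prob : IsProbabilityMeasure (μ T)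
  l_int : IsL1Nonneg T l
  L_int : IsL1Nonneg T L
  bound : ∀ᵐ t ∂(volume.restrict (Icc 0 T)), ∀ x ∈ Metric.closedBall (0 : Euc d) R,
    ‖fderiv ℝ (v t (μ t) (u t)) x‖ ≤ l t ∧
      ∀ y ∈ Metric.closedBall (0 : Euc d) R, ‖Dv t (μ t) (u t) x y‖ ≤ L t
  cont : ∀ᵐ t ∂(volume.restrict (Icc 0 T)),
    ContinuousOn (fun z : Euc d × Euc d => Dv t (μ t) (u t) z.1 z.2)
      (Metric.closedBall 0 R ×ˢ Metric.closedBall 0 R)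
  flow_cont : ∀ t ∈ Icc 0 T, Continuous fun y => odeFlow T (fun t => v t (μ t) (u t)) T y t
  meas : ∀ t ∈ Icc 0 T, Measurable fun y => r y t
  flow_mem : ∀ᵐ x ∂(μ T), ∀ t ∈ Icc 0 T,
    stateFlow T v u μ T t x = odeFlow T (fun t => v t (μ t) (u t)) T x t ∧
      odeFlow T (fun t => v t (μ t) (u t)) T x t ∈ Metric.closedBall 0 R
  mem : ∀ᵐ x ∂(μ T), ∀ t ∈ Icc 0 T, r x t ∈ Metric.closedBall 0 R
  solves : ∀ᵐ x ∂(μ T), SolvesODE T (costateVelocity T v Dv u μ r x) T (p x) (r x)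

/-- The distance of two Dirac masses is at most that of their atoms, and the costate velocity is at
most `(l + L) * R` along trajectories in the ball. Only the bounds of the derivatives on the ball
and its radius enter. -/
theorem IsCostateFamily.w1Bound_dirac (h : IsCostateFamily T R v Dv u μ l L p r) :
    ∀ᵐ x ∂(μ T), W1Bound T (fun t => (l t + L t) * R) fun t => Measure.dirac (r x t) := by
  filter_upwards [h.flow_mem, h.mem, h.solves] with x h1 h2 h3 τ t h0 hτt htT
  have hτ : τ ∈ Icc 0 T := ⟨h0, hτt.trans htT⟩
  have ht : t ∈ Icc 0 T := ⟨h0.trans hτt, htT⟩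
  refine (wasserstein_one_dirac_le _ _).trans ?_
  rw [edist_dist, dist_comm, dist_eq_norm]
  refine ENNReal.ofReal_le_ofReal ?_
  have h4 := (h3.restart (right_mem_Icc.2 h.time_nonneg) hτ).eq t ht
  rw [h4, add_sub_cancel_left]
  refine intervalIntegral.norm_integral_le_of_norm_le hτt ?_
    (intervalIntegrable_sub ((h.l_int.1.add h.L_int.1).mul_const R) hτ ht)
  have h5 : ∀ᵐ s ∂(volume.restrict (Icc 0 T)),
      ‖costateVelocity T v Dv u μ r x s (r x s)‖ ≤ (l s + L s) * R := by
    filter_upwards [h.bound, ae_restrict_mem measurableSet_Icc] with s hs hsI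
    refine norm_costateVelocity_le hs h.prob ?_ (h1 s hsI).2 (h2 s hsI)
    filter_upwards [h.flow_mem, h.mem] with y hy1 hy2 using ⟨(hy1 s hsI).2, hy2 s hsI⟩
  filter_upwards [(ae_restrict_iff' measurableSet_Icc).1 h5] with s hs hsI
  exact hs ⟨h0.trans hsI.1.le, hsI.2.trans htT⟩

theorem IsCostateFamily.costateField_eq (h : IsCostateFamily T R v Dv u μ l L p r)
    {σ : ℝ → Euc d → Measure (Euc d)} {r' : Euc d → ℝ → Euc d}
    (hσ : ∀ t ∈ Icc 0 T, ∀ᵐ y ∂(μ T), σ t y = Measure.dirac (r' y t)) :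
    ∀ᵐ x ∂(μ T), ∀ t ∈ Icc 0 T,
      costateField T v Dv u μ x t (σ t) = costateVelocity T v Dv u μ r' x t := by
  filter_upwards [h.flow_mem] with x hx t ht
  exact costateField_eq_costateVelocity (hσ t ht) (h.flow_mem.mono fun y hy => (hy t ht).1)
    (hx t ht).1

theorem IsCostateFamily.eq_dirac (h : IsCostateFamily T R v Dv u μ l L p r)
    {σ : ℝ → Euc d → Measure (Euc d)} {b : ℝ}
    (hσ : ∀ t ∈ Icc 0 T, ∀ᵐ y ∂(μ T), ProbOn (Metric.closedBall 0 b) (σ t y)) :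
    ∀ᵐ x ∂(μ T), ∀ s : ℝ → Measure (Euc d), (∀ t ∈ Icc 0 T, IsPc (s t)) → IsACCurve T s →
      SolvesContinuityEq T (fun t => costateField T v Dv u μ x t (σ t)) s →
      s T = Measure.dirac (p x) →
      ∃ y, SolvesODE T (fun t => costateField T v Dv u μ x t (σ t)) T (p x) y ∧
        ∀ t ∈ Icc 0 T, s t = Measure.dirac (y t) := by
  have hS : ∀ᵐ y ∂(μ T), ∀ t ∈ Icc 0 T, stateFlow T v u μ T t y ∈ Metric.closedBall 0 R := by
    filter_upwards [h.flow_mem] with y hy t ht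
    rw [(hy t ht).1]
    exact (hy t ht).2
  filter_upwards [hS] with x hx s hs hac hce hp
  exact eq_dirac_of_costateField h.time_nonneg h.l_int h.L_int h.bound h.prob hS hσ hx hs hac hce hp

/-- The field is fixed by the family, so a competitor is a Dirac curve whose atom solves the same
ODE, which is Lipschitz in the costate with constant `l`. -/
theorem IsCostateFamily.unique_fibre (h : IsCostateFamily T R v Dv u μ l L p r)
    {σ : ℝ → Euc d → Measure (Euc d)}
    (hσ : ∀ t ∈ Icc 0 T, ∀ y, σ t y = Measure.dirac (r y t)) :
    ∀ᵐ x ∂(μ T), ∀ s : ℝ → Measure (Euc d), (∀ t ∈ Icc 0 T, IsPc (s t)) → IsACCurve T s →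
      SolvesContinuityEq T (fun t => costateField T v Dv u μ x t (σ t)) s →
      s T = Measure.dirac (p x) → ∀ t ∈ Icc 0 T, s t = σ t x := by
  have hT' : T ∈ Icc 0 T := right_mem_Icc.2 h.time_nonneg
  have hσK : ∀ t ∈ Icc 0 T, ∀ᵐ y ∂(μ T), ProbOn (Metric.closedBall 0 R) (σ t y) := by
    intro t ht
    filter_upwards [h.mem] with y hy
    rw [hσ t ht]
    exact probOn_dirac Metric.isClosed_closedBall.measurableSet (hy t ht)
  filter_upwards [h.eq_dirac hσK, h.costateField_eq (r' := r) fun t ht =>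
    Eventually.of_forall (hσ t ht), h.solves, h.flow_mem] with x h1 h2 h3 h4 s hs hac hce hp t ht
  obtain ⟨y, hy, hys⟩ := h1 s hs hac hce hp
  have hy' : SolvesODE T (costateVelocity T v Dv u μ r x) T (p x) y := by
    refine ⟨hy.integrable.congr_fun (fun s hs => ?_) measurableSet_Icc, fun q hq => ?_⟩
    · simp only [h2 s hs]
    · rw [hy.eq q hq]
      congr 1
      exact intervalIntegral.integral_congr fun s hs => by
        simp only [h2 s (uIcc_subset_Icc hT' hq hs)]
  rw [hys t ht, hσ t ht, hy'.unique h3 hT' ht h.l_int (K := univ) (fun _ _ => mem_univ _)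
    (fun _ _ => mem_univ _) ?_]
  filter_upwards [h.bound, ae_restrict_mem measurableSet_Icc] with q hq hqI a _ b _
  rw [costateVelocity, costateVelocity, sub_sub_sub_cancel_right, neg_sub_neg, ← map_sub,
    norm_sub_rev a b]
  exact norm_adjoint_apply_le _ (hq _ (h4 q hqI).2).1 le_rfl

theorem IsCostateFamily.solvesContinuityEq (h : IsCostateFamily T R v Dv u μ l L p r)
    {σ : ℝ → Euc d → Measure (Euc d)}
    (hσ : ∀ t ∈ Icc 0 T, ∀ y, σ t y = Measure.dirac (r y t)) :
    ∀ᵐ x ∂(μ T), SolvesContinuityEq T (fun t => costateField T v Dv u μ x t (σ t))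
      fun t => σ t x := by
  filter_upwards [h.costateField_eq (r' := r) fun t ht => Eventually.of_forall (hσ t ht),
    h.solves] with x h1 h2
  refine h2.solvesContinuityEq_dirac (right_mem_Icc.2 h.time_nonneg) (fun t ht => hσ t ht x) ?_
  filter_upwards [ae_restrict_mem measurableSet_Icc] with t ht
  rw [h1 t ht]

/-- Uniqueness for the coupled system of the costate equations of all fibres. -/
theorem IsCostateFamily.unique (h : IsCostateFamily T R v Dv u μ l L p r) {b : ℝ}
    (σ' : ℝ → Kernel (Euc d) (Euc d))
    (hσ' : ∀ᵐ x ∂(μ T), (∀ t ∈ Icc 0 T, ProbOn (Metric.closedBall 0 b) (σ' t x)) ∧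
      IsACCurve T (fun t => σ' t x) ∧
      SolvesContinuityEq T (fun t => costateField T v Dv u μ x t (fun y => σ' t y))
        (fun t => σ' t x) ∧ σ' T x = Measure.dirac (p x)) :
    ∀ᵐ x ∂(μ T), ∀ t ∈ Icc 0 T, σ' t x = Measure.dirac (r x t) := by
  have := h.prob
  have hT' : T ∈ Icc 0 T := right_mem_Icc.2 h.time_nonneg
  -- The barycentre of a kernel is measurable in `x` without further assumptions, and it is the atom
  -- as soon as the fibre is known to be a Dirac mass.
  set r' : Euc d → ℝ → Euc d := fun x t => ∫ q, q ∂(σ' t x) with hr'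
  have hr'm : ∀ t, Measurable fun x => r' x t := fun t =>
    (StronglyMeasurable.integral_kernel (κ := σ' t) stronglyMeasurable_id).measurable
  have hdirac : ∀ᵐ x ∂(μ T),
      SolvesODE T (fun t => costateField T v Dv u μ x t (fun y => σ' t y)) T (p x) (r' x) ∧
      ∀ t ∈ Icc 0 T, σ' t x = Measure.dirac (r' x t) ∧ r' x t ∈ Metric.closedBall 0 b := by
    filter_upwards [h.eq_dirac (σ := fun t y => σ' t y) fun t ht =>
      hσ'.mono fun y hy => hy.1 t ht, hσ'] with x h1 h2
    obtain ⟨y, hy, hys⟩ := h1 _ (fun t ht => (h2.1 t ht).isPc (isCompact_closedBall _ _)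
      Metric.isClosed_closedBall) h2.2.1 h2.2.2.1 h2.2.2.2
    have hyr : ∀ t ∈ Icc 0 T, r' x t = y t := fun t ht => by
      simp only [hr', hys t ht, integral_dirac]
    refine ⟨⟨hy.integrable.congr_fun (fun t ht => ?_) measurableSet_Icc, fun t ht => ?_⟩,
      fun t ht => ⟨(hys t ht).trans (by rw [hyr t ht]), ?_⟩⟩
    · simp only [hyr t ht]
    · rw [hyr t ht, hy.eq t ht]
      congr 1
      exact intervalIntegral.integral_congr fun s hs => by
        simp only [hyr s (uIcc_subset_Icc hT' ht hs)]
    · rw [mem_closedBall_zero_iff]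
      exact (h2.1 t ht).norm_integral_le fun q hq => mem_closedBall_zero_iff.1 hq
  have hfield := h.costateField_eq (σ := fun t y => σ' t y) (r' := r') fun t ht =>
    hdirac.mono fun y hy => (hy.2 t ht).1
  have hgood := h.flow_mem.and (h.mem.and (h.solves.and (hdirac.and hfield)))
  have key := eq_of_integral_eq_of_mean_bound hT' (P := μ T) (S := {x | _}) hgood (x := p) (X := r)
    (Y := r') (p := fun x s => costateVelocity T v Dv u μ r x s (r x s))
    (q := fun x s => costateField T v Dv u μ x s (fun y => σ' s y) (r' x s)) (B := R + b)
    (fun t ht => ((h.meas t ht).sub (hr'm t)).aestronglyMeasurable)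
    (fun x hx => hx.2.2.1.integrable) (fun x hx => hx.2.2.2.1.1.integrable)
    (fun x hx => hx.2.2.1.eq) (fun x hx => hx.2.2.2.1.1.eq)
    (fun x hx t ht => (norm_sub_le _ _).trans (add_le_add
      (mem_closedBall_zero_iff.1 (hx.2.1 t ht))
      (mem_closedBall_zero_iff.1 (hx.2.2.2.1.2 t ht).2)))
    h.l_int h.L_int fun x hx => by
      filter_upwards [h.bound, h.cont, ae_restrict_mem measurableSet_Icc] with t h1 h2 ht
      rw [hx.2.2.2.2 t ht]
      refine norm_costateVelocity_sub_le h1 h2 h.prob (h.flow_cont t ht) (h.meas t ht) (hr'm t) ?_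
        (hx.1 t ht).2 _ _ (b := R) (b' := b)
      filter_upwards [hgood] with y hy
      exact ⟨(hy.1 t ht).2, hy.2.1 t ht, (hy.2.2.2.1.2 t ht).2⟩
  filter_upwards [hgood] with x hx t ht
  rw [(hx.2.2.2.1.2 t ht).1, key x hx t ht]

/-- Flowing from `t` to `T` undoes the flow from `T` to `t`, so the first component becomes the
label `x` itself. The chosen flow has to agree with the flow of the field only on the carrier of `ν
t`. -/
theorem transported_eq_map (hV : IsLocLipField T fun t x => v t (μ t) (u t) x) {t : ℝ}
    (ht : t ∈ Icc 0 T) {K : Set (Euc d × Euc d)} (hνK : ProbOn K (ν t))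
    (hflow : ∀ z ∈ K, stateFlow T v u μ t T z.1 = odeFlow T (fun t => v t (μ t) (u t)) t z.1 T)
    (hrm : Measurable fun x => r x t)
    (hν : ν t = (μ T).map fun x => (odeFlow T (fun t => v t (μ t) (u t)) T x t, r x t)) :
    transported T v u μ ν t = (μ T).map fun x => (x, r x t) := by
  have hT' : T ∈ Icc 0 T := right_mem_Icc.2 (ht.1.trans ht.2)
  have h1 : transported T v u μ ν t = (ν t).map fun z =>
      (odeFlow T (fun t => v t (μ t) (u t)) t z.1 T, z.2) := by
    refine Measure.map_congr ?_
    filter_upwards [hνK.ae_mem] with z hz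
    rw [hflow z hz]
  have h2 : Measurable fun z : Euc d × Euc d =>
      (odeFlow T (fun t => v t (μ t) (u t)) t z.1 T, z.2) :=
    ((hV.continuous_odeFlow ht hT').measurable.comp measurable_fst).prodMk measurable_snd
  have h3 : Measurable fun x => (odeFlow T (fun t => v t (μ t) (u t)) T x t, r x t) :=
    (hV.continuous_odeFlow hT' ht).measurable.prodMk hrm
  rw [h1, hν, Measure.map_map h2 h3]
  congr 1
  funext x
  refine Prod.ext ?_ rfl
  exact (hV.odeFlow_odeFlow hT' ht hT' x).trans (hV.odeFlow_self hT' x)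

end Main

end MeanField

theorem mainTheorem11 {d : ℕ} {U : Type*} [MetricSpace U] [CompactSpace U]
    (T : ℝ) (hT : 0 < T)
    (v : ℝ → Measure (EuclideanSpace ℝ (Fin d)) → U → EuclideanSpace ℝ (Fin d) →
      EuclideanSpace ℝ (Fin d))
    (Dv : ℝ → Measure (EuclideanSpace ℝ (Fin d)) → U → EuclideanSpace ℝ (Fin d) →
      EuclideanSpace ℝ (Fin d) → EuclideanSpace ℝ (Fin d) →L[ℝ] EuclideanSpace ℝ (Fin d))
    (φ : Measure (EuclideanSpace ℝ (Fin d)) → ℝ)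
    (gradφ : Measure (EuclideanSpace ℝ (Fin d)) → EuclideanSpace ℝ (Fin d) →
      EuclideanSpace ℝ (Fin d))
    (hOCP : MeanField.HypOCP T v Dv φ gradφ)
    (R' : ℝ) (hR' : 0 < R') :
    ∃ m : ℝ → ℝ, MeanField.IsL1Nonneg T m ∧
      ∀ (u : ℝ → U) (μ : ℝ → Measure (EuclideanSpace ℝ (Fin d)))
        (ν : ℝ → Measure (EuclideanSpace ℝ (Fin d) × EuclideanSpace ℝ (Fin d))),
        AEStronglyMeasurable u (volume.restrict (Icc 0 T)) →
        MeanField.IsStateCostateCurve T R' v Dv gradφ u μ ν →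
        ∃ σ : ℝ → Kernel (EuclideanSpace ℝ (Fin d)) (EuclideanSpace ℝ (Fin d)),
          -- `(σ t x)_x` is the disintegration of the transported measure against `μ T`
          (∀ t ∈ Icc 0 T, IsMarkovKernel (σ t) ∧
            (μ T).compProd (σ t) = MeanField.transported T v u μ ν t) ∧
          (∀ᵐ x ∂(μ T),
            -- the fibre curve is an absolutely continuous curve of measures on the ball
            (∀ t ∈ Icc 0 T, MeanField.ProbOn (Metric.closedBall 0 R') (σ t x)) ∧
            MeanField.W1Bound T m (fun t => σ t x) ∧
            -- it solves the backward Cauchy problem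
            MeanField.SolvesContinuityEq T
              (fun t => MeanField.costateField T v Dv u μ x t (fun y => σ t y))
              (fun t => σ t x) ∧
            σ T x = Measure.dirac (-gradφ (μ T) x) ∧
            -- and it is the only solution for the velocity field determined by the family
            (∀ s : ℝ → Measure (EuclideanSpace ℝ (Fin d)),
              (∀ t ∈ Icc 0 T, MeanField.IsPc (s t)) →
              MeanField.IsACCurve T s →
              MeanField.SolvesContinuityEq T
                (fun t => MeanField.costateField T v Dv u μ x t (fun y => σ t y)) s →
              s T = Measure.dirac (-gradφ (μ T) x) →
              ∀ t ∈ Icc 0 T, s t = σ t x)) ∧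
          -- the family is the only solution of the coupled system of non-local problems
          (∀ (R : ℝ) (σ' : ℝ → Kernel (EuclideanSpace ℝ (Fin d)) (EuclideanSpace ℝ (Fin d))),
            (∀ᵐ x ∂(μ T),
              (∀ t ∈ Icc 0 T, MeanField.ProbOn (Metric.closedBall 0 R) (σ' t x)) ∧
              MeanField.IsACCurve T (fun t => σ' t x) ∧
              MeanField.SolvesContinuityEq T
                (fun t => MeanField.costateField T v Dv u μ x t (fun y => σ' t y))
                (fun t => σ' t x) ∧
              σ' T x = Measure.dirac (-gradφ (μ T) x)) →
            ∀ᵐ x ∂(μ T), ∀ t ∈ Icc 0 T, σ' t x = σ t x) := by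

  obtain ⟨l, L, hl, hL, hlL⟩ := hOCP.exists_bounds hR'
  -- The bounds `l` and `L` on the ball are uniform over measures and controls, so the modulus is
  -- fixed before `u`, `μ` and `ν` appear.
  refine ⟨fun t => (l t + L t) * R', ⟨(hl.1.add hL.1).mul_const _, fun t =>
    mul_nonneg (add_nonneg (hl.2 t) (hL.2 t)) hR'.le⟩, fun u μ ν hu hν => ?_⟩
  have hT' : T ∈ Icc 0 T := right_mem_Icc.2 hT.le
  obtain ⟨m₀, hm₀, hWν⟩ := hν.absolutelyContinuous
  have hμ := fun t (ht : t ∈ Icc 0 T) => hν.probOn_state ht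
  have hV := hOCP.isLocLipField hT.le hu hR' hμ hm₀ (hν.w1Bound_state hWν)
  obtain ⟨r, hrm, hνr, hrc, hgood⟩ := hν.exists_costate hOCP hT.le hu hR'
  have hμΦ : ∀ t ∈ Icc 0 T,
      μ t = (μ T).map fun x => MeanField.odeFlow T (fun t => v t (μ t) (u t)) T x t := by
    intro t ht
    rw [← hν.marginal t ht, hνr t ht, Measure.map_map measurable_fst
      ((hV.continuous_odeFlow hT' ht).measurable.prodMk (hrm t ht))]
    rfl
  have hflow := fun τ (hτ : τ ∈ Icc 0 T) => MeanField.stateFlow_eq_odeFlow hOCP (hμ τ hτ) hV hμΦ hτ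
  have hfam : MeanField.IsCostateFamily T R' v Dv u μ l L (fun x => -gradφ (μ T) x) r :=
    { time_nonneg := hT.le
      prob := (hμ T hT').1
      l_int := hl
      L_int := hL
      bound := by
        filter_upwards [hlL, ae_restrict_mem measurableSet_Icc] with t h1 ht x hx
        exact (h1 (u t) (μ t) (hμ t ht) x hx).2.2
      cont := by
        filter_upwards [hOCP.continuous_measure_deriv R' hR', ae_restrict_mem measurableSet_Icc]
          with t h1 ht
        exact (h1 (u t)).continuousOn (hμ t ht)
      flow_cont := fun t ht => hV.continuous_odeFlow hT' ht
      meas := hrm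
      flow_mem := by
        filter_upwards [hgood, (hμ T hT').ae_mem] with x hx hxK t ht
        exact ⟨hflow T hT' x hxK t ht, (hx.1 t ht).1⟩
      mem := hgood.mono fun x hx t ht => (hx.1 t ht).2
      solves := hgood.mono fun x hx => hx.2 }
  have hprob := (hμ T hT').1
  -- The costates are measurable in `x` only for times in `[0, T]`; clamping defines a kernel at
  -- every real time.
  have hrm' : ∀ t, Measurable fun x => r x (MeanField.clampTime T t) := fun t =>
    hrm _ (MeanField.clampTime_mem hT.le t)
  have hσ : ∀ t ∈ Icc 0 T, ∀ x, Kernel.deterministic _ (hrm' t) x = Measure.dirac (r x t) := by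
    intro t ht x
    rw [Kernel.deterministic_apply, MeanField.clampTime_of_mem ht]
  -- Since the transported measure is the graph of `x ↦ r x t` over `μ T`, its disintegration is a
  -- deterministic kernel.
  refine ⟨fun t => Kernel.deterministic _ (hrm' t), fun t ht => ⟨inferInstance, ?_⟩, ?_, ?_⟩
  · rw [MeanField.transported_eq_map hV ht (hν.supported t ht)
      (fun z hz => hflow t ht z.1 hz.1 T hT') (hrm t ht) (hνr t ht), Measure.compProd_deterministic]
    simp only [MeanField.clampTime_of_mem ht]
  · filter_upwards [hfam.mem, hfam.w1Bound_dirac, hfam.solves,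
      hfam.solvesContinuityEq (σ := fun t x => Kernel.deterministic _ (hrm' t) x) hσ,
      hfam.unique_fibre (σ := fun t x => Kernel.deterministic _ (hrm' t) x) hσ]
      with x h1 h2 h3 h4 h5
    refine ⟨fun t ht => ?_, fun τ t h0 hτt htT => ?_, h4, ?_, h5⟩
    · rw [hσ t ht]
      exact MeanField.probOn_dirac Metric.isClosed_closedBall.measurableSet (h1 t ht)
    · beta_reduce
      rw [hσ τ ⟨h0, hτt.trans htT⟩, hσ t ⟨h0.trans hτt, htT⟩]
      exact h2 τ t h0 hτt htT
    · rw [hσ T hT', h3.initial hT']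
  · intro R σ' hσ'
    filter_upwards [hfam.unique σ' hσ'] with x hx t ht
    rw [hx t ht, hσ t ht]
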